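/- Let $0<k<1-\frac1{\sqrt e}$, $T>\frac{2}{1-k}$, $\sigma,\rho_0,\rho_1>0$, $\Omega=(0,1)$, $Q=\Omega\times(0,T)$, $\Sigma_0=\{0\}\times(0,T)$, $\Sigma_0^*=\{1\}\times(0,T)$, $\Sigma=\Sigma_0\cup\Sigma_0^*$, $$\alpha_k(t)=1+kt,\quad \beta_k(y,t)=\frac{1-k^2y^2}{\alpha_k(t)},\quad \gamma_k(y)=-2ky,$$ $$Lv=-\Big[\frac{\beta_k}{\alpha_k}v_y\Big]_y+\frac{\gamma_k}{\alpha_k}v'_y,\qquad L^*p=-\Big[\frac{\beta_k}{\alpha_k}p_y\Big]_y+\Big[\frac{\gamma_k}{\alpha_k}p\Big]'_y,$$ where $'=\partial_t$. Let $v_2\in L^2(Q)$, $v^0\in L^2(\Omega)$, $v^1\in H^{-1}(\Omega)$. Write $|\cdot|$ and $(\cdot,\cdot)$ for the norm and scalar product of $L^2(\Omega)$, $\|f\|=|f_y|$ for the norm of $H_0^1(\Omega)$, give $H^{-1}(\Omega)$ the dual norm, and write $\partial_\nu q=-q_y(0,\cdot)$ for the outward normal derivative on $\Sigma_0$. For $w\in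 L^2(\Sigma_0)$ let $v[w]\in C([0,T];L^2(\Omega))\cap C^1([0,T];H^{-1}(\Omega))$ be the solution by transposition of $v''+Lv=0$ in $Q$, $v=w$ on $\Sigma_0$, $v=0$ on $\Sigma_0^*$, $v(0)=v'(0)=0$. Leader and follower both act on $\Sigma_1=\Sigma_2=\Sigma_0$, with total control $w=w_1+w_2$. Given the leader $w_1\in L^2(\Sigma_0)$, the follower $w_2$ is a Nash equilibrium if it minimizes over $L^2(\Sigma_0)$ $$J_2(w_1,w_2)=\frac12\int_0^T\!\!\int_\Omega\alpha_k(t)\,(v[w_1+w_2]-v_2)^2\,dy\,dt+\frac\sigma2\int_{\Sigma_0}w_2^2\,d\Sigma .$$ The leader $w_1$ is admissible if, for the corresponding Nash equilibrium $w_2$, the state $v=v[w_1+w_2]$ satisfies $|v(T)-v^0|\le\rho_0$ and $\|v'(T)-v^1\|_{H^{-1}(\Omega)}\le\rho_1$. It is optimal if it minimizes $J(w_1)=\frac12\int_{\Sigma_0}w_1^2\,d\Sigma$ among the admissible leaders. Then the following hold. 1. For every $f=(f^0,f^1)\in H_0^1(\Omega)\times L^2(\Omega)$ there is exactly one quadruple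 $(\varphi,\psi,v,p)$ with $\varphi,p\in C([0,T];H_0^1(\Omega))\cap C^1([0,T];L^2(\Omega))$ having normal derivatives $\partial_\nu\varphi,\partial_\nu p\in L^2(\Sigma_0)$, and $\psi,v\in C([0,T];L^2(\Omega))\cap C^1([0,T];H^{-1}(\Omega))$, such that $$\varphi''+L^*\varphi=\alpha_k\psi,\quad \psi''+L\psi=0,\quad v''+Lv=0,\quad p''+L^*p=\alpha_k(v-v_2)\quad\text{in }Q,$$ $$\varphi=p=0\ \text{on }\Sigma,\qquad \psi=v=0\ \text{on }\Sigma_0^*,\qquad \psi=\frac{1}{\sigma\alpha_k^2}\,\partial_\nu\varphi,\quad v=-\frac1{\alpha_k^2}\,\partial_\nu\varphi+\frac1{\sigma\alpha_k^2}\,\partial_\nu p\ \text{ on }\Sigma_0,$$ $$\varphi(T)=f^0,\quad \varphi'(T)+\Big[\frac{\gamma_k}{\alpha_k(T)}\varphi(T)\Big]_y=f^1,\quad p(T)=p'(T)=0,\quad \psi(0)=\psi'(0)=v(0)=v'(0)=0\quad\text{in }\Omega .$$ 2. There is exactly one $f=(f^0,f^1)\in H_0^1(\Omega)\times L^2(\Omega)$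 such that, with $v(\cdot,f)$ the third component of the quadruple attached to $f$ by 1, $$\big\langle v'(T,f)-v^1,\widehat f^0-f^0\big\rangle_{H^{-1}(\Omega)\times H_0^1(\Omega)}-\big(v(T,f)-v^0,\widehat f^1-f^1\big)+\rho_1\big(\|\widehat f^0\|-\|f^0\|\big)+\rho_0\big(|\widehat f^1|-|f^1|\big)\ge0$$ for all $\widehat f=(\widehat f^0,\widehat f^1)\in H_0^1(\Omega)\times L^2(\Omega)$. 3. For this $f$, an optimal leader exists and is unique, and it is $$w_1=-\frac1{\alpha_k^2}\,\partial_\nu\varphi\quad\text{on }\Sigma_0,$$ where $\varphi$ is the first component of the quadruple attached to $f$. -/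

import Mathlib

open MeasureTheory Set Filter Topology
open scoped ContDiff ENNReal

noncomputable section

namespace StringControl

/-! ### Function spaces on the reference interval `(0, 1)` and on the time interval `(0, T)` -/

/-- Lebesgue measure on `Ω = (0, 1)`. -/
abbrev muOmega : Measure ℝ := volume.restrict (Ioo (0 : ℝ) 1)

/-- Lebesgue measure on `(0, T)`, that is, on the boundary part `Σ₀ = {0} × (0, T)`. -/
abbrev muTime (T : ℝ) : Measure ℝ := volume.restrict (Ioo (0 : ℝ) T)

/-- The space `L²(0, 1)`. -/
abbrev L2 : Type := Lp ℝ 2 muOmega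

/-- The space `H¹₀(0, 1)`: the closure of `C_c^∞(0, 1)` for the `H¹` topology. An element is stored
as the pair of a function and its weak derivative, both in `L²(0, 1)`. -/
def H10 : Submodule ℝ (L2 × L2) :=
  (Submodule.span ℝ {q : L2 × L2 | ∃ η : ℝ → ℝ, ContDiff ℝ ∞ η ∧ HasCompactSupport η ∧
    tsupport η ⊆ Ioo 0 1 ∧ (⇑q.1 =ᵐ[muOmega] η) ∧ (⇑q.2 =ᵐ[muOmega] deriv η)}).topologicalClosure

/-- The element of `L²(0, 1)` underlying an element of `H¹₀(0, 1)`. -/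
def h10Val (f : H10) : L2 := f.1.1

/-- The weak derivative of an element of `H¹₀(0, 1)`. -/
def h10Deriv (f : H10) : L2 := f.1.2

/-- The norm `‖f‖ = |f_y|_{L²(0,1)}` of `H¹₀(0, 1)`. -/
def h10Norm (f : H10) : ℝ := ‖h10Deriv f‖

/-- The space `H⁻¹(0, 1)`, the topological dual of `H¹₀(0, 1)`. -/
abbrev Hm1 : Type := H10 →L[ℝ] ℝ

/-- The canonical embedding of `L²(0, 1)` in `H⁻¹(0, 1)`, `g ↦ (h ↦ (g, h))`. -/
def l2ToHm1 (g : L2) : Hm1 :=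
  (innerSL ℝ g).comp ((ContinuousLinearMap.fst ℝ L2 L2).comp H10.subtypeL)

/-- The closed ball of centre `c` and radius `r` in `H⁻¹(0, 1)`, for the norm dual to
`h10Norm`. -/
def hm1Ball (c : Hm1) (r : ℝ) : Set Hm1 :=
  {ℓ | ∀ h : H10, |ℓ h - c h| ≤ r * h10Norm h}

/-! ### The differential operators -/

/-- `α_k(t) = 1 + k t`, the length of the string at time `t`. -/
def alpha (k t : ℝ) : ℝ := 1 + k * t

/-- `β_k(y, t) = (1 - k² y²) / α_k(t)`. -/
def beta (k y t : ℝ) : ℝ := (1 - k ^ 2 * y ^ 2) / alpha k t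

/-- `γ_k(y) = - 2 k y`. -/
def gamma (k y : ℝ) : ℝ := -2 * k * y

/-- Derivative in the first variable, `y`. -/
def dy (θ : ℝ → ℝ → ℝ) : ℝ → ℝ → ℝ := fun y t => deriv (fun z => θ z t) y

/-- Derivative in the second variable, `t`. -/
def dt (θ : ℝ → ℝ → ℝ) : ℝ → ℝ → ℝ := fun y t => deriv (fun s => θ y s) t

/-- `L θ = - [ (β_k / α_k) θ_y ]_y + (γ_k / α_k) θ'_y`. -/
def opL (k : ℝ) (θ : ℝ → ℝ → ℝ) : ℝ → ℝ → ℝ := fun y t =>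
  -dy (fun y t => beta k y t / alpha k t * dy θ y t) y t
    + gamma k y / alpha k t * dy (dt θ) y t

/-- The formal adjoint of `L`: `L* θ = - [ (β_k / α_k) θ_y ]_y + [ (γ_k / α_k) θ ]'_y`. -/
def opLadj (k : ℝ) (θ : ℝ → ℝ → ℝ) : ℝ → ℝ → ℝ := fun y t =>
  -dy (fun y t => beta k y t / alpha k t * dy θ y t) y t
    + dy (dt (fun y t => gamma k y / alpha k t * θ y t)) y t

/-! ### Solutions -/

/-- Test functions for solutions by transposition: smooth on the closed rectangle, zero for `y = 0`
and `y = 1`, with zero Cauchy data at `t = T`. -/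
structure IsTranspositionTest (T : ℝ) (θ : ℝ → ℝ → ℝ) : Prop where
  smooth : ContDiff ℝ ∞ (fun z : ℝ × ℝ => θ z.1 z.2)
  left : ∀ t ∈ Icc 0 T, θ 0 t = 0
  right : ∀ t ∈ Icc 0 T, θ 1 t = 0
  final : ∀ y ∈ Icc (0 : ℝ) 1, θ y T = 0
  final_dt : ∀ y ∈ Icc (0 : ℝ) 1, dt θ y T = 0

/-- Test functions in `C_c^∞(Q)`, `Q = (0, 1) × (0, T)`. -/
structure IsInteriorTest (T : ℝ) (θ : ℝ → ℝ → ℝ) : Prop where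
  smooth : ContDiff ℝ ∞ (fun z : ℝ × ℝ => θ z.1 z.2)
  compact : HasCompactSupport (fun z : ℝ × ℝ => θ z.1 z.2)
  support : tsupport (fun z : ℝ × ℝ => θ z.1 z.2) ⊆ Ioo (0 : ℝ) 1 ×ˢ Ioo (0 : ℝ) T

/-- `v ∈ C([0,T]; L²(0,1)) ∩ C¹([0,T]; H⁻¹(0,1))`, with time derivative `dv`, is the solution by
transposition of `v'' + L v = 0` in `Q`, `v = w` for `y = 0`, `v = 0` for `y = 1`,
`v(0) = v'(0) = 0`, where `w ∈ L²(0, T)`. -/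
structure IsState (k T : ℝ) (w : ℝ → ℝ) (v : ℝ → L2) (dv : ℝ → Hm1) : Prop where
  control_memLp : MemLp w 2 (muTime T)
  cont : ContinuousOn v (Icc 0 T)
  cont_deriv : ContinuousOn dv (Icc 0 T)
  hasDeriv : ∀ t ∈ Icc 0 T, HasDerivWithinAt (fun s => l2ToHm1 (v s)) (dv t) (Icc 0 T) t
  init : v 0 = 0
  init_deriv : dv 0 = 0
  transposition : ∀ θ : ℝ → ℝ → ℝ, IsTranspositionTest T θ →
    ∫ t in Ioo 0 T, ∫ y, v t y * (dt (dt θ) y t + opLadj k θ y t) ∂muOmega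
      = ∫ t in Ioo 0 T, 1 / alpha k t ^ 2 * (w t * dy θ 0 t)

/-- `q ∈ C([0,T]; H¹₀(0,1)) ∩ C¹([0,T]; L²(0,1))`, with time derivative `dq`, solves
`q'' + L* q = F` in the sense of distributions on `Q`, and `q = 0` for `y = 0` and `y = 1`. -/
structure IsAdjointState (k T : ℝ) (F : ℝ → L2) (q : ℝ → H10) (dq : ℝ → L2) : Prop where
  cont : ContinuousOn q (Icc 0 T)
  cont_deriv : ContinuousOn dq (Icc 0 T)
  hasDeriv : ∀ t ∈ Icc 0 T, HasDerivWithinAt (fun s => h10Val (q s)) (dq t) (Icc 0 T) t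
  weak : ∀ θ : ℝ → ℝ → ℝ, IsInteriorTest T θ →
    ∫ t in Ioo 0 T, ∫ y, h10Val (q t) y * (dt (dt θ) y t + opL k θ y t) ∂muOmega
      = ∫ t in Ioo 0 T, ∫ y, F t y * θ y t ∂muOmega

/-- `n ∈ L²(0, T)` is the trace on `Σ₀ = {0} × (0, T)` of the outward normal derivative
`∂q/∂ν = -q_y`: the averages of `q_y(·, t)` over `(0, ε)` tend to `-n(t)` in `L²(0, T)`. -/
structure IsNormalTrace (T : ℝ) (q : ℝ → H10) (n : ℝ → ℝ) : Prop where
  memLp : MemLp n 2 (muTime T)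
  tendsto : Tendsto
    (fun ε : ℝ => eLpNorm (fun t => ε⁻¹ * (∫ y in Ioo 0 ε, h10Deriv (q t) y) + n t) 2 (muTime T))
    (𝓝[>] 0) (𝓝 0)

/-! ### The two players -/

/-- The cost of the follower, as a function of the state `v` and of the follower's control `w₂`. -/
def costFollower (k T σ : ℝ) (v₂ v : ℝ → L2) (w₂ : ℝ → ℝ) : ℝ :=
  1 / 2 * (∫ t in Ioo 0 T, alpha k t * ‖v t - v₂ t‖ ^ 2)
    + σ / 2 * (∫ t in Ioo 0 T, w₂ t ^ 2)

/-- The cost of the leader. -/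
def costLeader (T : ℝ) (w₁ : ℝ → ℝ) : ℝ := 1 / 2 * (∫ t in Ioo 0 T, w₁ t ^ 2)

/-- `w₂` is a Nash equilibrium for the leader's choice `w₁`: it minimizes the follower's cost over
`L²(Σ₀)`; the total control is `w₁ + w₂`. -/
def IsNashEquilibrium (k T σ : ℝ) (v₂ : ℝ → L2) (w₁ w₂ : ℝ → ℝ) : Prop :=
  MemLp w₂ 2 (muTime T) ∧ ∃ (v : ℝ → L2) (dv : ℝ → Hm1), IsState k T (w₁ + w₂) v dv ∧
    ∀ (z : ℝ → ℝ) (u : ℝ → L2) (du : ℝ → Hm1), MemLp z 2 (muTime T) → IsState k T (w₁ + z) u du →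
      costFollower k T σ v₂ v w₂ ≤ costFollower k T σ v₂ u z

/-- The admissible leaders: those for which the state with the follower at its Nash equilibrium
satisfies `v(T) ∈ B(v⁰, ρ₀)` in `L²(0,1)` and `v'(T) ∈ B(v¹, ρ₁)` in `H⁻¹(0,1)`. -/
def admissibleLeaders (k T σ ρ₀ ρ₁ : ℝ) (v₂ : ℝ → L2) (v0 : L2) (v1 : Hm1) : Set (ℝ → ℝ) :=
  {w₁ | MemLp w₁ 2 (muTime T) ∧ ∃ (w₂ : ℝ → ℝ) (v : ℝ → L2) (dv : ℝ → Hm1),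
    IsNashEquilibrium k T σ v₂ w₁ w₂ ∧ IsState k T (w₁ + w₂) v dv ∧
    v T ∈ Metric.closedBall v0 ρ₀ ∧ dv T ∈ hm1Ball v1 ρ₁}

/-- `w₁` minimizes the leader's cost over the admissible leaders. -/
def IsOptimalLeader (k T σ ρ₀ ρ₁ : ℝ) (v₂ : ℝ → L2) (v0 : L2) (v1 : Hm1) (w₁ : ℝ → ℝ) : Prop :=
  w₁ ∈ admissibleLeaders k T σ ρ₀ ρ₁ v₂ v0 v1 ∧
    ∀ w ∈ admissibleLeaders k T σ ρ₀ ρ₁ v₂ v0 v1, costLeader T w₁ ≤ costLeader T w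

/-! ### The optimality system -/

/-- Candidates for the quadruple `(φ, ψ, v, p)`, with the time derivatives, and with the outward
normal derivatives `nφ`, `np` of `φ` and `p` on `Σ₀`. -/
structure Quadruple where
  φ : ℝ → H10
  dφ : ℝ → L2
  ψ : ℝ → L2
  dψ : ℝ → Hm1
  v : ℝ → L2
  dv : ℝ → Hm1
  p : ℝ → H10
  dp : ℝ → L2
  nφ : ℝ → ℝ
  np : ℝ → ℝ

/-- Two quadruples agree on `[0, T]`. -/
structure Quadruple.Same (T : ℝ) (s s' : Quadruple) : Prop where
  φ : EqOn s.φ s'.φ (Icc 0 T)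
  dφ : EqOn s.dφ s'.dφ (Icc 0 T)
  ψ : EqOn s.ψ s'.ψ (Icc 0 T)
  dψ : EqOn s.dψ s'.dψ (Icc 0 T)
  v : EqOn s.v s'.v (Icc 0 T)
  dv : EqOn s.dv s'.dv (Icc 0 T)
  p : EqOn s.p s'.p (Icc 0 T)
  dp : EqOn s.dp s'.dp (Icc 0 T)
  nφ : s.nφ =ᵐ[muTime T] s'.nφ
  np : s.np =ᵐ[muTime T] s'.np

/-- The coupled system for `(φ, ψ, v, p)` with final data `f = (f⁰, f¹)`. The final conditions for
`φ` are `φ(T) = f⁰` and `φ'(T) + [ (γ_k / α_k(T)) φ(T) ]_y = f¹`. -/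
structure IsOptimalitySystem (k T σ : ℝ) (v₂ : ℝ → L2) (f : H10 × L2) (s : Quadruple) : Prop where
  φ_eq : IsAdjointState k T (fun t => alpha k t • s.ψ t) s.φ s.dφ
  φ_trace : IsNormalTrace T s.φ s.nφ
  φ_final : s.φ T = f.1
  dφ_final : ∀ᵐ y ∂muOmega, s.dφ T y
    + (deriv (gamma k) y * h10Val f.1 y + gamma k y * h10Deriv f.1 y) / alpha k T = f.2 y
  ψ_eq : IsState k T (fun t => 1 / (σ * alpha k t ^ 2) * s.nφ t) s.ψ s.dψ
  v_eq : IsState k T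
    (fun t => -(1 / alpha k t ^ 2) * s.nφ t + 1 / (σ * alpha k t ^ 2) * s.np t) s.v s.dv
  p_eq : IsAdjointState k T (fun t => alpha k t • (s.v t - v₂ t)) s.p s.dp
  p_trace : IsNormalTrace T s.p s.np
  p_final : s.p T = 0
  dp_final : s.dp T = 0

/-- `f = (f⁰, f¹)` solves the variational inequality, where `v` is the third component of the
quadruple attached to `f`. -/
def SolvesVI (k T σ ρ₀ ρ₁ : ℝ) (v₂ : ℝ → L2) (v0 : L2) (v1 : Hm1) (f : H10 × L2) : Prop :=
  ∃ s : Quadruple, IsOptimalitySystem k T σ v₂ f s ∧ ∀ g : H10 × L2,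
    0 ≤ (s.dv T - v1) (g.1 - f.1) - inner ℝ (s.v T - v0) (g.2 - f.2)
      + ρ₁ * (h10Norm g.1 - h10Norm f.1) + ρ₀ * (‖g.2‖ - ‖f.2‖)

end StringControl

end

open scoped BoundedContinuousFunction

noncomputable section

namespace StringControl

/-! In the variable x = α y the equation is the constant-coefficient wave equation on the interval 0
< x < α(t), so everything is explicit along the two characteristic fields `charD k e` = α ∂_t + (e -
k y) ∂_y, e = ±1, written D_e below. Their first integrals are `charS k e` = α (1 - e k y). For both
signs the invariant R_e = D_{-e} θ - k θ (`riem`) satisfies D_e (α⁻² R_e) = θ'' + L*θ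
(`charD_riem`). Integrating D_e of α⁻⁴ times a weighted R_e² over a rectangle gives, according to
the weight, the energy estimate, the bound of the boundary trace, and the observability inequality
(`exists_observability`), which is the place where T > 2/(1-k) enters.

These estimates are proved for smooth functions. The data of smooth functions are dense
(`denseRange_dataMap`), because finite sums over reflections solve the wave equation with right-hand
side f₁(`charS k 1`) f₂(`charS k (-1)`), and such products are total in L²(Q)
(`ae_eq_zero_of_forall_charBox`). Hence the solution of the backward problem, its velocity and the
trace q_y(0,·)/α² extend to bounded operators `adjPos`, `adjVel`, `adjTrace`. The state is a
difference of two travelling waves depending continuously on the control (`statePos`); Green's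
formula then yields `duality`. Uniqueness for both problems comes from the same explicit test
functions.

The rest is Hilbert space theory. Let S be the map from controls to states in L²(Q). By duality S*
sends a source to the trace of the backward solution with zero final data. Put G = S*αS (`gram`).
The follower's equilibrium means (σ + G) w = σ w₁ + S*(α v₂) for the total control w, which is
uniquely solvable. Eliminating ψ and p from the optimality system leaves (1 + σ⁻¹G) c = `dataTrace`
f for c = -α⁻² ∂_ν φ. Thus c = Λ f with Λ = `leaderMap`, and claim 1 follows.

Since (σ + G)⁻¹ is symmetric, Λ is also the adjoint of the linear part of the map from the leader to
the final state (`state_final_eq`). A leader w is therefore admissible exactly when (w, Λ h) - m(h)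
+ j(h) ≥ 0 for all h, with j the support function of the product of the two balls, and the
variational inequality is the optimality condition of ½|Λ f|² - m(f) + j(f). Observability gives |f|
≤ c |Λ f|, so this functional has exactly one minimizer: claim 2. Testing the inequality with f + h
and with 0 shows that Λ f is admissible and is the element of least norm among the admissible
leaders: claim 3. -/

/-! ### Smooth functions of `(y, t)` -/

/-- `θ` is smooth on the plane. -/
def Sm (θ : ℝ → ℝ → ℝ) : Prop := ContDiff ℝ ∞ (fun z : ℝ × ℝ => θ z.1 z.2)

namespace Sm

variable {θ ζ : ℝ → ℝ → ℝ}

theorem add (h : Sm θ) (h' : Sm ζ) : Sm (fun y t => θ y t + ζ y t) := ContDiff.add h h'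
theorem sub (h : Sm θ) (h' : Sm ζ) : Sm (fun y t => θ y t - ζ y t) := ContDiff.sub h h'
theorem neg (h : Sm θ) : Sm (fun y t => -θ y t) := ContDiff.neg h
theorem mul (h : Sm θ) (h' : Sm ζ) : Sm (fun y t => θ y t * ζ y t) := ContDiff.mul h h'
theorem pow (h : Sm θ) (n : ℕ) : Sm (fun y t => θ y t ^ n) := ContDiff.pow h n
theorem const (c : ℝ) : Sm (fun _ _ => c) := contDiff_const
theorem of_fst {f : ℝ → ℝ} (hf : ContDiff ℝ ∞ f) : Sm (fun y _ => f y) := hf.comp contDiff_fst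
theorem of_snd {f : ℝ → ℝ} (hf : ContDiff ℝ ∞ f) : Sm (fun _ t => f t) := hf.comp contDiff_snd
theorem comp {f : ℝ → ℝ} (hf : ContDiff ℝ ∞ f) (h : Sm θ) : Sm (fun y t => f (θ y t)) :=
  ContDiff.comp (f := fun z : ℝ × ℝ => θ z.1 z.2) hf h
theorem zero : Sm 0 := contDiff_const
theorem const_mul (c : ℝ) (h : Sm θ) : Sm (fun y t => c * θ y t) := (const c).mul h

theorem sum {ι : Type*} (s : Finset ι) {f : ι → ℝ → ℝ → ℝ} (h : ∀ i ∈ s, Sm (f i)) :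
    Sm (fun y t => ∑ i ∈ s, f i y t) := ContDiff.sum h

theorem slice_fst (h : Sm θ) (t : ℝ) : ContDiff ℝ ∞ (fun y => θ y t) :=
  ContDiff.comp (g := fun z : ℝ × ℝ => θ z.1 z.2) h (contDiff_id.prodMk contDiff_const)

theorem slice_snd (h : Sm θ) (y : ℝ) : ContDiff ℝ ∞ (fun t => θ y t) :=
  ContDiff.comp (g := fun z : ℝ × ℝ => θ z.1 z.2) h (contDiff_const.prodMk contDiff_id)

theorem continuous (h : Sm θ) : Continuous (fun z : ℝ × ℝ => θ z.1 z.2) := ContDiff.continuous h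

theorem continuous_fst (h : Sm θ) (t : ℝ) : Continuous (fun y => θ y t) :=
  (h.slice_fst t).continuous

theorem continuous_snd (h : Sm θ) (y : ℝ) : Continuous (fun t => θ y t) :=
  (h.slice_snd y).continuous

theorem hasDerivAt_dy (h : Sm θ) (y t : ℝ) : HasDerivAt (fun z => θ z t) (dy θ y t) y :=
  ((h.slice_fst t).differentiable (by simp) y).hasDerivAt

theorem hasDerivAt_dt (h : Sm θ) (y t : ℝ) : HasDerivAt (fun s => θ y s) (dt θ y t) t :=
  ((h.slice_snd y).differentiable (by simp) t).hasDerivAt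

theorem hasFDerivAt (h : Sm θ) (z : ℝ × ℝ) :
    HasFDerivAt (fun z : ℝ × ℝ => θ z.1 z.2) (fderiv ℝ (fun z : ℝ × ℝ => θ z.1 z.2) z) z :=
  (ContDiff.differentiable h (by simp) z).hasFDerivAt

theorem dy_eq_fderiv (h : Sm θ) (y t : ℝ) :
    dy θ y t = fderiv ℝ (fun z : ℝ × ℝ => θ z.1 z.2) (y, t) (1, 0) := by
  have h1 : HasDerivAt (fun z : ℝ => (z, t)) ((1 : ℝ), (0 : ℝ)) y :=
    (hasDerivAt_id y).prodMk (hasDerivAt_const y t)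
  exact ((h.hasFDerivAt (y, t)).comp_hasDerivAt y h1).deriv

theorem dt_eq_fderiv (h : Sm θ) (y t : ℝ) :
    dt θ y t = fderiv ℝ (fun z : ℝ × ℝ => θ z.1 z.2) (y, t) (0, 1) := by
  have h1 : HasDerivAt (fun s : ℝ => (y, s)) ((0 : ℝ), (1 : ℝ)) t :=
    (hasDerivAt_const t y).prodMk (hasDerivAt_id t)
  exact ((h.hasFDerivAt (y, t)).comp_hasDerivAt t h1).deriv

theorem dy (h : Sm θ) : Sm (dy θ) := by
  have : (fun z : ℝ × ℝ => StringControl.dy θ z.1 z.2)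
      = fun z => fderiv ℝ (fun z : ℝ × ℝ => θ z.1 z.2) z (1, 0) := by
    ext z; exact h.dy_eq_fderiv z.1 z.2
  unfold Sm; rw [this]
  exact (ContDiff.fderiv_right (m := ∞) h (by simp)).clm_apply contDiff_const

theorem dt (h : Sm θ) : Sm (dt θ) := by
  have : (fun z : ℝ × ℝ => StringControl.dt θ z.1 z.2)
      = fun z => fderiv ℝ (fun z : ℝ × ℝ => θ z.1 z.2) z (0, 1) := by
    ext z; exact h.dt_eq_fderiv z.1 z.2
  unfold Sm; rw [this]
  exact (ContDiff.fderiv_right (m := ∞) h (by simp)).clm_apply contDiff_const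

theorem dt_dy (h : Sm θ) (y t : ℝ) :
    StringControl.dt (StringControl.dy θ) y t = StringControl.dy (StringControl.dt θ) y t := by
  set F : ℝ × ℝ → ℝ := fun z => θ z.1 z.2 with hF
  have hd : DifferentiableAt ℝ (fderiv ℝ F) (y, t) :=
    (ContDiff.fderiv_right (m := ∞) h (by simp)).differentiable (by simp) _
  have key : ∀ v w : ℝ × ℝ, fderiv ℝ (fun z => fderiv ℝ F z v) (y, t) w
      = fderiv ℝ (fderiv ℝ F) (y, t) w v := by
    intro v w
    rw [fderiv_clm_apply hd (differentiableAt_const v)]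
    simp
  have e1 : (fun z : ℝ × ℝ => StringControl.dy θ z.1 z.2) = fun z => fderiv ℝ F z (1, 0) := by
    ext z; exact h.dy_eq_fderiv z.1 z.2
  have e2 : (fun z : ℝ × ℝ => StringControl.dt θ z.1 z.2) = fun z => fderiv ℝ F z (0, 1) := by
    ext z; exact h.dt_eq_fderiv z.1 z.2
  rw [h.dy.dt_eq_fderiv, h.dt.dy_eq_fderiv, e1, e2, key, key]
  have hs : IsSymmSndFDerivAt ℝ F (y, t) :=
    (ContDiff.contDiffAt h).isSymmSndFDerivAt (by
      rw [minSmoothness_of_isRCLikeNormedField]; exact WithTop.coe_le_coe.2 le_top)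
  exact hs.eq _ _

theorem dy_mul (h : Sm θ) (h' : Sm ζ) (y t : ℝ) :
    StringControl.dy (fun y t => θ y t * ζ y t) y t
      = StringControl.dy θ y t * ζ y t + θ y t * StringControl.dy ζ y t :=
  ((h.hasDerivAt_dy y t).mul (h'.hasDerivAt_dy y t)).deriv

theorem dt_mul (h : Sm θ) (h' : Sm ζ) (y t : ℝ) :
    StringControl.dt (fun y t => θ y t * ζ y t) y t
      = StringControl.dt θ y t * ζ y t + θ y t * StringControl.dt ζ y t :=
  ((h.hasDerivAt_dt y t).mul (h'.hasDerivAt_dt y t)).deriv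

theorem dy_add (h : Sm θ) (h' : Sm ζ) (y t : ℝ) :
    StringControl.dy (fun y t => θ y t + ζ y t) y t
      = StringControl.dy θ y t + StringControl.dy ζ y t :=
  ((h.hasDerivAt_dy y t).add (h'.hasDerivAt_dy y t)).deriv

theorem dt_add (h : Sm θ) (h' : Sm ζ) (y t : ℝ) :
    StringControl.dt (fun y t => θ y t + ζ y t) y t
      = StringControl.dt θ y t + StringControl.dt ζ y t :=
  ((h.hasDerivAt_dt y t).add (h'.hasDerivAt_dt y t)).deriv

theorem dy_sub (h : Sm θ) (h' : Sm ζ) (y t : ℝ) :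
    StringControl.dy (fun y t => θ y t - ζ y t) y t
      = StringControl.dy θ y t - StringControl.dy ζ y t :=
  ((h.hasDerivAt_dy y t).sub (h'.hasDerivAt_dy y t)).deriv

theorem dt_sub (h : Sm θ) (h' : Sm ζ) (y t : ℝ) :
    StringControl.dt (fun y t => θ y t - ζ y t) y t
      = StringControl.dt θ y t - StringControl.dt ζ y t :=
  ((h.hasDerivAt_dt y t).sub (h'.hasDerivAt_dt y t)).deriv

end Sm

theorem dy_of_fst (f : ℝ → ℝ) (y t : ℝ) : dy (fun y _ => f y) y t = deriv f y := rfl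
theorem dt_of_snd (f : ℝ → ℝ) (y t : ℝ) : dt (fun _ t => f t) y t = deriv f t := rfl
theorem dy_of_snd (f : ℝ → ℝ) (y t : ℝ) : dy (fun _ t => f t) y t = 0 := by simp [dy]
theorem dt_of_fst (f : ℝ → ℝ) (y t : ℝ) : dt (fun y _ => f y) y t = 0 := by simp [dt]

theorem dy_const_mul (c : ℝ) (θ : ℝ → ℝ → ℝ) (y t : ℝ) :
    dy (fun y t => c * θ y t) y t = c * dy θ y t := by
  simp [dy]

theorem dt_const_mul (c : ℝ) (θ : ℝ → ℝ → ℝ) (y t : ℝ) :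
    dt (fun y t => c * θ y t) y t = c * dt θ y t := by
  simp [dt]

theorem dy_comp {f : ℝ → ℝ} (hf : ContDiff ℝ ∞ f) {θ : ℝ → ℝ → ℝ} (h : Sm θ) (y t : ℝ) :
    dy (fun y t => f (θ y t)) y t = deriv f (θ y t) * dy θ y t :=
  (((hf.differentiable (by simp) _).hasDerivAt).comp y (h.hasDerivAt_dy y t)).deriv

theorem dt_comp {f : ℝ → ℝ} (hf : ContDiff ℝ ∞ f) {θ : ℝ → ℝ → ℝ} (h : Sm θ) (y t : ℝ) :
    dt (fun y t => f (θ y t)) y t = deriv f (θ y t) * dt θ y t :=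
  (((hf.differentiable (by simp) _).hasDerivAt).comp t (h.hasDerivAt_dt y t)).deriv

theorem deriv_smooth {f : ℝ → ℝ} (hf : ContDiff ℝ ∞ f) : ContDiff ℝ ∞ (deriv f) :=
  (contDiff_infty_iff_deriv.1 hf).2

theorem hasDerivAt_alpha (k t : ℝ) : HasDerivAt (alpha k) k t := by
  unfold alpha
  simpa using ((hasDerivAt_id t).const_mul k).const_add 1

theorem contDiff_alpha (k : ℝ) : ContDiff ℝ ∞ (alpha k) := by
  unfold alpha; fun_prop

theorem alpha_pos {k t : ℝ} (hk : 0 < k) (ht : 0 ≤ t) : 0 < alpha k t := by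
  unfold alpha; positivity

theorem one_le_alpha {k t : ℝ} (hk : 0 < k) (ht : 0 ≤ t) : 1 ≤ alpha k t := by
  unfold alpha; nlinarith [mul_nonneg hk.le ht]

theorem alpha_mono {k s t : ℝ} (hk : 0 < k) (h : s ≤ t) : alpha k s ≤ alpha k t := by
  unfold alpha; nlinarith

/-! ### A smooth function equal to `1 / α` for nonnegative times -/

/-- A smooth function on the line which is equal to `1 / α_k` where `α_k ≥ 1/2`. -/
def invAlpha (k t : ℝ) : ℝ :=
  alpha k t / (alpha k t ^ 2 + (1 - Real.smoothTransition (4 * alpha k t - 1)))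

/-- `Sm` asks for smoothness on the whole plane, while 1/α is singular at t = -1/k. The denominator
here has no zero: where α = 0 the transition is evaluated at -1, so the denominator equals 1, and
elsewhere α² > 0. -/
theorem contDiff_invAlpha (k : ℝ) : ContDiff ℝ ∞ (invAlpha k) := by
  unfold invAlpha
  have h1 := contDiff_alpha k
  refine h1.div ((h1.pow 2).add (contDiff_const.sub
    (Real.smoothTransition.contDiff.comp ((contDiff_const.mul h1).sub contDiff_const)))) ?_
  intro t
  by_cases h : alpha k t = 0
  · rw [h, Real.smoothTransition.zero_of_nonpos (by norm_num)]; norm_num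
  · have := Real.smoothTransition.le_one (4 * alpha k t - 1)
    have h2 : 0 < alpha k t ^ 2 := by positivity
    linarith

theorem invAlpha_eq {k t : ℝ} (h : 1 / 2 ≤ alpha k t) : invAlpha k t = (alpha k t)⁻¹ := by
  have h0 : alpha k t ≠ 0 := by linarith
  rw [invAlpha, Real.smoothTransition.one_of_one_le (by linarith)]
  field_simp; ring

theorem invAlpha_eq_of_nonneg {k t : ℝ} (hk : 0 < k) (ht : 0 ≤ t) :
    invAlpha k t = (alpha k t)⁻¹ := invAlpha_eq (by linarith [one_le_alpha hk ht])

theorem eventually_invAlpha {k t : ℝ} (hk : 0 < k) (ht : 0 ≤ t) :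
    ∀ᶠ s in 𝓝 t, invAlpha k s = (alpha k s)⁻¹ ∧ 0 < alpha k s := by
  have h : ∀ᶠ s in 𝓝 t, 1 / 2 < alpha k s :=
    (contDiff_alpha k).continuous.continuousAt.eventually
      (lt_mem_nhds (by linarith [one_le_alpha hk ht]))
  filter_upwards [h] with s hs
  exact ⟨invAlpha_eq hs.le, by linarith⟩

theorem deriv_invAlpha {k t : ℝ} (hk : 0 < k) (ht : 0 ≤ t) :
    deriv (invAlpha k) t = -k * invAlpha k t ^ 2 := by
  have h : invAlpha k =ᶠ[𝓝 t] fun s => (alpha k s)⁻¹ :=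
    (eventually_invAlpha hk ht).mono fun s hs => hs.1
  have h0 : alpha k t ≠ 0 := (alpha_pos hk ht).ne'
  have h1 : deriv (fun s => (alpha k s)⁻¹) t = _ := ((hasDerivAt_alpha k t).inv h0).deriv
  rw [h.deriv_eq, h1, invAlpha_eq_of_nonneg hk ht]
  field_simp

theorem alpha_mul_invAlpha {k t : ℝ} (hk : 0 < k) (ht : 0 ≤ t) : alpha k t * invAlpha k t = 1 := by
  rw [invAlpha_eq_of_nonneg hk ht, mul_inv_cancel₀ (alpha_pos hk ht).ne']

theorem invAlpha_pos {k t : ℝ} (hk : 0 < k) (ht : 0 ≤ t) : 0 < invAlpha k t := by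
  rw [invAlpha_eq_of_nonneg hk ht]; exact inv_pos.2 (alpha_pos hk ht)

theorem invAlpha_le_one {k t : ℝ} (hk : 0 < k) (ht : 0 ≤ t) : invAlpha k t ≤ 1 := by
  rw [invAlpha_eq_of_nonneg hk ht]; exact inv_le_one_of_one_le₀ (one_le_alpha hk ht)

theorem Sm.alpha (k : ℝ) : Sm (fun _ t => alpha k t) := Sm.of_snd (contDiff_alpha k)
theorem Sm.invAlpha (k : ℝ) : Sm (fun _ t => invAlpha k t) := Sm.of_snd (contDiff_invAlpha k)
theorem Sm.affine (a b : ℝ) : Sm (fun y _ => a - b * y) := Sm.of_fst (by fun_prop)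

/-! ### Characteristic derivatives -/

/-- Derivative along the characteristic field `α_k ∂_t + (e - k y) ∂_y`, for `e = ±1`. -/
def charD (k e : ℝ) (θ : ℝ → ℝ → ℝ) : ℝ → ℝ → ℝ := fun y t =>
  alpha k t * dt θ y t + (e - k * y) * dy θ y t

theorem Sm.charD {θ : ℝ → ℝ → ℝ} (h : Sm θ) (k e : ℝ) : Sm (charD k e θ) :=
  ((Sm.alpha k).mul h.dt).add ((Sm.affine e k).mul h.dy)

theorem charD_mul {θ ζ : ℝ → ℝ → ℝ} (h : Sm θ) (h' : Sm ζ) (k e y t : ℝ) :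
    charD k e (fun y t => θ y t * ζ y t) y t
      = charD k e θ y t * ζ y t + θ y t * charD k e ζ y t := by
  simp only [charD, h.dy_mul h', h.dt_mul h']; ring

theorem charD_add {θ ζ : ℝ → ℝ → ℝ} (h : Sm θ) (h' : Sm ζ) (k e y t : ℝ) :
    charD k e (fun y t => θ y t + ζ y t) y t = charD k e θ y t + charD k e ζ y t := by
  simp only [charD, h.dy_add h', h.dt_add h']; ring

theorem charD_sub {θ ζ : ℝ → ℝ → ℝ} (h : Sm θ) (h' : Sm ζ) (k e y t : ℝ) :
    charD k e (fun y t => θ y t - ζ y t) y t = charD k e θ y t - charD k e ζ y t := by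
  simp only [charD, h.dy_sub h', h.dt_sub h']; ring

theorem charD_const_mul (c : ℝ) (θ : ℝ → ℝ → ℝ) (k e y t : ℝ) :
    charD k e (fun y t => c * θ y t) y t = c * charD k e θ y t := by
  simp only [charD, dy_const_mul, dt_const_mul]; ring

theorem charD_comp {f : ℝ → ℝ} (hf : ContDiff ℝ ∞ f) {θ : ℝ → ℝ → ℝ} (h : Sm θ) (k e y t : ℝ) :
    charD k e (fun y t => f (θ y t)) y t = deriv f (θ y t) * charD k e θ y t := by
  simp only [charD, dy_comp hf h, dt_comp hf h]; ring

theorem charD_alpha (k e y t : ℝ) : charD k e (fun _ t => alpha k t) y t = k * alpha k t := by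
  simp only [charD, dt_of_snd, dy_of_snd, (hasDerivAt_alpha k t).deriv]; ring

theorem charD_invAlpha {k t : ℝ} (hk : 0 < k) (ht : 0 ≤ t) (e y : ℝ) :
    charD k e (fun _ t => invAlpha k t) y t = -k * invAlpha k t := by
  simp only [charD, dt_of_snd, dy_of_snd, deriv_invAlpha hk ht]
  linear_combination (-k * invAlpha k t) * alpha_mul_invAlpha hk ht

theorem charD_affine (k e a b y t : ℝ) :
    charD k e (fun y _ => a - b * y) y t = -(e - k * y) * b := by
  have : deriv (fun y : ℝ => a - b * y) y = -b := by
    simp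
  simp only [charD, dt_of_fst, dy_of_fst, this]; ring

/-- The characteristic coordinate `α_k(t) (1 - e k y)`. -/
def charS (k e : ℝ) : ℝ → ℝ → ℝ := fun y t => alpha k t * (1 - e * k * y)

theorem Sm.charS (k e : ℝ) : Sm (charS k e) := (Sm.alpha k).mul (Sm.affine 1 (e * k))

/-- For e = e' = ±1 the right side is zero: functions of `charS k e` are constant along the field
with the same sign. This makes weights and travelling waves built from `charS` free of interior
terms. -/
theorem charD_charS (k e e' y t : ℝ) :
    charD k e (charS k e') y t = (1 - e * e') * (k * alpha k t) := by
  unfold charS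
  rw [charD_mul (Sm.alpha k) (Sm.affine 1 (e' * k)), charD_alpha, charD_affine]; ring

/-- The divergence form of `charD`. -/
theorem charD_eq_div {θ : ℝ → ℝ → ℝ} (h : Sm θ) (k e y t : ℝ) :
    charD k e θ y t = dt (fun y t => alpha k t * θ y t) y t
      + dy (fun y t => (e - k * y) * θ y t) y t := by
  have : deriv (fun y : ℝ => e - k * y) y = -k := by
    simp
  rw [(Sm.alpha k).dt_mul h, (Sm.affine e k).dy_mul h, dt_of_snd, dy_of_fst, this,
    (hasDerivAt_alpha k t).deriv, charD]
  ring

/-- The Riemann invariant `D_{-e} θ - k θ`. -/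
def riem (k e : ℝ) (θ : ℝ → ℝ → ℝ) : ℝ → ℝ → ℝ := fun y t => charD k (-e) θ y t - k * θ y t

theorem Sm.riem {θ : ℝ → ℝ → ℝ} (h : Sm θ) (k e : ℝ) : Sm (riem k e θ) :=
  (h.charD k (-e)).sub (h.const_mul k)

/-- `θ'' + L* θ`, as a smooth function. -/
def waveAdj (k : ℝ) (θ : ℝ → ℝ → ℝ) : ℝ → ℝ → ℝ := fun y t =>
  invAlpha k t ^ 2 * (charD k 1 (riem k 1 θ) y t - 2 * k * riem k 1 θ y t)

theorem Sm.waveAdj {θ : ℝ → ℝ → ℝ} (h : Sm θ) (k : ℝ) : Sm (waveAdj k θ) :=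
  ((Sm.invAlpha k).pow 2).mul (((h.riem k 1).charD k 1).sub ((h.riem k 1).const_mul (2 * k)))

/-- Second-order expansion of `D_e D_{-e}`. -/
theorem charD_charD {θ : ℝ → ℝ → ℝ} (h : Sm θ) {e : ℝ} (he : e * e = 1) (k y t : ℝ) :
    charD k e (charD k (-e) θ) y t
      = alpha k t ^ 2 * dt (dt θ) y t - 2 * k * y * alpha k t * dy (dt θ) y t
        - (1 - k ^ 2 * y ^ 2) * dy (dy θ) y t + k * alpha k t * dt θ y t
        - k * (e - k * y) * dy θ y t := by
  have h1 : charD k (-e) θ = fun y t => alpha k t * dt θ y t + (-e - k * y) * dy θ y t := rfl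
  rw [h1, charD_add ((Sm.alpha k).mul h.dt) ((Sm.affine (-e) k).mul h.dy),
    charD_mul (Sm.alpha k) h.dt, charD_mul (Sm.affine (-e) k) h.dy, charD_alpha, charD_affine]
  simp only [charD, h.dt_dy]
  linear_combination (-dy (dy θ) y t) * he

/-- Only e² = 1 matters in the expansion of D_e R_e - 2k R_e; the zero-order term -kθ of `riem` is
what makes the lower-order terms of both signs agree. As `waveAdj` is defined through e = 1, the
content lies in e = -1. -/
theorem charD_riem {θ : ℝ → ℝ → ℝ} (h : Sm θ) {k e t : ℝ} (he : e * e = 1) (hk : 0 < k)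
    (ht : 0 ≤ t) (y : ℝ) :
    charD k e (riem k e θ) y t = 2 * k * riem k e θ y t + alpha k t ^ 2 * waveAdj k θ y t := by
  have ha := alpha_mul_invAlpha hk ht
  have key : ∀ e : ℝ, e * e = 1 → charD k e (riem k e θ) y t - 2 * k * riem k e θ y t
      = alpha k t ^ 2 * dt (dt θ) y t - 2 * k * y * alpha k t * dy (dt θ) y t
        - (1 - k ^ 2 * y ^ 2) * dy (dy θ) y t - 2 * k * alpha k t * dt θ y t
        + 4 * k ^ 2 * y * dy θ y t + 2 * k ^ 2 * θ y t := by
    intro e he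
    have h1 : riem k e θ = fun y t => charD k (-e) θ y t - k * θ y t := rfl
    rw [h1, charD_sub (h.charD k (-e)) (h.const_mul k), charD_charD h he, charD_const_mul]
    simp only [charD]
    ring
  have h1 := key 1 (by norm_num)
  have he' := key e he
  rw [waveAdj]
  have : alpha k t ^ 2 * invAlpha k t ^ 2 = 1 := by rw [← mul_pow, ha, one_pow]
  linear_combination he' - h1
    - (charD k 1 (riem k 1 θ) y t - 2 * k * riem k 1 θ y t) * this

theorem dt_gamma_mul {θ : ℝ → ℝ → ℝ} (h : Sm θ) {k t : ℝ} (hk : 0 < k) (ht : 0 ≤ t) (y : ℝ) :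
    dt (fun y t => gamma k y / alpha k t * θ y t) y t
      = -2 * k * y * (invAlpha k t * dt θ y t - k * invAlpha k t ^ 2 * θ y t) := by
  have ha := (alpha_pos hk ht).ne'
  have h1 := ((hasDerivAt_const t (gamma k y)).div (hasDerivAt_alpha k t) ha).mul
    (h.hasDerivAt_dt y t)
  have : dt (fun y t => gamma k y / alpha k t * θ y t) y t = _ := h1.deriv
  rw [this, invAlpha_eq_of_nonneg hk ht, gamma]
  simp only [Pi.div_apply]
  field_simp
  ring

theorem dy_beta_dy {θ : ℝ → ℝ → ℝ} (h : Sm θ) {k t : ℝ} (hk : 0 < k) (ht : 0 ≤ t) (y : ℝ) :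
    dy (fun y t => beta k y t / alpha k t * dy θ y t) y t
      = invAlpha k t ^ 2 * ((1 - k ^ 2 * y ^ 2) * dy (dy θ) y t - 2 * k ^ 2 * y * dy θ y t) := by
  have ha := (alpha_pos hk ht).ne'
  have h0 : HasDerivAt (fun y : ℝ => 1 - k ^ 2 * y ^ 2) (-(k ^ 2 * (2 * y))) y := by
    simpa using ((hasDerivAt_pow 2 y).const_mul (k ^ 2)).const_sub 1
  have h1 := ((h0.div_const (alpha k t)).div_const (alpha k t)).mul (h.dy.hasDerivAt_dy y t)
  have : dy (fun y t => beta k y t / alpha k t * dy θ y t) y t = _ := h1.deriv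
  rw [this, invAlpha_eq_of_nonneg hk ht]
  field_simp
  ring

theorem wave_opLadj_eq {θ : ℝ → ℝ → ℝ} (h : Sm θ) {k t : ℝ} (hk : 0 < k) (ht : 0 ≤ t) (y : ℝ) :
    dt (dt θ) y t + opLadj k θ y t = waveAdj k θ y t := by
  have ha := alpha_mul_invAlpha hk ht
  have h2 : dy (dt (fun y t => gamma k y / alpha k t * θ y t)) y t
      = -2 * k * (invAlpha k t * dt θ y t - k * invAlpha k t ^ 2 * θ y t)
        -2 * k * y * (invAlpha k t * dy (dt θ) y t - k * invAlpha k t ^ 2 * dy θ y t) := by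
    have e : dy (dt (fun y t => gamma k y / alpha k t * θ y t)) y t = deriv (fun y =>
        -2 * k * y * (invAlpha k t * dt θ y t - k * invAlpha k t ^ 2 * θ y t)) y := by
      refine congrArg (fun f => deriv f y) (funext fun z => ?_)
      exact dt_gamma_mul h hk ht z
    rw [e]
    have h1 := (((hasDerivAt_id y).const_mul (-2 * k)).mul
      (((h.dt.hasDerivAt_dy y t).const_mul (invAlpha k t)).sub
        ((h.hasDerivAt_dy y t).const_mul (k * invAlpha k t ^ 2))))
    refine h1.deriv.trans ?_
    simp only [id, Pi.sub_apply]
    ring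
  rw [opLadj, dy_beta_dy h hk ht, h2]
  have hr := charD_riem h (e := 1) (by norm_num) hk ht y
  have h3 : riem k 1 θ = fun y t => charD k (-1) θ y t - k * θ y t := rfl
  rw [h3, charD_sub (h.charD k (-1)) (h.const_mul k), charD_charD h (by norm_num),
    charD_const_mul] at hr
  simp only [charD] at hr
  have hw : waveAdj k θ y t = invAlpha k t ^ 2 * (alpha k t ^ 2 * waveAdj k θ y t) := by
    linear_combination (-waveAdj k θ y t * (1 + alpha k t * invAlpha k t)) * ha
  rw [hw]
  have hr' := eq_sub_of_add_eq' hr.symm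
  rw [hr']
  linear_combination
    (-(1 + alpha k t * invAlpha k t) * dt (dt θ) y t + 2 * k * y * invAlpha k t * dy (dt θ) y t
      + 2 * k * invAlpha k t * dt θ y t) * ha

theorem wave_opL_eq {θ : ℝ → ℝ → ℝ} (h : Sm θ) {k t : ℝ} (hk : 0 < k) (ht : 0 ≤ t) (y : ℝ) :
    dt (dt θ) y t + opL k θ y t
      = invAlpha k t ^ 2 * (charD k 1 (charD k (-1) θ) y t - k * charD k (-1) θ y t) := by
  have ha := alpha_mul_invAlpha hk ht
  rw [opL, dy_beta_dy h hk ht, charD_charD h (by norm_num), charD, gamma,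
    div_eq_mul_inv, ← invAlpha_eq_of_nonneg hk ht]
  linear_combination
    (-(1 + alpha k t * invAlpha k t) * dt (dt θ) y t
      + 2 * k * y * invAlpha k t * dy (dt θ) y t) * ha

/-! ### The divergence theorem on rectangles -/

theorem integral_div_rectangle {P Q : ℝ → ℝ → ℝ} (hP : Sm P) (hQ : Sm Q) (y₀ y₁ t₀ t₁ : ℝ) :
    ∫ t in t₀..t₁, ∫ y in y₀..y₁, (dt P y t + dy Q y t)
      = (∫ y in y₀..y₁, P y t₁) - (∫ y in y₀..y₁, P y t₀)
        + ((∫ t in t₀..t₁, Q y₁ t) - ∫ t in t₀..t₁, Q y₀ t) := by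
  have h1 : ∀ t, ∫ y in y₀..y₁, (dt P y t + dy Q y t)
      = (∫ y in y₀..y₁, dt P y t) + (Q y₁ t - Q y₀ t) := by
    intro t
    rw [intervalIntegral.integral_add ((hP.dt.continuous_fst t).intervalIntegrable _ _)
      ((hQ.dy.continuous_fst t).intervalIntegrable _ _),
      intervalIntegral.integral_eq_sub_of_hasDerivAt (fun y _ => hQ.hasDerivAt_dy y t)
        ((hQ.dy.continuous_fst t).intervalIntegrable _ _)]
  have hc : Continuous fun t => ∫ y in y₀..y₁, dt P y t :=
    intervalIntegral.continuous_parametric_intervalIntegral_of_continuous'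
      (f := fun t y => dt P y t) (hP.dt.continuous.comp continuous_swap) _ _
  simp only [h1]
  have hc' : Continuous fun t => Q y₁ t - Q y₀ t :=
    (hQ.continuous_snd y₁).sub (hQ.continuous_snd y₀)
  rw [intervalIntegral.integral_add (hc.intervalIntegrable _ _) (hc'.intervalIntegrable _ _),
    intervalIntegral.integral_sub ((hQ.continuous_snd y₁).intervalIntegrable _ _)
      ((hQ.continuous_snd y₀).intervalIntegrable _ _),
    ← intervalIntegral.integral_sub ((hP.continuous_fst t₁).intervalIntegrable _ _)
      ((hP.continuous_fst t₀).intervalIntegrable _ _)]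
  congr 1
  rw [MeasureTheory.intervalIntegral_intervalIntegral_swap]
  · refine intervalIntegral.integral_congr fun y _ => ?_
    exact intervalIntegral.integral_eq_sub_of_hasDerivAt (fun t _ => hP.hasDerivAt_dt y t)
      ((hP.dt.continuous_snd y).intervalIntegrable _ _)
  · have hcont : Continuous (Function.uncurry fun t y => dt P y t) :=
      hP.dt.continuous.comp continuous_swap
    exact (hcont.continuousOn.integrableOn_compact (isCompact_uIcc.prod isCompact_uIcc)).mono_set
      (prod_mono uIoc_subset_uIcc uIoc_subset_uIcc)

theorem integral_charD {A : ℝ → ℝ → ℝ} (hA : Sm A) (k e y₀ y₁ t₀ t₁ : ℝ) :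
    ∫ t in t₀..t₁, ∫ y in y₀..y₁, charD k e A y t
      = (∫ y in y₀..y₁, alpha k t₁ * A y t₁) - (∫ y in y₀..y₁, alpha k t₀ * A y t₀)
        + ((∫ t in t₀..t₁, (e - k * y₁) * A y₁ t) - ∫ t in t₀..t₁, (e - k * y₀) * A y₀ t) := by
  simp only [charD_eq_div hA]
  exact integral_div_rectangle ((Sm.alpha k).mul hA) ((Sm.affine e k).mul hA) y₀ y₁ t₀ t₁

/-! ### Square-integrable classes of continuous functions -/

theorem integral_muTime {T : ℝ} (hT : 0 ≤ T) (f : ℝ → ℝ) :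
    ∫ x, f x ∂muTime T = ∫ x in (0 : ℝ)..T, f x := by
  rw [intervalIntegral.integral_of_le hT, integral_Ioc_eq_integral_Ioo]

instance (T : ℝ) : IsFiniteMeasure (muTime T) :=
  ⟨by simp [Real.volume_Ioo]⟩

theorem ae_muTime_mem (T : ℝ) : ∀ᵐ t ∂muTime T, t ∈ Ioo 0 T := ae_restrict_mem measurableSet_Ioo

theorem memLp_of_continuousOn {E : Type*} [NormedAddCommGroup E] {f : ℝ → E} {T : ℝ}
    (hf : ContinuousOn f (Icc 0 T)) (p : ℝ≥0∞) : MemLp f p (muTime T) := by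
  obtain ⟨C, hC⟩ := isCompact_Icc.exists_bound_of_continuousOn hf
  refine MemLp.of_bound ((hf.aestronglyMeasurable measurableSet_Icc).mono_measure
    (Measure.restrict_mono Ioo_subset_Icc_self le_rfl)) C ?_
  filter_upwards [ae_muTime_mem T] with t ht using hC t (Ioo_subset_Icc_self ht)

theorem memLp_of_continuous {E : Type*} [NormedAddCommGroup E] {f : ℝ → E} {T : ℝ}
    (hf : Continuous f) (p : ℝ≥0∞) : MemLp f p (muTime T) :=
  memLp_of_continuousOn hf.continuousOn p

/-- The class in `L²(0, T)` of a function. -/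
def lpc (T : ℝ) (f : ℝ → ℝ) : Lp ℝ 2 (muTime T) := by
  classical exact if h : MemLp f 2 (muTime T) then h.toLp f else 0

/-- The class in `L²(0, 1)` of a function. -/
def l2c (f : ℝ → ℝ) : L2 := lpc 1 f

section lpc

variable {T : ℝ} {f g : ℝ → ℝ}

theorem lpc_of_memLp (h : MemLp f 2 (muTime T)) : lpc T f = h.toLp f := by
  simp [lpc, h]

theorem coeFn_lpc_of_memLp (h : MemLp f 2 (muTime T)) : lpc T f =ᵐ[muTime T] f := by
  rw [lpc_of_memLp h]; exact h.coeFn_toLp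

theorem coeFn_lpc (hf : Continuous f) : lpc T f =ᵐ[muTime T] f :=
  coeFn_lpc_of_memLp (memLp_of_continuous hf 2)

theorem coeFn_l2c (hf : Continuous f) : l2c f =ᵐ[muOmega] f := coeFn_lpc hf

theorem lpc_congr_ae (h : f =ᵐ[muTime T] g) : lpc T f = lpc T g := by
  by_cases hf : MemLp f 2 (muTime T)
  · have hg : MemLp g 2 (muTime T) := (memLp_congr_ae h).1 hf
    rw [lpc_of_memLp hf, lpc_of_memLp hg]
    exact (MemLp.toLp_eq_toLp_iff hf hg).2 h
  · have hg : ¬ MemLp g 2 (muTime T) := fun hg => hf ((memLp_congr_ae h).2 hg)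
    simp [lpc, hf, hg]

theorem lpc_congr (h : EqOn f g (Ioo 0 T)) : lpc T f = lpc T g :=
  lpc_congr_ae (by filter_upwards [ae_muTime_mem T] with t ht using h ht)

theorem l2c_congr (h : EqOn f g (Ioo 0 1)) : l2c f = l2c g := lpc_congr h

theorem lpc_add_of_memLp (hf : MemLp f 2 (muTime T)) (hg : MemLp g 2 (muTime T)) :
    lpc T (fun x => f x + g x) = lpc T f + lpc T g := by
  rw [lpc_of_memLp hf, lpc_of_memLp hg]; exact lpc_of_memLp (hf.add hg)

theorem lpc_smul_of_memLp (c : ℝ) (hf : MemLp f 2 (muTime T)) :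
    lpc T (fun x => c * f x) = c • lpc T f := by
  rw [lpc_of_memLp hf]; exact lpc_of_memLp (hf.const_mul c)

theorem lpc_add (hf : Continuous f) (hg : Continuous g) :
    lpc T (fun x => f x + g x) = lpc T f + lpc T g :=
  lpc_add_of_memLp (memLp_of_continuous hf 2) (memLp_of_continuous hg 2)

theorem lpc_smul (c : ℝ) (hf : Continuous f) : lpc T (fun x => c * f x) = c • lpc T f :=
  lpc_smul_of_memLp c (memLp_of_continuous hf 2)

theorem lpc_sub (hf : Continuous f) (hg : Continuous g) :
    lpc T (fun x => f x - g x) = lpc T f - lpc T g := by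
  have := lpc_add (T := T) (g := fun x => -1 * g x) hf (continuous_const.mul hg)
  rw [lpc_smul _ hg] at this
  simpa [sub_eq_add_neg] using this

theorem l2c_add (hf : Continuous f) (hg : Continuous g) :
    l2c (fun x => f x + g x) = l2c f + l2c g := lpc_add hf hg
theorem l2c_sub (hf : Continuous f) (hg : Continuous g) :
    l2c (fun x => f x - g x) = l2c f - l2c g := lpc_sub hf hg
theorem l2c_smul (c : ℝ) (hf : Continuous f) : l2c (fun x => c * f x) = c • l2c f := lpc_smul c hf

theorem inner_lpc (u : Lp ℝ 2 (muTime T)) (hg : Continuous g) :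
    inner ℝ u (lpc T g) = ∫ x, u x * g x ∂muTime T := by
  rw [L2.inner_def]
  refine integral_congr_ae ?_
  filter_upwards [coeFn_lpc (T := T) hg] with x hx
  rw [hx, real_inner_comm]; simp

theorem inner_l2c (u : L2) (hg : Continuous g) :
    inner ℝ u (l2c g) = ∫ x, u x * g x ∂muOmega := inner_lpc u hg

theorem inner_lpc_lpc (hT : 0 ≤ T) (hf : Continuous f) (hg : Continuous g) :
    inner ℝ (lpc T f) (lpc T g) = ∫ x in (0 : ℝ)..T, f x * g x := by
  rw [inner_lpc _ hg, ← integral_muTime hT]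
  refine integral_congr_ae ?_
  filter_upwards [coeFn_lpc (T := T) hf] with x hx
  rw [hx]

theorem inner_l2c_l2c (hf : Continuous f) (hg : Continuous g) :
    inner ℝ (l2c f) (l2c g) = ∫ x in (0 : ℝ)..1, f x * g x := inner_lpc_lpc zero_le_one hf hg

theorem norm_sq_lpc (hT : 0 ≤ T) (hf : Continuous f) :
    ‖lpc T f‖ ^ 2 = ∫ x in (0 : ℝ)..T, f x ^ 2 := by
  rw [← real_inner_self_eq_norm_sq, inner_lpc_lpc hT hf hf]; simp only [sq]

theorem norm_sq_l2c (hf : Continuous f) : ‖l2c f‖ ^ 2 = ∫ x in (0 : ℝ)..1, f x ^ 2 :=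
  norm_sq_lpc zero_le_one hf

theorem norm_l2c_le (hf : Continuous f) {C : ℝ} (hC : 0 ≤ C) (h : ∀ y ∈ Icc (0 : ℝ) 1, |f y| ≤ C) :
    ‖l2c f‖ ≤ C := by
  refine abs_le_of_sq_le_sq' ?_ hC |>.2
  rw [norm_sq_l2c hf]
  calc ∫ x in (0 : ℝ)..1, f x ^ 2 ≤ ∫ x in (0 : ℝ)..1, C ^ 2 := by
        refine intervalIntegral.integral_mono_on zero_le_one
          ((hf.pow 2).intervalIntegrable _ _) (by simp) fun y hy => ?_
        exact sq_le_sq.2 (by rw [abs_of_nonneg hC]; exact h y hy)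
    _ = C ^ 2 := by simp

end lpc

/-! ### Density of test functions -/

/-- Test functions on the interval `(0, T)`. -/
structure IsBump (T : ℝ) (η : ℝ → ℝ) : Prop where
  smooth : ContDiff ℝ ∞ η
  compact : HasCompactSupport η
  support : tsupport η ⊆ Ioo 0 T

namespace IsBump

variable {T : ℝ} {η η' : ℝ → ℝ}

theorem add (h : IsBump T η) (h' : IsBump T η') : IsBump T (fun y => η y + η' y) :=
  ⟨h.smooth.add h'.smooth, h.compact.add h'.compact,
    (tsupport_add η η').trans (union_subset h.support h'.support)⟩

theorem mul_left {ξ : ℝ → ℝ} (hξ : ContDiff ℝ ∞ ξ) (h : IsBump T η) :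
    IsBump T (fun y => ξ y * η y) :=
  ⟨hξ.mul h.smooth, h.compact.mul_left, (tsupport_mul_subset_right).trans h.support⟩

theorem const_mul (c : ℝ) (h : IsBump T η) : IsBump T (fun y => c * η y) :=
  h.mul_left contDiff_const

theorem zero : IsBump T (fun _ => 0) :=
  ⟨contDiff_const, HasCompactSupport.zero, by simp [tsupport]⟩

theorem deriv (h : IsBump T η) : IsBump T (deriv η) :=
  ⟨deriv_smooth h.smooth, h.compact.deriv, (tsupport_deriv_subset (𝕜 := ℝ)).trans h.support⟩

theorem eq_zero (h : IsBump T η) {y : ℝ} (hy : y ∉ Ioo 0 T) : η y = 0 :=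
  image_eq_zero_of_notMem_tsupport fun h' => hy (h.support h')

theorem continuous (h : IsBump T η) : Continuous η := h.smooth.continuous

/-- The support of a test function keeps a positive distance to the end points. -/
theorem exists_margin (h : IsBump T η) :
    ∃ δ > 0, ∀ y, η y ≠ 0 → δ ≤ y ∧ y ≤ T - δ := by
  rcases (tsupport η).eq_empty_or_nonempty with he | hne
  · refine ⟨1, one_pos, fun y hy => absurd (subset_tsupport _ hy) (by simp [he])⟩
  · have hc : IsCompact (tsupport η) := h.compact
    obtain ⟨a, ha, ha'⟩ := hc.exists_isLeast hne
    obtain ⟨b, hb, hb'⟩ := hc.exists_isGreatest hne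
    have h1 := h.support ha
    have h2 := h.support hb
    refine ⟨min a (T - b), lt_min h1.1 (by linarith [h2.2]), fun y hy => ?_⟩
    have h3 := ha' (subset_tsupport _ hy)
    have h4 := hb' (subset_tsupport _ hy)
    exact ⟨(min_le_left _ _).trans h3, by linarith [min_le_right a (T - b)]⟩

end IsBump

theorem lpc_eq_zero_of_forall_bump {T : ℝ} (u : Lp ℝ 2 (muTime T))
    (h : ∀ η, IsBump T η → ∫ x, u x * η x ∂muTime T = 0) : u = 0 := by
  have h1 : ∀ᵐ x ∂(volume : Measure ℝ), x ∈ Ioo 0 T → u x = 0 := by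
    refine isOpen_Ioo.ae_eq_zero_of_integral_contDiff_smul_eq_zero ?_ ?_
    · have : IntegrableOn u (Ioo 0 T) := (Lp.memLp u).integrable (by norm_num)
      exact this.locallyIntegrableOn
    · intro g hg hgc hgs
      have h2 := h g ⟨hg, hgc, hgs⟩
      rw [← setIntegral_eq_integral_of_forall_compl_eq_zero (s := Ioo 0 T)]
      · simpa [mul_comm] using h2
      · intro x hx
        simp [image_eq_zero_of_notMem_tsupport fun h' => hx (hgs h')]
  exact (Lp.eq_zero_iff_ae_eq_zero).2 ((ae_restrict_iff' measurableSet_Ioo).2 h1)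

/-- The test functions as a subspace. -/
def bumps (T : ℝ) : Submodule ℝ (ℝ → ℝ) where
  carrier := {η | IsBump T η}
  add_mem' h h' := h.add h'
  zero_mem' := IsBump.zero
  smul_mem' c _ h := h.const_mul c

/-- The embedding of the test functions in `L²(0, T)`. -/
def bumpToLp (T : ℝ) : bumps T →ₗ[ℝ] Lp ℝ 2 (muTime T) where
  toFun η := lpc T η.1
  map_add' η η' := lpc_add η.2.continuous η'.2.continuous
  map_smul' c η := lpc_smul c η.2.continuous

theorem denseRange_bumpToLp (T : ℝ) : DenseRange (bumpToLp T) := by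
  have h : (LinearMap.range (bumpToLp T)).topologicalClosure = ⊤ := by
    rw [Submodule.topologicalClosure_eq_top_iff, Submodule.eq_bot_iff]
    intro u hu
    refine lpc_eq_zero_of_forall_bump u fun η hη => ?_
    have := (Submodule.mem_orthogonal' _ _).1 hu (bumpToLp T ⟨η, hη⟩) ⟨_, rfl⟩
    rwa [bumpToLp, LinearMap.coe_mk, AddHom.coe_mk, inner_lpc _ hη.continuous] at this
  exact (Submodule.dense_iff_topologicalClosure_eq_top.2 h :)

/-! ### Cut-off functions -/

/-- Both derivatives vanish off [0, 1], so compactness of that interval suffices. -/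
theorem exists_smoothTransition_bound : ∃ C : ℝ, 1 ≤ C ∧
    (∀ x, |deriv Real.smoothTransition x| ≤ C) ∧
    (∀ x, |deriv (deriv Real.smoothTransition) x| ≤ C) := by
  have h0 : ContDiff ℝ ∞ Real.smoothTransition := Real.smoothTransition.contDiff
  have hl : ∀ x < 0, deriv Real.smoothTransition x = 0 := by
    intro x hx
    have : Real.smoothTransition =ᶠ[𝓝 x] fun _ => 0 := by
      filter_upwards [gt_mem_nhds hx] with z hz using Real.smoothTransition.zero_of_nonpos hz.le
    rw [this.deriv_eq, deriv_const]
  have hr : ∀ x, 1 < x → deriv Real.smoothTransition x = 0 := by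
    intro x hx
    have : Real.smoothTransition =ᶠ[𝓝 x] fun _ => 1 := by
      filter_upwards [lt_mem_nhds hx] with z hz using Real.smoothTransition.one_of_one_le hz.le
    rw [this.deriv_eq, deriv_const]
  have hl' : ∀ x < 0, deriv (deriv Real.smoothTransition) x = 0 := by
    intro x hx
    have : deriv Real.smoothTransition =ᶠ[𝓝 x] fun _ => 0 := by
      filter_upwards [gt_mem_nhds hx] with z hz using hl z hz
    rw [this.deriv_eq, deriv_const]
  have hr' : ∀ x, 1 < x → deriv (deriv Real.smoothTransition) x = 0 := by
    intro x hx
    have : deriv Real.smoothTransition =ᶠ[𝓝 x] fun _ => 0 := by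
      filter_upwards [lt_mem_nhds hx] with z hz using hr z hz
    rw [this.deriv_eq, deriv_const]
  obtain ⟨C₁, h₁⟩ := isCompact_Icc.exists_bound_of_continuousOn (s := Icc (0 : ℝ) 1)
    (deriv_smooth h0).continuous.continuousOn
  obtain ⟨C₂, h₂⟩ := isCompact_Icc.exists_bound_of_continuousOn (s := Icc (0 : ℝ) 1)
    (deriv_smooth (deriv_smooth h0)).continuous.continuousOn
  refine ⟨max 1 (max C₁ C₂), le_max_left _ _, fun x => ?_, fun x => ?_⟩
  · by_cases hx : x ∈ Icc (0 : ℝ) 1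
    · exact (h₁ x hx).trans ((le_max_left _ _).trans (le_max_right _ _))
    · have : deriv Real.smoothTransition x = 0 := by
        rcases lt_or_ge x 0 with h | h
        · exact hl x h
        · exact hr x (not_le.1 fun h' => hx ⟨h, h'⟩)
      rw [this, abs_zero]; exact zero_le_one.trans (le_max_left _ _)
  · by_cases hx : x ∈ Icc (0 : ℝ) 1
    · exact (h₂ x hx).trans ((le_max_right _ _).trans (le_max_right _ _))
    · have : deriv (deriv Real.smoothTransition) x = 0 := by
        rcases lt_or_ge x 0 with h | h
        · exact hl' x h
        · exact hr' x (not_le.1 fun h' => hx ⟨h, h'⟩)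
      rw [this, abs_zero]; exact zero_le_one.trans (le_max_left _ _)

/-- A cut-off that vanishes for `x ≤ 1/n` and is `1` for `x ≥ 2/n`. -/
def cutL (n x : ℝ) : ℝ := Real.smoothTransition (n * x - 1)

theorem contDiff_cutL (n : ℝ) : ContDiff ℝ ∞ (cutL n) :=
  Real.smoothTransition.contDiff.comp (by fun_prop)

theorem deriv_cutL (n x : ℝ) : deriv (cutL n) x = n * deriv Real.smoothTransition (n * x - 1) := by
  have h1 : HasDerivAt (fun x : ℝ => n * x - 1) n x := by
    simpa using ((hasDerivAt_id x).const_mul n).sub_const 1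
  have h2 := ((Real.smoothTransition.contDiff (n := 1)).differentiable (by simp)
    (n * x - 1)).hasDerivAt
  have := (h2.comp x h1).deriv
  rw [mul_comm]; exact this

theorem deriv_deriv_cutL (n x : ℝ) :
    deriv (deriv (cutL n)) x = n ^ 2 * deriv (deriv Real.smoothTransition) (n * x - 1) := by
  have h1 : HasDerivAt (fun x : ℝ => n * x - 1) n x := by
    simpa using ((hasDerivAt_id x).const_mul n).sub_const 1
  have h2 := ((deriv_smooth Real.smoothTransition.contDiff).differentiable (by simp)
    (n * x - 1)).hasDerivAt
  have h3 := ((h2.comp x h1).const_mul n).deriv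
  have : deriv (cutL n) = fun x => n * deriv Real.smoothTransition (n * x - 1) :=
    funext (deriv_cutL n)
  rw [this]
  refine Eq.trans h3 ?_
  ring

theorem cutL_nonneg (n x : ℝ) : 0 ≤ cutL n x := Real.smoothTransition.nonneg _
theorem cutL_le_one (n x : ℝ) : cutL n x ≤ 1 := Real.smoothTransition.le_one _

theorem cutL_eq_zero {n x : ℝ} (h : n * x ≤ 1) : cutL n x = 0 :=
  Real.smoothTransition.zero_of_nonpos (by linarith)

theorem cutL_eq_one {n x : ℝ} (h : 2 ≤ n * x) : cutL n x = 1 :=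
  Real.smoothTransition.one_of_one_le (by linarith)

theorem eventually_cutL_eq_one {n x : ℝ} (h : 2 < n * x) : cutL n =ᶠ[𝓝 x] fun _ => 1 := by
  have : ∀ᶠ z in 𝓝 x, 2 < n * z :=
    (continuous_const.mul continuous_id).continuousAt.eventually (lt_mem_nhds h)
  filter_upwards [this] with z hz using cutL_eq_one hz.le

theorem deriv_cutL_eq_zero {n x : ℝ} (h : 2 < n * x) : deriv (cutL n) x = 0 := by
  rw [(eventually_cutL_eq_one h).deriv_eq, deriv_const]

theorem deriv_deriv_cutL_eq_zero {n x : ℝ} (h : 2 < n * x) : deriv (deriv (cutL n)) x = 0 := by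
  have : deriv (cutL n) =ᶠ[𝓝 x] fun _ => 0 :=
    (eventually_cutL_eq_one h).deriv.trans (by simp)
  rw [this.deriv_eq, deriv_const]

/-- A cut-off near both end points of `[0, 1]`. -/
def cutB (n y : ℝ) : ℝ := cutL n y * cutL n (1 - y)

theorem contDiff_cutB (n : ℝ) : ContDiff ℝ ∞ (cutB n) :=
  (contDiff_cutL n).mul ((contDiff_cutL n).comp (by fun_prop))

theorem cutB_nonneg (n y : ℝ) : 0 ≤ cutB n y := mul_nonneg (cutL_nonneg _ _) (cutL_nonneg _ _)

theorem cutB_le_one (n y : ℝ) : cutB n y ≤ 1 :=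
  mul_le_one₀ (cutL_le_one _ _) (cutL_nonneg _ _) (cutL_le_one _ _)

theorem eventually_cutB_eq_one {n y : ℝ} (h : 2 < n * y) (h' : 2 < n * (1 - y)) :
    cutB n =ᶠ[𝓝 y] fun _ => 1 := by
  have h2 : ContinuousAt (fun z : ℝ => 1 - z) y := by fun_prop
  filter_upwards [eventually_cutL_eq_one h, h2.eventually (eventually_cutL_eq_one h')] with z h1 h2
  rw [cutB, h1, h2, one_mul]

theorem hasDerivAt_cutL_comp (n y : ℝ) :
    HasDerivAt (fun y => cutL n (1 - y)) (-deriv (cutL n) (1 - y)) y := by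
  have h1 : HasDerivAt (fun x : ℝ => 1 - x) (-1) y := by
    simpa using (hasDerivAt_id y).const_sub 1
  have h2 := ((contDiff_cutL n).differentiable (by simp) (1 - y)).hasDerivAt
  have h3 : HasDerivAt (fun y => cutL n (1 - y)) (deriv (cutL n) (1 - y) * -1) y := h2.comp y h1
  simpa using h3

theorem deriv_cutB (n y : ℝ) : deriv (cutB n) y
    = deriv (cutL n) y * cutL n (1 - y) - cutL n y * deriv (cutL n) (1 - y) := by
  have h1 := ((contDiff_cutL n).differentiable (by simp) y).hasDerivAt
  have := (h1.mul (hasDerivAt_cutL_comp n y)).deriv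
  refine Eq.trans this ?_
  ring

theorem deriv_deriv_cutB (n y : ℝ) : deriv (deriv (cutB n)) y
    = deriv (deriv (cutL n)) y * cutL n (1 - y) - 2 * (deriv (cutL n) y * deriv (cutL n) (1 - y))
      + cutL n y * deriv (deriv (cutL n)) (1 - y) := by
  have h0 : deriv (cutB n) = fun y =>
    deriv (cutL n) y * cutL n (1 - y) - cutL n y * deriv (cutL n) (1 - y) := funext (deriv_cutB n)
  have h1 := ((contDiff_cutL n).differentiable (by simp) y).hasDerivAt
  have h2 := ((deriv_smooth (contDiff_cutL n)).differentiable (by simp) y).hasDerivAt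
  have h3 : HasDerivAt (fun x : ℝ => 1 - x) (-1) y := by
    simpa using (hasDerivAt_id y).const_sub 1
  have h4 := (((deriv_smooth (contDiff_cutL n)).differentiable (by simp) (1 - y)).hasDerivAt).comp
    y h3
  rw [h0]
  refine ((h2.mul (hasDerivAt_cutL_comp n y)).sub (h1.mul h4)).deriv.trans ?_
  simp only [Function.comp]
  ring

theorem exists_cutB_bound : ∃ C : ℝ, 1 ≤ C ∧ ∀ n y : ℝ, 0 ≤ n →
    |deriv (cutB n) y| ≤ C * n ∧ |deriv (deriv (cutB n)) y| ≤ C * n ^ 2 := by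
  obtain ⟨C, hC, h1, h2⟩ := exists_smoothTransition_bound
  refine ⟨2 * C + 2 * C ^ 2, by nlinarith, fun n y hn => ?_⟩
  have e1 : ∀ x, |deriv (cutL n) x| ≤ C * n := by
    intro x
    rw [deriv_cutL, abs_mul, abs_of_nonneg hn, mul_comm]
    exact mul_le_mul_of_nonneg_right (h1 _) hn
  have e2 : ∀ x, |deriv (deriv (cutL n)) x| ≤ C * n ^ 2 := by
    intro x
    rw [deriv_deriv_cutL, abs_mul, abs_of_nonneg (by positivity), mul_comm]
    exact mul_le_mul_of_nonneg_right (h2 _) (by positivity)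
  have e3 : ∀ x, |cutL n x| ≤ 1 := fun x => by
    rw [abs_of_nonneg (cutL_nonneg _ _)]; exact cutL_le_one _ _
  constructor
  · rw [deriv_cutB]
    refine (abs_sub _ _).trans ?_
    rw [abs_mul, abs_mul]
    have := mul_le_mul (e1 y) (e3 (1 - y)) (abs_nonneg _) (by positivity)
    have := mul_le_mul (e3 y) (e1 (1 - y)) (abs_nonneg _) (by positivity)
    nlinarith [mul_nonneg (sq_nonneg C) hn]
  · rw [deriv_deriv_cutB]
    refine (abs_add_le _ _).trans ((add_le_add_left (abs_sub _ _) _).trans ?_)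
    rw [abs_mul, abs_mul, abs_mul, abs_mul, abs_two]
    have := mul_le_mul (e2 y) (e3 (1 - y)) (abs_nonneg _) (by positivity)
    have := mul_le_mul (e3 y) (e2 (1 - y)) (abs_nonneg _) (by positivity)
    have := mul_le_mul (e1 y) (e1 (1 - y)) (abs_nonneg _) (by positivity)
    nlinarith

theorem isBump_cutB_mul {n : ℝ} (hn : 0 < n) {η : ℝ → ℝ} (hη : ContDiff ℝ ∞ η) :
    IsBump 1 (fun y => η y * cutB n y) := by
  have hs : Function.support (fun y => η y * cutB n y) ⊆ Icc (1 / n) (1 - 1 / n) := by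
    intro y hy
    by_contra h
    apply hy
    have : cutB n y = 0 := by
      rw [cutB]
      by_cases h1 : 1 / n ≤ y
      · have h2 : 1 - 1 / n < y := not_le.1 fun h2 => h ⟨h1, h2⟩
        have : n * (1 - y) ≤ 1 := by
          have : 1 - y ≤ 1 / n := by linarith
          rwa [le_div_iff₀ hn, mul_comm] at this
        rw [cutL_eq_zero this, mul_zero]
      · have : n * y ≤ 1 := by
          have := (not_le.1 h1).le
          rwa [le_div_iff₀ hn, mul_comm] at this
        rw [cutL_eq_zero this, zero_mul]
    simp [this]
  have ht : tsupport (fun y => η y * cutB n y) ⊆ Icc (1 / n) (1 - 1 / n) :=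
    closure_minimal hs isClosed_Icc
  have hp : 0 < 1 / n := by positivity
  exact ⟨hη.mul (contDiff_cutB n), HasCompactSupport.of_support_subset_isCompact isCompact_Icc hs,
    ht.trans fun y hy => ⟨hp.trans_le hy.1, hy.2.trans_lt (by linarith)⟩⟩

/-- Cauchy–Schwarz, read off from the nonnegativity of the integral of (f - c)² with c the mean of
f. -/
theorem sq_intervalIntegral_le {f : ℝ → ℝ} (hf : Continuous f) {a b : ℝ} (hab : a ≤ b) :
    (∫ x in a..b, f x) ^ 2 ≤ (b - a) * ∫ x in a..b, f x ^ 2 := by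
  rcases hab.eq_or_lt with rfl | hlt
  · simp
  set I := ∫ x in a..b, f x
  set c := I / (b - a)
  have hb : 0 < b - a := by linarith
  have h0 : 0 ≤ ∫ x in a..b, (f x - c) ^ 2 :=
    intervalIntegral.integral_nonneg hab fun x _ => sq_nonneg _
  have h1 : ∫ x in a..b, (f x - c) ^ 2 = (∫ x in a..b, f x ^ 2) - 2 * c * I + (b - a) * c ^ 2 := by
    have e : ∀ x, (f x - c) ^ 2 = f x ^ 2 - 2 * c * f x + c ^ 2 := fun x => by ring
    simp only [e]
    rw [intervalIntegral.integral_add (Continuous.intervalIntegrable (by fun_prop) _ _) (by simp),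
      intervalIntegral.integral_sub (Continuous.intervalIntegrable (by fun_prop) _ _)
        (Continuous.intervalIntegrable (by fun_prop) _ _), intervalIntegral.integral_const_mul]
    simp [I]
  have h2 : c * (b - a) = I := div_mul_cancel₀ _ hb.ne'
  have h3 : (∫ x in a..b, f x ^ 2) - 2 * c * I + (b - a) * c ^ 2
      = (∫ x in a..b, f x ^ 2) - c * I := by linear_combination c * h2
  rw [h1, h3] at h0
  calc I ^ 2 = (b - a) * (c * I) := by rw [← h2]; ring
    _ ≤ _ := mul_le_mul_of_nonneg_left (by linarith) hb.le

/-! ### The space `H¹₀` -/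

instance : CompleteSpace H10 := by
  unfold H10; exact Submodule.topologicalClosure.completeSpace _

theorem mem_H10_of_isBump {η : ℝ → ℝ} (h : IsBump 1 η) : (l2c η, l2c (deriv η)) ∈ H10 :=
  Submodule.le_topologicalClosure _ (Submodule.subset_span
    ⟨η, h.smooth, h.compact, h.support, coeFn_l2c h.continuous, coeFn_l2c h.deriv.continuous⟩)

/-- The pairs `(η, η')` for `η ∈ C_c^∞(0, 1)`. -/
def bumpPairs : Submodule ℝ (L2 × L2) where
  carrier := {q | ∃ η, IsBump 1 η ∧ q = (l2c η, l2c (deriv η))}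
  add_mem' := by
    rintro _ _ ⟨η, h, rfl⟩ ⟨η', h', rfl⟩
    refine ⟨_, h.add h', ?_⟩
    have e : deriv (fun y => η y + η' y) = fun y => deriv η y + deriv η' y := by
      funext y
      exact deriv_add (h.smooth.differentiable (by simp) y) (h'.smooth.differentiable (by simp) y)
    rw [e, l2c_add h.continuous h'.continuous, l2c_add h.deriv.continuous h'.deriv.continuous]
    rfl
  zero_mem' := by
    refine ⟨_, IsBump.zero, ?_⟩
    have e : l2c (fun _ => 0) = 0 := by
      simpa using l2c_smul 0 (continuous_const (y := (0 : ℝ)))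
    have e' : deriv (fun _ : ℝ => (0 : ℝ)) = fun _ => 0 := by ext; simp
    rw [e', e]; rfl
  smul_mem' := by
    rintro c _ ⟨η, h, rfl⟩
    refine ⟨_, h.const_mul c, ?_⟩
    have e : deriv (fun y => c * η y) = fun y => c * deriv η y := by
      funext y; simp
    rw [e, l2c_smul c h.continuous, l2c_smul c h.deriv.continuous]
    rfl

theorem H10_eq_closure : H10 = bumpPairs.topologicalClosure := by
  have : Submodule.span ℝ {q : L2 × L2 | ∃ η : ℝ → ℝ, ContDiff ℝ ∞ η ∧ HasCompactSupport η ∧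
    tsupport η ⊆ Ioo 0 1 ∧ (⇑q.1 =ᵐ[muOmega] η) ∧ (⇑q.2 =ᵐ[muOmega] deriv η)} = bumpPairs := by
    refine le_antisymm (Submodule.span_le.2 ?_) ?_
    · rintro q ⟨η, h1, h2, h3, h4, h5⟩
      have h : IsBump 1 η := ⟨h1, h2, h3⟩
      exact ⟨η, h, Prod.ext (Lp.ext (h4.trans (coeFn_l2c h.continuous).symm))
        (Lp.ext (h5.trans (coeFn_l2c h.deriv.continuous).symm))⟩
    · rintro q ⟨η, h, rfl⟩
      exact Submodule.subset_span ⟨η, h.smooth, h.compact, h.support, coeFn_l2c h.continuous,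
        coeFn_l2c h.deriv.continuous⟩
  rw [H10, this]

/-- A closed property that holds for test functions holds on `H¹₀`. -/
theorem H10_induction {P : L2 × L2 → Prop} (hP : IsClosed {q | P q})
    (h : ∀ η, IsBump 1 η → P (l2c η, l2c (deriv η))) (f : H10) : P (h10Val f, h10Deriv f) := by
  have hf : f.1 ∈ closure (bumpPairs : Set (L2 × L2)) := by
    have h1 : H10 ≤ bumpPairs.topologicalClosure := H10_eq_closure.le
    exact h1 f.2
  have : f.1 ∈ {q | P q} := closure_minimal (by rintro _ ⟨η, hη, rfl⟩; exact h η hη) hP hf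
  exact this

/-- The map `f ↦ f_y`. -/
def h10DerivL : H10 →L[ℝ] L2 := (ContinuousLinearMap.snd ℝ L2 L2).comp H10.subtypeL
/-- The embedding of `H¹₀` in `L²`. -/
def h10ValL : H10 →L[ℝ] L2 := (ContinuousLinearMap.fst ℝ L2 L2).comp H10.subtypeL

/-- Cauchy–Schwarz for the integral of η' from either end point. The factors y and 1 - y give
Poincaré's inequality and also a gain √δ in strips of width δ near the ends. -/
theorem IsBump.sq_le {η : ℝ → ℝ} (h : IsBump 1 η) {y : ℝ} (hy : y ∈ Icc (0 : ℝ) 1) :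
    η y ^ 2 ≤ y * ‖l2c (_root_.deriv η)‖ ^ 2 ∧ η y ^ 2 ≤ (1 - y) * ‖l2c (_root_.deriv η)‖ ^ 2 := by
  have hd : ∀ x, HasDerivAt η (_root_.deriv η x) x := fun x =>
    (h.smooth.differentiable (by simp) x).hasDerivAt
  have hc := h.deriv.continuous
  rw [norm_sq_l2c hc]
  have hsplit := intervalIntegral.integral_add_adjacent_intervals (μ := volume)
    ((hc.pow 2).intervalIntegrable 0 y) ((hc.pow 2).intervalIntegrable y 1)
  have hp1 : 0 ≤ ∫ x in (0 : ℝ)..y, _root_.deriv η x ^ 2 :=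
    intervalIntegral.integral_nonneg hy.1 fun x _ => sq_nonneg _
  have hp2 : 0 ≤ ∫ x in y..(1 : ℝ), _root_.deriv η x ^ 2 :=
    intervalIntegral.integral_nonneg hy.2 fun x _ => sq_nonneg _
  simp only [Pi.pow_apply] at hsplit
  constructor
  · have h1 := intervalIntegral.integral_eq_sub_of_hasDerivAt (fun x _ => hd x)
      (hc.intervalIntegrable 0 y)
    rw [h.eq_zero (y := 0) (by simp), sub_zero] at h1
    have h2 := sq_intervalIntegral_le hc hy.1
    rw [h1, sub_zero] at h2
    exact h2.trans (mul_le_mul_of_nonneg_left (by linarith) hy.1)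
  · have h1 := intervalIntegral.integral_eq_sub_of_hasDerivAt (fun x _ => hd x)
      (hc.intervalIntegrable y 1)
    rw [h.eq_zero (y := 1) (by simp), zero_sub] at h1
    have h2 := sq_intervalIntegral_le hc hy.2
    rw [h1, neg_sq] at h2
    exact h2.trans (mul_le_mul_of_nonneg_left (by linarith) (by linarith [hy.2]))

/-- Poincaré's inequality. -/
theorem norm_h10Val_le (f : H10) : ‖h10Val f‖ ≤ ‖h10Deriv f‖ := by
  refine H10_induction (P := fun q => ‖q.1‖ ≤ ‖q.2‖) (isClosed_le (by fun_prop) (by fun_prop)) ?_ f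
  intro η h
  refine norm_l2c_le h.continuous (norm_nonneg _) fun y hy => ?_
  refine abs_le_of_sq_le_sq ?_ (norm_nonneg _)
  exact (h.sq_le hy).1.trans (mul_le_of_le_one_left (sq_nonneg _) hy.2)

theorem norm_H10_eq (f : H10) : ‖f‖ = ‖h10Deriv f‖ :=
  max_eq_right (norm_h10Val_le f)

theorem inner_h10Val_deriv {ξ : ℝ → ℝ} (hξ : ContDiff ℝ ∞ ξ) (f : H10) :
    inner ℝ (h10Val f) (l2c (deriv ξ)) = -inner ℝ (h10Deriv f) (l2c ξ) := by
  refine H10_induction (P := fun q => inner ℝ q.1 (l2c (deriv ξ)) = -inner ℝ q.2 (l2c ξ))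
    (isClosed_eq (by fun_prop) (by fun_prop)) ?_ f
  intro η h
  have hξ' := (deriv_smooth hξ).continuous
  rw [inner_l2c_l2c h.continuous hξ', inner_l2c_l2c h.deriv.continuous hξ.continuous,
    intervalIntegral.integral_mul_deriv_eq_deriv_mul
      (fun x _ => (h.smooth.differentiable (by simp) x).hasDerivAt)
      (fun x _ => (hξ.differentiable (by simp) x).hasDerivAt)
      (h.deriv.continuous.intervalIntegrable _ _) (hξ'.intervalIntegrable _ _),
    h.eq_zero (y := 0) (by simp), h.eq_zero (y := 1) (by simp)]
  ring

theorem l2_eq_zero_of_forall_bump (u : L2) (h : ∀ η, IsBump 1 η → inner ℝ u (l2c η) = 0) :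
    u = 0 :=
  lpc_eq_zero_of_forall_bump (T := 1) u fun η hη => by
    rw [← h η hη, inner_l2c _ hη.continuous]

/-- The weak derivative is determined by the function, through pairing with test functions; so the
pair that stores an element of `H10` is determined by its first entry. -/
theorem h10_ext {f g : H10} (h : h10Val f = h10Val g) : f = g := by
  have hd : h10Deriv (f - g) = 0 := by
    refine l2_eq_zero_of_forall_bump _ fun η hη => ?_
    have := inner_h10Val_deriv hη.smooth (f - g)
    have h0 : h10Val (f - g) = 0 := sub_eq_zero.2 h
    rw [h0, inner_zero_left] at this
    linarith
  exact Subtype.ext (Prod.ext h (sub_eq_zero.1 hd))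

/-- Pairing of an element of `H¹₀` with a function supported near the end points. -/
theorem abs_inner_h10Val_strip_le (f : H10) {R : ℝ → ℝ} (hR : Continuous R) {M δ : ℝ}
    (hδ : 0 ≤ δ) (hδ' : δ ≤ 1 / 2) (hM : ∀ y ∈ Icc (0 : ℝ) 1, |R y| ≤ M)
    (h0 : ∀ y ∈ Icc δ (1 - δ), R y = 0) :
    |inner ℝ (h10Val f) (l2c R)| ≤ 2 * M * δ * √δ * ‖h10Deriv f‖ := by
  refine H10_induction (P := fun q => |inner ℝ q.1 (l2c R)| ≤ 2 * M * δ * √δ * ‖q.2‖)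
    (isClosed_le (by fun_prop) (by fun_prop)) ?_ f
  intro η h
  rw [inner_l2c_l2c h.continuous hR]
  set N := ‖l2c (deriv η)‖
  have hM0 : 0 ≤ M := (abs_nonneg _).trans (hM 0 (by simp))
  have hN : 0 ≤ N := norm_nonneg _
  have hc : Continuous fun y => η y * R y := h.continuous.mul hR
  -- On each strip |η| ≤ √δ N and |R| ≤ M; the two strips have total length 2δ, whence the constant
  -- 2Mδ√δ.
  have hbd : ∀ y ∈ Icc (0 : ℝ) 1, (y ≤ δ ∨ 1 - δ ≤ y) → ‖η y * R y‖ ≤ √δ * N * M := by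
    intro y hy hyd
    rw [norm_mul]
    refine mul_le_mul ?_ (hM y hy) (norm_nonneg _) (by positivity)
    refine abs_le_of_sq_le_sq ?_ (by positivity)
    rw [mul_pow, Real.sq_sqrt hδ]
    rcases hyd with hyd | hyd
    · exact (h.sq_le hy).1.trans (mul_le_mul_of_nonneg_right hyd (sq_nonneg _))
    · have hyd' : 1 - y ≤ δ := by linarith
      exact (h.sq_le hy).2.trans (mul_le_mul_of_nonneg_right hyd' (sq_nonneg _))
  rw [← intervalIntegral.integral_add_adjacent_intervals (hc.intervalIntegrable 0 δ)
    (hc.intervalIntegrable δ 1), ← intervalIntegral.integral_add_adjacent_intervals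
    (hc.intervalIntegrable δ (1 - δ)) (hc.intervalIntegrable (1 - δ) 1)]
  have e2 : ∫ y in δ..(1 - δ), η y * R y = 0 := by
    refine intervalIntegral.integral_zero_ae (ae_of_all _ fun y hy => ?_)
    rw [uIoc_of_le (by linarith)] at hy
    rw [h0 y ⟨hy.1.le, hy.2⟩, mul_zero]
  have e1 := intervalIntegral.norm_integral_le_of_norm_le_const (a := 0) (b := δ)
    (f := fun y => η y * R y) (C := √δ * N * M) fun y hy => by
      rw [uIoc_of_le hδ] at hy
      exact hbd y ⟨hy.1.le, by linarith [hy.2]⟩ (Or.inl hy.2)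
  have e3 := intervalIntegral.norm_integral_le_of_norm_le_const (a := 1 - δ) (b := 1)
    (f := fun y => η y * R y) (C := √δ * N * M) fun y hy => by
      rw [uIoc_of_le (by linarith)] at hy
      exact hbd y ⟨by linarith [hy.1], hy.2⟩ (Or.inr hy.1.le)
  rw [e2, zero_add]
  refine (abs_add_le _ _).trans ((add_le_add e1 e3).trans (le_of_eq ?_))
  rw [sub_zero, sub_sub_cancel, abs_of_nonneg hδ]
  ring

theorem exists_bound_Icc {f : ℝ → ℝ} (hf : Continuous f) :
    ∃ M : ℝ, 0 ≤ M ∧ ∀ y ∈ Icc (0 : ℝ) 1, |f y| ≤ M := by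
  obtain ⟨C, hC⟩ := isCompact_Icc.exists_bound_of_continuousOn (s := Icc (0 : ℝ) 1) hf.continuousOn
  exact ⟨C, (norm_nonneg _).trans (hC 0 (by simp)), hC⟩

/-- A function vanishing at both end points is bounded by the distance to them. -/
theorem abs_le_of_deriv_le {η : ℝ → ℝ} (hη : Differentiable ℝ η) {M : ℝ}
    (hM : ∀ y ∈ Icc (0 : ℝ) 1, |deriv η y| ≤ M) (h0 : η 0 = 0) (h1 : η 1 = 0) {y : ℝ}
    (hy : y ∈ Icc (0 : ℝ) 1) : |η y| ≤ M * y ∧ |η y| ≤ M * (1 - y) := by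
  have key := fun z hz => (convex_Icc (0 : ℝ) 1).norm_image_sub_le_of_norm_deriv_le
    (f := η) (C := M) (x := z) (y := y) (fun x _ => hη x) hM hz hy
  constructor
  · simpa [h0, abs_of_nonneg hy.1] using key 0 (by simp)
  · have := key 1 (by simp)
    simpa [h1, abs_sub_comm y 1, abs_of_nonneg (sub_nonneg.2 hy.2)] using this

theorem tendsto_l2c {f : ℕ → ℝ → ℝ} {g : ℝ → ℝ} (hf : ∀ n, Continuous (f n)) (hg : Continuous g)
    {M : ℝ} (hM : ∀ᶠ n in atTop, ∀ y ∈ Icc (0 : ℝ) 1, |f n y| ≤ M)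
    (h : ∀ y ∈ Ioo (0 : ℝ) 1, Tendsto (fun n => f n y) atTop (𝓝 (g y))) :
    Tendsto (fun n => l2c (f n)) atTop (𝓝 (l2c g)) := by
  obtain ⟨G, hG0, hG⟩ := exists_bound_Icc hg
  rw [tendsto_iff_norm_sub_tendsto_zero]
  have hsq : Tendsto (fun n => ‖l2c (f n) - l2c g‖ ^ 2) atTop (𝓝 0) := by
    have e : ∀ n, ‖l2c (f n) - l2c g‖ ^ 2 = ∫ y, (f n y - g y) ^ 2 ∂muOmega := by
      intro n
      have hc : Continuous fun y => f n y - g y := (hf n).sub hg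
      rw [← l2c_sub (hf n) hg, norm_sq_l2c hc, ← integral_muTime zero_le_one]
    simp only [e]
    have : ∫ y, ((g y - g y) ^ 2) ∂muOmega = 0 := by simp
    rw [← this]
    refine tendsto_integral_filter_of_dominated_convergence (fun _ => (M + G) ^ 2)
      (Eventually.of_forall fun n => (((hf n).sub hg).pow 2).aestronglyMeasurable) ?_
      (integrable_const _) ?_
    · filter_upwards [hM] with n hn
      filter_upwards [ae_muTime_mem 1] with y hy
      have hy' := Ioo_subset_Icc_self hy
      rw [norm_pow, Real.norm_eq_abs]
      refine pow_le_pow_left₀ (abs_nonneg _) ((abs_sub _ _).trans ?_) 2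
      exact add_le_add (hn y hy') (hG y hy')
    · filter_upwards [ae_muTime_mem 1] with y hy
      exact ((h y hy).sub_const _).pow 2
  have := hsq.sqrt
  simpa using this

/-- Multiply η by `cutB n`. The derivative of the cut-off is of size Cn, but it lives where n times
the distance to an end is at most 2, and there |η| ≤ M · distance. So η (cutB n)' stays bounded, and
dominated convergence gives convergence of the pair in L². -/
theorem mem_H10_of_smooth {η : ℝ → ℝ} (hη : ContDiff ℝ ∞ η) (h0 : η 0 = 0) (h1 : η 1 = 0) :
    (l2c η, l2c (deriv η)) ∈ H10 := by
  have hη' := deriv_smooth hη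
  obtain ⟨M, hM0, hM⟩ := exists_bound_Icc hη'.continuous
  obtain ⟨C, hC1, hC⟩ := exists_cutB_bound
  have hdist := fun y hy => abs_le_of_deriv_le (hη.differentiable (by simp)) hM h0 h1 (y := y) hy
  have hderiv : ∀ n y : ℝ, deriv (fun y => η y * cutB n y) y
      = deriv η y * cutB n y + η y * deriv (cutB n) y := fun n y =>
    ((hη.differentiable (by simp) y).hasDerivAt.mul
      ((contDiff_cutB n).differentiable (by simp) y).hasDerivAt).deriv
  have hev : ∀ y ∈ Ioo (0 : ℝ) 1, ∀ᶠ n : ℕ in atTop, 2 < (n : ℝ) * y ∧ 2 < (n : ℝ) * (1 - y) := by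
    intro y hy
    exact ((tendsto_natCast_atTop_atTop.atTop_mul_const hy.1).eventually_gt_atTop 2).and
      ((tendsto_natCast_atTop_atTop.atTop_mul_const (sub_pos.2 hy.2)).eventually_gt_atTop 2)
  have hmem : ∀ᶠ n : ℕ in atTop, (l2c (fun y => η y * cutB n y),
      l2c (deriv (fun y => η y * cutB n y))) ∈ H10 := by
    filter_upwards [eventually_gt_atTop 0] with n hn
    exact mem_H10_of_isBump (isBump_cutB_mul (by exact_mod_cast hn) hη)
  have hcl : IsClosed (H10 : Set (L2 × L2)) := by
    rw [H10_eq_closure]; exact Submodule.isClosed_topologicalClosure _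
  refine hcl.mem_of_tendsto (Tendsto.prodMk_nhds ?_ ?_) hmem
  · refine tendsto_l2c (M := M) (fun n => (hη.mul (contDiff_cutB n)).continuous) hη.continuous
      (Eventually.of_forall fun n y hy => ?_) fun y hy => ?_
    · rw [abs_mul, abs_of_nonneg (cutB_nonneg _ _)]
      refine (mul_le_of_le_one_right (abs_nonneg _) (cutB_le_one _ _)).trans ?_
      exact (hdist y hy).1.trans (mul_le_of_le_one_right hM0 hy.2)
    · refine tendsto_nhds_of_eventually_eq ?_
      filter_upwards [hev y hy] with n hn
      rw [(eventually_cutB_eq_one hn.1 hn.2).eq_of_nhds, mul_one]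
  · refine tendsto_l2c (M := M + 2 * M * C)
      (fun n => (deriv_smooth (hη.mul (contDiff_cutB n))).continuous) hη'.continuous
      ?_ fun y hy => ?_
    · filter_upwards [eventually_gt_atTop 0] with n hn y hy
      have hn' : (0 : ℝ) < n := by exact_mod_cast hn
      rw [hderiv]
      refine (abs_add_le _ _).trans (add_le_add ?_ ?_)
      · rw [abs_mul, abs_of_nonneg (cutB_nonneg _ _)]
        exact (mul_le_of_le_one_right (abs_nonneg _) (cutB_le_one _ _)).trans (hM y hy)
      · rw [abs_mul]
        by_cases h2 : 2 < (n : ℝ) * y ∧ 2 < (n : ℝ) * (1 - y)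
        · rw [(eventually_cutB_eq_one h2.1 h2.2).deriv_eq, deriv_const, abs_zero, mul_zero]
          positivity
        · have h3 : |η y| * n ≤ 2 * M := by
            rcases not_and_or.1 h2 with h2 | h2
            · calc |η y| * n ≤ M * y * n := mul_le_mul_of_nonneg_right (hdist y hy).1 hn'.le
                _ = M * (n * y) := by ring
                _ ≤ M * 2 := mul_le_mul_of_nonneg_left (not_lt.1 h2) hM0
                _ = 2 * M := by ring
            · calc |η y| * n ≤ M * (1 - y) * n :=
                    mul_le_mul_of_nonneg_right (hdist y hy).2 hn'.le
                _ = M * (n * (1 - y)) := by ring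
                _ ≤ M * 2 := mul_le_mul_of_nonneg_left (not_lt.1 h2) hM0
                _ = 2 * M := by ring
          calc |η y| * |deriv (cutB n) y| ≤ |η y| * (C * n) :=
                mul_le_mul_of_nonneg_left (hC n y hn'.le).1 (abs_nonneg _)
            _ = |η y| * n * C := by ring
            _ ≤ 2 * M * C := mul_le_mul_of_nonneg_right h3 (by linarith)
    · refine tendsto_nhds_of_eventually_eq ?_
      filter_upwards [hev y hy] with n hn
      have h3 := eventually_cutB_eq_one hn.1 hn.2
      rw [hderiv, h3.deriv_eq, deriv_const, h3.eq_of_nhds]; ring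

/-! ### Curves of square-integrable functions -/

theorem exists_uniform_modulus {θ : ℝ → ℝ → ℝ} (hθ : Continuous fun z : ℝ × ℝ => θ z.1 z.2)
    (t : ℝ) {ε : ℝ} (hε : 0 < ε) :
    ∃ δ > 0, ∀ s, |s - t| < δ → ∀ y ∈ Icc (0 : ℝ) 1, |θ y s - θ y t| ≤ ε := by
  have hK : IsCompact (Icc (0 : ℝ) 1 ×ˢ Icc (t - 1) (t + 1)) := isCompact_Icc.prod isCompact_Icc
  have hu := hK.uniformContinuousOn_of_continuous hθ.continuousOn
  obtain ⟨δ, hδ, h⟩ := Metric.uniformContinuousOn_iff.1 hu ε hε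
  refine ⟨min δ 1, lt_min hδ one_pos, fun s hs y hy => ?_⟩
  have hs1 := abs_lt.1 (hs.trans_le (min_le_right _ _))
  have := h (y, s) ⟨hy, by constructor <;> linarith [hs1.1, hs1.2]⟩ (y, t)
    ⟨hy, by constructor <;> linarith⟩ (by
      rw [Prod.dist_eq, dist_self, max_eq_right dist_nonneg]
      exact hs.trans_le (min_le_left _ _))
  exact this.le

theorem continuous_l2c_curve {θ : ℝ → ℝ → ℝ} (hθ : Continuous fun z : ℝ × ℝ => θ z.1 z.2) :
    Continuous fun t => l2c fun y => θ y t := by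
  have hs : ∀ t, Continuous fun y => θ y t := fun t =>
    hθ.comp (continuous_id.prodMk continuous_const)
  refine Metric.continuous_iff.2 fun t ε hε => ?_
  obtain ⟨δ, hδ, h⟩ := exists_uniform_modulus hθ t (half_pos hε)
  refine ⟨δ, hδ, fun s hst => ?_⟩
  rw [dist_eq_norm, ← l2c_sub (hs s) (hs t)]
  exact (norm_l2c_le ((hs s).sub (hs t)) (half_pos hε).le (h s hst)).trans_lt (half_lt_self hε)

/-- Mean value inequality for r ↦ θ(y, r) - r θ'(y, t), with a bound uniform in y because θ' is
uniformly continuous on compact sets. -/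
theorem hasDerivAt_l2c_curve {θ : ℝ → ℝ → ℝ} (hθ : Sm θ) (t : ℝ) :
    HasDerivAt (fun t => l2c fun y => θ y t) (l2c fun y => dt θ y t) t := by
  rw [hasDerivAt_iff_isLittleO, Asymptotics.isLittleO_iff]
  intro c hc
  obtain ⟨δ, hδ, h⟩ := exists_uniform_modulus hθ.dt.continuous t hc
  filter_upwards [Metric.ball_mem_nhds t hδ] with s hs
  have hc1 : Continuous fun y => θ y s - θ y t := (hθ.continuous_fst s).sub (hθ.continuous_fst t)
  have hc2 : Continuous fun y => (s - t) * dt θ y t := (hθ.dt.continuous_fst t).const_mul _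
  have hc3 : Continuous fun y => θ y s - θ y t - (s - t) * dt θ y t := hc1.sub hc2
  rw [← l2c_sub (hθ.continuous_fst s) (hθ.continuous_fst t), ← l2c_smul _ (hθ.dt.continuous_fst t),
    ← l2c_sub hc1 hc2]
  refine norm_l2c_le hc3 (by positivity) fun y hy => ?_
  have hd : ∀ r, HasDerivAt (fun r => θ y r - r * dt θ y t) (dt θ y r - dt θ y t) r := fun r => by
    have h1 := (hθ.hasDerivAt_dt y r).sub ((hasDerivAt_id r).mul_const (dt θ y t))
    rw [one_mul] at h1
    exact h1
  have := (convex_ball t δ).norm_image_sub_le_of_norm_hasDerivWithin_le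
    (f := fun r => θ y r - r * dt θ y t) (C := c) (x := t) (y := s)
    (fun r _ => (hd r).hasDerivWithinAt) (fun r hr => h r hr y hy) (Metric.mem_ball_self hδ) hs
  refine le_trans (le_of_eq ?_) this
  rw [Real.norm_eq_abs]
  congr 1; ring

/-! ### Integrals over rectangles -/

section

variable {f g : ℝ → ℝ → ℝ}

theorem Sm.continuous_integral (h : Sm f) (a b : ℝ) : Continuous fun t => ∫ y in a..b, f y t :=
  intervalIntegral.continuous_parametric_intervalIntegral_of_continuous'
    (f := fun t y => f y t) (h.continuous.comp continuous_swap) _ _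

theorem rect_integral_mono (hf : Sm f) (hg : Sm g) {y₀ y₁ t₀ t₁ : ℝ} (hy : y₀ ≤ y₁) (ht : t₀ ≤ t₁)
    (h : ∀ y ∈ Icc y₀ y₁, ∀ t ∈ Icc t₀ t₁, f y t ≤ g y t) :
    ∫ t in t₀..t₁, ∫ y in y₀..y₁, f y t ≤ ∫ t in t₀..t₁, ∫ y in y₀..y₁, g y t :=
  intervalIntegral.integral_mono_on ht ((hf.continuous_integral _ _).intervalIntegrable _ _)
    ((hg.continuous_integral _ _).intervalIntegrable _ _) fun t ht =>
    intervalIntegral.integral_mono_on hy ((hf.continuous_fst t).intervalIntegrable _ _)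
      ((hg.continuous_fst t).intervalIntegrable _ _) fun y hy => h y hy t ht

theorem rect_integral_add (hf : Sm f) (hg : Sm g) (y₀ y₁ t₀ t₁ : ℝ) :
    ∫ t in t₀..t₁, ∫ y in y₀..y₁, (f y t + g y t)
      = (∫ t in t₀..t₁, ∫ y in y₀..y₁, f y t) + ∫ t in t₀..t₁, ∫ y in y₀..y₁, g y t := by
  rw [← intervalIntegral.integral_add ((hf.continuous_integral _ _).intervalIntegrable _ _)
    ((hg.continuous_integral _ _).intervalIntegrable _ _)]
  refine intervalIntegral.integral_congr fun t _ => ?_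
  exact intervalIntegral.integral_add ((hf.continuous_fst t).intervalIntegrable _ _)
    ((hg.continuous_fst t).intervalIntegrable _ _)

theorem rect_integral_const_mul (c : ℝ) (f : ℝ → ℝ → ℝ) (y₀ y₁ t₀ t₁ : ℝ) :
    ∫ t in t₀..t₁, ∫ y in y₀..y₁, c * f y t = c * ∫ t in t₀..t₁, ∫ y in y₀..y₁, f y t := by
  simp only [intervalIntegral.integral_const_mul]

theorem rect_integral_congr {y₀ y₁ t₀ t₁ : ℝ} (hy : y₀ ≤ y₁) (ht : t₀ ≤ t₁)
    (h : ∀ y ∈ Icc y₀ y₁, ∀ t ∈ Icc t₀ t₁, f y t = g y t) :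
    ∫ t in t₀..t₁, ∫ y in y₀..y₁, f y t = ∫ t in t₀..t₁, ∫ y in y₀..y₁, g y t := by
  refine intervalIntegral.integral_congr fun t ht' => ?_
  rw [uIcc_of_le ht] at ht'
  refine intervalIntegral.integral_congr fun y hy' => ?_
  rw [uIcc_of_le hy] at hy'
  exact h y hy' t ht'

theorem rect_integral_nonneg {y₀ y₁ t₀ t₁ : ℝ} (hy : y₀ ≤ y₁) (ht : t₀ ≤ t₁)
    (h : ∀ y ∈ Icc y₀ y₁, ∀ t ∈ Icc t₀ t₁, 0 ≤ f y t) :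
    0 ≤ ∫ t in t₀..t₁, ∫ y in y₀..y₁, f y t :=
  intervalIntegral.integral_nonneg ht fun t ht' =>
    intervalIntegral.integral_nonneg hy fun y hy' => h y hy' t ht'

/-- Restricting a rectangle decreases the integral of a nonnegative function. -/
theorem rect_integral_mono_set (hf : Sm f) {y₀ t₀ T : ℝ} (hy : y₀ ∈ Icc (0 : ℝ) 1)
    (ht : t₀ ∈ Icc (0 : ℝ) T) (h : ∀ y t, 0 ≤ f y t) :
    ∫ t in t₀..T, ∫ y in y₀..1, f y t ≤ ∫ t in (0 : ℝ)..T, ∫ y in (0 : ℝ)..1, f y t := by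
  have hn : ∀ t, 0 ≤ ∫ y in (0 : ℝ)..1, f y t := fun t =>
    intervalIntegral.integral_nonneg zero_le_one fun y _ => h y t
  calc ∫ t in t₀..T, ∫ y in y₀..1, f y t ≤ ∫ t in t₀..T, ∫ y in (0 : ℝ)..1, f y t := by
        refine intervalIntegral.integral_mono_on ht.2
          ((hf.continuous_integral _ _).intervalIntegrable _ _)
          ((hf.continuous_integral _ _).intervalIntegrable _ _) fun t _ => ?_
        exact intervalIntegral.integral_mono_interval hy.1 hy.2 le_rfl
          (ae_of_all _ fun y => h y t) ((hf.continuous_fst t).intervalIntegrable _ _)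
    _ ≤ _ := intervalIntegral.integral_mono_interval ht.1 ht.2 le_rfl
          (ae_of_all _ hn) ((hf.continuous_integral _ _).intervalIntegrable _ _)

end

/-! ### Smooth functions vanishing on the lateral boundary -/

/-- Smooth functions that vanish for `y = 0` and `y = 1` during `[0, T]`. -/
structure IsDirichlet (T : ℝ) (θ : ℝ → ℝ → ℝ) : Prop where
  smooth : Sm θ
  left : ∀ t ∈ Icc 0 T, θ 0 t = 0
  right : ∀ t ∈ Icc 0 T, θ 1 t = 0

section

variable {k T : ℝ} {θ : ℝ → ℝ → ℝ}

/-- At t = 0 and t = T the vanishing is known on one side only; the two-sided derivative of the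
smooth θ is recovered as the derivative within [0, T]. -/
theorem dt_eq_zero_of_forall (hT : 0 < T) (h : Sm θ) {y : ℝ} (h0 : ∀ t ∈ Icc 0 T, θ y t = 0)
    {t : ℝ} (ht : t ∈ Icc 0 T) : dt θ y t = 0 := by
  have h1 : HasDerivWithinAt (fun s => θ y s) (dt θ y t) (Icc 0 T) t :=
    (h.hasDerivAt_dt y t).hasDerivWithinAt
  have h2 : HasDerivWithinAt (fun s => θ y s) 0 (Icc 0 T) t :=
    (hasDerivWithinAt_const t _ (0 : ℝ)).congr h0 (h0 t ht)
  exact (uniqueDiffOn_Icc hT t ht).eq_deriv _ h1 h2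

theorem IsDirichlet.riem_left (h : IsDirichlet T θ) (hT : 0 < T) (e : ℝ) {t : ℝ}
    (ht : t ∈ Icc 0 T) : riem k e θ 0 t = -e * dy θ 0 t := by
  rw [riem, charD, dt_eq_zero_of_forall hT h.smooth h.left ht, h.left t ht]; ring

theorem IsDirichlet.riem_right (h : IsDirichlet T θ) (hT : 0 < T) (e : ℝ) {t : ℝ}
    (ht : t ∈ Icc 0 T) : riem k e θ 1 t = (-e - k) * dy θ 1 t := by
  rw [riem, charD, dt_eq_zero_of_forall hT h.smooth h.right ht, h.right t ht]; ring

theorem charD_pow {θ : ℝ → ℝ → ℝ} (h : Sm θ) (n : ℕ) (k e y t : ℝ) :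
    charD k e (fun y t => θ y t ^ n) y t = n * θ y t ^ (n - 1) * charD k e θ y t := by
  rw [charD_comp (f := fun x => x ^ n) (by fun_prop) h]; simp

/-- Transport of the weighted square of a Riemann invariant. -/
theorem charD_weight_riem {wt : ℝ → ℝ → ℝ} (hwt : Sm wt) (h : Sm θ) {e t : ℝ} (he : e * e = 1)
    (hk : 0 < k) (ht : 0 ≤ t) (y : ℝ) :
    charD k e (fun y t => invAlpha k t ^ 4 * (wt y t * riem k e θ y t ^ 2)) y t
      = invAlpha k t ^ 4 * (charD k e wt y t * riem k e θ y t ^ 2)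
        + 2 * invAlpha k t ^ 2 * (wt y t * (riem k e θ y t * waveAdj k θ y t)) := by
  have hr := h.riem k e
  rw [charD_mul ((Sm.invAlpha k).pow 4) (hwt.mul (hr.pow 2)), charD_mul hwt (hr.pow 2),
    charD_pow hr, charD_pow (Sm.invAlpha k), charD_invAlpha hk ht, charD_riem h he hk ht]
  have ha := alpha_mul_invAlpha hk ht
  simp only [Nat.cast_ofNat, Nat.add_one_sub_one, pow_one]
  linear_combination (2 * invAlpha k t ^ 2 * wt y t * riem k e θ y t * waveAdj k θ y t
    * (1 + alpha k t * invAlpha k t)) * ha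

/-- The divergence form of D_e applied to α⁻⁴ wt R_e². The factor α of the time component turns α⁻⁴
into α⁻³ on the horizontal sides, and at y = 1 the Dirichlet condition gives R_e = -(e + k) θ_y. All
estimates below choose a weight in this identity. -/
theorem integral_weight_riem {wt : ℝ → ℝ → ℝ} (hwt : Sm wt) (h : IsDirichlet T θ) {e : ℝ}
    (he : e * e = 1) (hk : 0 < k) (hT : 0 < T) {y₀ t₀ : ℝ} (hy : y₀ ≤ 1) (ht₀ : t₀ ∈ Icc 0 T) :
    ∫ t in t₀..T, ∫ y in y₀..1, (invAlpha k t ^ 4 * (charD k e wt y t * riem k e θ y t ^ 2)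
        + 2 * invAlpha k t ^ 2 * (wt y t * (riem k e θ y t * waveAdj k θ y t)))
      = (∫ y in y₀..1, invAlpha k T ^ 3 * (wt y T * riem k e θ y T ^ 2))
        - (∫ y in y₀..1, invAlpha k t₀ ^ 3 * (wt y t₀ * riem k e θ y t₀ ^ 2))
        + ((∫ t in t₀..T, (e - k) * (e + k) ^ 2 * (invAlpha k t ^ 4 * (wt 1 t * dy θ 1 t ^ 2)))
          - ∫ t in t₀..T, (e - k * y₀) * (invAlpha k t ^ 4 * (wt y₀ t * riem k e θ y₀ t ^ 2))) := by
  have hs : ∀ t : ℝ, 0 ≤ t → ∀ x : ℝ, alpha k t * (invAlpha k t ^ 4 * x) = invAlpha k t ^ 3 * x := by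
    intro t ht x
    linear_combination (invAlpha k t ^ 3 * x) * alpha_mul_invAlpha hk ht
  have hA : Sm (fun y t => invAlpha k t ^ 4 * (wt y t * riem k e θ y t ^ 2)) :=
    ((Sm.invAlpha k).pow 4).mul (hwt.mul ((h.smooth.riem k e).pow 2))
  have key := integral_charD hA k e y₀ 1 t₀ T
  rw [rect_integral_congr hy ht₀.2 fun y _ t ht =>
    charD_weight_riem hwt h.smooth he hk (ht₀.1.trans ht.1) y] at key
  rw [key]
  simp only [hs T hT.le, hs t₀ ht₀.1, mul_one]
  congr 2
  refine intervalIntegral.integral_congr fun t ht => ?_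
  rw [uIcc_of_le ht₀.2] at ht
  simp only [h.riem_right hT e ⟨ht₀.1.trans ht.1, ht.2⟩]
  ring

/-! ### Energy estimates -/

theorem neg_le_mul_of_le {δ c : ℝ} (hδ : 0 < δ) (hc : 0 ≤ c) (hc4 : c ≤ 4) (x w : ℝ) :
    -(δ * x ^ 2 + 16 / δ * w ^ 2) ≤ c * (x * w) := by
  have h1 : δ * x ^ 2 + 16 / δ * w ^ 2 + c * (x * w)
      = δ * (x + c * w / (2 * δ)) ^ 2 + (16 - c ^ 2 / 4) / δ * w ^ 2 := by
    field_simp; ring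
  have h2 : 0 ≤ 16 - c ^ 2 / 4 := by nlinarith
  have h3 : 0 ≤ δ * (x + c * w / (2 * δ)) ^ 2 + (16 - c ^ 2 / 4) / δ * w ^ 2 := by positivity
  linarith

/-- The energy of the Riemann invariants. -/
def riemEnergy (k : ℝ) (θ : ℝ → ℝ → ℝ) (t : ℝ) : ℝ :=
  ∫ y in (0 : ℝ)..1, (riem k 1 θ y t ^ 2 + riem k (-1) θ y t ^ 2)

/-- The squared norm of the source. -/
def sourceEnergy (k T : ℝ) (θ : ℝ → ℝ → ℝ) : ℝ :=
  ∫ t in (0 : ℝ)..T, ∫ y in (0 : ℝ)..1, waveAdj k θ y t ^ 2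

theorem Sm.riemSq (h : Sm θ) (k : ℝ) : Sm fun y t => StringControl.riem k 1 θ y t ^ 2
    + StringControl.riem k (-1) θ y t ^ 2 :=
  ((h.riem k 1).pow 2).add ((h.riem k (-1)).pow 2)

theorem riemEnergy_nonneg (k : ℝ) (θ : ℝ → ℝ → ℝ) (t : ℝ) : 0 ≤ riemEnergy k θ t :=
  intervalIntegral.integral_nonneg zero_le_one fun _ _ => by positivity

theorem sourceEnergy_nonneg (k : ℝ) (hT : 0 ≤ T) (θ : ℝ → ℝ → ℝ) : 0 ≤ sourceEnergy k T θ :=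
  rect_integral_nonneg zero_le_one hT fun _ _ _ _ => by positivity

theorem continuous_riemEnergy (h : Sm θ) : Continuous (riemEnergy k θ) :=
  (h.riemSq k).continuous_integral 0 1

theorem charS_bounds {e y t : ℝ} (hk : 0 < k) (hk1 : k < 1) (he : e = 1 ∨ e = -1)
    (hy : y ∈ Icc (0 : ℝ) 1) (ht : 0 ≤ t) :
    alpha k t * (1 - k) ≤ charS k e y t ∧ charS k e y t ≤ alpha k t * 2 := by
  have ha := (alpha_pos hk ht).le
  have h1 : 0 ≤ k * y := mul_nonneg hk.le hy.1
  have h2 : k * y ≤ k := mul_le_of_le_one_right hk.le hy.2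
  unfold charS
  rcases he with rfl | rfl
  · constructor <;> refine mul_le_mul_of_nonneg_left ?_ ha <;> linarith
  · constructor <;> refine mul_le_mul_of_nonneg_left ?_ ha <;> linarith

/-- The conserved form of the energy identity. -/
theorem energy_identity (h : IsDirichlet T θ) (hk : 0 < k) (hT : 0 < T) {t₀ : ℝ}
    (ht₀ : t₀ ∈ Icc 0 T) :
    ∫ t in t₀..T, ∫ y in (0 : ℝ)..1, 2 * invAlpha k t ^ 2 * ((charS k 1 y t * riem k 1 θ y t
        + charS k (-1) y t * riem k (-1) θ y t) * waveAdj k θ y t)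
      = (∫ y in (0 : ℝ)..1, invAlpha k T ^ 3 * (charS k 1 y T * riem k 1 θ y T ^ 2
          + charS k (-1) y T * riem k (-1) θ y T ^ 2))
        - ∫ y in (0 : ℝ)..1, invAlpha k t₀ ^ 3 * (charS k 1 y t₀ * riem k 1 θ y t₀ ^ 2
          + charS k (-1) y t₀ * riem k (-1) θ y t₀ ^ 2) := by
  have h1 := integral_weight_riem (Sm.charS k 1) h (e := 1) (by norm_num) hk hT zero_le_one ht₀
  have h2 := integral_weight_riem (Sm.charS k (-1)) h (e := -1) (by norm_num) hk hT zero_le_one ht₀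
  simp only [charD_charS, mul_one, sub_self, zero_mul, mul_zero, zero_add, mul_neg, neg_neg]
    at h1 h2
  have hu1 := h.smooth.riem k 1
  have hu2 := h.smooth.riem k (-1)
  have hw := h.smooth.waveAdj k
  have hs1 := Sm.charS k 1
  have hs2 := Sm.charS k (-1)
  have hi := Sm.invAlpha k
  have e1 : ∀ y t : ℝ, 2 * invAlpha k t ^ 2 * ((charS k 1 y t * riem k 1 θ y t
        + charS k (-1) y t * riem k (-1) θ y t) * waveAdj k θ y t)
      = 2 * invAlpha k t ^ 2 * (charS k 1 y t * (riem k 1 θ y t * waveAdj k θ y t))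
      + 2 * invAlpha k t ^ 2 * (charS k (-1) y t * (riem k (-1) θ y t * waveAdj k θ y t)) :=
    fun y t => by ring
  have e2 : ∀ y t : ℝ, invAlpha k t ^ 3 * (charS k 1 y t * riem k 1 θ y t ^ 2
          + charS k (-1) y t * riem k (-1) θ y t ^ 2)
      = invAlpha k t ^ 3 * (charS k 1 y t * riem k 1 θ y t ^ 2)
        + invAlpha k t ^ 3 * (charS k (-1) y t * riem k (-1) θ y t ^ 2) := fun y t => by ring
  have e3 : ∀ t, ∫ y in (0 : ℝ)..1, invAlpha k t ^ 3 * (charS k 1 y t * riem k 1 θ y t ^ 2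
          + charS k (-1) y t * riem k (-1) θ y t ^ 2)
      = (∫ y in (0 : ℝ)..1, invAlpha k t ^ 3 * (charS k 1 y t * riem k 1 θ y t ^ 2))
        + ∫ y in (0 : ℝ)..1, invAlpha k t ^ 3 * (charS k (-1) y t * riem k (-1) θ y t ^ 2) := by
    intro t
    simp only [e2]
    exact intervalIntegral.integral_add
      ((((hi.pow 3).mul (hs1.mul (hu1.pow 2))).continuous_fst t).intervalIntegrable _ _)
      ((((hi.pow 3).mul (hs2.mul (hu2.pow 2))).continuous_fst t).intervalIntegrable _ _)
  rw [e3, e3]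
  simp only [e1]
  rw [rect_integral_add (((hi.pow 2).const_mul 2).mul (hs1.mul (hu1.mul hw)))
    (((hi.pow 2).const_mul 2).mul (hs2.mul (hu2.mul hw))), h1, h2]
  -- At y = 1 the weights contribute factors 1 - k for e = 1 and 1 + k for e = -1; both coefficients
  -- then have modulus (1 - k)²(1 + k)² and opposite signs.
  have b1 : ∫ t in t₀..T, (-1 - k) * (-1 + k) ^ 2 * (invAlpha k t ^ 4
        * (charS k (-1) 1 t * dy θ 1 t ^ 2))
      = -∫ t in t₀..T, (1 - k) * (1 + k) ^ 2 * (invAlpha k t ^ 4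
        * (charS k 1 1 t * dy θ 1 t ^ 2)) := by
    rw [← intervalIntegral.integral_neg]
    refine intervalIntegral.integral_congr fun t _ => ?_
    simp only [charS]; ring
  -- At y = 0 both weights equal α and both invariants have square θ_y², while e changes sign.
  have b2 : ∫ t in t₀..T, (-1 - 0) * (invAlpha k t ^ 4
        * (charS k (-1) 0 t * riem k (-1) θ 0 t ^ 2))
      = -∫ t in t₀..T, (1 - 0) * (invAlpha k t ^ 4 * (charS k 1 0 t * riem k 1 θ 0 t ^ 2)) := by
    rw [← intervalIntegral.integral_neg]
    refine intervalIntegral.integral_congr fun t ht => ?_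
    rw [uIcc_of_le ht₀.2] at ht
    have ht' : t ∈ Icc 0 T := ⟨ht₀.1.trans ht.1, ht.2⟩
    simp only [charS, h.riem_left hT _ ht']; ring
  rw [b1, b2]
  ring

/-- Apply the energy identity on [t₀, T], where t₀ is a time of maximal energy M. The weights keep
the left side above m M; Young's inequality splits the source term, and the part containing the
energy is absorbed. -/
theorem exists_energy_bound (hk : 0 < k) (hk1 : k < 1) (hT : 0 < T) :
    ∃ C : ℝ, 0 < C ∧ ∀ θ, IsDirichlet T θ → ∀ t ∈ Icc 0 T,
      riemEnergy k θ t ≤ C * (riemEnergy k θ T + sourceEnergy k T θ) := by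
  set m : ℝ := (1 - k) * invAlpha k T ^ 2
  have hm : 0 < m := mul_pos (by linarith) (pow_pos (invAlpha_pos hk hT.le) 2)
  -- The energy integrated over [t₀, T] is at most T M, so Young's inequality with this δ costs
  -- exactly half of m M.
  set δ : ℝ := m / (2 * T)
  have hδ : 0 < δ := by positivity
  refine ⟨4 / m + 2 * (32 / δ) / m, by positivity, fun θ h t ht => ?_⟩
  obtain ⟨t₀, ht₀, hmax⟩ := isCompact_Icc.exists_isMaxOn (nonempty_Icc.2 hT.le)
    (continuous_riemEnergy (k := k) h.smooth).continuousOn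
  refine (hmax ht).trans ?_
  change riemEnergy k θ t₀ ≤ _
  set M := riemEnergy k θ t₀
  set Γ := sourceEnergy k T θ
  have hΓ : 0 ≤ Γ := sourceEnergy_nonneg k hT.le θ
  have hN := riemEnergy_nonneg k θ T
  have hid := energy_identity h hk hT ht₀
  have hu1 := h.smooth.riem k 1
  have hu2 := h.smooth.riem k (-1)
  have hw := h.smooth.waveAdj k
  have hs1 := Sm.charS k 1
  have hs2 := Sm.charS k (-1)
  have hi := Sm.invAlpha k
  have hsq := h.smooth.riemSq k
  have hEsm : Sm fun y t => invAlpha k t ^ 3 * (charS k 1 y t * riem k 1 θ y t ^ 2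
          + charS k (-1) y t * riem k (-1) θ y t ^ 2) :=
    (hi.pow 3).mul ((hs1.mul (hu1.pow 2)).add (hs2.mul (hu2.pow 2)))
  have hexp : ∀ y t : ℝ, 0 ≤ t → invAlpha k t ^ 3 * (charS k 1 y t * riem k 1 θ y t ^ 2
          + charS k (-1) y t * riem k (-1) θ y t ^ 2)
      = invAlpha k t ^ 2 * ((1 - k * y) * riem k 1 θ y t ^ 2
        + (1 + k * y) * riem k (-1) θ y t ^ 2) := by
    intro y t ht
    simp only [charS]
    linear_combination (invAlpha k t ^ 2 * ((1 - k * y) * riem k 1 θ y t ^ 2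
        + (1 + k * y) * riem k (-1) θ y t ^ 2)) * alpha_mul_invAlpha hk ht
  have hinv : ∀ t ∈ Icc 0 T, invAlpha k T ≤ invAlpha k t := by
    intro t ht
    rw [invAlpha_eq_of_nonneg hk hT.le, invAlpha_eq_of_nonneg hk ht.1]
    exact inv_anti₀ (alpha_pos hk ht.1) (alpha_mono hk ht.2)
  have hlow : m * M ≤ ∫ y in (0 : ℝ)..1, invAlpha k t₀ ^ 3 * (charS k 1 y t₀ * riem k 1 θ y t₀ ^ 2
          + charS k (-1) y t₀ * riem k (-1) θ y t₀ ^ 2) := by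
    rw [show m * M = ∫ y in (0 : ℝ)..1, m * (riem k 1 θ y t₀ ^ 2 + riem k (-1) θ y t₀ ^ 2) from
      (intervalIntegral.integral_const_mul _ _).symm]
    refine intervalIntegral.integral_mono_on zero_le_one
      (((hsq.const_mul m).continuous_fst t₀).intervalIntegrable _ _)
      ((hEsm.continuous_fst t₀).intervalIntegrable _ _) fun y hy => ?_
    rw [hexp y t₀ ht₀.1]
    have h1 : invAlpha k T ^ 2 ≤ invAlpha k t₀ ^ 2 :=
      pow_le_pow_left₀ (invAlpha_pos hk hT.le).le (hinv t₀ ht₀) 2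
    have h2 : k * y ≤ k := mul_le_of_le_one_right hk.le hy.2
    have h3 : 0 ≤ k * y := mul_nonneg hk.le hy.1
    have h4 : (1 - k) * (riem k 1 θ y t₀ ^ 2 + riem k (-1) θ y t₀ ^ 2)
        ≤ (1 - k * y) * riem k 1 θ y t₀ ^ 2 + (1 + k * y) * riem k (-1) θ y t₀ ^ 2 := by
      nlinarith [sq_nonneg (riem k 1 θ y t₀), sq_nonneg (riem k (-1) θ y t₀)]
    calc m * (riem k 1 θ y t₀ ^ 2 + riem k (-1) θ y t₀ ^ 2)
        = invAlpha k T ^ 2 * ((1 - k) * (riem k 1 θ y t₀ ^ 2 + riem k (-1) θ y t₀ ^ 2)) := by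
          simp only [m]; ring
      _ ≤ _ := mul_le_mul h1 h4 (mul_nonneg (by linarith) (by positivity)) (by positivity)
  have hup : ∫ y in (0 : ℝ)..1, invAlpha k T ^ 3 * (charS k 1 y T * riem k 1 θ y T ^ 2
          + charS k (-1) y T * riem k (-1) θ y T ^ 2) ≤ 2 * riemEnergy k θ T := by
    rw [riemEnergy, ← intervalIntegral.integral_const_mul]
    refine intervalIntegral.integral_mono_on zero_le_one
      ((hEsm.continuous_fst T).intervalIntegrable _ _)
      (((hsq.const_mul 2).continuous_fst T).intervalIntegrable _ _) fun y hy => ?_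
    rw [hexp y T hT.le]
    have h1 : invAlpha k T ^ 2 ≤ 1 := pow_le_one₀ (invAlpha_pos hk hT.le).le (invAlpha_le_one hk hT.le)
    have h2 : k * y ≤ k := mul_le_of_le_one_right hk.le hy.2
    have h3 : 0 ≤ k * y := mul_nonneg hk.le hy.1
    have h4 : (1 - k * y) * riem k 1 θ y T ^ 2 + (1 + k * y) * riem k (-1) θ y T ^ 2
        ≤ 2 * (riem k 1 θ y T ^ 2 + riem k (-1) θ y T ^ 2) := by
      nlinarith [sq_nonneg (riem k 1 θ y T), sq_nonneg (riem k (-1) θ y T)]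
    refine le_trans ?_ h4
    refine mul_le_of_le_one_left ?_ h1
    have : 0 ≤ 1 - k * y := by linarith
    positivity
  have hrhs : -(δ * (T * M) + 32 / δ * Γ) ≤ ∫ t in t₀..T, ∫ y in (0 : ℝ)..1, 2 * invAlpha k t ^ 2
      * ((charS k 1 y t * riem k 1 θ y t + charS k (-1) y t * riem k (-1) θ y t)
        * waveAdj k θ y t) := by
    have hp : Sm fun y t => δ * (riem k 1 θ y t ^ 2 + riem k (-1) θ y t ^ 2)
        + 32 / δ * waveAdj k θ y t ^ 2 := (hsq.const_mul δ).add ((hw.pow 2).const_mul _)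
    have h1 : ∫ t in t₀..T, ∫ y in (0 : ℝ)..1, (-1) * (δ * (riem k 1 θ y t ^ 2
        + riem k (-1) θ y t ^ 2) + 32 / δ * waveAdj k θ y t ^ 2)
      ≤ ∫ t in t₀..T, ∫ y in (0 : ℝ)..1, 2 * invAlpha k t ^ 2
      * ((charS k 1 y t * riem k 1 θ y t + charS k (-1) y t * riem k (-1) θ y t)
        * waveAdj k θ y t) := by
      refine rect_integral_mono (hp.const_mul _) (((hi.pow 2).const_mul 2).mul
        (((hs1.mul hu1).add (hs2.mul hu2)).mul hw)) zero_le_one ht₀.2 fun y hy t ht => ?_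
      have ht0 : 0 ≤ t := ht₀.1.trans ht.1
      have ha := alpha_mul_invAlpha hk ht0
      have hi0 := invAlpha_pos hk ht0
      have hi1 := invAlpha_le_one hk ht0
      have h2 : k * y ≤ k := mul_le_of_le_one_right hk.le hy.2
      have h3 : 0 ≤ k * y := mul_nonneg hk.le hy.1
      set a := riem k 1 θ y t
      set b := riem k (-1) θ y t
      set w := waveAdj k θ y t
      have e1 : 2 * invAlpha k t ^ 2 * ((charS k 1 y t * a + charS k (-1) y t * b) * w)
          = (2 * invAlpha k t * (1 - k * y)) * (a * w) + (2 * invAlpha k t * (1 + k * y)) * (b * w)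
          := by
        simp only [charS]
        linear_combination (2 * invAlpha k t * ((1 - k * y) * (a * w) + (1 + k * y) * (b * w))) * ha
      rw [e1]
      have key : ∀ c x : ℝ, 0 ≤ c → c ≤ 4 → -(δ * x ^ 2 + 16 / δ * w ^ 2) ≤ c * (x * w) :=
        fun c x hc hc4 => neg_le_mul_of_le hδ hc hc4 x w
      have k1 := key (2 * invAlpha k t * (1 - k * y)) a
        (mul_nonneg (by positivity) (by linarith)) (by nlinarith)
      have k2 := key (2 * invAlpha k t * (1 + k * y)) b
        (mul_nonneg (by positivity) (by linarith)) (by nlinarith)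
      have e2 : 32 / δ * w ^ 2 = 16 / δ * w ^ 2 + 16 / δ * w ^ 2 := by ring
      rw [e2]; linarith
    refine le_trans ?_ h1
    rw [rect_integral_const_mul, neg_one_mul, neg_le_neg_iff,
      rect_integral_add (hsq.const_mul δ) ((hw.pow 2).const_mul _), rect_integral_const_mul,
      rect_integral_const_mul]
    have h0 : (0 : ℝ) ∈ Icc (0 : ℝ) 1 := by simp
    refine add_le_add (mul_le_mul_of_nonneg_left ?_ hδ.le) (mul_le_mul_of_nonneg_left
      (rect_integral_mono_set (hw.pow 2) h0 ht₀ fun y t => by positivity) (by positivity))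
    refine (rect_integral_mono_set hsq h0 ht₀ fun y t => by positivity).trans ?_
    calc ∫ t in (0 : ℝ)..T, riemEnergy k θ t ≤ ∫ _ in (0 : ℝ)..T, M :=
          intervalIntegral.integral_mono_on hT.le
            ((continuous_riemEnergy h.smooth).intervalIntegrable _ _) (by simp) fun t ht => hmax ht
      _ = T * M := by simp
  rw [hid] at hrhs
  have hδT : δ * (T * M) = m * M / 2 := by simp only [δ]; field_simp
  rw [hδT] at hrhs
  have hfin : m * M / 2 ≤ 2 * riemEnergy k θ T + 32 / δ * Γ := by linarith
  have hfin' : M ≤ (2 * riemEnergy k θ T + 32 / δ * Γ) * (2 / m) := by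
    rw [mul_div_assoc', le_div_iff₀ hm]; linarith
  refine hfin'.trans ?_
  have p1 : 0 ≤ 4 / m * Γ := by positivity
  have p2 : 0 ≤ 2 * (32 / δ) / m * riemEnergy k θ T := by positivity
  have : (2 * riemEnergy k θ T + 32 / δ * Γ) * (2 / m)
      = 4 / m * riemEnergy k θ T + 2 * (32 / δ) / m * Γ := by ring
  rw [this]
  nlinarith

end

/-! ### Boundary traces and observability. -/

section

variable {k T : ℝ} {θ : ℝ → ℝ → ℝ}

theorem rect_integral_abs_le {f g : ℝ → ℝ → ℝ} (hf : Sm f) (hg : Sm g) {y₀ y₁ t₀ t₁ : ℝ}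
    (hy : y₀ ≤ y₁) (ht : t₀ ≤ t₁) (h : ∀ y ∈ Icc y₀ y₁, ∀ t ∈ Icc t₀ t₁, |f y t| ≤ g y t) :
    |∫ t in t₀..t₁, ∫ y in y₀..y₁, f y t| ≤ ∫ t in t₀..t₁, ∫ y in y₀..y₁, g y t := by
  refine abs_le.2 ⟨?_, rect_integral_mono hf hg hy ht fun y hy t ht =>
    (le_abs_self _).trans (h y hy t ht)⟩
  have h1 := rect_integral_mono (hg.const_mul (-1)) hf hy ht fun y hy t ht => by
    have := neg_le_of_abs_le (h y hy t ht)
    linarith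
  rw [rect_integral_const_mul] at h1
  linarith

theorem rect_integral_riemSq_le (h : IsDirichlet T θ) (hT : 0 < T) {C : ℝ}
    (hC : ∀ t ∈ Icc 0 T, riemEnergy k θ t ≤ C * (riemEnergy k θ T + sourceEnergy k T θ)) :
    ∫ t in (0 : ℝ)..T, ∫ y in (0 : ℝ)..1, (riem k 1 θ y t ^ 2 + riem k (-1) θ y t ^ 2)
      ≤ T * (C * (riemEnergy k θ T + sourceEnergy k T θ)) := by
  calc ∫ t in (0 : ℝ)..T, riemEnergy k θ t
      ≤ ∫ _ in (0 : ℝ)..T, C * (riemEnergy k θ T + sourceEnergy k T θ) :=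
        intervalIntegral.integral_mono_on hT.le
          ((continuous_riemEnergy h.smooth).intervalIntegrable _ _) (by simp) hC
    _ = _ := by rw [intervalIntegral.integral_const, sub_zero, smul_eq_mul]

theorem invAlpha_anti (hk : 0 < k) {t : ℝ} (ht : t ∈ Icc 0 T) : invAlpha k T ≤ invAlpha k t := by
  rw [invAlpha_eq_of_nonneg hk (ht.1.trans ht.2), invAlpha_eq_of_nonneg hk ht.1]
  exact inv_anti₀ (alpha_pos hk ht.1) (alpha_mono hk ht.2)

/-- The weight 1 - y on [y₀, 1] × [0, T] removes the boundary term at y = 1 and is at least 1/2 at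
y₀. The slice term has coefficient e - k y₀, of the sign of e and of modulus at least 1 - k.
Uniformity in y₀ is what later controls averages over (0, ε). -/
theorem exists_riem_slice_bound (hk : 0 < k) (hk1 : k < 1) (hT : 0 < T) :
    ∃ C : ℝ, 0 < C ∧ ∀ θ, IsDirichlet T θ → ∀ e : ℝ, (e = 1 ∨ e = -1) → ∀ y₀ ∈ Icc (0 : ℝ) (1 / 2),
      ∫ t in (0 : ℝ)..T, riem k e θ y₀ t ^ 2
        ≤ C * (riemEnergy k θ T + sourceEnergy k T θ) := by
  obtain ⟨C, hC0, hC⟩ := exists_energy_bound hk hk1 hT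
  set m : ℝ := (1 - k) * (invAlpha k T ^ 4 * (1 / 2))
  have hm : 0 < m := mul_pos (by linarith) (mul_pos (pow_pos (invAlpha_pos hk hT.le) 4) (by norm_num))
  refine ⟨(2 * C + 3 * (T * C) + 2) / m, by positivity, fun θ h e he y₀ hy₀ => ?_⟩
  have hee : e * e = 1 := by rcases he with rfl | rfl <;> norm_num
  set E := riemEnergy k θ T + sourceEnergy k T θ
  have hN := riemEnergy_nonneg k θ T
  have hΓ := sourceEnergy_nonneg k hT.le θ
  have hE : 0 ≤ E := add_nonneg hN hΓ
  have hu := h.smooth.riem k e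
  have hw := h.smooth.waveAdj k
  have hi := Sm.invAlpha k
  have hsq := h.smooth.riemSq k
  have hwt := Sm.affine 1 1
  have hule : ∀ y t, riem k e θ y t ^ 2 ≤ riem k 1 θ y t ^ 2 + riem k (-1) θ y t ^ 2 := by
    intro y t
    rcases he with rfl | rfl
    · linarith [sq_nonneg (riem k (-1) θ y t)]
    · linarith [sq_nonneg (riem k 1 θ y t)]
  have hid := integral_weight_riem hwt h hee hk hT (y₀ := y₀) (by linarith [hy₀.2])
    (left_mem_Icc.2 hT.le)
  simp only [charD_affine] at hid
  have hy1 : y₀ ≤ 1 := by linarith [hy₀.2]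
  have hy01 : y₀ ∈ Icc (0 : ℝ) 1 := ⟨hy₀.1, hy1⟩
  have hslice : ∀ t ∈ Icc 0 T, |∫ y in y₀..1, invAlpha k t ^ 3
      * ((1 - 1 * y) * riem k e θ y t ^ 2)| ≤ C * E := by
    intro t ht
    have hi0 := (invAlpha_pos hk ht.1).le
    have hi1 : invAlpha k t ^ 3 ≤ 1 := pow_le_one₀ hi0 (invAlpha_le_one hk ht.1)
    have hp : ∀ y ∈ Icc y₀ 1, 0 ≤ (1 - 1 * y) * riem k e θ y t ^ 2 := fun y hy =>
      mul_nonneg (by linarith [hy.2]) (sq_nonneg _)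
    rw [abs_of_nonneg (intervalIntegral.integral_nonneg hy1 fun y hy =>
      mul_nonneg (pow_nonneg hi0 3) (hp y hy))]
    refine le_trans ?_ (hC θ h t ht)
    refine le_trans (b := ∫ y in y₀..1, (riem k 1 θ y t ^ 2 + riem k (-1) θ y t ^ 2)) ?_ ?_
    · refine intervalIntegral.integral_mono_on hy1
        ((((hi.pow 3).mul (hwt.mul (hu.pow 2))).continuous_fst t).intervalIntegrable _ _)
        ((hsq.continuous_fst t).intervalIntegrable _ _) fun y hy => ?_
      refine (mul_le_of_le_one_left (hp y hy) hi1).trans (le_trans ?_ (hule y t))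
      exact mul_le_of_le_one_left (sq_nonneg _) (by linarith [hy.1, hy₀.1])
    · exact intervalIntegral.integral_mono_interval hy₀.1 hy1 le_rfl
        (ae_of_all _ fun y => by positivity) ((hsq.continuous_fst t).intervalIntegrable _ _)
  have hlhs : |∫ t in (0 : ℝ)..T, ∫ y in y₀..1, (invAlpha k t ^ 4
      * (-(e - k * y) * 1 * riem k e θ y t ^ 2)
        + 2 * invAlpha k t ^ 2 * ((1 - 1 * y) * (riem k e θ y t * waveAdj k θ y t)))|
      ≤ 3 * (T * (C * E)) + E := by
    have hdom : Sm fun y t => 3 * (riem k 1 θ y t ^ 2 + riem k (-1) θ y t ^ 2)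
        + waveAdj k θ y t ^ 2 := (hsq.const_mul 3).add (hw.pow 2)
    refine (rect_integral_abs_le (((hi.pow 4).mul (((Sm.affine e k).neg.mul (Sm.const 1)).mul
      (hu.pow 2))).add (((hi.pow 2).const_mul 2).mul (hwt.mul (hu.mul hw)))) hdom hy1 hT.le
      fun y hy t ht => ?_).trans ?_
    · have hi0 := (invAlpha_pos hk ht.1).le
      have hi1 := invAlpha_le_one hk ht.1
      have hi4 : invAlpha k t ^ 4 ≤ 1 := pow_le_one₀ hi0 hi1
      have hi2 : invAlpha k t ^ 2 ≤ 1 := pow_le_one₀ hi0 hi1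
      have hyn : 0 ≤ y := hy₀.1.trans hy.1
      have hky : 0 ≤ k * y := mul_nonneg hk.le hyn
      have hky1 : k * y ≤ 1 := by nlinarith [hy.2]
      refine (abs_add_le _ _).trans ?_
      have t1 : |invAlpha k t ^ 4 * (-(e - k * y) * 1 * riem k e θ y t ^ 2)|
          ≤ 2 * riem k e θ y t ^ 2 := by
        rw [abs_mul, abs_of_nonneg (pow_nonneg hi0 4), abs_mul,
          abs_of_nonneg (sq_nonneg (riem k e θ y t))]
        refine (mul_le_of_le_one_left (by positivity) hi4).trans ?_
        refine mul_le_mul_of_nonneg_right ?_ (sq_nonneg _)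
        rcases he with rfl | rfl <;> rw [abs_le] <;> constructor <;> linarith
      have t2 : |2 * invAlpha k t ^ 2 * ((1 - 1 * y) * (riem k e θ y t * waveAdj k θ y t))|
          ≤ riem k e θ y t ^ 2 + waveAdj k θ y t ^ 2 := by
        have e1 : 2 * invAlpha k t ^ 2 * ((1 - 1 * y) * (riem k e θ y t * waveAdj k θ y t))
          = (invAlpha k t ^ 2 * (1 - y)) * (2 * riem k e θ y t * waveAdj k θ y t) := by ring
        rw [e1, abs_mul]
        have c1 : |invAlpha k t ^ 2 * (1 - y)| ≤ 1 := by
          rw [abs_of_nonneg (mul_nonneg (by positivity) (by linarith [hy.2]))]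
          exact mul_le_one₀ hi2 (by linarith [hy.2]) (by linarith)
        refine (mul_le_of_le_one_left (abs_nonneg _) c1).trans ?_
        exact abs_le.2 ⟨by nlinarith [sq_nonneg (riem k e θ y t + waveAdj k θ y t)],
          by nlinarith [sq_nonneg (riem k e θ y t - waveAdj k θ y t)]⟩
      have := hule y t
      linarith
    · rw [rect_integral_add (hsq.const_mul 3) (hw.pow 2), rect_integral_const_mul]
      have h0 : (0 : ℝ) ∈ Icc 0 T := left_mem_Icc.2 hT.le
      refine add_le_add (mul_le_mul_of_nonneg_left ?_ (by norm_num)) ?_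
      · exact (rect_integral_mono_set hsq hy01 h0 fun y t => by positivity).trans
          (rect_integral_riemSq_le h hT (hC θ h))
      · exact (rect_integral_mono_set (hw.pow 2) hy01 h0 fun y t => by positivity).trans
          (le_add_of_nonneg_left hN)
  have hzero : ∫ t in (0 : ℝ)..T, (e - k) * (e + k) ^ 2 * (invAlpha k t ^ 4
      * ((1 - 1 * 1) * dy θ 1 t ^ 2)) = 0 := by simp
  rw [hzero, zero_sub] at hid
  set X := ∫ t in (0 : ℝ)..T, (e - k * y₀) * (invAlpha k t ^ 4
    * ((1 - 1 * y₀) * riem k e θ y₀ t ^ 2)) with hX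
  have hXle : |X| ≤ C * E + C * E + (3 * (T * (C * E)) + E) := by
    have a1 := abs_le.1 (hslice T (right_mem_Icc.2 hT.le))
    have a2 := abs_le.1 (hslice 0 (left_mem_Icc.2 hT.le))
    have a3 := abs_le.1 hlhs
    rw [hid] at a3
    refine abs_le.2 ⟨?_, ?_⟩ <;> linarith [a1.1, a1.2, a2.1, a2.2, a3.1, a3.2]
  have hlow : m * ∫ t in (0 : ℝ)..T, riem k e θ y₀ t ^ 2 ≤ e * X := by
    rw [hX, ← intervalIntegral.integral_const_mul, ← intervalIntegral.integral_const_mul]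
    refine intervalIntegral.integral_mono_on hT.le
      ((((hu.pow 2).const_mul m).continuous_snd y₀).intervalIntegrable _ _)
      ((((((hi.pow 4).mul (hwt.mul (hu.pow 2))).continuous_snd y₀).const_mul
        (e - k * y₀)).const_mul e).intervalIntegrable _ _) fun t ht => ?_
    have h1 : 1 - k ≤ e * (e - k * y₀) := by
      have : 0 ≤ k * y₀ := mul_nonneg hk.le hy₀.1
      have : k * y₀ ≤ k := mul_le_of_le_one_right hk.le hy1
      rcases he with rfl | rfl <;> linarith
    have h2 : invAlpha k T ^ 4 ≤ invAlpha k t ^ 4 :=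
      pow_le_pow_left₀ (invAlpha_pos hk hT.le).le (invAlpha_anti hk ht) 4
    have h3 : (1 / 2 : ℝ) ≤ 1 - 1 * y₀ := by linarith [hy₀.2]
    have hi4 : 0 ≤ invAlpha k T ^ 4 := pow_nonneg (invAlpha_pos hk hT.le).le 4
    calc m * riem k e θ y₀ t ^ 2 ≤ (e * (e - k * y₀) * (invAlpha k t ^ 4 * (1 - 1 * y₀)))
          * riem k e θ y₀ t ^ 2 := by
          refine mul_le_mul_of_nonneg_right ?_ (sq_nonneg _)
          exact mul_le_mul h1 (mul_le_mul h2 h3 (by norm_num) (hi4.trans h2))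
            (by positivity) (by linarith)
      _ = _ := by ring
  have heX : e * X ≤ |X| := by
    rcases he with rfl | rfl
    · rw [one_mul]; exact le_abs_self X
    · rw [neg_one_mul]; exact neg_le_abs X
  rw [div_mul_eq_mul_div, le_div_iff₀ hm, mul_comm]
  refine (hlow.trans (heX.trans hXle)).trans ?_
  nlinarith

theorem dy_eq_riem_sub (k : ℝ) (θ : ℝ → ℝ → ℝ) (y t : ℝ) :
    dy θ y t = (riem k (-1) θ y t - riem k 1 θ y t) / 2 := by
  simp only [riem, charD]; ring

theorem exists_trace_bound (hk : 0 < k) (hk1 : k < 1) (hT : 0 < T) :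
    ∃ C : ℝ, 0 < C ∧ ∀ θ, IsDirichlet T θ → ∀ y₀ ∈ Icc (0 : ℝ) (1 / 2),
      ∫ t in (0 : ℝ)..T, dy θ y₀ t ^ 2 ≤ C * (riemEnergy k θ T + sourceEnergy k T θ) := by
  obtain ⟨C, hC0, hC⟩ := exists_riem_slice_bound hk hk1 hT
  refine ⟨C, hC0, fun θ h y₀ hy₀ => ?_⟩
  have h1 := hC θ h 1 (Or.inl rfl) y₀ hy₀
  have h2 := hC θ h (-1) (Or.inr rfl) y₀ hy₀
  have hc1 := ((h.smooth.riem k 1).pow 2).continuous_snd y₀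
  have hc2 := ((h.smooth.riem k (-1)).pow 2).continuous_snd y₀
  have h3 : ∫ t in (0 : ℝ)..T, dy θ y₀ t ^ 2
      ≤ ∫ t in (0 : ℝ)..T, (1 / 2 * riem k 1 θ y₀ t ^ 2 + 1 / 2 * riem k (-1) θ y₀ t ^ 2) := by
    refine intervalIntegral.integral_mono_on hT.le
      (((h.smooth.dy.pow 2).continuous_snd y₀).intervalIntegrable _ _)
      (((hc1.const_mul _).add (hc2.const_mul _)).intervalIntegrable _ _) fun t _ => ?_
    rw [dy_eq_riem_sub k]
    nlinarith [sq_nonneg (riem k (-1) θ y₀ t + riem k 1 θ y₀ t)]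
  rw [intervalIntegral.integral_add ((hc1.const_mul _).intervalIntegrable _ _)
    ((hc2.const_mul _).intervalIntegrable _ _), intervalIntegral.integral_const_mul,
    intervalIntegral.integral_const_mul] at h3
  linarith

set_option maxHeartbeats 1000000 in
/-- The observability inequality. -/
theorem exists_observability (hk : 0 < k) (hk1 : k < 1) (hT : 2 / (1 - k) < T) :
    ∃ C : ℝ, 0 < C ∧ ∀ θ, IsDirichlet T θ →
      riemEnergy k θ T ≤ C * ((∫ t in (0 : ℝ)..T, dy θ 0 t ^ 2) + sourceEnergy k T θ) := by
  have hk1' : 0 < 1 - k := by linarith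
  have hT0 : 0 < T := lt_trans (by positivity) hT
  obtain ⟨C, hC0, hC⟩ := exists_energy_bound hk hk1 hT0
  set κ : ℝ := (1 + k) / (1 - k)
  have hκ1 : 1 < κ := (one_lt_div hk1').2 (by linarith)
  have hκ0 : 0 < κ := by linarith
  have hκk : κ * (1 - k) = 1 + k := div_mul_cancel₀ _ hk1'.ne'
  -- The condition α(T) > κ is the same as T > 2/(1-k). It makes c > 1 and leaves room for a cut-off
  -- that passes from 0 to 1 between 1 and c.
  set c : ℝ := alpha k T / κ
  have hc1 : 1 < c := by
    rw [lt_div_iff₀ hκ0, one_mul]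
    have h1 : 2 < T * (1 - k) := (div_lt_iff₀ hk1').1 hT
    have h2 : κ * (1 - k) < alpha k T * (1 - k) := by
      rw [hκk, alpha]; nlinarith
    exact lt_of_mul_lt_mul_right h2 hk1'.le
  set g : ℝ → ℝ := fun s => Real.smoothTransition ((s - 1) / (c - 1)) with hgdef
  have hg : ContDiff ℝ ∞ g := Real.smoothTransition.contDiff.comp (by fun_prop)
  have hg0 : ∀ s, s ≤ 1 → g s = 0 := fun s hs =>
    Real.smoothTransition.zero_of_nonpos (div_nonpos_of_nonpos_of_nonneg (by linarith) (by linarith))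
  have hg1 : ∀ s, c ≤ s → g s = 1 := fun s hs =>
    Real.smoothTransition.one_of_one_le ((one_le_div (by linarith)).2 (by linarith))
  have hgn : ∀ s, 0 ≤ g s := fun s => Real.smoothTransition.nonneg _
  have hgl : ∀ s, g s ≤ 1 := fun s => Real.smoothTransition.le_one _
  -- Each weight is a function of the first integral of its own field, so no interior term arises.
  -- On y = 1 one has `charS k (-1)` = κ `charS k 1`; dividing by κ inside and multiplying by κ
  -- outside makes the two boundary terms there cancel.
  set w₁ : ℝ → ℝ → ℝ := fun y t => g (charS k 1 y t)
  set w₂ : ℝ → ℝ → ℝ := fun y t => κ * g (charS k (-1) y t / κ)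
  have hw₁ : Sm w₁ := Sm.comp hg (Sm.charS k 1)
  have hg' : ContDiff ℝ ∞ fun s => κ * g (s / κ) :=
    contDiff_const.mul (hg.comp (contDiff_id.div_const κ))
  have hw₂ : Sm w₂ := Sm.comp (f := fun s => κ * g (s / κ)) hg' (Sm.charS k (-1))
  have hD₁ : ∀ y t, charD k 1 w₁ y t = 0 := fun y t => by
    rw [charD_comp hg (Sm.charS k 1), charD_charS]; ring
  have hD₂ : ∀ y t, charD k (-1) w₂ y t = 0 := fun y t => by
    have := charD_comp hg' (Sm.charS k (-1)) k (-1) y t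
    rw [charD_charS] at this
    refine this.trans ?_; ring
  set i3 : ℝ := invAlpha k T ^ 3
  have hi3 : 0 < i3 := pow_pos (invAlpha_pos hk hT0.le) 3
  -- The source terms produce δ times the space-time energy, at most δTC(N + Γ); this δ makes that
  -- (i3/2)(N + Γ), half of which the left side i3 N can absorb.
  set δ : ℝ := i3 / (2 * (T * C))
  have hδ : 0 < δ := by positivity
  refine ⟨2 / i3 + 2 / i3 * (i3 / 2 + 2 * κ ^ 2 / δ), by positivity, fun θ h => ?_⟩
  set Γ := sourceEnergy k T θ
  set N := riemEnergy k θ T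
  set Y := ∫ t in (0 : ℝ)..T, dy θ 0 t ^ 2
  have hΓ : 0 ≤ Γ := sourceEnergy_nonneg k hT0.le θ
  have hN : 0 ≤ N := riemEnergy_nonneg k θ T
  have hY : 0 ≤ Y := intervalIntegral.integral_nonneg hT0.le fun _ _ => sq_nonneg _
  have h0T : (0 : ℝ) ∈ Icc 0 T := left_mem_Icc.2 hT0.le
  have hu1 := h.smooth.riem k 1
  have hu2 := h.smooth.riem k (-1)
  have hw := h.smooth.waveAdj k
  have hi := Sm.invAlpha k
  have hsq := h.smooth.riemSq k
  have id1 := integral_weight_riem hw₁ h (e := 1) (by norm_num) hk hT0 zero_le_one h0T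
  have id2 := integral_weight_riem hw₂ h (e := -1) (by norm_num) hk hT0 zero_le_one h0T
  simp only [hD₁, hD₂, zero_mul, mul_zero, zero_add, sub_zero] at id1 id2
  have hky : ∀ y ∈ Icc (0 : ℝ) 1, 0 ≤ k * y ∧ k * y ≤ k := fun y hy =>
    ⟨mul_nonneg hk.le hy.1, mul_le_of_le_one_right hk.le hy.2⟩
  -- At t = 0 one has `charS k 1` ≤ 1 and `charS k (-1)` ≤ 1 + k ≤ κ, so both cut-offs are still
  -- zero.
  have z1 : ∫ y in (0 : ℝ)..1, invAlpha k 0 ^ 3 * (w₁ y 0 * riem k 1 θ y 0 ^ 2) = 0 := by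
    refine intervalIntegral.integral_zero_ae (ae_of_all _ fun y hy => ?_)
    rw [uIoc_of_le zero_le_one] at hy
    have : w₁ y 0 = 0 := hg0 _ (by
      have := hky y (Ioc_subset_Icc_self hy)
      simp only [charS, alpha]; linarith [this.1])
    rw [this]; ring
  have z2 : ∫ y in (0 : ℝ)..1, invAlpha k 0 ^ 3 * (w₂ y 0 * riem k (-1) θ y 0 ^ 2) = 0 := by
    refine intervalIntegral.integral_zero_ae (ae_of_all _ fun y hy => ?_)
    rw [uIoc_of_le zero_le_one] at hy
    have : w₂ y 0 = 0 := by
      simp only [w₂]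
      rw [hg0 _ ?_, mul_zero]
      have := hky y (Ioc_subset_Icc_self hy)
      rw [div_le_one hκ0, charS, alpha]
      nlinarith [this.2]
    rw [this]; ring
  have b12 : (∫ t in (0 : ℝ)..T, (1 - k) * (1 + k) ^ 2 * (invAlpha k t ^ 4
        * (w₁ 1 t * dy θ 1 t ^ 2)))
      + ∫ t in (0 : ℝ)..T, (-1 - k) * (-1 + k) ^ 2 * (invAlpha k t ^ 4
        * (w₂ 1 t * dy θ 1 t ^ 2)) = 0 := by
    rw [← intervalIntegral.integral_add
      (((((hi.pow 4).mul (hw₁.mul (h.smooth.dy.pow 2))).continuous_snd 1).const_mul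
        _).intervalIntegrable _ _)
      (((((hi.pow 4).mul (hw₂.mul (h.smooth.dy.pow 2))).continuous_snd 1).const_mul
        _).intervalIntegrable _ _)]
    refine intervalIntegral.integral_zero_ae (ae_of_all _ fun t _ => ?_)
    have e1 : charS k (-1) 1 t / κ = charS k 1 1 t := by
      rw [div_eq_iff hκ0.ne']
      simp only [charS]
      linear_combination (-alpha k t) * hκk
    simp only [w₁, w₂, e1]
    linear_combination (-(1 + k) * (1 - k) * invAlpha k t ^ 4 * g (charS k 1 1 t) * dy θ 1 t ^ 2)
      * hκk
  -- At y = 0 the family e = 1 produces the observed integral; the family e = -1 enters with a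
  -- favourable sign and is dropped.
  have c1 : ∫ t in (0 : ℝ)..T, (1 : ℝ) * (invAlpha k t ^ 4 * (w₁ 0 t * riem k 1 θ 0 t ^ 2)) ≤ Y := by
    refine intervalIntegral.integral_mono_on hT0.le
      (((((hi.pow 4).mul (hw₁.mul (hu1.pow 2))).continuous_snd 0).const_mul
        _).intervalIntegrable _ _)
      (((h.smooth.dy.pow 2).continuous_snd 0).intervalIntegrable _ _) fun t ht => ?_
    rw [one_mul, h.riem_left hT0 1 ht]
    have hi4 : invAlpha k t ^ 4 ≤ 1 :=
      pow_le_one₀ (invAlpha_pos hk ht.1).le (invAlpha_le_one hk ht.1)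
    have : (-1 * dy θ 0 t) ^ 2 = dy θ 0 t ^ 2 := by ring
    rw [this]
    refine (mul_le_of_le_one_left (mul_nonneg (hgn _) (sq_nonneg _)) hi4).trans ?_
    exact mul_le_of_le_one_left (sq_nonneg _) (hgl _)
  have c2 : ∫ t in (0 : ℝ)..T, (-1 : ℝ) * (invAlpha k t ^ 4 * (w₂ 0 t * riem k (-1) θ 0 t ^ 2))
      ≤ 0 := by
    rw [intervalIntegral.integral_const_mul, neg_one_mul, neg_nonpos]
    refine intervalIntegral.integral_nonneg hT0.le fun t _ => ?_
    have : 0 ≤ w₂ 0 t := mul_nonneg hκ0.le (hgn _)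
    positivity
  -- At t = T both arguments exceed c, since (1 - k)κ = 1 + k ≥ 1; the weights are then 1 and κ.
  have pT : i3 * N ≤ (∫ y in (0 : ℝ)..1, i3 * (w₁ y T * riem k 1 θ y T ^ 2))
      + ∫ y in (0 : ℝ)..1, i3 * (w₂ y T * riem k (-1) θ y T ^ 2) := by
    have hq1 : Continuous fun y => i3 * (w₁ y T * riem k 1 θ y T ^ 2) :=
      ((hw₁.mul (hu1.pow 2)).continuous_fst T).const_mul _
    have hq2 : Continuous fun y => i3 * (w₂ y T * riem k (-1) θ y T ^ 2) :=
      ((hw₂.mul (hu2.pow 2)).continuous_fst T).const_mul _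
    rw [← intervalIntegral.integral_add (hq1.intervalIntegrable _ _) (hq2.intervalIntegrable _ _),
      show i3 * N = ∫ y in (0 : ℝ)..1, i3 * (riem k 1 θ y T ^ 2 + riem k (-1) θ y T ^ 2) from
      (intervalIntegral.integral_const_mul _ _).symm]
    refine intervalIntegral.integral_mono_on zero_le_one
      (((hsq.const_mul i3).continuous_fst T).intervalIntegrable _ _)
      ((hq1.add hq2).intervalIntegrable _ _) fun y hy => ?_
    have hy' := hky y hy
    have haT := alpha_pos hk hT0.le
    have e1 : w₁ y T = 1 := hg1 _ (by
      rw [div_le_iff₀ hκ0, charS]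
      have : 1 ≤ (1 - 1 * k * y) * κ := by nlinarith [hy'.2]
      nlinarith)
    have e2 : w₂ y T = κ := by
      simp only [w₂]
      rw [hg1 _ ?_, mul_one]
      refine div_le_div_of_nonneg_right ?_ hκ0.le
      rw [charS]; nlinarith [hy'.1]
    rw [e1, e2, ← mul_add]
    refine mul_le_mul_of_nonneg_left ?_ hi3.le
    nlinarith [sq_nonneg (riem k (-1) θ y T)]
  have hL : ∀ (e : ℝ) (q : ℝ → ℝ → ℝ), Sm q → (e = 1 ∨ e = -1) → (∀ y t, 0 ≤ q y t ∧ q y t ≤ κ) →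
      ∫ t in (0 : ℝ)..T, ∫ y in (0 : ℝ)..1, 2 * invAlpha k t ^ 2
        * (q y t * (riem k e θ y t * waveAdj k θ y t))
      ≤ ∫ t in (0 : ℝ)..T, ∫ y in (0 : ℝ)..1, (δ * riem k e θ y t ^ 2
        + κ ^ 2 / δ * waveAdj k θ y t ^ 2) := by
    intro e q hq he hqb
    have hu := h.smooth.riem k e
    refine rect_integral_mono (((hi.pow 2).const_mul 2).mul (hq.mul (hu.mul hw)))
      (((hu.pow 2).const_mul δ).add ((hw.pow 2).const_mul _)) zero_le_one hT0.le fun y _ t ht => ?_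
    have hi0 := (invAlpha_pos hk ht.1).le
    have hi2 : invAlpha k t ^ 2 ≤ 1 := pow_le_one₀ hi0 (invAlpha_le_one hk ht.1)
    set b := invAlpha k t ^ 2 * q y t
    have hb0 : 0 ≤ b := mul_nonneg (by positivity) (hqb y t).1
    have hb1 : b ≤ κ := (mul_le_of_le_one_left (hqb y t).1 hi2).trans (hqb y t).2
    have e1 : 2 * invAlpha k t ^ 2 * (q y t * (riem k e θ y t * waveAdj k θ y t))
        = δ * riem k e θ y t ^ 2 + b ^ 2 / δ * waveAdj k θ y t ^ 2
          - δ * (riem k e θ y t - b / δ * waveAdj k θ y t) ^ 2 := by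
      simp only [b]; field_simp; ring
    rw [e1]
    have e2 : b ^ 2 / δ * waveAdj k θ y t ^ 2 ≤ κ ^ 2 / δ * waveAdj k θ y t ^ 2 := by gcongr
    have e3 : 0 ≤ δ * (riem k e θ y t - b / δ * waveAdj k θ y t) ^ 2 := by positivity
    linarith
  have l1 := hL 1 w₁ hw₁ (Or.inl rfl) fun y t => ⟨hgn _, (hgl _).trans hκ1.le⟩
  have l2 := hL (-1) w₂ hw₂ (Or.inr rfl) fun y t =>
    ⟨mul_nonneg hκ0.le (hgn _), mul_le_of_le_one_right hκ0.le (hgl _)⟩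
  rw [rect_integral_add ((hu1.pow 2).const_mul δ) ((hw.pow 2).const_mul _),
    rect_integral_const_mul, rect_integral_const_mul] at l1
  rw [rect_integral_add ((hu2.pow 2).const_mul δ) ((hw.pow 2).const_mul _),
    rect_integral_const_mul, rect_integral_const_mul] at l2
  have hsum := rect_integral_riemSq_le h hT0 (hC θ h)
  rw [rect_integral_add (hu1.pow 2) (hu2.pow 2)] at hsum
  have hsum' := mul_le_mul_of_nonneg_left hsum hδ.le
  have hδ' : δ * (T * (C * (N + Γ))) = i3 / 2 * (N + Γ) := by
    simp only [δ]; field_simp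
  have hsum'' : δ * ((∫ t in (0 : ℝ)..T, ∫ y in (0 : ℝ)..1, riem k 1 θ y t ^ 2)
      + ∫ t in (0 : ℝ)..T, ∫ y in (0 : ℝ)..1, riem k (-1) θ y t ^ 2) ≤ i3 / 2 * (N + Γ) :=
    hsum'.trans hδ'.le
  rw [z1, sub_zero] at id1
  rw [z2, sub_zero] at id2
  have hΓdef : ∫ t in (0 : ℝ)..T, ∫ y in (0 : ℝ)..1, waveAdj k θ y t ^ 2 = Γ := rfl
  rw [hΓdef] at l1 l2
  have hmain : i3 * N ≤ Y + i3 / 2 * (N + Γ) + 2 * (κ ^ 2 / δ * Γ) := by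
    have : ∀ x : ℝ, (-1 - k * 0) * x = -1 * x := fun x => by ring
    have : ∀ x : ℝ, (1 - k * 0) * x = 1 * x := fun x => by ring
    linarith [mul_add δ (∫ t in (0 : ℝ)..T, ∫ y in (0 : ℝ)..1, riem k 1 θ y t ^ 2)
      (∫ t in (0 : ℝ)..T, ∫ y in (0 : ℝ)..1, riem k (-1) θ y t ^ 2)]
  have hfin : N ≤ 2 / i3 * (Y + (i3 / 2 + 2 * κ ^ 2 / δ) * Γ) := by
    rw [div_mul_eq_mul_div, le_div_iff₀ hi3]
    have : 2 * κ ^ 2 / δ * Γ = 2 * (κ ^ 2 / δ * Γ) := by ring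
    nlinarith
  refine hfin.trans ?_
  have p1 : 0 ≤ 2 / i3 * (i3 / 2 + 2 * κ ^ 2 / δ) * Y := by positivity
  have p2 : 0 ≤ 2 / i3 * Γ := by positivity
  nlinarith

end

/-! ### Curves on `[0, T]` as bounded continuous functions -/

/-- The projection of the line onto `[0, T]`. -/
def clamp (T t : ℝ) : ℝ := max 0 (min T t)

theorem continuous_clamp (T : ℝ) : Continuous (clamp T) := by unfold clamp; fun_prop

theorem clamp_mem {T : ℝ} (hT : 0 ≤ T) (t : ℝ) : clamp T t ∈ Icc 0 T :=
  ⟨le_max_left _ _, max_le hT (min_le_left _ _)⟩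

theorem clamp_eq {T t : ℝ} (ht : t ∈ Icc 0 T) : clamp T t = t := by
  rw [clamp, min_eq_right ht.2, max_eq_right ht.1]

section clampCurve

variable {X : Type*} [NormedAddCommGroup X] {T : ℝ} {u v : ℝ → X}

/-- A curve that is continuous on `[0, T]`, extended by constants. -/
def clampCurve (hT : 0 ≤ T) (u : ℝ → X) : ℝ →ᵇ X := by
  classical
  exact if h : ContinuousOn u (Icc 0 T) then
    (BoundedContinuousFunction.ofNormedAddCommGroup (fun t => u (clamp T t))
      (h.comp_continuous (continuous_clamp T) (clamp_mem hT))
      (isCompact_Icc.exists_bound_of_continuousOn h).choose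
      (fun t => (isCompact_Icc.exists_bound_of_continuousOn h).choose_spec _ (clamp_mem hT t)))
  else 0

theorem clampCurve_apply (hT : 0 ≤ T) (h : ContinuousOn u (Icc 0 T)) (t : ℝ) :
    clampCurve hT u t = u (clamp T t) := by
  simp [clampCurve, h]

theorem clampCurve_of_mem (hT : 0 ≤ T) (h : ContinuousOn u (Icc 0 T)) {t : ℝ} (ht : t ∈ Icc 0 T) :
    clampCurve hT u t = u t := by rw [clampCurve_apply hT h, clamp_eq ht]

theorem norm_clampCurve_le (hT : 0 ≤ T) (h : ContinuousOn u (Icc 0 T)) {C : ℝ}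
    (hC : ∀ t ∈ Icc 0 T, ‖u t‖ ≤ C) : ‖clampCurve hT u‖ ≤ C := by
  have hC0 : 0 ≤ C := (norm_nonneg _).trans (hC 0 ⟨le_rfl, hT⟩)
  refine (BoundedContinuousFunction.norm_le hC0).2 fun t => ?_
  rw [clampCurve_apply hT h]; exact hC _ (clamp_mem hT t)

end clampCurve

/-! ### The data map and the solution map on smooth functions -/

section

variable {k T : ℝ} {θ ζ : ℝ → ℝ → ℝ}

/-- Smooth functions vanishing on the lateral boundary, as a space. -/
def dirichlet (T : ℝ) : Submodule ℝ (ℝ → ℝ → ℝ) where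
  carrier := {θ | IsDirichlet T θ}
  add_mem' h h' := ⟨h.smooth.add h'.smooth,
    fun t ht => by simp [h.left t ht, h'.left t ht], fun t ht => by simp [h.right t ht, h'.right t ht]⟩
  zero_mem' := ⟨Sm.zero, fun _ _ => rfl, fun _ _ => rfl⟩
  smul_mem' c _ h := ⟨h.smooth.const_mul c,
    fun t ht => by simp [h.left t ht], fun t ht => by simp [h.right t ht]⟩

theorem riem_add (h : Sm θ) (h' : Sm ζ) (k e : ℝ) :
    riem k e (θ + ζ) = fun y t => riem k e θ y t + riem k e ζ y t := by
  funext y t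
  have := charD_add h h' k (-e) y t
  simp only [riem]
  rw [show charD k (-e) (θ + ζ) y t = charD k (-e) (fun y t => θ y t + ζ y t) y t from rfl, this]
  simp only [Pi.add_apply]; ring

theorem riem_smul (c : ℝ) (θ : ℝ → ℝ → ℝ) (k e : ℝ) :
    riem k e (c • θ) = fun y t => c * riem k e θ y t := by
  funext y t
  have := charD_const_mul c θ k (-e) y t
  simp only [riem]
  rw [show charD k (-e) (c • θ) y t = charD k (-e) (fun y t => c * θ y t) y t from rfl, this]
  simp only [Pi.smul_apply, smul_eq_mul]; ring

theorem waveAdj_add (h : Sm θ) (h' : Sm ζ) (k y t : ℝ) :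
    waveAdj k (θ + ζ) y t = waveAdj k θ y t + waveAdj k ζ y t := by
  rw [waveAdj, riem_add h h', charD_add (h.riem k 1) (h'.riem k 1), waveAdj, waveAdj]; ring

theorem waveAdj_smul (c : ℝ) (θ : ℝ → ℝ → ℝ) (k y t : ℝ) :
    waveAdj k (c • θ) y t = c * waveAdj k θ y t := by
  rw [waveAdj, riem_smul, charD_const_mul, waveAdj]; ring

theorem dy_add' (h : Sm θ) (h' : Sm ζ) (y t : ℝ) : dy (θ + ζ) y t = dy θ y t + dy ζ y t :=
  h.dy_add h' y t
theorem dt_add' (h : Sm θ) (h' : Sm ζ) (y t : ℝ) : dt (θ + ζ) y t = dt θ y t + dt ζ y t :=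
  h.dt_add h' y t
theorem dy_smul' (c : ℝ) (θ : ℝ → ℝ → ℝ) (y t : ℝ) : dy (c • θ) y t = c * dy θ y t :=
  dy_const_mul c θ y t
theorem dt_smul' (c : ℝ) (θ : ℝ → ℝ → ℝ) (y t : ℝ) : dt (c • θ) y t = c * dt θ y t :=
  dt_const_mul c θ y t

/-- The element of `H¹₀` given by a smooth function vanishing at the end points. -/
def h10c (η : ℝ → ℝ) : H10 := by
  classical exact if h : (l2c η, l2c (deriv η)) ∈ H10 then ⟨_, h⟩ else 0

theorem h10c_val {η : ℝ → ℝ} (hη : ContDiff ℝ ∞ η) (h0 : η 0 = 0) (h1 : η 1 = 0) :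
    (h10c η).1 = (l2c η, l2c (deriv η)) := by
  simp [h10c, mem_H10_of_smooth hη h0 h1]

theorem IsDirichlet.h10c_slice (h : IsDirichlet T θ) {t : ℝ} (ht : t ∈ Icc 0 T) :
    (h10c fun y => θ y t).1 = (l2c fun y => θ y t, l2c fun y => dy θ y t) :=
  h10c_val (h.smooth.slice_fst t) (h.left t ht) (h.right t ht)

theorem IsDirichlet.continuousOn_h10c (h : IsDirichlet T θ) :
    ContinuousOn (fun t => h10c fun y => θ y t) (Icc 0 T) := by
  rw [continuousOn_iff_continuous_domRestrict]
  refine Continuous.congr (f := fun t : Icc 0 T =>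
    (⟨(l2c fun y => θ y t, l2c fun y => dy θ y t), by
      have := h.h10c_slice t.2
      rw [← this]; exact Subtype.mem _⟩ : H10)) ?_ fun t => Subtype.ext (h.h10c_slice t.2).symm
  refine Continuous.subtype_mk ?_ _
  exact ((continuous_l2c_curve h.smooth.continuous).comp continuous_subtype_val).prodMk
    ((continuous_l2c_curve h.smooth.dy.continuous).comp continuous_subtype_val)

/-- The velocity `θ' + [(γ/α) θ]_y`. -/
def velocity (k : ℝ) (θ : ℝ → ℝ → ℝ) (y t : ℝ) : ℝ :=
  dt θ y t + (-2 * k * θ y t + -2 * k * y * dy θ y t) * invAlpha k t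

theorem Sm.velocity (h : Sm θ) (k : ℝ) : Sm (velocity k θ) :=
  h.dt.add (((h.const_mul (-2 * k)).add ((Sm.of_fst (by fun_prop)).mul h.dy)).mul (Sm.invAlpha k))

theorem velocity_add (h : Sm θ) (h' : Sm ζ) (k y t : ℝ) :
    velocity k (θ + ζ) y t = velocity k θ y t + velocity k ζ y t := by
  simp only [velocity, dt_add' h h', dy_add' h h', Pi.add_apply]; ring

theorem velocity_smul (c : ℝ) (θ : ℝ → ℝ → ℝ) (k y t : ℝ) :
    velocity k (c • θ) y t = c * velocity k θ y t := by
  simp only [velocity, dt_smul', dy_smul', Pi.smul_apply, smul_eq_mul]; ring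

/-- The space `L²(0, T; L²(0, 1))`. -/
abbrev L2L2 (T : ℝ) : Type := Lp L2 2 (muTime T)

/-- The class of a bounded continuous curve in `L²(0, T; L²(0, 1))`. -/
def toL2L2 (T : ℝ) : (ℝ →ᵇ L2) →L[ℝ] L2L2 T := BoundedContinuousFunction.toLp 2 (muTime T) ℝ

theorem coeFn_toL2L2 (T : ℝ) (u : ℝ →ᵇ L2) : toL2L2 T u =ᵐ[muTime T] u :=
  BoundedContinuousFunction.coeFn_toLp 2 (muTime T) ℝ u

/-- The curve in `L²` given by a continuous function. -/
def l2Curve (hT : 0 ≤ T) (θ : ℝ → ℝ → ℝ) : ℝ →ᵇ L2 := clampCurve hT fun t => l2c fun y => θ y t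

theorem l2Curve_apply (hT : 0 ≤ T) (h : Sm θ) (t : ℝ) :
    l2Curve hT θ t = l2c fun y => θ y (clamp T t) :=
  clampCurve_apply hT (continuous_l2c_curve h.continuous).continuousOn t

theorem l2Curve_of_mem (hT : 0 ≤ T) (h : Sm θ) {t : ℝ} (ht : t ∈ Icc 0 T) :
    l2Curve hT θ t = l2c fun y => θ y t := by rw [l2Curve_apply hT h, clamp_eq ht]

theorem l2Curve_add (hT : 0 ≤ T) {ξ : ℝ → ℝ → ℝ} (h : Sm θ) (h' : Sm ζ) (hξ : Sm ξ)
    (e : ∀ y t, ξ y t = θ y t + ζ y t) : l2Curve hT ξ = l2Curve hT θ + l2Curve hT ζ := by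
  ext1 t
  rw [BoundedContinuousFunction.add_apply, l2Curve_apply hT h, l2Curve_apply hT h',
    l2Curve_apply hT hξ, ← l2c_add (h.continuous_fst _) (h'.continuous_fst _)]
  simp only [e]

theorem l2Curve_smul (hT : 0 ≤ T) {ξ : ℝ → ℝ → ℝ} (c : ℝ) (h : Sm θ) (hξ : Sm ξ)
    (e : ∀ y t, ξ y t = c * θ y t) : l2Curve hT ξ = c • l2Curve hT θ := by
  ext1 t
  rw [BoundedContinuousFunction.smul_apply, l2Curve_apply hT h,
    l2Curve_apply hT hξ, ← l2c_smul _ (h.continuous_fst _)]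
  simp only [e]

theorem norm_sq_toL2L2 (hT : 0 ≤ T) (h : Sm θ) :
    ‖toL2L2 T (l2Curve hT θ)‖ ^ 2 = ∫ t in (0 : ℝ)..T, ∫ y in (0 : ℝ)..1, θ y t ^ 2 := by
  rw [← real_inner_self_eq_norm_sq, L2.inner_def, ← integral_muTime hT]
  refine integral_congr_ae ?_
  filter_upwards [coeFn_toL2L2 T (l2Curve hT θ), ae_muTime_mem T] with t ht htT
  rw [ht, real_inner_self_eq_norm_sq, l2Curve_of_mem hT h (Ioo_subset_Icc_self htT),
    norm_sq_l2c (h.continuous_fst t)]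

/-- The curve in `H¹₀` of a smooth function vanishing on the lateral boundary. -/
def h10Curve (hT : 0 ≤ T) (θ : ℝ → ℝ → ℝ) : ℝ →ᵇ H10 := clampCurve hT fun t => h10c fun y => θ y t

theorem IsDirichlet.h10Curve_val (hT : 0 ≤ T) (h : IsDirichlet T θ) (t : ℝ) :
    (h10Curve hT θ t).1
      = (l2c fun y => θ y (clamp T t), l2c fun y => dy θ y (clamp T t)) := by
  rw [h10Curve, clampCurve_apply hT h.continuousOn_h10c, h.h10c_slice (clamp_mem hT t)]

/-- Final data and source of a smooth function. -/
def dataMap (k : ℝ) (hT : 0 ≤ T) : dirichlet T →ₗ[ℝ] H10 × L2 × L2L2 T where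
  toFun θ := (h10c fun y => θ.1 y T, l2c fun y => velocity k θ.1 y T,
    toL2L2 T (l2Curve hT (waveAdj k θ.1)))
  map_add' θ ζ := by
    have hθ : IsDirichlet T θ.1 := θ.2
    have hζ : IsDirichlet T ζ.1 := ζ.2
    have hs : IsDirichlet T (θ.1 + ζ.1) := (θ + ζ).2
    have hm : T ∈ Icc 0 T := ⟨hT, le_rfl⟩
    refine Prod.ext ?_ (Prod.ext ?_ ?_)
    · refine Subtype.ext ?_
      have e := l2c_add (hθ.smooth.continuous_fst T) (hζ.smooth.continuous_fst T)
      have e' := l2c_add (hθ.smooth.dy.continuous_fst T) (hζ.smooth.dy.continuous_fst T)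
      refine (hs.h10c_slice hm).trans ?_
      change _ = (h10c fun y => θ.1 y T).1 + (h10c fun y => ζ.1 y T).1
      rw [hθ.h10c_slice hm, hζ.h10c_slice hm]
      simp only [dy_add' hθ.smooth hζ.smooth, Pi.add_apply, e, e']
      rfl
    · have e := l2c_add ((hθ.smooth.velocity k).continuous_fst T)
        ((hζ.smooth.velocity k).continuous_fst T)
      change (l2c fun y => velocity k (θ.1 + ζ.1) y T) = _
      simp only [velocity_add hθ.smooth hζ.smooth]
      exact e
    · change toL2L2 T (l2Curve hT (waveAdj k (θ.1 + ζ.1))) = _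
      rw [l2Curve_add hT (hθ.smooth.waveAdj k) (hζ.smooth.waveAdj k) (hs.smooth.waveAdj k)
        fun y t => waveAdj_add hθ.smooth hζ.smooth k y t, map_add]
      rfl
  map_smul' c θ := by
    have hθ : IsDirichlet T θ.1 := θ.2
    have hs : IsDirichlet T (c • θ.1) := (c • θ).2
    have hm : T ∈ Icc 0 T := ⟨hT, le_rfl⟩
    refine Prod.ext ?_ (Prod.ext ?_ ?_)
    · refine Subtype.ext ?_
      have e := l2c_smul c (hθ.smooth.continuous_fst T)
      have e' := l2c_smul c (hθ.smooth.dy.continuous_fst T)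
      refine (hs.h10c_slice hm).trans ?_
      change _ = c • (h10c fun y => θ.1 y T).1
      rw [hθ.h10c_slice hm]
      simp only [dy_smul', Pi.smul_apply, smul_eq_mul, e, e']
      rfl
    · have e := l2c_smul c ((hθ.smooth.velocity k).continuous_fst T)
      change (l2c fun y => velocity k (c • θ.1) y T) = _
      simp only [velocity_smul]
      exact e
    · change toL2L2 T (l2Curve hT (waveAdj k (c • θ.1))) = _
      rw [l2Curve_smul hT c (hθ.smooth.waveAdj k) (hs.smooth.waveAdj k)
        fun y t => waveAdj_smul c θ.1 k y t, map_smul]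
      rfl

theorem Sm.continuous_trace (h : Sm θ) (k : ℝ) :
    Continuous fun t => StringControl.invAlpha k t ^ 2 * StringControl.dy θ 0 t :=
  ((contDiff_invAlpha k).continuous.pow 2).mul (h.dy.continuous_snd 0)

/-- The solution, its time derivative, and the trace `θ_y(0, ·) / α²`. -/
def solMap (k : ℝ) (hT : 0 ≤ T) :
    dirichlet T →ₗ[ℝ] (ℝ →ᵇ H10) × (ℝ →ᵇ L2) × Lp ℝ 2 (muTime T) where
  toFun θ := (h10Curve hT θ.1, l2Curve hT (dt θ.1), lpc T fun t => invAlpha k t ^ 2 * dy θ.1 0 t)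
  map_add' θ ζ := by
    have hθ : IsDirichlet T θ.1 := θ.2
    have hζ : IsDirichlet T ζ.1 := ζ.2
    have hs : IsDirichlet T (θ.1 + ζ.1) := (θ + ζ).2
    refine Prod.ext ?_ (Prod.ext ?_ ?_)
    · ext1 t
      refine Subtype.ext ?_
      have e := l2c_add (hθ.smooth.continuous_fst (clamp T t)) (hζ.smooth.continuous_fst (clamp T t))
      have e' := l2c_add (hθ.smooth.dy.continuous_fst (clamp T t))
        (hζ.smooth.dy.continuous_fst (clamp T t))
      refine (hs.h10Curve_val hT t).trans ?_
      change _ = (h10Curve hT θ.1 t).1 + (h10Curve hT ζ.1 t).1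
      rw [hθ.h10Curve_val hT t, hζ.h10Curve_val hT t]
      simp only [dy_add' hθ.smooth hζ.smooth, Pi.add_apply, e, e']
      rfl
    · exact l2Curve_add hT hθ.smooth.dt hζ.smooth.dt hs.smooth.dt
        fun y t => dt_add' hθ.smooth hζ.smooth y t
    · have e := lpc_add (T := T) (hθ.smooth.continuous_trace k) (hζ.smooth.continuous_trace k)
      change lpc T (fun t => invAlpha k t ^ 2 * dy (θ.1 + ζ.1) 0 t) = _
      simp only [dy_add' hθ.smooth hζ.smooth, mul_add]
      exact e
  map_smul' c θ := by
    have hθ : IsDirichlet T θ.1 := θ.2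
    have hs : IsDirichlet T (c • θ.1) := (c • θ).2
    refine Prod.ext ?_ (Prod.ext ?_ ?_)
    · ext1 t
      refine Subtype.ext ?_
      have e := l2c_smul c (hθ.smooth.continuous_fst (clamp T t))
      have e' := l2c_smul c (hθ.smooth.dy.continuous_fst (clamp T t))
      refine (hs.h10Curve_val hT t).trans ?_
      change _ = c • (h10Curve hT θ.1 t).1
      rw [hθ.h10Curve_val hT t]
      simp only [dy_smul', Pi.smul_apply, smul_eq_mul, e, e']
      rfl
    · exact l2Curve_smul hT c hθ.smooth.dt hs.smooth.dt fun y t => dt_smul' c θ.1 y t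
    · have e := lpc_smul (T := T) c (hθ.smooth.continuous_trace k)
      change lpc T (fun t => invAlpha k t ^ 2 * dy (c • θ.1) 0 t) = _
      simp only [dy_smul', mul_left_comm _ c]
      exact e

/-! ### Bounds in terms of the data -/

theorem integral_sq_le_integral_dy_sq (h : IsDirichlet T θ) {t : ℝ} (ht : t ∈ Icc 0 T) :
    ∫ y in (0 : ℝ)..1, θ y t ^ 2 ≤ ∫ y in (0 : ℝ)..1, dy θ y t ^ 2 := by
  have h1 := norm_h10Val_le (h10c fun y => θ y t)
  rw [h10Val, h10Deriv, h.h10c_slice ht] at h1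
  have h2 := pow_le_pow_left₀ (norm_nonneg _) h1 2
  rwa [norm_sq_l2c (h.smooth.continuous_fst t), norm_sq_l2c (h.smooth.dy.continuous_fst t)] at h2

theorem integral_dy_sq_le (h : Sm θ) (k t : ℝ) :
    ∫ y in (0 : ℝ)..1, dy θ y t ^ 2 ≤ riemEnergy k θ t := by
  refine intervalIntegral.integral_mono_on zero_le_one
    (((h.dy.pow 2).continuous_fst t).intervalIntegrable _ _)
    (((h.riemSq k).continuous_fst t).intervalIntegrable _ _) fun y _ => ?_
  rw [dy_eq_riem_sub k]
  nlinarith [sq_nonneg (riem k (-1) θ y t + riem k 1 θ y t), sq_nonneg (riem k (-1) θ y t),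
    sq_nonneg (riem k 1 θ y t)]

/-- A bound of the square of a combination of `f`, `θ` and `θ_y`. -/
theorem integral_sq_comb_le (h : IsDirichlet T θ) {t : ℝ} (ht : t ∈ Icc 0 T) {f g : ℝ → ℝ}
    (hf : Continuous f) (hg : Continuous g)
    (hle : ∀ y ∈ Icc (0 : ℝ) 1, |g y| ≤ |f y| + |θ y t| + 2 * |dy θ y t|) :
    ∫ y in (0 : ℝ)..1, g y ^ 2
      ≤ 3 * (∫ y in (0 : ℝ)..1, f y ^ 2) + 15 * ∫ y in (0 : ℝ)..1, dy θ y t ^ 2 := by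
  have c0 := (h.smooth.pow 2).continuous_fst t
  have c1 := (h.smooth.dy.pow 2).continuous_fst t
  have h1 : ∫ y in (0 : ℝ)..1, g y ^ 2
      ≤ ∫ y in (0 : ℝ)..1, (3 * f y ^ 2 + 3 * θ y t ^ 2 + 12 * dy θ y t ^ 2) := by
    refine intervalIntegral.integral_mono_on zero_le_one ((hg.pow 2).intervalIntegrable _ _)
      ((((hf.pow 2).const_mul 3).add (c0.const_mul 3)).add (c1.const_mul 12) |>.intervalIntegrable
        _ _) fun y hy => ?_
    have := hle y hy
    have h2 : g y ^ 2 ≤ (|f y| + |θ y t| + 2 * |dy θ y t|) ^ 2 := by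
      rw [← sq_abs (g y)]; exact pow_le_pow_left₀ (abs_nonneg _) this 2
    rw [← sq_abs (f y), ← sq_abs (θ y t), ← sq_abs (dy θ y t)]
    nlinarith [sq_nonneg (|f y| - |θ y t|), sq_nonneg (|f y| - 2 * |dy θ y t|),
      sq_nonneg (|θ y t| - 2 * |dy θ y t|)]
  have i1 : Continuous fun y => 3 * f y ^ 2 := by fun_prop
  have i2 : Continuous fun y => 3 * θ y t ^ 2 := c0.const_mul 3
  have i3 : Continuous fun y => 12 * dy θ y t ^ 2 := c1.const_mul 12
  have i4 : Continuous fun y => 3 * f y ^ 2 + 3 * θ y t ^ 2 := i1.add i2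
  rw [intervalIntegral.integral_add (i4.intervalIntegrable _ _) (i3.intervalIntegrable _ _),
    intervalIntegral.integral_add (i1.intervalIntegrable _ _) (i2.intervalIntegrable _ _),
    intervalIntegral.integral_const_mul, intervalIntegral.integral_const_mul,
    intervalIntegral.integral_const_mul] at h1
  linarith [integral_sq_le_integral_dy_sq h ht]

theorem integral_dt_sq_le (h : IsDirichlet T θ) (hk : 0 < k) (hk1 : k < 1) {t : ℝ}
    (ht : t ∈ Icc 0 T) : ∫ y in (0 : ℝ)..1, dt θ y t ^ 2 ≤ 18 * riemEnergy k θ t := by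
  have hu := (h.smooth.riem k 1)
  refine (integral_sq_comb_le h ht (hu.continuous_fst t) (h.smooth.dt.continuous_fst t)
    fun y hy => ?_).trans ?_
  · have h1 : alpha k t * dt θ y t = riem k 1 θ y t + k * θ y t + (1 + k * y) * dy θ y t := by
      simp only [riem, charD]; ring
    have h2 : |dt θ y t| ≤ |alpha k t * dt θ y t| := by
      rw [abs_mul, abs_of_pos (alpha_pos hk ht.1)]
      exact le_mul_of_one_le_left (abs_nonneg _) (one_le_alpha hk ht.1)
    rw [h1] at h2
    refine h2.trans ((abs_add_three _ _ _).trans ?_)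
    rw [abs_mul, abs_mul, abs_of_pos hk]
    have h3 : |1 + k * y| ≤ 2 := by
      have := mul_nonneg hk.le hy.1
      rw [abs_of_nonneg (by linarith)]; nlinarith [hy.2]
    have := mul_le_mul_of_nonneg_right hk1.le (abs_nonneg (θ y t))
    have := mul_le_mul_of_nonneg_right h3 (abs_nonneg (dy θ y t))
    linarith
  · have h1 := integral_dy_sq_le h.smooth k t
    have h2 : ∫ y in (0 : ℝ)..1, riem k 1 θ y t ^ 2 ≤ riemEnergy k θ t :=
      intervalIntegral.integral_mono_on zero_le_one
        (((hu.pow 2).continuous_fst t).intervalIntegrable _ _)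
        (((h.smooth.riemSq k).continuous_fst t).intervalIntegrable _ _)
        fun y _ => le_add_of_nonneg_right (sq_nonneg _)
    linarith

theorem alpha_mul_velocity (hk : 0 < k) {t : ℝ} (ht : 0 ≤ t) (θ : ℝ → ℝ → ℝ) (y : ℝ) :
    alpha k t * velocity k θ y t
      = alpha k t * dt θ y t - 2 * k * θ y t - 2 * k * y * dy θ y t := by
  rw [velocity]
  linear_combination (-2 * k * θ y t - 2 * k * y * dy θ y t) * alpha_mul_invAlpha hk ht

theorem riem_eq_velocity (hk : 0 < k) {t : ℝ} (ht : 0 ≤ t) (e : ℝ) (θ : ℝ → ℝ → ℝ) (y : ℝ) :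
    riem k e θ y t = alpha k t * velocity k θ y t + k * θ y t + (k * y - e) * dy θ y t := by
  rw [alpha_mul_velocity hk ht, riem, charD]; ring

theorem riemEnergy_le_data (h : IsDirichlet T θ) (hk : 0 < k) (hk1 : k < 1) (hT : 0 ≤ T) :
    riemEnergy k θ T ≤ 6 * alpha k T ^ 2 * (∫ y in (0 : ℝ)..1, velocity k θ y T ^ 2)
      + 30 * ∫ y in (0 : ℝ)..1, dy θ y T ^ 2 := by
  have hm : T ∈ Icc 0 T := ⟨hT, le_rfl⟩
  have hv : Continuous fun y => alpha k T * velocity k θ y T :=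
    ((h.smooth.velocity k).continuous_fst T).const_mul _
  have key : ∀ e : ℝ, (e = 1 ∨ e = -1) → ∫ y in (0 : ℝ)..1, riem k e θ y T ^ 2
      ≤ 3 * (∫ y in (0 : ℝ)..1, (alpha k T * velocity k θ y T) ^ 2)
        + 15 * ∫ y in (0 : ℝ)..1, dy θ y T ^ 2 := by
    intro e he
    refine integral_sq_comb_le h hm hv ((h.smooth.riem k e).continuous_fst T) fun y hy => ?_
    rw [riem_eq_velocity hk hT]
    refine (abs_add_three _ _ _).trans ?_
    have h3 : |k * y - e| ≤ 2 := by
      have := mul_nonneg hk.le hy.1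
      have : k * y ≤ k := mul_le_of_le_one_right hk.le hy.2
      rcases he with rfl | rfl <;> rw [abs_le] <;> constructor <;> linarith
    rw [abs_mul k, abs_mul (k * y - e), abs_of_pos hk]
    have := mul_le_mul_of_nonneg_right hk1.le (abs_nonneg (θ y T))
    have := mul_le_mul_of_nonneg_right h3 (abs_nonneg (dy θ y T))
    linarith
  have k1 := key 1 (Or.inl rfl)
  have k2 := key (-1) (Or.inr rfl)
  rw [riemEnergy, intervalIntegral.integral_add
    ((((h.smooth.riem k 1).pow 2).continuous_fst T).intervalIntegrable _ _)
    ((((h.smooth.riem k (-1)).pow 2).continuous_fst T).intervalIntegrable _ _)]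
  have e : ∫ y in (0 : ℝ)..1, (alpha k T * velocity k θ y T) ^ 2
      = alpha k T ^ 2 * ∫ y in (0 : ℝ)..1, velocity k θ y T ^ 2 := by
    rw [← intervalIntegral.integral_const_mul]; simp only [mul_pow]
  rw [e] at k1 k2
  linarith

theorem integral_velocity_sq_le (h : IsDirichlet T θ) (hk : 0 < k) (hk1 : k < 1) (hT : 0 ≤ T) :
    ∫ y in (0 : ℝ)..1, velocity k θ y T ^ 2 ≤ 18 * riemEnergy k θ T := by
  have hm : T ∈ Icc 0 T := ⟨hT, le_rfl⟩
  have hu := (h.smooth.riem k 1)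
  refine (integral_sq_comb_le h hm (hu.continuous_fst T) ((h.smooth.velocity k).continuous_fst T)
    fun y hy => ?_).trans ?_
  · have h1 : alpha k T * velocity k θ y T
        = riem k 1 θ y T + -(k * θ y T) + (1 - k * y) * dy θ y T := by
      rw [riem_eq_velocity hk hT]; ring
    have h2 : |velocity k θ y T| ≤ |alpha k T * velocity k θ y T| := by
      rw [abs_mul, abs_of_pos (alpha_pos hk hT)]
      exact le_mul_of_one_le_left (abs_nonneg _) (one_le_alpha hk hT)
    rw [h1] at h2
    refine h2.trans ((abs_add_three _ _ _).trans ?_)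
    rw [abs_neg, abs_mul, abs_mul, abs_of_pos hk]
    have h3 : |1 - k * y| ≤ 2 := by
      have := mul_nonneg hk.le hy.1
      have : k * y ≤ k := mul_le_of_le_one_right hk.le hy.2
      rw [abs_le]; constructor <;> linarith
    have := mul_le_mul_of_nonneg_right hk1.le (abs_nonneg (θ y T))
    have := mul_le_mul_of_nonneg_right h3 (abs_nonneg (dy θ y T))
    linarith
  · have h1 := integral_dy_sq_le h.smooth k T
    have h2 : ∫ y in (0 : ℝ)..1, riem k 1 θ y T ^ 2 ≤ riemEnergy k θ T :=
      intervalIntegral.integral_mono_on zero_le_one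
        (((hu.pow 2).continuous_fst T).intervalIntegrable _ _)
        (((h.smooth.riemSq k).continuous_fst T).intervalIntegrable _ _)
        fun y _ => le_add_of_nonneg_right (sq_nonneg _)
    linarith

theorem norm_sq_h10c (h : IsDirichlet T θ) {t : ℝ} (ht : t ∈ Icc 0 T) :
    ‖h10c fun y => θ y t‖ ^ 2 = ∫ y in (0 : ℝ)..1, dy θ y t ^ 2 := by
  rw [norm_H10_eq, h10Deriv, h.h10c_slice ht, norm_sq_l2c (h.smooth.dy.continuous_fst t)]

/-- The total energy is controlled by the norm of the data. -/
theorem exists_energy_le_dataMap (hk : 0 < k) (hk1 : k < 1) (hT : 0 < T) :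
    ∃ C : ℝ, 0 < C ∧ ∀ θ : dirichlet T,
      riemEnergy k θ.1 T + sourceEnergy k T θ.1 ≤ (C * ‖dataMap k hT.le θ‖) ^ 2 := by
  refine ⟨6 * alpha k T + 6, by have := alpha_pos hk hT.le; positivity, fun θ => ?_⟩
  have hθ : IsDirichlet T θ.1 := θ.2
  have h1 := riemEnergy_le_data hθ hk hk1 hT.le
  have d1 : ‖h10c fun y => θ.1 y T‖ ≤ ‖dataMap k hT.le θ‖ := norm_fst_le (dataMap k hT.le θ)
  have d23 : ‖(dataMap k hT.le θ).2‖ ≤ ‖dataMap k hT.le θ‖ := norm_snd_le (dataMap k hT.le θ)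
  have d2 : ‖l2c fun y => velocity k θ.1 y T‖ ≤ ‖dataMap k hT.le θ‖ :=
    (norm_fst_le (dataMap k hT.le θ).2).trans d23
  have d3 : ‖toL2L2 T (l2Curve hT.le (waveAdj k θ.1))‖ ≤ ‖dataMap k hT.le θ‖ :=
    (norm_snd_le (dataMap k hT.le θ).2).trans d23
  have s1 := pow_le_pow_left₀ (norm_nonneg _) d1 2
  have s2 := pow_le_pow_left₀ (norm_nonneg _) d2 2
  have s3 := pow_le_pow_left₀ (norm_nonneg _) d3 2
  rw [norm_sq_h10c hθ ⟨hT.le, le_rfl⟩] at s1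
  rw [norm_sq_l2c ((hθ.smooth.velocity k).continuous_fst T)] at s2
  rw [norm_sq_toL2L2 hT.le (hθ.smooth.waveAdj k)] at s3
  have ha := alpha_pos hk hT.le
  have s2' := mul_le_mul_of_nonneg_left s2 (by positivity : 0 ≤ 6 * alpha k T ^ 2)
  rw [sourceEnergy, mul_pow]
  nlinarith [sq_nonneg ‖dataMap k hT.le θ‖, mul_nonneg ha.le (sq_nonneg ‖dataMap k hT.le θ‖)]

/-- This continuity, with the density of the data, lets the solution operators extend from smooth
functions to all data. -/
theorem exists_solMap_bound (hk : 0 < k) (hk1 : k < 1) (hT : 0 < T) :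
    ∃ C : ℝ, ∀ θ : dirichlet T, ‖solMap k hT.le θ‖ ≤ C * ‖dataMap k hT.le θ‖ := by
  obtain ⟨C₁, h₁, hC₁⟩ := exists_energy_bound hk hk1 hT
  obtain ⟨C₂, h₂, hC₂⟩ := exists_trace_bound hk hk1 hT
  obtain ⟨C₃, h₃, hC₃⟩ := exists_energy_le_dataMap hk hk1 hT
  -- The 18 comes from `integral_dt_sq_le`. With A = 18C₁ + C₂, the added 1 serves to pass from x² ≤
  -- A D² to x ≤ (A + 1) D without a square root.
  refine ⟨(18 * C₁ + C₂ + 1) * C₃, fun θ => ?_⟩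
  have hθ : IsDirichlet T θ.1 := θ.2
  set E := riemEnergy k θ.1 T + sourceEnergy k T θ.1
  have hE : 0 ≤ E := add_nonneg (riemEnergy_nonneg _ _ _) (sourceEnergy_nonneg _ hT.le _)
  have hD := hC₃ θ
  set D := C₃ * ‖dataMap k hT.le θ‖ with hDdef
  have hD0 : 0 ≤ D := by positivity
  have key : ∀ x : ℝ, 0 ≤ x → x ^ 2 ≤ (18 * C₁ + C₂) * E → x ≤ (18 * C₁ + C₂ + 1) * D := by
    intro x hx hxs
    refine abs_le_of_sq_le_sq' ?_ (by positivity) |>.2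
    calc x ^ 2 ≤ (18 * C₁ + C₂) * D ^ 2 := hxs.trans (mul_le_mul_of_nonneg_left hD (by positivity))
      _ ≤ (18 * C₁ + C₂ + 1) ^ 2 * D ^ 2 := by
          refine mul_le_mul_of_nonneg_right ?_ (sq_nonneg _)
          nlinarith
      _ = _ := by ring
  rw [mul_assoc, ← hDdef]
  have b1 : ‖h10Curve hT.le θ.1‖ ≤ (18 * C₁ + C₂ + 1) * D := by
    refine norm_clampCurve_le hT.le hθ.continuousOn_h10c fun t ht => key _ (norm_nonneg _) ?_
    rw [norm_sq_h10c hθ ht]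
    refine (integral_dy_sq_le hθ.smooth k t).trans ((hC₁ θ.1 hθ t ht).trans ?_)
    exact mul_le_mul_of_nonneg_right (by linarith) hE
  have b2 : ‖l2Curve hT.le (dt θ.1)‖ ≤ (18 * C₁ + C₂ + 1) * D := by
    refine norm_clampCurve_le hT.le (continuous_l2c_curve hθ.smooth.dt.continuous).continuousOn
      fun t ht => key _ (norm_nonneg _) ?_
    rw [norm_sq_l2c (hθ.smooth.dt.continuous_fst t)]
    refine (integral_dt_sq_le hθ hk hk1 ht).trans ?_
    have := hC₁ θ.1 hθ t ht
    nlinarith [mul_nonneg h₂.le hE]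
  have b3 : ‖lpc T fun t => invAlpha k t ^ 2 * dy θ.1 0 t‖ ≤ (18 * C₁ + C₂ + 1) * D := by
    refine key _ (norm_nonneg _) ?_
    rw [norm_sq_lpc hT.le (hθ.smooth.continuous_trace k)]
    refine le_trans (b := ∫ t in (0 : ℝ)..T, dy θ.1 0 t ^ 2) ?_ ?_
    · refine intervalIntegral.integral_mono_on hT.le
        (((hθ.smooth.continuous_trace k).pow 2).intervalIntegrable _ _)
        (((hθ.smooth.dy.pow 2).continuous_snd 0).intervalIntegrable _ _) fun t ht => ?_
      rw [mul_pow, ← pow_mul]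
      exact mul_le_of_le_one_left (sq_nonneg _)
        (pow_le_one₀ (invAlpha_pos hk ht.1).le (invAlpha_le_one hk ht.1))
    · refine (hC₂ θ.1 hθ 0 (by constructor <;> norm_num)).trans ?_
      exact mul_le_mul_of_nonneg_right (by linarith) hE
  exact norm_prod_le_iff.2 ⟨b1, norm_prod_le_iff.2 ⟨b2, b3⟩⟩

/-- Averages of the derivative near `y = 0` are controlled by the data. -/
theorem exists_average_bound (hk : 0 < k) (hk1 : k < 1) (hT : 0 < T) :
    ∃ C : ℝ, 0 < C ∧ ∀ θ : dirichlet T, ∀ ε ∈ Ioc (0 : ℝ) (1 / 2),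
      ∫ t in (0 : ℝ)..T, (ε⁻¹ * ∫ y in (0 : ℝ)..ε, dy θ.1 y t) ^ 2
        ≤ (C * ‖dataMap k hT.le θ‖) ^ 2 := by
  obtain ⟨C₂, h₂, hC₂⟩ := exists_trace_bound hk hk1 hT
  obtain ⟨C₃, h₃, hC₃⟩ := exists_energy_le_dataMap hk hk1 hT
  refine ⟨(C₂ + 1) * C₃, by positivity, fun θ ε hε => ?_⟩
  have hθ : IsDirichlet T θ.1 := θ.2
  have hd := hθ.smooth.dy
  set E := riemEnergy k θ.1 T + sourceEnergy k T θ.1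
  -- The square of a mean is at most the mean of the squares. After exchanging the integrals there
  -- remains a mean over y in (0, ε) of slice integrals, each controlled by the trace bound as long
  -- as ε ≤ 1/2.
  have h1 : ∫ t in (0 : ℝ)..T, (ε⁻¹ * ∫ y in (0 : ℝ)..ε, dy θ.1 y t) ^ 2
      ≤ ∫ t in (0 : ℝ)..T, ε⁻¹ * ∫ y in (0 : ℝ)..ε, dy θ.1 y t ^ 2 := by
    refine intervalIntegral.integral_mono_on hT.le
      ((((hd.continuous_integral 0 ε).const_mul _).pow 2).intervalIntegrable _ _)
      ((((hd.pow 2).continuous_integral 0 ε).const_mul _).intervalIntegrable _ _) fun t _ => ?_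
    have := sq_intervalIntegral_le (hd.continuous_fst t) hε.1.le
    rw [sub_zero] at this
    calc (ε⁻¹ * ∫ y in (0 : ℝ)..ε, dy θ.1 y t) ^ 2
        = ε⁻¹ ^ 2 * (∫ y in (0 : ℝ)..ε, dy θ.1 y t) ^ 2 := by ring
      _ ≤ ε⁻¹ ^ 2 * (ε * ∫ y in (0 : ℝ)..ε, dy θ.1 y t ^ 2) :=
          mul_le_mul_of_nonneg_left this (by positivity)
      _ = _ := by have := hε.1.ne'; field_simp
  have h2 : ∫ t in (0 : ℝ)..T, ∫ y in (0 : ℝ)..ε, dy θ.1 y t ^ 2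
      = ∫ y in (0 : ℝ)..ε, ∫ t in (0 : ℝ)..T, dy θ.1 y t ^ 2 := by
    refine MeasureTheory.intervalIntegral_intervalIntegral_swap ?_
    have hcont : Continuous (Function.uncurry fun t y => dy θ.1 y t ^ 2) :=
      (hd.pow 2).continuous.comp continuous_swap
    exact (hcont.continuousOn.integrableOn_compact (isCompact_uIcc.prod isCompact_uIcc)).mono_set
      (prod_mono uIoc_subset_uIcc uIoc_subset_uIcc)
  have h3 : ∫ y in (0 : ℝ)..ε, ∫ t in (0 : ℝ)..T, dy θ.1 y t ^ 2 ≤ ε * (C₂ * E) := by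
    have hc : Continuous fun y => ∫ t in (0 : ℝ)..T, dy θ.1 y t ^ 2 :=
      intervalIntegral.continuous_parametric_intervalIntegral_of_continuous'
        (f := fun y t => dy θ.1 y t ^ 2) (hd.pow 2).continuous _ _
    calc ∫ y in (0 : ℝ)..ε, ∫ t in (0 : ℝ)..T, dy θ.1 y t ^ 2
        ≤ ∫ _ in (0 : ℝ)..ε, C₂ * E := intervalIntegral.integral_mono_on hε.1.le
          (hc.intervalIntegrable _ _) (by simp)
          fun y hy => hC₂ θ.1 hθ y ⟨hy.1, hy.2.trans hε.2⟩
      _ = ε * (C₂ * E) := by rw [intervalIntegral.integral_const, sub_zero, smul_eq_mul]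
  refine h1.trans ?_
  rw [intervalIntegral.integral_const_mul, h2]
  calc ε⁻¹ * ∫ y in (0 : ℝ)..ε, ∫ t in (0 : ℝ)..T, dy θ.1 y t ^ 2
      ≤ ε⁻¹ * (ε * (C₂ * E)) := mul_le_mul_of_nonneg_left h3 (inv_nonneg.2 hε.1.le)
    _ = C₂ * E := by have := hε.1.ne'; field_simp
    _ ≤ (C₂ + 1) ^ 2 * (C₃ * ‖dataMap k hT.le θ‖) ^ 2 := by
        have := hC₃ θ
        have h5 := sq_nonneg (C₃ * ‖dataMap k hT.le θ‖)
        calc C₂ * E ≤ C₂ * (C₃ * ‖dataMap k hT.le θ‖) ^ 2 := mul_le_mul_of_nonneg_left this h₂.le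
          _ ≤ _ := mul_le_mul_of_nonneg_right (by nlinarith) h5
    _ = _ := by ring

/-- The final data are controlled by the trace and the source. -/
theorem exists_data_le_trace (hk : 0 < k) (hk1 : k < 1) (hT : 2 / (1 - k) < T) (hT0 : 0 < T) :
    ∃ C : ℝ, 0 < C ∧ ∀ θ : dirichlet T,
      ‖(dataMap k hT0.le θ).1‖ + ‖(dataMap k hT0.le θ).2.1‖
        ≤ C * (‖(solMap k hT0.le θ).2.2‖ + ‖(dataMap k hT0.le θ).2.2‖) := by
  obtain ⟨C, hC0, hC⟩ := exists_observability hk hk1 hT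
  set a := alpha k T
  have ha : 1 ≤ a := one_le_alpha hk hT0.le
  refine ⟨2 * (18 * C * a ^ 4 + 1), by positivity, fun θ => ?_⟩
  have hθ : IsDirichlet T θ.1 := θ.2
  have hm : T ∈ Icc 0 T := ⟨hT0.le, le_rfl⟩
  set c := ‖(solMap k hT0.le θ).2.2‖ with hc
  set S := ‖(dataMap k hT0.le θ).2.2‖ with hS
  have hc2 : c ^ 2 = ∫ t in (0 : ℝ)..T, (invAlpha k t ^ 2 * dy θ.1 0 t) ^ 2 :=
    norm_sq_lpc hT0.le (hθ.smooth.continuous_trace k)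
  have hS2 : S ^ 2 = sourceEnergy k T θ.1 := norm_sq_toL2L2 hT0.le (hθ.smooth.waveAdj k)
  have hY : ∫ t in (0 : ℝ)..T, dy θ.1 0 t ^ 2 ≤ a ^ 4 * c ^ 2 := by
    rw [hc2, ← intervalIntegral.integral_const_mul]
    refine intervalIntegral.integral_mono_on hT0.le
      (((hθ.smooth.dy.pow 2).continuous_snd 0).intervalIntegrable _ _)
      ((((hθ.smooth.continuous_trace k).pow 2).const_mul _).intervalIntegrable _ _) fun t ht => ?_
    have h1 : 1 ≤ a * invAlpha k t := by
      rw [← alpha_mul_invAlpha hk ht.1]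
      exact mul_le_mul_of_nonneg_right (alpha_mono hk ht.2) (invAlpha_pos hk ht.1).le
    calc dy θ.1 0 t ^ 2 ≤ (a * invAlpha k t) ^ 4 * dy θ.1 0 t ^ 2 :=
          le_mul_of_one_le_left (sq_nonneg _) (one_le_pow₀ h1)
      _ = _ := by ring
  have hN := hC θ.1 hθ
  rw [← hS2] at hN
  have hc0 : 0 ≤ c := norm_nonneg _
  have hS0 : 0 ≤ S := norm_nonneg _
  have ha4 : 1 ≤ a ^ 4 := one_le_pow₀ ha
  have hNle : 18 * riemEnergy k θ.1 T ≤ (18 * C * a ^ 4) * (c + S) ^ 2 := by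
    have h1 : C * ((∫ t in (0 : ℝ)..T, dy θ.1 0 t ^ 2) + S ^ 2) ≤ C * (a ^ 4 * (c + S) ^ 2) := by
      refine mul_le_mul_of_nonneg_left ?_ hC0.le
      nlinarith [mul_nonneg hc0 hS0, sq_nonneg S]
    nlinarith
  have key : ∀ x : ℝ, x ^ 2 ≤ 18 * riemEnergy k θ.1 T → x ≤ (18 * C * a ^ 4 + 1) * (c + S) := by
    intro x hx
    refine abs_le_of_sq_le_sq' ?_ (by positivity) |>.2
    refine (hx.trans hNle).trans ?_
    rw [mul_pow]
    refine mul_le_mul_of_nonneg_right ?_ (sq_nonneg _)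
    have : 0 ≤ 18 * C * a ^ 4 := by positivity
    nlinarith
  have hN0 := riemEnergy_nonneg k θ.1 T
  have k1 := key ‖(dataMap k hT0.le θ).1‖ (by
    change ‖h10c fun y => θ.1 y T‖ ^ 2 ≤ _
    rw [norm_sq_h10c hθ hm]
    linarith [integral_dy_sq_le hθ.smooth k T])
  have k2 := key ‖(dataMap k hT0.le θ).2.1‖ (by
    change ‖l2c fun y => velocity k θ.1 y T‖ ^ 2 ≤ _
    rw [norm_sq_l2c ((hθ.smooth.velocity k).continuous_fst T)]
    exact integral_velocity_sq_le hθ hk hk1 hT0.le)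
  linarith

end

/-! ### Products of functions of the characteristic coordinates are total -/

section

variable {k T : ℝ} {V : ℝ → L2} {F G : ℝ → ℝ → ℝ}

theorem integrable_inner_of_memLp {μ : Measure ℝ} {V W : ℝ → L2} (hV : MemLp V 2 μ)
    (hW : MemLp W 2 μ) : Integrable (fun t => inner ℝ (V t) (W t)) μ := by
  refine (L2.integrable_inner (𝕜 := ℝ) (hV.toLp V) (hW.toLp W)).congr ?_
  filter_upwards [hV.coeFn_toLp, hW.coeFn_toLp] with t h1 h2
  rw [h1, h2]

/-- The integral over `Q` of `V` against a continuous function. -/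
def pairQ (T : ℝ) (V : ℝ → L2) (F : ℝ → ℝ → ℝ) : ℝ :=
  ∫ t in Ioo 0 T, inner ℝ (V t) (l2c fun y => F y t)

theorem integrable_pairQ (hV : MemLp V 2 (muTime T)) (hF : Continuous fun z : ℝ × ℝ => F z.1 z.2) :
    Integrable (fun t => inner ℝ (V t) (l2c fun y => F y t)) (muTime T) :=
  integrable_inner_of_memLp hV (memLp_of_continuous (continuous_l2c_curve hF) 2)

theorem continuous_slice (hF : Continuous fun z : ℝ × ℝ => F z.1 z.2) (t : ℝ) :
    Continuous fun y => F y t := hF.comp (continuous_id.prodMk continuous_const)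

theorem pairQ_add (hV : MemLp V 2 (muTime T)) (hF : Continuous fun z : ℝ × ℝ => F z.1 z.2)
    (hG : Continuous fun z : ℝ × ℝ => G z.1 z.2) :
    pairQ T V (fun y t => F y t + G y t) = pairQ T V F + pairQ T V G := by
  rw [pairQ, pairQ, pairQ, ← integral_add (integrable_pairQ hV hF) (integrable_pairQ hV hG)]
  refine integral_congr_ae (Eventually.of_forall fun t => ?_)
  simp only
  rw [l2c_add (continuous_slice hF t) (continuous_slice hG t), inner_add_right]

theorem pairQ_const_mul (c : ℝ) (hF : Continuous fun z : ℝ × ℝ => F z.1 z.2) :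
    pairQ T V (fun y t => c * F y t) = c * pairQ T V F := by
  rw [pairQ, pairQ, ← integral_const_mul]
  refine integral_congr_ae (Eventually.of_forall fun t => ?_)
  simp only
  rw [l2c_smul c (continuous_slice hF t), inner_smul_right]

theorem pairQ_sum (hV : MemLp V 2 (muTime T)) {ι : Type*} (s : Finset ι) {F : ι → ℝ → ℝ → ℝ}
    (hF : ∀ i, Continuous fun z : ℝ × ℝ => F i z.1 z.2) :
    pairQ T V (fun y t => ∑ i ∈ s, F i y t) = ∑ i ∈ s, pairQ T V (F i) := by
  classical
  induction s using Finset.induction_on with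
  | empty =>
    have := pairQ_const_mul (T := T) (V := V) (F := fun _ _ => 0) 0 continuous_const
    simpa using this
  | insert i s hi ih =>
    simp only [Finset.sum_insert hi]
    rw [pairQ_add hV (hF i) (by fun_prop), ih]

theorem abs_pairQ_le (hV : MemLp V 2 (muTime T)) (hF : Continuous fun z : ℝ × ℝ => F z.1 z.2)
    {ε : ℝ} (hε : 0 ≤ ε) (h : ∀ y ∈ Icc (0 : ℝ) 1, ∀ t ∈ Ioo 0 T, |F y t| ≤ ε) :
    |pairQ T V F| ≤ (∫ t in Ioo 0 T, ‖V t‖) * ε := by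
  have hV1 : Integrable V (muTime T) := hV.integrable (by norm_num)
  rw [pairQ, ← integral_mul_const, ← Real.norm_eq_abs]
  refine norm_integral_le_of_norm_le (hV1.norm.mul_const ε) ?_
  filter_upwards [ae_muTime_mem T] with t ht
  exact (norm_inner_le_norm _ _).trans (mul_le_mul_of_nonneg_left
    (norm_l2c_le (continuous_slice hF t) hε fun y hy => h y hy t ht) (norm_nonneg _))

theorem pairQ_congr (h : ∀ y ∈ Ioo (0 : ℝ) 1, ∀ t ∈ Ioo 0 T, F y t = G y t) :
    pairQ T V F = pairQ T V G := by
  refine integral_congr_ae ?_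
  filter_upwards [ae_muTime_mem T] with t ht
  rw [l2c_congr fun y hy => h y hy t ht]

theorem ae_eq_zero_of_forall_bump (hV : MemLp V 2 (muTime T))
    (h : ∀ χ η, IsBump T χ → IsBump 1 η → pairQ T V (fun y t => χ t * η y) = 0) :
    V =ᵐ[muTime T] 0 := by
  have hV1 : Integrable V (muTime T) := hV.integrable (by norm_num)
  have hloc : LocallyIntegrableOn V (Ioo 0 T) :=
    IntegrableOn.locallyIntegrableOn (μ := volume) hV1
  have h1 : ∀ᵐ t ∂(volume : Measure ℝ), t ∈ Ioo 0 T → V t = 0 := by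
    refine isOpen_Ioo.ae_eq_zero_of_integral_contDiff_smul_eq_zero hloc fun χ h1 h2 h3 => ?_
    have hχ : IsBump T χ := ⟨h1, h2, h3⟩
    have hi : Integrable (fun t => χ t • V t) (muTime T) := by
      obtain ⟨C, hC⟩ := hχ.compact.exists_bound_of_continuous hχ.continuous
      exact hV1.bdd_smul (𝕜 := ℝ) C hχ.continuous.aestronglyMeasurable
        (Eventually.of_forall hC)
    have e : ∫ t, χ t • V t = ∫ t in Ioo 0 T, χ t • V t := by
      refine (setIntegral_eq_integral_of_forall_compl_eq_zero fun t ht => ?_).symm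
      rw [hχ.eq_zero ht, zero_smul]
    rw [e]
    refine l2_eq_zero_of_forall_bump _ fun η hη => ?_
    refine Eq.trans ?_ (h χ η hχ hη)
    rw [pairQ, real_inner_comm, ← integral_inner hi]
    refine integral_congr_ae (Eventually.of_forall fun t => ?_)
    simp only
    rw [l2c_smul _ hη.continuous, inner_smul_right, inner_smul_right, real_inner_comm]
  exact (ae_restrict_iff' measurableSet_Ioo).2 h1

/-- Rectangles in the characteristic coordinates that are contained in the image of `Q`. -/
structure CharBox (k T a₁ a₂ b₁ b₂ : ℝ) : Prop where
  pos : 0 < a₁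
  le_a : a₁ ≤ a₂
  mid : a₂ ≤ b₁
  le_b : b₁ ≤ b₂
  ratio : (1 - k) * b₂ ≤ (1 + k) * a₁
  low : 2 < a₁ + b₁
  high : a₂ + b₂ < 2 * alpha k T

/-- A smooth function supported in `[-1, 1]` whose integer translates form a partition of unity. -/
def unitBump (x : ℝ) : ℝ := Real.smoothTransition (x + 1) - Real.smoothTransition x

theorem contDiff_unitBump : ContDiff ℝ ∞ unitBump :=
  (Real.smoothTransition.contDiff.comp (by fun_prop)).sub Real.smoothTransition.contDiff

theorem unitBump_nonneg (x : ℝ) : 0 ≤ unitBump x :=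
  sub_nonneg.2 (Real.smoothTransition.monotone (by linarith))

theorem abs_le_of_unitBump_ne_zero {x : ℝ} (h : unitBump x ≠ 0) : |x| ≤ 1 := by
  by_contra! hx
  refine h ?_
  rcases lt_abs.1 hx with hx | hx
  · rw [unitBump, Real.smoothTransition.one_of_one_le (by linarith),
      Real.smoothTransition.one_of_one_le (by linarith), sub_self]
  · rw [unitBump, Real.smoothTransition.zero_of_nonpos (by linarith),
      Real.smoothTransition.zero_of_nonpos (by linarith), sub_self]

theorem sum_unitBump {x : ℝ} {n : ℕ} (h0 : 0 ≤ x) (hn : x + 1 ≤ n) :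
    ∑ i ∈ Finset.range n, unitBump (x - i) = 1 := by
  have h := Finset.sum_range_sub' (fun i : ℕ => Real.smoothTransition (x + 1 - i)) n
  rw [Real.smoothTransition.zero_of_nonpos (x := x + 1 - n) (by linarith),
    Real.smoothTransition.one_of_one_le (by push_cast; linarith), sub_zero] at h
  rw [← h]
  refine Finset.sum_congr rfl fun i _ => ?_
  rw [unitBump]; push_cast; congr 2 <;> ring

/-- Approximation of a function by sums of products. -/
theorem abs_sub_sum_unitBump_le {Φ : ℝ → ℝ → ℝ} {r ε a b : ℝ} (hr : 0 < r)
    (hΦ : ∀ a b a' b', |a - a'| ≤ r → |b - b'| ≤ r → |Φ a b - Φ a' b'| ≤ ε) {n : ℕ}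
    (ha : 0 ≤ a / r) (hb : 0 ≤ b / r) (han : a / r + 1 ≤ n) (hbn : b / r + 1 ≤ n) :
    |Φ a b - ∑ i ∈ Finset.range n, ∑ j ∈ Finset.range n,
      Φ (r * i) (r * j) * (unitBump (a / r - i) * unitBump (b / r - j))| ≤ ε := by
  have e1 : ∀ c : ℝ, ∑ i ∈ Finset.range n, ∑ j ∈ Finset.range n,
      c * (unitBump (a / r - i) * unitBump (b / r - j)) = c := fun c => by
    simp only [← Finset.mul_sum]
    rw [← Finset.sum_mul, sum_unitBump hb hbn, sum_unitBump ha han]; ring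
  have key : ∀ x : ℝ, ∀ i : ℕ, unitBump (x / r - i) ≠ 0 → |x - r * i| ≤ r := by
    intro x i h
    have := abs_le_of_unitBump_ne_zero h
    have e : x - r * i = r * (x / r - i) := by field_simp
    rw [e, abs_mul, abs_of_pos hr]
    exact mul_le_of_le_one_right hr.le this
  conv_lhs => rw [← e1 (Φ a b)]
  rw [← Finset.sum_sub_distrib]
  simp only [← Finset.sum_sub_distrib, ← sub_mul]
  refine le_trans ?_ (e1 ε).le
  refine (Finset.abs_sum_le_sum_abs _ _).trans (Finset.sum_le_sum fun i _ => ?_)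
  refine (Finset.abs_sum_le_sum_abs _ _).trans (Finset.sum_le_sum fun j _ => ?_)
  by_cases h1 : unitBump (a / r - i) = 0
  · simp [h1]
  by_cases h2 : unitBump (b / r - j) = 0
  · simp [h2]
  have hnn := mul_nonneg (unitBump_nonneg (a / r - i)) (unitBump_nonneg (b / r - j))
  rw [abs_mul, abs_of_nonneg hnn]
  exact mul_le_mul_of_nonneg_right (hΦ _ _ _ _ (key _ _ h1) (key _ _ h2)) hnn

/-- The function `χ(t) η(y)` in the characteristic coordinates. -/
def charPull (k : ℝ) (χ η : ℝ → ℝ) (a b : ℝ) : ℝ :=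
  χ (((a + b) / 2 - 1) / k) * η ((b - a) / (k * max (a + b) 1))

theorem charPull_charS (hk : 0 < k) {t : ℝ} (ht : 0 ≤ t) (χ η : ℝ → ℝ) (y : ℝ) :
    charPull k χ η (charS k 1 y t) (charS k (-1) y t) = χ t * η y := by
  have ha := one_le_alpha hk ht
  have e : charS k 1 y t + charS k (-1) y t = 2 * alpha k t := by simp only [charS]; ring
  have e' : charS k (-1) y t - charS k 1 y t = 2 * alpha k t * (k * y) := by
    simp only [charS]; ring
  rw [charPull, e, e', max_eq_left (by linarith)]
  have h0 : alpha k t ≠ 0 := by linarith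
  have h1 : (2 * alpha k t / 2 - 1) / k = t := by rw [alpha]; field_simp; ring
  have h2 : 2 * alpha k t * (k * y) / (k * (2 * alpha k t)) = y := by field_simp
  rw [h1, h2]

/-- The `max` keeps the denominator away from zero outside the image of Q, so the function is
continuous on the whole plane; having compact support, it is then uniformly continuous. -/
theorem continuous_charPull (hk : 0 < k) {χ η : ℝ → ℝ} (hχ : Continuous χ) (hη : Continuous η) :
    Continuous fun z : ℝ × ℝ => charPull k χ η z.1 z.2 := by
  refine (hχ.comp (by fun_prop)).mul (hη.comp (Continuous.div (by fun_prop) (by fun_prop) ?_))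
  intro z
  have : 1 ≤ max (z.1 + z.2) 1 := le_max_right _ _
  positivity

/-- Margins of the support in the characteristic coordinates. -/
theorem charPull_support (hk : 0 < k) (hk1 : k < 1) {χ η : ℝ → ℝ} {δ : ℝ} (hδ : 0 < δ)
    (hχ : ∀ t, χ t ≠ 0 → δ ≤ t ∧ t ≤ T - δ) (hη : ∀ y, η y ≠ 0 → δ ≤ y ∧ y ≤ 1 - δ) {a b : ℝ}
    (h : charPull k χ η a b ≠ 0) :
    1 - k ≤ a ∧ 2 * k * δ ≤ b - a ∧ 2 * k * δ ≤ (1 + k) * a - (1 - k) * b ∧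
      2 + 2 * k * δ ≤ a + b ∧ a + b ≤ 2 * alpha k T - 2 * k * δ := by
  obtain ⟨h1, h2⟩ := hχ _ (left_ne_zero_of_mul h)
  obtain ⟨h3, h4⟩ := hη _ (right_ne_zero_of_mul h)
  rw [le_div_iff₀ hk] at h1
  rw [div_le_iff₀ hk] at h2
  have hs : 2 + 2 * k * δ ≤ a + b := by linarith
  have hkδ : 0 < k * δ := mul_pos hk hδ
  have hm : max (a + b) 1 = a + b := max_eq_left (by linarith)
  have hp : 0 < k * (a + b) := mul_pos hk (by linarith)
  rw [hm, le_div_iff₀ hp] at h3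
  rw [hm, div_le_iff₀ hp] at h4
  have h5 : 2 * (k * δ) ≤ (a + b) * (k * δ) := mul_le_mul_of_nonneg_right (by linarith) hkδ.le
  refine ⟨?_, by linarith, by linarith, hs, by rw [alpha]; linarith⟩
  nlinarith

/-- In the coordinates a = `charS k 1`, b = `charS k (-1)` the domain Q is the region a < b, (1-k)b
< (1+k)a, 2 < a + b < 2α(T), and `CharBox` describes rectangles inside it. A function χ(t)η(y)
becomes uniformly continuous in (a, b), hence a uniform limit of sums of products on a grid. Only
grid points where it is nonzero contribute, and these lie at a positive distance from the boundary
of the region. -/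
theorem ae_eq_zero_of_forall_charBox (hk : 0 < k) (hk1 : k < 1) (hV : MemLp V 2 (muTime T))
    (h : ∀ a₁ a₂ b₁ b₂ : ℝ, CharBox k T a₁ a₂ b₁ b₂ → ∀ f₁ f₂ : ℝ → ℝ, ContDiff ℝ ∞ f₁ →
      ContDiff ℝ ∞ f₂ → (∀ s, f₁ s ≠ 0 → s ∈ Icc a₁ a₂) → (∀ s, f₂ s ≠ 0 → s ∈ Icc b₁ b₂) →
      pairQ T V (fun y t => f₁ (charS k 1 y t) * f₂ (charS k (-1) y t)) = 0) :
    V =ᵐ[muTime T] 0 := by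
  refine ae_eq_zero_of_forall_bump hV fun χ η hχ hη => ?_
  obtain ⟨δ₁, hδ₁, h₁⟩ := hχ.exists_margin
  obtain ⟨δ₂, hδ₂, h₂⟩ := hη.exists_margin
  set δ := min δ₁ δ₂
  have hδ : 0 < δ := lt_min hδ₁ hδ₂
  have l1 : δ ≤ δ₁ := min_le_left _ _
  have l2 : δ ≤ δ₂ := min_le_right _ _
  have hχ' : ∀ t, χ t ≠ 0 → δ ≤ t ∧ t ≤ T - δ := fun t ht =>
    ⟨l1.trans (h₁ t ht).1, (h₁ t ht).2.trans (by linarith)⟩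
  have hη' : ∀ y, η y ≠ 0 → δ ≤ y ∧ y ≤ 1 - δ := fun y hy =>
    ⟨l2.trans (h₂ y hy).1, (h₂ y hy).2.trans (by linarith)⟩
  have hsup := fun a b => charPull_support (T := T) hk hk1 hδ hχ' hη' (a := a) (b := b)
  have hcont := continuous_charPull hk hχ.continuous hη.continuous
  have hcomp : HasCompactSupport fun z : ℝ × ℝ => charPull k χ η z.1 z.2 := by
    refine HasCompactSupport.intro (K := Icc 0 (2 * alpha k T) ×ˢ Icc 0 (2 * alpha k T))
      (isCompact_Icc.prod isCompact_Icc) fun z hz => ?_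
    by_contra hne
    obtain ⟨s1, s2, s3, s4, s5⟩ := hsup _ _ hne
    have := mul_pos hk hδ
    exact hz ⟨⟨by linarith, by linarith⟩, ⟨by linarith, by linarith⟩⟩
  have huc := hcomp.uniformContinuous_of_continuous hcont
  set M := ∫ t in Ioo 0 T, ‖V t‖
  have hM : 0 ≤ M := integral_nonneg fun _ => norm_nonneg _
  refine abs_eq_zero.1 (le_antisymm (le_of_forall_pos_le_add fun ε hε => ?_) (abs_nonneg _))
  rw [zero_add]
  obtain ⟨d, hd, hΦ⟩ := Metric.uniformContinuous_iff.1 huc (ε / (M + 1)) (by positivity)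
  -- The mesh is below d for the uniform continuity, below 1 - k so that a - r > 0, and at most kδ/2
  -- so that a square of half-side r fits into the margins 2kδ of `charPull_support`.
  obtain ⟨r, hr, hr1⟩ : ∃ r : ℝ, 0 < r ∧ r < d ∧ r < 1 - k ∧ r ≤ k * δ / 2 := by
    refine ⟨min (d / 2) (min ((1 - k) / 2) (k * δ / 2)), ?_, ?_, ?_, ?_⟩
    · have : 0 < 1 - k := by linarith
      positivity
    · exact (min_le_left _ _).trans_lt (by linarith)
    · exact ((min_le_right _ _).trans (min_le_left _ _)).trans_lt (by linarith)
    · exact (min_le_right _ _).trans (min_le_right _ _)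
  obtain ⟨hrd, hrk, hrδ⟩ := hr1
  have hΦ' : ∀ a b a' b', |a - a'| ≤ r → |b - b'| ≤ r →
      |charPull k χ η a b - charPull k χ η a' b'| ≤ ε / (M + 1) := by
    intro a b a' b' h1 h2
    refine (hΦ (a := (a, b)) (b := (a', b')) ?_).le
    rw [Prod.dist_eq]
    exact max_lt (h1.trans_lt hrd) (h2.trans_lt hrd)
  obtain ⟨n, hn⟩ := exists_nat_ge (2 * alpha k T / r + 1)
  set S : ℝ → ℝ → ℝ := fun y t => ∑ i ∈ Finset.range n, ∑ j ∈ Finset.range n,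
      charPull k χ η (r * i) (r * j) * (unitBump (charS k 1 y t / r - i)
        * unitBump (charS k (-1) y t / r - j)) with hS
  have hterm : ∀ (e : ℝ) (i : ℕ), Continuous fun z : ℝ × ℝ => unitBump (charS k e z.1 z.2 / r - i) :=
    fun e i => contDiff_unitBump.continuous.comp
      (((Sm.charS k e).continuous.div_const r).sub continuous_const)
  have hprod : ∀ i j : ℕ, Continuous fun z : ℝ × ℝ => unitBump (charS k 1 z.1 z.2 / r - i)
      * unitBump (charS k (-1) z.1 z.2 / r - j) := fun i j => (hterm _ i).mul (hterm _ j)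
  have hS0 : pairQ T V S = 0 := by
    rw [hS, pairQ_sum hV]
    · refine Finset.sum_eq_zero fun i _ => ?_
      rw [pairQ_sum hV]
      · refine Finset.sum_eq_zero fun j _ => ?_
        rw [pairQ_const_mul _ (hprod i j)]
        by_cases hne : charPull k χ η (r * i) (r * j) = 0
        · rw [hne, zero_mul]
        obtain ⟨s1, s2, s3, s4, s5⟩ := hsup _ _ hne
        have hkδ := mul_pos hk hδ
        have hsm : ∀ i : ℕ, ContDiff ℝ ∞ fun s => unitBump (s / r - i) := fun i =>
          contDiff_unitBump.comp (by fun_prop)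
        have hsu : ∀ (i : ℕ) (s : ℝ), unitBump (s / r - i) ≠ 0 →
            s ∈ Icc (r * i - r) (r * i + r) := by
          intro i s hs
          have h1 := abs_le.1 (abs_le_of_unitBump_ne_zero hs)
          have e : s = r * (s / r - i) + r * i := by field_simp; ring
          have h2 := mul_le_mul_of_nonneg_left h1.1 hr.le
          have h3 := mul_le_mul_of_nonneg_left h1.2 hr.le
          constructor <;> linarith
        have hrk2 : k * r ≤ 1 * r := mul_le_mul_of_nonneg_right hk1.le hr.le
        have := h (r * i - r) (r * i + r) (r * j - r) (r * j + r)
          ⟨by linarith, by linarith, by linarith, by linarith, by nlinarith, by linarith,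
            by linarith⟩ _ _ (hsm i) (hsm j) (hsu i) (hsu j)
        rw [this, mul_zero]
      · exact fun j => (hprod i j).const_mul _
    · exact fun i => continuous_finsetSum _ fun j _ => (hprod i j).const_mul _
  have hSc : Continuous fun z : ℝ × ℝ => S z.1 z.2 :=
    continuous_finsetSum _ fun i _ => continuous_finsetSum _ fun j _ => (hprod i j).const_mul _
  have hFc : Continuous fun z : ℝ × ℝ => χ z.2 * η z.1 :=
    (hχ.continuous.comp continuous_snd).mul (hη.continuous.comp continuous_fst)
  have hdiff : pairQ T V (fun y t => χ t * η y)
      = pairQ T V (fun y t => χ t * η y + -1 * S y t) := by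
    rw [pairQ_add hV hFc (hSc.const_mul _), pairQ_const_mul _ hSc, hS0]; ring
  rw [hdiff]
  refine (abs_pairQ_le hV (hFc.add (hSc.const_mul _)) (ε := ε / (M + 1)) (by positivity)
    fun y hy t ht => ?_).trans ?_
  · have hb := fun e he => charS_bounds (e := e) hk hk1 he hy ht.1.le
    have hb1 := hb 1 (Or.inl rfl)
    have hb2 := hb (-1) (Or.inr rfl)
    have ha := alpha_pos hk ht.1.le
    have ha' := alpha_mono hk ht.2.le
    have hak : 0 ≤ alpha k t * (1 - k) := mul_nonneg ha.le (by linarith)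
    have hup : ∀ x, x ≤ alpha k t * 2 → x / r + 1 ≤ n := fun x hx => by
      refine le_trans ?_ hn
      have : x / r ≤ 2 * alpha k T / r := div_le_div_of_nonneg_right (by linarith) hr.le
      linarith
    have := abs_sub_sum_unitBump_le hr hΦ' (div_nonneg (hak.trans hb1.1) hr.le)
      (div_nonneg (hak.trans hb2.1) hr.le) (hup _ hb1.2) (hup _ hb2.2)
    rw [charPull_charS hk ht.1.le] at this
    rwa [neg_one_mul, ← sub_eq_add_neg]
  · change M * (ε / (M + 1)) ≤ ε
    rw [mul_div_assoc', div_le_iff₀ (by linarith)]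
    nlinarith

end

/-! ### Solutions obtained by successive reflections -/

section

variable {k T a₁ a₂ b₁ b₂ : ℝ}

/-- The ratio of the reflections. -/
def refl (k : ℝ) : ℝ := (1 + k) / (1 - k)

theorem refl_mul (hk1 : k < 1) : (1 - k) * refl k = 1 + k := by
  have : 1 - k ≠ 0 := by linarith
  rw [refl]; field_simp

theorem one_lt_refl (hk : 0 < k) (hk1 : k < 1) : 1 < refl k := by
  rw [refl, one_lt_div (by linarith)]; linarith

theorem CharBox.b_le (h : CharBox k T a₁ a₂ b₁ b₂) (hk1 : k < 1) : b₂ ≤ refl k * a₁ := by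
  have := h.ratio
  rw [← refl_mul hk1, mul_assoc] at this
  exact le_of_mul_le_mul_left this (by linarith)

theorem zpow_refl_cases (hk : 0 < k) (hk1 : k < 1) (j : ℤ) :
    (j = 0 ∧ refl k ^ j = 1) ∨ refl k ≤ refl k ^ j ∨ refl k ^ j * refl k ≤ 1 := by
  have h1 := one_lt_refl hk hk1
  have h0 : refl k ≠ 0 := by linarith
  rcases lt_trichotomy j 0 with h | h | h
  · right; right
    rw [← zpow_add_one₀ h0]
    exact zpow_le_one_of_nonpos₀ h1.le (by omega)
  · left; simp [h]
  · right; left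
    calc refl k = refl k ^ (1 : ℤ) := (zpow_one _).symm
      _ ≤ refl k ^ j := zpow_le_zpow_right₀ h1.le (by omega)

/-! ### Inequalities that locate the reflected supports. -/

section inequalities

variable {κ a b c : ℝ}

/-- Here (a, b) are the characteristic coordinates of a point, so a ≤ b ≤ κa, and c is a power of κ,
hence c = 1, c ≥ κ or cκ ≤ 1. In this group, `backward` and `forward` exclude every reflected
product after, respectively before, the times met by the box; `interior` shows that inside Q only
the unreflected product with c = 1 is met. Each case is linear arithmetic after multiplying by c or
κ. -/
theorem backward_first (h12 : a₁ ≤ a₂) (hm : a₂ ≤ b₁) (hb : b₁ ≤ b₂)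
    (hr : b₂ ≤ κ * a₁) (ha : 0 < a) (hc0 : 0 < c) (ha1 : 0 < a₁)
    (hab : a ≤ b) (hba : b ≤ κ * a) (hc : c = 1 ∨ κ ≤ c ∨ c * κ ≤ 1) (hs : a₂ + b₂ ≤ a + b)
    (h1 : c * a < a₂) (h2 : b < c * b₂) : False := by
  rcases hc with rfl | hc | hc
  · linarith
  · have := mul_le_mul_of_nonneg_right hc ha.le
    linarith
  · have e1 := mul_le_mul_of_nonneg_left hr hc0.le
    have e2 := mul_le_mul_of_nonneg_right hc ha1.le
    linarith

theorem backward_second (hκ : 1 < κ) (h12 : a₁ ≤ a₂) (hm : a₂ ≤ b₁) (hb : b₁ ≤ b₂)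
    (hr : b₂ ≤ κ * a₁) (ha : 0 < a) (hc0 : 0 < c) (ha1 : 0 < a₁)
    (hab : a ≤ b) (hba : b ≤ κ * a) (hc : c = 1 ∨ κ ≤ c ∨ c * κ ≤ 1) (hs : a₂ + b₂ ≤ a + b)
    (h1 : c * b < a₂) (h2 : a < c * b₂) : False := by
  rcases hc with rfl | hc | hc
  · linarith
  · have := mul_le_mul_of_nonneg_right (hκ.le.trans hc) (ha.le.trans hab)
    linarith
  · have e1 := mul_le_mul_of_nonneg_left hr hc0.le
    have e2 := mul_le_mul_of_nonneg_right hc ha1.le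
    have e3 := mul_lt_mul_of_pos_left h2 (zero_lt_one.trans hκ)
    have e4 := mul_le_mul_of_nonneg_right hc (by linarith : 0 ≤ b₂)
    linarith

theorem forward_first (hκ : 1 < κ) (h12 : a₁ ≤ a₂) (hm : a₂ ≤ b₁) (hb : b₁ ≤ b₂)
    (hr : b₂ ≤ κ * a₁) (ha : 0 < a) (ha1 : 0 < a₁)
    (hab : a ≤ b) (hba : b ≤ κ * a) (hc : c = 1 ∨ κ ≤ c ∨ c * κ ≤ 1) (hs : a + b ≤ a₁ + b₁)
    (h1 : a₁ < c * a) (h2 : c * b₁ < b) : False := by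
  rcases hc with rfl | hc | hc
  · linarith
  · have e1 := mul_le_mul_of_nonneg_right hc (by linarith : 0 ≤ b₁)
    have e2 : b₁ < a := lt_of_mul_lt_mul_left (by linarith : κ * b₁ < κ * a) (by linarith)
    linarith
  · have e1 := mul_lt_mul_of_pos_left h1 (zero_lt_one.trans hκ)
    have e2 := mul_le_mul_of_nonneg_right hc ha.le
    linarith

theorem forward_second (hκ : 1 < κ) (h12 : a₁ ≤ a₂) (hm : a₂ ≤ b₁) (hb : b₁ ≤ b₂)
    (hr : b₂ ≤ κ * a₁) (ha : 0 < a) (ha1 : 0 < a₁)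
    (hab : a ≤ b) (hba : b ≤ κ * a) (hc : c = 1 ∨ κ ≤ c ∨ c * κ ≤ 1) (hs : a + b ≤ a₁ + b₁)
    (h1 : a₁ < c * b) (h2 : c * b₁ < a) : False := by
  rcases hc with rfl | hc | hc
  · linarith
  · have e1 := mul_le_mul_of_nonneg_right (hκ.le.trans hc) (by linarith : 0 ≤ b₁)
    linarith
  · have e1 := mul_lt_mul_of_pos_left h1 (zero_lt_one.trans hκ)
    have e2 := mul_le_mul_of_nonneg_right hc (ha.le.trans hab)
    have e3 : a₁ < a := lt_of_mul_lt_mul_left (by linarith : κ * a₁ < κ * a) (by linarith)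
    linarith

theorem interior_first (hκ : 1 < κ) (h12 : a₁ ≤ a₂) (hm : a₂ ≤ b₁)
    (hr : b₂ ≤ κ * a₁) (ha : 0 < a) (hc0 : 0 < c) (ha1 : 0 < a₁)
    (hab : a < b) (hba : b < κ * a) (hc : κ ≤ c ∨ c * κ ≤ 1)
    (h1 : a₁ ≤ c * a) (h1' : c * a ≤ a₂) (h2 : c * b₁ ≤ b) (h2' : b ≤ c * b₂) : False := by
  rcases hc with hc | hc
  · have e1 := mul_le_mul_of_nonneg_right hc ha.le
    have e2 := mul_le_mul_of_nonneg_right (hκ.le.trans hc) (by linarith : 0 ≤ b₁)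
    linarith
  · have e1 := mul_le_mul_of_nonneg_left hr hc0.le
    have e2 := mul_le_mul_of_nonneg_right hc ha1.le
    have e3 : c * a ≤ a := mul_le_of_le_one_left ha.le
      ((le_mul_of_one_le_right hc0.le hκ.le).trans hc)
    linarith

theorem interior_second (hκ : 1 < κ) (h12 : a₁ ≤ a₂) (hm : a₂ ≤ b₁)
    (hr : b₂ ≤ κ * a₁) (ha : 0 < a) (hc0 : 0 < c) (ha1 : 0 < a₁)
    (hab : a < b) (hba : b < κ * a) (hc : c = 1 ∨ κ ≤ c ∨ c * κ ≤ 1)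
    (h1 : a₁ ≤ c * b) (h1' : c * b ≤ a₂) (h2 : c * b₁ ≤ a) (h2' : a ≤ c * b₂) : False := by
  have hb0 : 0 < b := ha.trans hab
  have key : 1 ≤ c → False := fun hc => by
    have e1 := mul_le_mul_of_nonneg_right hc hb0.le
    have e2 := mul_le_mul_of_nonneg_right hc (by linarith : 0 ≤ b₁)
    linarith
  rcases hc with rfl | hc | hc
  · exact key le_rfl
  · exact key (hκ.le.trans hc)
  · have e1 := mul_le_mul_of_nonneg_left hr hc0.le
    have e2 := mul_le_mul_of_nonneg_right hc ha1.le
    have e3 := mul_le_mul_of_nonneg_left (by linarith : a ≤ c * b) (zero_le_one.trans hκ.le)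
    have e4 := mul_le_mul_of_nonneg_right hc hb0.le
    linarith

end inequalities

theorem charS_relations (hk : 0 < k) (hk1 : k < 1) {y t : ℝ} (hy : y ∈ Icc (0 : ℝ) 1)
    (ht : 0 < alpha k t) : 0 < charS k 1 y t ∧ charS k 1 y t ≤ charS k (-1) y t ∧
      charS k (-1) y t ≤ refl k * charS k 1 y t := by
  have h1 : k * y ≤ k := mul_le_of_le_one_right hk.le hy.2
  have h2 : 0 ≤ k * y := mul_nonneg hk.le hy.1
  refine ⟨mul_pos ht (by linarith), mul_le_mul_of_nonneg_left (by linarith) ht.le, ?_⟩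
  have hk' : 0 < 1 - k := by linarith
  refine le_of_mul_le_mul_left ?_ hk'
  rw [← mul_assoc, refl_mul hk1]
  simp only [charS]
  nlinarith

theorem charS_relations_strict (hk : 0 < k) (hk1 : k < 1) {y t : ℝ} (hy : y ∈ Ioo (0 : ℝ) 1)
    (ht : 0 < alpha k t) : charS k 1 y t < charS k (-1) y t ∧
      charS k (-1) y t < refl k * charS k 1 y t := by
  have h1 : k * y < k := mul_lt_of_lt_one_right hk hy.2
  have h2 : 0 < k * y := mul_pos hk hy.1
  refine ⟨mul_lt_mul_of_pos_left (by linarith) ht, ?_⟩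
  have hk' : 0 < 1 - k := by linarith
  refine lt_of_mul_lt_mul_left ?_ hk'.le
  rw [← mul_assoc, refl_mul hk1]
  simp only [charS]
  nlinarith

/-- One term of the sum over the reflections. -/
def reflTerm (k c : ℝ) (φ₁ φ₂ : ℝ → ℝ) (y t : ℝ) : ℝ :=
  φ₁ (c * charS k 1 y t) * φ₂ (c⁻¹ * charS k (-1) y t)
    - φ₂ (c⁻¹ * charS k 1 y t) * φ₁ (c * charS k (-1) y t)

/-- A sum over reflections. -/
def reflSum (k : ℝ) (N : ℕ) (φ₁ φ₂ : ℝ → ℝ) (y t : ℝ) : ℝ :=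
  ∑ i ∈ Finset.range (2 * N + 1), reflTerm k (refl k ^ ((i : ℤ) - N)) φ₁ φ₂ y t

/-- `α² (θ'' + L θ)`. -/
def waveNum (k : ℝ) (θ : ℝ → ℝ → ℝ) (y t : ℝ) : ℝ :=
  charD k 1 (charD k (-1) θ) y t - k * charD k (-1) θ y t

variable {θ ζ : ℝ → ℝ → ℝ}

theorem Sm.waveNum (h : Sm θ) (k : ℝ) : Sm (waveNum k θ) :=
  ((h.charD k (-1)).charD k 1).sub ((h.charD k (-1)).const_mul k)

theorem waveNum_add (h : Sm θ) (h' : Sm ζ) (k y t : ℝ) :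
    waveNum k (fun y t => θ y t + ζ y t) y t = waveNum k θ y t + waveNum k ζ y t := by
  have e : charD k (-1) (fun y t => θ y t + ζ y t)
      = fun y t => charD k (-1) θ y t + charD k (-1) ζ y t :=
    funext fun y => funext fun t => charD_add h h' k (-1) y t
  rw [waveNum, e, charD_add (h.charD k (-1)) (h'.charD k (-1)), waveNum, waveNum]; ring

theorem waveNum_sub (h : Sm θ) (h' : Sm ζ) (k y t : ℝ) :
    waveNum k (fun y t => θ y t - ζ y t) y t = waveNum k θ y t - waveNum k ζ y t := by
  have e : charD k (-1) (fun y t => θ y t - ζ y t)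
      = fun y t => charD k (-1) θ y t - charD k (-1) ζ y t :=
    funext fun y => funext fun t => charD_sub h h' k (-1) y t
  rw [waveNum, e, charD_sub (h.charD k (-1)) (h'.charD k (-1)), waveNum, waveNum]; ring

theorem waveNum_zero (k y t : ℝ) : waveNum k (fun _ _ => 0) y t = 0 := by
  have e : charD k (-1) (fun _ _ => 0) = fun _ _ => 0 := by
    funext y t; simp [charD, dt_of_fst, dy_of_snd]
  have e1 : charD k 1 (fun _ _ => 0) = fun _ _ => 0 := by
    funext y t; simp [charD, dt_of_fst, dy_of_snd]
  rw [waveNum, e, e1]; ring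

theorem waveNum_sum {ι : Type*} (s : Finset ι) {f : ι → ℝ → ℝ → ℝ} (h : ∀ i, Sm (f i))
    (k y t : ℝ) : waveNum k (fun y t => ∑ i ∈ s, f i y t) y t = ∑ i ∈ s, waveNum k (f i) y t := by
  classical
  induction s using Finset.induction_on with
  | empty => simpa using waveNum_zero k y t
  | insert i s hi ih =>
    simp only [Finset.sum_insert hi]
    rw [waveNum_add (h i) (Sm.sum s fun i _ => h i), ih]

/-- The wave operator on a product of functions of the characteristic coordinates. -/
theorem waveNum_prod {G H : ℝ → ℝ} (hG : ContDiff ℝ ∞ G) (hH : ContDiff ℝ ∞ H) (k y t : ℝ) :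
    waveNum k (fun y t => G (charS k 1 y t) * H (charS k (-1) y t)) y t
      = 4 * k ^ 2 * alpha k t ^ 2 * (deriv G (charS k 1 y t) * deriv H (charS k (-1) y t)) := by
  have sa := Sm.charS k 1
  have sb := Sm.charS k (-1)
  have sα := Sm.alpha k
  have e : charD k (-1) (fun y t => G (charS k 1 y t) * H (charS k (-1) y t))
      = fun y t => 2 * k * (alpha k t * (deriv G (charS k 1 y t) * H (charS k (-1) y t))) := by
    funext y t
    rw [charD_mul (Sm.comp hG sa) (Sm.comp hH sb), charD_comp hG sa, charD_comp hH sb,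
      charD_charS, charD_charS]
    ring
  rw [waveNum, e, charD_const_mul,
    charD_mul sα ((Sm.comp (deriv_smooth hG) sa).mul (Sm.comp hH sb)), charD_alpha,
    charD_mul (Sm.comp (deriv_smooth hG) sa) (Sm.comp hH sb), charD_comp (deriv_smooth hG) sa,
    charD_comp hH sb, charD_charS, charD_charS]
  ring

/-- Multiplication by α conjugates the two operators: for t ≥ 0 the adjoint wave operator applied to
αz is α (z'' + Lz). It transfers the sums over reflections, built for L, to the adjoint operator. -/
theorem waveAdj_alpha_mul (h : Sm θ) (k y t : ℝ) :
    waveAdj k (fun y t => alpha k t * θ y t) y t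
      = invAlpha k t ^ 2 * (alpha k t * waveNum k θ y t) := by
  have e : riem k 1 (fun y t => alpha k t * θ y t) = fun y t => alpha k t * charD k (-1) θ y t := by
    funext y t
    rw [riem, charD_mul (Sm.alpha k) h, charD_alpha]; ring
  rw [waveAdj, e, charD_mul (Sm.alpha k) (h.charD k (-1)), charD_alpha, waveNum]; ring

variable {φ₁ φ₂ f₁ f₂ : ℝ → ℝ}

theorem hasDerivAt_scale {φ f : ℝ → ℝ} (h : ∀ s, HasDerivAt φ (f s) s) (c : ℝ) :
    deriv (fun s => φ (c * s)) = fun s => c * f (c * s) := by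
  funext s
  have h1 : HasDerivAt (fun s : ℝ => c * s) c s := by simpa using (hasDerivAt_id s).const_mul c
  exact ((h (c * s)).comp s h1).deriv.trans (mul_comm _ _)

theorem contDiff_scale {φ : ℝ → ℝ} (h : ContDiff ℝ ∞ φ) (c : ℝ) :
    ContDiff ℝ ∞ fun s => φ (c * s) := h.comp (by fun_prop)

theorem Sm.reflTerm (h₁ : ContDiff ℝ ∞ φ₁) (h₂ : ContDiff ℝ ∞ φ₂) (k c : ℝ) :
    Sm (reflTerm k c φ₁ φ₂) :=
  ((Sm.comp h₁ ((Sm.charS k 1).const_mul c)).mul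
    (Sm.comp h₂ ((Sm.charS k (-1)).const_mul c⁻¹))).sub
  ((Sm.comp h₂ ((Sm.charS k 1).const_mul c⁻¹)).mul
    (Sm.comp h₁ ((Sm.charS k (-1)).const_mul c)))

theorem Sm.reflSum (h₁ : ContDiff ℝ ∞ φ₁) (h₂ : ContDiff ℝ ∞ φ₂) (k : ℝ) (N : ℕ) :
    Sm (reflSum k N φ₁ φ₂) := Sm.sum _ fun _ _ => Sm.reflTerm h₁ h₂ k _

theorem waveNum_reflTerm (h₁ : ContDiff ℝ ∞ φ₁) (h₂ : ContDiff ℝ ∞ φ₂)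
    (d₁ : ∀ s, HasDerivAt φ₁ (f₁ s) s) (d₂ : ∀ s, HasDerivAt φ₂ (f₂ s) s) {c : ℝ} (hc : c ≠ 0)
    (k y t : ℝ) : waveNum k (reflTerm k c φ₁ φ₂) y t
      = 4 * k ^ 2 * alpha k t ^ 2 * reflTerm k c f₁ f₂ y t := by
  have s₁ := contDiff_scale h₁ c
  have s₂ := contDiff_scale h₂ c⁻¹
  have := waveNum_sub
    ((Sm.comp s₁ (Sm.charS k 1)).mul (Sm.comp s₂ (Sm.charS k (-1))))
    ((Sm.comp s₂ (Sm.charS k 1)).mul (Sm.comp s₁ (Sm.charS k (-1)))) k y t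
  rw [waveNum_prod s₁ s₂, waveNum_prod s₂ s₁, hasDerivAt_scale d₁, hasDerivAt_scale d₂] at this
  refine this.trans ?_
  rw [reflTerm]
  field_simp

/-- On y = 0 the two characteristic coordinates coincide, and each term is antisymmetric in them. -/
theorem reflSum_left (k : ℝ) (N : ℕ) (φ₁ φ₂ : ℝ → ℝ) (t : ℝ) : reflSum k N φ₁ φ₂ 0 t = 0 := by
  refine Finset.sum_eq_zero fun i _ => ?_
  simp only [reflTerm, charS]; ring_nf

/-- On y = 1 the second coordinate is κ times the first, so the second half of the term with
exponent j is the first half of the term with exponent j + 1. The sum telescopes to two extreme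
products, which vanish for suitable profiles once N is large. -/
theorem reflSum_right (hk : 0 < k) (hk1 : k < 1) (N : ℕ) (φ₁ φ₂ : ℝ → ℝ) (t : ℝ) :
    reflSum k N φ₁ φ₂ 1 t
      = φ₁ (refl k ^ (-N : ℤ) * charS k 1 1 t) * φ₂ (refl k ^ (N + 1 : ℤ) * charS k 1 1 t)
        - φ₁ (refl k ^ (N + 1 : ℤ) * charS k 1 1 t) * φ₂ (refl k ^ (-N : ℤ) * charS k 1 1 t) := by
  have h0 : refl k ≠ 0 := by linarith [one_lt_refl hk hk1]
  set a := charS k 1 1 t with ha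
  have hb : charS k (-1) 1 t = refl k * a := by
    have := refl_mul hk1
    simp only [ha, charS]
    linear_combination (-alpha k t) * this
  have h := Finset.sum_range_sub' (fun i : ℕ =>
    φ₁ (refl k ^ ((i : ℤ) - N) * a) * φ₂ (refl k ^ (1 - ((i : ℤ) - N)) * a)) (2 * N + 1)
  have e1 : ((0 : ℕ) : ℤ) - N = -N := by push_cast; ring
  have e2 : ((2 * N + 1 : ℕ) : ℤ) - N = N + 1 := by push_cast; ring
  have e3 : (1 : ℤ) - -(N : ℤ) = N + 1 := by ring
  have e4 : (1 : ℤ) - (N + 1) = -N := by ring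
  simp only [e1, e2, e3, e4] at h
  rw [reflSum, ← h]
  refine Finset.sum_congr rfl fun i _ => ?_
  have e5 : ((i + 1 : ℕ) : ℤ) - N = ((i : ℤ) - N) + 1 := by push_cast; ring
  have e6 : (1 : ℤ) - (((i : ℤ) - N) + 1) = -((i : ℤ) - N) := by ring
  have e7 : (1 : ℤ) - ((i : ℤ) - N) = -((i : ℤ) - N) + 1 := by ring
  rw [reflTerm, hb, e5, e6, e7, zpow_add_one₀ h0, zpow_add_one₀ h0, zpow_neg, ← mul_assoc,
    ← mul_assoc]
  ring

/-- Only one reflection is seen by profiles supported in a characteristic box. -/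
theorem waveNum_reflSum (hbox : CharBox k T a₁ a₂ b₁ b₂) (hk : 0 < k) (hk1 : k < 1)
    (h₁ : ContDiff ℝ ∞ φ₁) (h₂ : ContDiff ℝ ∞ φ₂)
    (d₁ : ∀ s, HasDerivAt φ₁ (f₁ s) s) (d₂ : ∀ s, HasDerivAt φ₂ (f₂ s) s)
    (s₁ : ∀ s, f₁ s ≠ 0 → s ∈ Icc a₁ a₂) (s₂ : ∀ s, f₂ s ≠ 0 → s ∈ Icc b₁ b₂)
    (N : ℕ) {y t : ℝ} (hy : y ∈ Ioo (0 : ℝ) 1) (ht : 0 ≤ t) :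
    waveNum k (reflSum k N φ₁ φ₂) y t
      = 4 * k ^ 2 * alpha k t ^ 2 * (f₁ (charS k 1 y t) * f₂ (charS k (-1) y t)) := by
  have hκ := one_lt_refl hk hk1
  have hα := alpha_pos hk ht
  obtain ⟨ha, -, -⟩ := charS_relations hk hk1 (Ioo_subset_Icc_self hy) hα
  obtain ⟨hab, hba⟩ := charS_relations_strict hk hk1 hy hα
  have hpos : ∀ j : ℤ, 0 < refl k ^ j := fun j => zpow_pos (by linarith) j
  -- The mirrored products are never seen in the interior, whatever the exponent.
  have hsnd : ∀ j : ℤ, f₂ ((refl k ^ j)⁻¹ * charS k 1 y t) * f₁ (refl k ^ j * charS k (-1) y t)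
      = 0 := by
    intro j
    by_contra hne
    obtain ⟨m1, m2⟩ := s₁ _ (right_ne_zero_of_mul hne)
    obtain ⟨m3, m4⟩ := s₂ _ (left_ne_zero_of_mul hne)
    rw [le_inv_mul_iff₀ (hpos j)] at m3
    rw [inv_mul_le_iff₀ (hpos j)] at m4
    exact interior_second hκ hbox.le_a hbox.mid (hbox.b_le hk1) ha (hpos j) hbox.pos hab hba
      ((zpow_refl_cases hk hk1 j).imp_left And.right) m1 m2 m3 m4
  change waveNum k (fun y t => ∑ i ∈ Finset.range (2 * N + 1),
    reflTerm k (refl k ^ ((i : ℤ) - N)) φ₁ φ₂ y t) y t = _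
  rw [waveNum_sum _ fun i => Sm.reflTerm h₁ h₂ k _]
  simp only [waveNum_reflTerm h₁ h₂ d₁ d₂ (hpos _).ne']
  rw [← Finset.mul_sum]
  congr 1
  -- The exponent is i - N, so i = N is the unreflected term.
  rw [Finset.sum_eq_single N]
  · rw [reflTerm, hsnd, sub_self, zpow_zero]; simp
  · intro i _ hi
    rw [reflTerm, hsnd, sub_zero]
    by_contra hne
    obtain ⟨m1, m2⟩ := s₁ _ (left_ne_zero_of_mul hne)
    obtain ⟨m3, m4⟩ := s₂ _ (right_ne_zero_of_mul hne)
    rw [le_inv_mul_iff₀ (hpos _)] at m3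
    rw [inv_mul_le_iff₀ (hpos _)] at m4
    rcases zpow_refl_cases hk hk1 ((i : ℤ) - N) with h | h
    · exact hi (by omega)
    · exact interior_first hκ hbox.le_a hbox.mid (hbox.b_le hk1) ha (hpos _) hbox.pos
        hab hba h m1 m2 m3 m4
  · intro h; exact absurd (Finset.mem_range.2 (by omega)) h

theorem reflSum_eq_zero_of_late (hbox : CharBox k T a₁ a₂ b₁ b₂) (hk : 0 < k) (hk1 : k < 1)
    (z₁ : ∀ s, a₂ ≤ s → φ₁ s = 0) (z₂ : ∀ s, b₂ ≤ s → φ₂ s = 0) (N : ℕ) {y t : ℝ}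
    (hy : y ∈ Icc (0 : ℝ) 1) (ht : a₂ + b₂ ≤ 2 * alpha k t) : reflSum k N φ₁ φ₂ y t = 0 := by
  have hκ := one_lt_refl hk hk1
  have := hbox.pos; have := hbox.le_a; have := hbox.mid; have := hbox.le_b
  obtain ⟨ha, hab, hba⟩ := charS_relations hk hk1 hy (by linarith : 0 < alpha k t)
  have hs : a₂ + b₂ ≤ charS k 1 y t + charS k (-1) y t := by simp only [charS]; linarith
  have hpos : ∀ j : ℤ, 0 < refl k ^ j := fun j => zpow_pos (by linarith) j
  refine Finset.sum_eq_zero fun i _ => ?_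
  have hc := (zpow_refl_cases hk hk1 ((i : ℤ) - N)).imp_left And.right
  set c := refl k ^ ((i : ℤ) - N)
  have hc0 : 0 < c := hpos _
  have e1 : φ₁ (c * charS k 1 y t) * φ₂ (c⁻¹ * charS k (-1) y t) = 0 := by
    by_contra hne
    have m1 := lt_of_not_ge fun h => left_ne_zero_of_mul hne (z₁ _ h)
    have m2 := lt_of_not_ge fun h => right_ne_zero_of_mul hne (z₂ _ h)
    rw [inv_mul_lt_iff₀ hc0] at m2
    exact backward_first hbox.le_a hbox.mid hbox.le_b (hbox.b_le hk1) ha hc0 hbox.pos hab hba hc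
      hs m1 m2
  have e2 : φ₂ (c⁻¹ * charS k 1 y t) * φ₁ (c * charS k (-1) y t) = 0 := by
    by_contra hne
    have m1 := lt_of_not_ge fun h => right_ne_zero_of_mul hne (z₁ _ h)
    have m2 := lt_of_not_ge fun h => left_ne_zero_of_mul hne (z₂ _ h)
    rw [inv_mul_lt_iff₀ hc0] at m2
    exact backward_second hκ hbox.le_a hbox.mid hbox.le_b (hbox.b_le hk1) ha hc0 hbox.pos hab hba hc
      hs m1 m2
  rw [reflTerm, e1, e2, sub_self]

theorem reflSum_eq_zero_of_early (hbox : CharBox k T a₁ a₂ b₁ b₂) (hk : 0 < k) (hk1 : k < 1)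
    (z₁ : ∀ s, s ≤ a₁ → φ₁ s = 0) (z₂ : ∀ s, s ≤ b₁ → φ₂ s = 0) (N : ℕ) {y t : ℝ}
    (hy : y ∈ Icc (0 : ℝ) 1) (h0 : 0 < alpha k t) (ht : 2 * alpha k t ≤ a₁ + b₁) :
    reflSum k N φ₁ φ₂ y t = 0 := by
  have hκ := one_lt_refl hk hk1
  obtain ⟨ha, hab, hba⟩ := charS_relations hk hk1 hy h0
  have hs : charS k 1 y t + charS k (-1) y t ≤ a₁ + b₁ := by simp only [charS]; linarith
  have hpos : ∀ j : ℤ, 0 < refl k ^ j := fun j => zpow_pos (by linarith) j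
  refine Finset.sum_eq_zero fun i _ => ?_
  have hc := (zpow_refl_cases hk hk1 ((i : ℤ) - N)).imp_left And.right
  set c := refl k ^ ((i : ℤ) - N)
  have hc0 : 0 < c := hpos _
  have e1 : φ₁ (c * charS k 1 y t) * φ₂ (c⁻¹ * charS k (-1) y t) = 0 := by
    by_contra hne
    have m1 := lt_of_not_ge fun h => left_ne_zero_of_mul hne (z₁ _ h)
    have m2 := lt_of_not_ge fun h => right_ne_zero_of_mul hne (z₂ _ h)
    rw [lt_inv_mul_iff₀ hc0] at m2
    exact forward_first hκ hbox.le_a hbox.mid hbox.le_b (hbox.b_le hk1) ha hbox.pos hab hba hc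
      hs m1 m2
  have e2 : φ₂ (c⁻¹ * charS k 1 y t) * φ₁ (c * charS k (-1) y t) = 0 := by
    by_contra hne
    have m1 := lt_of_not_ge fun h => right_ne_zero_of_mul hne (z₁ _ h)
    have m2 := lt_of_not_ge fun h => left_ne_zero_of_mul hne (z₂ _ h)
    rw [lt_inv_mul_iff₀ hc0] at m2
    exact forward_second hκ hbox.le_a hbox.mid hbox.le_b (hbox.b_le hk1) ha hbox.pos hab hba hc
      hs m1 m2
  rw [reflTerm, e1, e2, sub_self]

theorem exists_refl_pow_gt (hk : 0 < k) (hk1 : k < 1) (A : ℝ) : ∃ N : ℕ, A < refl k ^ (N : ℤ) := by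
  obtain ⟨N, hN⟩ := pow_unbounded_of_one_lt A (one_lt_refl hk hk1)
  exact ⟨N, by rwa [zpow_natCast]⟩

theorem exists_antideriv {f : ℝ → ℝ} (hf : ContDiff ℝ ∞ f) (s₀ : ℝ) :
    ContDiff ℝ ∞ (fun s => ∫ x in s₀..s, f x) ∧
      ∀ s, HasDerivAt (fun s => ∫ x in s₀..s, f x) (f s) s := by
  have h : ∀ s, HasDerivAt (fun s => ∫ x in s₀..s, f x) (f s) s := fun s =>
    intervalIntegral.integral_hasDerivAt_right (hf.continuous.intervalIntegrable _ _)
      (hf.continuous.stronglyMeasurableAtFilter _ _) hf.continuous.continuousAt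
  have hd : deriv (fun s => ∫ x in s₀..s, f x) = f := funext fun s => (h s).deriv
  exact ⟨contDiff_infty_iff_deriv.2 ⟨fun s => (h s).differentiableAt, by rwa [hd]⟩, h⟩

theorem integral_eq_zero_of_support {f : ℝ → ℝ} {a b s₀ s : ℝ} (h : ∀ x, f x ≠ 0 → x ∈ Icc a b)
    (hs : (s₀ ≤ a ∧ s ≤ a) ∨ (b ≤ s₀ ∧ b ≤ s)) (hf : Continuous f) : ∫ x in s₀..s, f x = 0 := by
  have hz : ∀ x, (x < a ∨ b < x) → f x = 0 := fun x hx => by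
    by_contra hne
    obtain ⟨h1, h2⟩ := h x hne
    rcases hx with hx | hx <;> linarith
  have hz' : ∀ x, (x ≤ a ∨ b ≤ x) → f x = 0 := by
    rintro x (hx | hx)
    · have hcl : Iic a ⊆ {x | f x = 0} := by
        rw [← closure_Iio]
        exact closure_minimal (fun x hx => hz x (Or.inl hx)) (isClosed_eq hf continuous_const)
      exact hcl hx
    · have hcl : Ici b ⊆ {x | f x = 0} := by
        rw [← closure_Ioi]
        exact closure_minimal (fun x hx => hz x (Or.inr hx)) (isClosed_eq hf continuous_const)
      exact hcl hx
  rw [intervalIntegral.integral_congr (g := fun _ => (0 : ℝ)), intervalIntegral.integral_zero]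
  intro x hx
  refine hz' x ?_
  rcases hs with hs | hs
  · exact Or.inl (hx.2.trans (max_le hs.1 hs.2))
  · exact Or.inr ((le_min hs.1 hs.2).trans hx.1)

/-- Backward test functions with prescribed image under the wave operator. -/
theorem exists_backward_test (hbox : CharBox k T a₁ a₂ b₁ b₂) (hk : 0 < k) (hk1 : k < 1)
    (hf₁ : ContDiff ℝ ∞ f₁) (hf₂ : ContDiff ℝ ∞ f₂)
    (s₁ : ∀ s, f₁ s ≠ 0 → s ∈ Icc a₁ a₂) (s₂ : ∀ s, f₂ s ≠ 0 → s ∈ Icc b₁ b₂) :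
    ∃ θ, IsTranspositionTest T θ ∧ ∀ y ∈ Ioo (0 : ℝ) 1, ∀ t ∈ Icc 0 T, waveAdj k θ y t
      = 4 * k ^ 2 * (alpha k t * (f₁ (charS k 1 y t) * f₂ (charS k (-1) y t))) := by
  -- Antiderivatives taken from the upper ends vanish beyond the box, so the sum over reflections
  -- vanishes near t = T.
  obtain ⟨c₁, d₁⟩ := exists_antideriv hf₁ a₂
  obtain ⟨c₂, d₂⟩ := exists_antideriv hf₂ b₂
  set φ₁ := fun s => ∫ x in a₂..s, f₁ x
  set φ₂ := fun s => ∫ x in b₂..s, f₂ x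
  have z₁ : ∀ s, a₂ ≤ s → φ₁ s = 0 := fun s hs =>
    integral_eq_zero_of_support s₁ (Or.inr ⟨le_rfl, hs⟩) hf₁.continuous
  have z₂ : ∀ s, b₂ ≤ s → φ₂ s = 0 := fun s hs =>
    integral_eq_zero_of_support s₂ (Or.inr ⟨le_rfl, hs⟩) hf₂.continuous
  have hk' : 0 < 1 - k := by linarith
  -- On y = 1 one has `charS k 1` ≥ 1 - k, so κ^(N+1) times it exceeds b₂ ≥ a₂, where both
  -- antiderivatives are zero: this kills both extreme products.
  obtain ⟨N, hN⟩ := exists_refl_pow_gt hk hk1 (b₂ / (1 - k))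
  have hκ := one_lt_refl hk hk1
  have hz := Sm.reflSum c₁ c₂ k N
  have hlate : ∀ y ∈ Icc (0 : ℝ) 1, ∀ t, a₂ + b₂ ≤ 2 * alpha k t →
      alpha k t * reflSum k N φ₁ φ₂ y t = 0 := fun y hy t ht => by
    rw [reflSum_eq_zero_of_late hbox hk hk1 z₁ z₂ N hy ht, mul_zero]
  refine ⟨fun y t => alpha k t * reflSum k N φ₁ φ₂ y t,
    ⟨(Sm.alpha k).mul hz, fun t _ => ?_, fun t ht => ?_, fun y hy => hlate y hy T hbox.high.le,
      fun y hy => ?_⟩, fun y hy t ht => ?_⟩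
  · simp only [reflSum_left, mul_zero]
  · have ha : 1 - k ≤ charS k 1 1 t := by
      have := mul_le_mul_of_nonneg_right (one_le_alpha hk ht.1) hk'.le
      simp only [charS]; linarith
    have hbig : b₂ ≤ refl k ^ (N + 1 : ℤ) * charS k 1 1 t := by
      have h1 : refl k ^ (N : ℤ) ≤ refl k ^ (N + 1 : ℤ) := zpow_le_zpow_right₀ hκ.le (by omega)
      have h2 : b₂ / (1 - k) * (1 - k) = b₂ := by field_simp
      have h0 : 0 < refl k ^ (N + 1 : ℤ) := zpow_pos (by linarith) _
      calc b₂ = b₂ / (1 - k) * (1 - k) := h2.symm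
        _ ≤ refl k ^ (N + 1 : ℤ) * (1 - k) := mul_le_mul_of_nonneg_right (by linarith) hk'.le
        _ ≤ _ := mul_le_mul_of_nonneg_left ha h0.le
    have := hbox.mid; have := hbox.le_b
    simp only [reflSum_right hk hk1]
    rw [z₂ _ hbig, z₁ (refl k ^ (N + 1 : ℤ) * charS k 1 1 t) (by linarith)]; ring
  · have hev : ∀ᶠ t in 𝓝 T, alpha k t * reflSum k N φ₁ φ₂ y t = 0 := by
      have : ∀ᶠ t in 𝓝 T, a₂ + b₂ < 2 * alpha k t :=
        ((contDiff_alpha k).continuous.const_mul 2).continuousAt.eventually (lt_mem_nhds hbox.high)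
      exact this.mono fun t ht => hlate y hy t ht.le
    have e : (fun t => alpha k t * reflSum k N φ₁ φ₂ y t) =ᶠ[𝓝 T] fun _ => 0 := hev
    rw [dt, e.deriv_eq, deriv_const]
  · rw [waveAdj_alpha_mul hz, waveNum_reflSum hbox hk hk1 c₁ c₂ d₁ d₂ s₁ s₂ N hy ht.1]
    have := alpha_mul_invAlpha hk ht.1
    linear_combination (4 * k ^ 2 * alpha k t * (f₁ (charS k 1 y t) * f₂ (charS k (-1) y t))
      * (alpha k t * invAlpha k t + 1)) * this

/-- Forward test functions with prescribed image under the wave operator. -/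
theorem exists_forward_test (hbox : CharBox k T a₁ a₂ b₁ b₂) (hk : 0 < k) (hk1 : k < 1)
    (hf₁ : ContDiff ℝ ∞ f₁) (hf₂ : ContDiff ℝ ∞ f₂)
    (s₁ : ∀ s, f₁ s ≠ 0 → s ∈ Icc a₁ a₂) (s₂ : ∀ s, f₂ s ≠ 0 → s ∈ Icc b₁ b₂) :
    ∃ θ, IsDirichlet T θ ∧ (∃ t₁ > 0, ∀ y ∈ Icc (0 : ℝ) 1, ∀ t ∈ Icc 0 t₁, θ y t = 0) ∧
      ∀ y ∈ Ioo (0 : ℝ) 1, ∀ t ∈ Icc 0 T, dt (dt θ) y t + opL k θ y t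
        = 4 * k ^ 2 * (f₁ (charS k 1 y t) * f₂ (charS k (-1) y t)) := by
  obtain ⟨c₁, d₁⟩ := exists_antideriv hf₁ a₁
  obtain ⟨c₂, d₂⟩ := exists_antideriv hf₂ b₁
  set φ₁ := fun s => ∫ x in a₁..s, f₁ x
  set φ₂ := fun s => ∫ x in b₁..s, f₂ x
  have z₁ : ∀ s, s ≤ a₁ → φ₁ s = 0 := fun s hs =>
    integral_eq_zero_of_support s₁ (Or.inl ⟨le_rfl, hs⟩) hf₁.continuous
  have z₂ : ∀ s, s ≤ b₁ → φ₂ s = 0 := fun s hs =>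
    integral_eq_zero_of_support s₂ (Or.inl ⟨le_rfl, hs⟩) hf₂.continuous
  have hk' : 0 < 1 - k := by linarith
  -- On y = 1 one has `charS k 1` ≤ 2α(T), so κ^(-N) times it is at most a₁ ≤ b₁, where the
  -- antiderivatives taken from the lower ends vanish.
  obtain ⟨N, hN⟩ := exists_refl_pow_gt hk hk1 (2 * alpha k T / a₁)
  have hκ := one_lt_refl hk hk1
  have hz := Sm.reflSum c₁ c₂ k N
  have h1 := hbox.pos; have h2 := hbox.le_a; have h3 := hbox.mid
  refine ⟨reflSum k N φ₁ φ₂, ⟨hz, fun t _ => reflSum_left _ _ _ _ _, fun t ht => ?_⟩,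
    -- The time at which 2α = a₁ + b₁, before which no reflected product is nonzero; it is positive
    -- by the field `low` of the box.
    ⟨((a₁ + b₁) / 2 - 1) / k, div_pos (by linarith [hbox.low]) hk, fun y hy t ht => ?_⟩,
    fun y hy t ht => ?_⟩
  · have ha := charS_bounds (e := 1) (y := 1) hk hk1 (Or.inl rfl) ⟨zero_le_one, le_rfl⟩ ht.1
    have hsmall : refl k ^ (-N : ℤ) * charS k 1 1 t ≤ a₁ := by
      rw [zpow_neg, inv_mul_le_iff₀ (zpow_pos (by linarith) _)]
      rw [div_lt_iff₀ h1] at hN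
      linarith [alpha_mono hk ht.2]
    rw [reflSum_right hk hk1, z₁ _ hsmall,
      z₂ (refl k ^ (-N : ℤ) * charS k 1 1 t) (by linarith)]; ring
  · refine reflSum_eq_zero_of_early hbox hk hk1 z₁ z₂ N hy (alpha_pos hk ht.1) ?_
    have := ht.2
    rw [le_div_iff₀ hk] at this
    rw [alpha]; linarith
  · rw [wave_opL_eq hz hk ht.1]
    refine (congrArg (invAlpha k t ^ 2 * ·)
      (waveNum_reflSum hbox hk hk1 c₁ c₂ d₁ d₂ s₁ s₂ N hy ht.1)).trans ?_
    have := alpha_mul_invAlpha hk ht.1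
    linear_combination (4 * k ^ 2 * (f₁ (charS k 1 y t) * f₂ (charS k (-1) y t))
      * (alpha k t * invAlpha k t + 1)) * this

end

/-! ### Multiplication by functions of time -/

section timeMul

variable {E : Type*} [NormedAddCommGroup E] [NormedSpace ℝ E] {T : ℝ} {m : ℝ → ℝ}

theorem MemLp.time_smul (hm : Continuous m) {f : ℝ → E} (hf : MemLp f 2 (muTime T)) :
    MemLp (fun t => m t • f t) 2 (muTime T) :=
  MemLp.smul (p := ∞) (q := 2) (r := 2) hf (memLp_of_continuous hm ∞)

/-- Multiplication by a continuous function of time in `L²(0, T; E)`. -/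
def timeMul (T : ℝ) (hm : Continuous m) : Lp E 2 (muTime T) →L[ℝ] Lp E 2 (muTime T) :=
  LinearMap.mkContinuousOfExistsBound
    { toFun := fun f => (MemLp.time_smul hm (Lp.memLp f)).toLp _
      map_add' := fun f g => by
        rw [← MemLp.toLp_add, MemLp.toLp_eq_toLp_iff]
        filter_upwards [Lp.coeFn_add f g] with t ht
        change m t • (f + g : Lp E 2 (muTime T)) t = m t • f t + m t • g t
        rw [ht]; exact smul_add _ _ _
      map_smul' := fun c f => by
        rw [RingHom.id_apply, ← MemLp.toLp_const_smul, MemLp.toLp_eq_toLp_iff]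
        filter_upwards [Lp.coeFn_smul c f] with t ht
        change m t • (c • f : Lp E 2 (muTime T)) t = c • m t • f t
        rw [ht]; exact smul_comm _ _ _ }
    (by
      obtain ⟨C, hC⟩ := isCompact_Icc.exists_bound_of_continuousOn (s := Icc 0 T) hm.continuousOn
      refine ⟨C, fun f => Lp.norm_le_mul_norm_of_ae_le_mul ?_⟩
      have h := (MemLp.time_smul hm (Lp.memLp f)).coeFn_toLp
      filter_upwards [h, ae_muTime_mem T] with t ht htT
      refine (congrArg norm ht).le.trans ?_
      rw [norm_smul]
      exact mul_le_mul_of_nonneg_right (hC t (Ioo_subset_Icc_self htT)) (norm_nonneg _))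

theorem coeFn_timeMul (hm : Continuous m) (f : Lp E 2 (muTime T)) :
    timeMul T hm f =ᵐ[muTime T] fun t => m t • f t :=
  (MemLp.time_smul hm (Lp.memLp f)).coeFn_toLp

end timeMul

/-! ### Density of the data of smooth functions -/

section

variable {k T : ℝ} {θ : ℝ → ℝ → ℝ}

theorem inner_toL2L2_l2Curve (hT : 0 ≤ T) (hθ : Sm θ) (u : L2L2 T) :
    inner ℝ u (toL2L2 T (l2Curve hT θ)) = pairQ T u θ := by
  rw [L2.inner_def, pairQ]
  refine integral_congr_ae ?_
  filter_upwards [coeFn_toL2L2 T (l2Curve hT θ), ae_muTime_mem T] with t ht htT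
  rw [ht, l2Curve_of_mem hT hθ (Ioo_subset_Icc_self htT)]

theorem IsTranspositionTest.isDirichlet (h : IsTranspositionTest T θ) : IsDirichlet T θ :=
  ⟨h.smooth, h.left, h.right⟩

theorem l2c_zero : l2c (fun _ => 0) = 0 := by
  have := l2c_smul 0 (continuous_const (y := (0 : ℝ)) (X := ℝ))
  simpa using this

theorem h10c_eq_zero {η : ℝ → ℝ} (hη : ContDiff ℝ ∞ η) (h : ∀ y ∈ Icc (0 : ℝ) 1, η y = 0) :
    h10c η = 0 := by
  refine h10_ext ?_
  rw [h10Val, h10c_val hη (h 0 (by simp)) (h 1 (by simp))]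
  refine (l2c_congr fun y hy => h y (Ioo_subset_Icc_self hy)).trans ?_
  exact l2c_zero

theorem deriv_eq_zero_of_forall {η : ℝ → ℝ} (h : ∀ y ∈ Icc (0 : ℝ) 1, η y = 0) {y : ℝ}
    (hy : y ∈ Ioo (0 : ℝ) 1) : deriv η y = 0 := by
  have : η =ᶠ[𝓝 y] fun _ => 0 := by
    filter_upwards [Icc_mem_nhds hy.1 hy.2] with z hz using h z hz
  rw [this.deriv_eq, deriv_const]

theorem dataMap_of_test (hT : 0 ≤ T) (h : IsTranspositionTest T θ) :
    dataMap k hT ⟨θ, h.isDirichlet⟩ = (0, 0, toL2L2 T (l2Curve hT (waveAdj k θ))) := by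
  have hs : Sm θ := h.smooth
  refine Prod.ext (h10c_eq_zero (hs.slice_fst T) h.final) (Prod.ext ?_ rfl)
  refine (l2c_congr fun y hy => ?_ : l2c (fun y => velocity k θ y T) = l2c fun _ => 0).trans l2c_zero
  have h1 : dy θ y T = 0 := deriv_eq_zero_of_forall h.final hy
  have hy' := Ioo_subset_Icc_self hy
  simp only [velocity, h1, h.final y hy', h.final_dt y hy']
  ring

/-- The closure of the set of data of smooth functions. -/
def dataClosure (k : ℝ) (hT : 0 ≤ T) : Submodule ℝ (H10 × L2 × L2L2 T) :=
  (LinearMap.range (dataMap k hT)).topologicalClosure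

theorem dataMap_mem_dataClosure (hT : 0 ≤ T) (θ : dirichlet T) :
    dataMap k hT θ ∈ dataClosure k hT :=
  Submodule.le_topologicalClosure _ (LinearMap.mem_range_self _ _)

theorem isClosed_dataClosure (k : ℝ) (hT : 0 ≤ T) :
    IsClosed (dataClosure k hT : Set (H10 × L2 × L2L2 T)) :=
  Submodule.isClosed_topologicalClosure _

/-- If u is orthogonal to all sources that belong to the closure with zero final data, the backward
tests make αu orthogonal to all products of functions of the characteristic coordinates. Then αu =
0, so u = 0, and a closed subspace with trivial orthogonal complement is everything. -/
theorem source_mem_dataClosure (hk : 0 < k) (hk1 : k < 1) (hT : 0 ≤ T) (g : L2L2 T) :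
    ((0 : H10), (0 : L2), g) ∈ dataClosure k hT := by
  set P : Submodule ℝ (L2L2 T) := (dataClosure k hT).comap
    ((LinearMap.inr ℝ H10 (L2 × L2L2 T)).comp (LinearMap.inr ℝ L2 (L2L2 T))) with hP
  have hcl : IsClosed (P : Set (L2L2 T)) :=
    (isClosed_dataClosure k hT).preimage
      (f := fun g : L2L2 T => ((0 : H10), (0 : L2), g)) (by fun_prop)
  have htop : P = ⊤ := by
    rw [← hcl.submodule_topologicalClosure_eq, Submodule.topologicalClosure_eq_top_iff,
      Submodule.eq_bot_iff]
    intro u hu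
    have hα := (contDiff_alpha k).continuous
    have hW := coeFn_timeMul (T := T) hα u
    have h0 : (⇑(timeMul T hα u)) =ᵐ[muTime T] 0 := by
      refine ae_eq_zero_of_forall_charBox hk hk1 (Lp.memLp _) fun a₁ a₂ b₁ b₂ hb f₁ f₂ h₁ h₂ s₁ s₂ => ?_
      obtain ⟨θ, hθ, hwave⟩ := exists_backward_test hb hk hk1 h₁ h₂ s₁ s₂
      have hmem : toL2L2 T (l2Curve hT (waveAdj k θ)) ∈ P := by
        have := dataMap_mem_dataClosure (k := k) hT ⟨θ, hθ.isDirichlet⟩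
        rwa [dataMap_of_test hT hθ] at this
      have hs : Sm θ := hθ.smooth
      have horth := (Submodule.mem_orthogonal' _ _).1 hu _ hmem
      rw [inner_toL2L2_l2Curve hT (hs.waveAdj k)] at horth
      have hF : Sm fun y t => f₁ (charS k 1 y t) * f₂ (charS k (-1) y t) :=
        (Sm.comp h₁ (Sm.charS k 1)).mul (Sm.comp h₂ (Sm.charS k (-1)))
      have e1 : pairQ T u (waveAdj k θ) = pairQ T u (fun y t => 4 * k ^ 2 *
          (alpha k t * (f₁ (charS k 1 y t) * f₂ (charS k (-1) y t)))) :=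
        pairQ_congr fun y hy t ht => hwave y hy t (Ioo_subset_Icc_self ht)
      rw [e1, pairQ_const_mul _ ((Sm.alpha k).mul hF).continuous] at horth
      have h4 : 4 * k ^ 2 ≠ 0 := by positivity
      refine Eq.trans ?_ ((mul_eq_zero.1 horth).resolve_left h4)
      refine integral_congr_ae ?_
      filter_upwards [hW] with t ht
      rw [ht, l2c_smul _ (hF.continuous_fst t), inner_smul_left, inner_smul_right]
      rfl
    refine Lp.eq_zero_iff_ae_eq_zero.2 ?_
    filter_upwards [h0, hW, ae_muTime_mem T] with t h1 h2 h3
    rw [h1] at h2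
    exact (smul_eq_zero.1 h2.symm).resolve_left (alpha_pos hk h3.1.le).ne'
  have : g ∈ P := htop ▸ Submodule.mem_top
  exact this

theorem isBump_h10c_mem_dataClosure (hk : 0 < k) (hk1 : k < 1) (hT : 0 ≤ T) {η ξ : ℝ → ℝ}
    (hη : IsBump 1 η) (hξ : IsBump 1 ξ) :
    (h10c η, l2c ξ, (0 : L2L2 T)) ∈ dataClosure k hT := by
  -- With θ = η + (t - T)ζ the velocity at T is ζ - (2k/α(T))(η + yη'); this ζ makes it equal to ξ.
  -- The source of θ is then subtracted.
  set ζ : ℝ → ℝ := fun y => ξ y + (2 * k * invAlpha k T) * (η y + y * deriv η y)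
  have hζ : IsBump 1 ζ :=
    hξ.add ((hη.add (hη.deriv.mul_left contDiff_id)).const_mul _)
  have hs1 : ContDiff ℝ ∞ fun t : ℝ => t - T := by fun_prop
  have hs : Sm fun y t => η y + (t - T) * ζ y :=
    (Sm.of_fst hη.smooth).add ((Sm.of_snd hs1).mul (Sm.of_fst hζ.smooth))
  have hz : ∀ {f : ℝ → ℝ}, IsBump 1 f → f 0 = 0 ∧ f 1 = 0 := fun hf =>
    ⟨hf.eq_zero (by simp), hf.eq_zero (by simp)⟩
  have hd : IsDirichlet T fun y t => η y + (t - T) * ζ y :=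
    ⟨hs, fun t _ => by simp [(hz hη).1, (hz hζ).1], fun t _ => by simp [(hz hη).2, (hz hζ).2]⟩
  have h1 := dataMap_mem_dataClosure (k := k) hT ⟨_, hd⟩
  have h2 := source_mem_dataClosure hk hk1 hT
    (toL2L2 T (l2Curve hT (waveAdj k fun y t => η y + (t - T) * ζ y)))
  have h3 := Submodule.sub_mem _ h1 h2
  have e1 : (fun y => η y + (T - T) * ζ y) = η := by funext y; simp
  have ed : ∀ y, dt (fun y t => η y + (t - T) * ζ y) y T = ζ y := fun y => by
    have : HasDerivAt (fun t => η y + (t - T) * ζ y) (1 * ζ y) T :=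
      (((hasDerivAt_id T).sub_const T).mul_const (ζ y)).const_add _
    rw [dt, this.deriv, one_mul]
  have ey : ∀ y, dy (fun y t => η y + (t - T) * ζ y) y T = deriv η y := fun y => by
    simp only [dy, e1]
  have e2 : (fun y => velocity k (fun y t => η y + (t - T) * ζ y) y T) = ξ := by
    funext y
    rw [velocity, ed, ey]
    simp only [ζ]; ring
  have e3 : dataMap k hT ⟨_, hd⟩ = (h10c η, l2c ξ,
      toL2L2 T (l2Curve hT (waveAdj k fun y t => η y + (t - T) * ζ y))) := by
    refine Prod.ext ?_ (Prod.ext ?_ rfl)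
    · exact congrArg h10c e1
    · exact congrArg l2c e2
  rw [e3] at h3
  simpa using h3

theorem dense_h10c (f : H10) : f ∈ closure {g : H10 | ∃ η, IsBump 1 η ∧ g = h10c η} := by
  rw [closure_subtype]
  have hf : f.1 ∈ closure (bumpPairs : Set (L2 × L2)) := by
    have h1 : H10 ≤ bumpPairs.topologicalClosure := H10_eq_closure.le
    exact h1 f.2
  refine closure_mono ?_ hf
  rintro _ ⟨η, hη, rfl⟩
  exact ⟨h10c η, ⟨η, hη, rfl⟩, h10c_val hη.smooth (hη.eq_zero (by simp)) (hη.eq_zero (by simp))⟩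

theorem denseRange_dataMap (hk : 0 < k) (hk1 : k < 1) (hT : 0 ≤ T) :
    DenseRange (dataMap k hT) := by
  have hcl := isClosed_dataClosure k hT
  have h0 : l2c (fun _ => 0) = 0 := l2c_zero
  have hb0 : h10c (fun _ => 0) = 0 := h10c_eq_zero contDiff_const fun _ _ => rfl
  have key : ∀ d, d ∈ dataClosure k hT := by
    rintro ⟨f, u, g⟩
    have h1 : (f, (0 : L2), (0 : L2L2 T)) ∈ dataClosure k hT := by
      refine closure_minimal (s := {g : H10 | ∃ η, IsBump 1 η ∧ g = h10c η})
        (t := {f : H10 | (f, (0 : L2), (0 : L2L2 T)) ∈ dataClosure k hT}) ?_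
        (hcl.preimage (f := fun f : H10 => (f, (0 : L2), (0 : L2L2 T))) (by fun_prop)) (dense_h10c f)
      rintro _ ⟨η, hη, rfl⟩
      have := isBump_h10c_mem_dataClosure (T := T) hk hk1 hT hη IsBump.zero
      rwa [h0] at this
    have h2 : ((0 : H10), u, (0 : L2L2 T)) ∈ dataClosure k hT := by
      refine (denseRange_bumpToLp 1).induction_on
        (p := fun u : L2 => ((0 : H10), u, (0 : L2L2 T)) ∈ dataClosure k hT) u
        (hcl.preimage (f := fun u : L2 => ((0 : H10), u, (0 : L2L2 T))) (by fun_prop)) fun ξ => ?_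
      have := isBump_h10c_mem_dataClosure (T := T) hk hk1 hT IsBump.zero ξ.2
      rwa [hb0] at this
    have h3 := source_mem_dataClosure hk hk1 hT g
    have := Submodule.add_mem _ (Submodule.add_mem _ h1 h2) h3
    simpa using this
  intro d
  have := key d
  rwa [dataClosure, ← SetLike.mem_coe, Submodule.topologicalClosure_coe, LinearMap.coe_range] at this

/-! ### Extension of the solution operators by density. -/

/-- The solution, as a function of a smooth function. -/
def posMap (k : ℝ) (hT : 0 ≤ T) : dirichlet T →ₗ[ℝ] (ℝ →ᵇ H10) where
  toFun θ := (solMap k hT θ).1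
  map_add' θ ζ := by rw [map_add]; rfl
  map_smul' c θ := by rw [map_smul]; rfl

/-- The time derivative, as a function of a smooth function. -/
def velMap (k : ℝ) (hT : 0 ≤ T) : dirichlet T →ₗ[ℝ] (ℝ →ᵇ L2) where
  toFun θ := (solMap k hT θ).2.1
  map_add' θ ζ := by rw [map_add]; rfl
  map_smul' c θ := by rw [map_smul]; rfl

/-- The trace, as a function of a smooth function. -/
def traceMap (k : ℝ) (hT : 0 ≤ T) : dirichlet T →ₗ[ℝ] Lp ℝ 2 (muTime T) where
  toFun θ := (solMap k hT θ).2.2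
  map_add' θ ζ := by rw [map_add]; rfl
  map_smul' c θ := by rw [map_smul]; rfl

/-- The solution of the backward problem, as a function of the final data and the source. -/
def adjPos (k : ℝ) (hT : 0 ≤ T) : (H10 × L2 × L2L2 T) →L[ℝ] (ℝ →ᵇ H10) :=
  LinearMap.extendOfNorm (F := ℝ →ᵇ H10) (posMap k hT) (dataMap k hT)

/-- The time derivative of the solution of the backward problem. -/
def adjVel (k : ℝ) (hT : 0 ≤ T) : (H10 × L2 × L2L2 T) →L[ℝ] (ℝ →ᵇ L2) :=
  LinearMap.extendOfNorm (F := ℝ →ᵇ L2) (velMap k hT) (dataMap k hT)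

/-- The trace `q_y(0, ·) / α²` of the solution of the backward problem. -/
def adjTrace (k : ℝ) (hT : 0 ≤ T) : (H10 × L2 × L2L2 T) →L[ℝ] Lp ℝ 2 (muTime T) :=
  LinearMap.extendOfNorm (F := Lp ℝ 2 (muTime T)) (traceMap k hT) (dataMap k hT)

theorem adjPos_dataMap (hk : 0 < k) (hk1 : k < 1) (hT : 0 < T) (θ : dirichlet T) :
    adjPos k hT.le (dataMap k hT.le θ) = (solMap k hT.le θ).1 := by
  obtain ⟨C, hC⟩ := exists_solMap_bound hk hk1 hT
  have hb : ∀ θ, ‖posMap k hT.le θ‖ ≤ C * ‖dataMap k hT.le θ‖ := fun θ =>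
    (norm_fst_le (solMap k hT.le θ)).trans (hC θ)
  exact LinearMap.extendOfNorm_eq (denseRange_dataMap hk hk1 hT.le) ⟨C, hb⟩ θ

theorem adjVel_dataMap (hk : 0 < k) (hk1 : k < 1) (hT : 0 < T) (θ : dirichlet T) :
    adjVel k hT.le (dataMap k hT.le θ) = (solMap k hT.le θ).2.1 := by
  obtain ⟨C, hC⟩ := exists_solMap_bound hk hk1 hT
  exact LinearMap.extendOfNorm_eq (f := velMap k hT.le) (denseRange_dataMap hk hk1 hT.le)
    ⟨C, fun θ => (norm_fst_le (solMap k hT.le θ).2).trans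
      ((norm_snd_le (solMap k hT.le θ)).trans (hC θ))⟩ θ

theorem adjTrace_dataMap (hk : 0 < k) (hk1 : k < 1) (hT : 0 < T) (θ : dirichlet T) :
    adjTrace k hT.le (dataMap k hT.le θ) = (solMap k hT.le θ).2.2 := by
  obtain ⟨C, hC⟩ := exists_solMap_bound hk hk1 hT
  exact LinearMap.extendOfNorm_eq (f := traceMap k hT.le) (denseRange_dataMap hk hk1 hT.le)
    ⟨C, fun θ => (norm_snd_le (solMap k hT.le θ).2).trans
      ((norm_snd_le (solMap k hT.le θ)).trans (hC θ))⟩ θ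

/-- A closed property of data and solutions holds as soon as it holds for smooth functions. -/
theorem adjoint_induction (hk : 0 < k) (hk1 : k < 1) (hT : 0 < T)
    {P : (H10 × L2 × L2L2 T) → (ℝ →ᵇ H10) → (ℝ →ᵇ L2) → Lp ℝ 2 (muTime T) → Prop}
    (hP : IsClosed {d | P d (adjPos k hT.le d) (adjVel k hT.le d) (adjTrace k hT.le d)})
    (h : ∀ θ : dirichlet T, P (dataMap k hT.le θ) (h10Curve hT.le θ.1) (l2Curve hT.le (dt θ.1))
      (lpc T fun t => invAlpha k t ^ 2 * dy θ.1 0 t)) (d : H10 × L2 × L2L2 T) :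
    P d (adjPos k hT.le d) (adjVel k hT.le d) (adjTrace k hT.le d) :=
  (denseRange_dataMap hk hk1 hT.le).induction_on
    (p := fun d => P d (adjPos k hT.le d) (adjVel k hT.le d) (adjTrace k hT.le d)) d hP
    fun θ => by
      rw [adjPos_dataMap hk hk1 hT, adjVel_dataMap hk hk1 hT, adjTrace_dataMap hk hk1 hT]; exact h θ

end

/-! ### The backward problem with general data -/

section

variable {k T : ℝ} {θ ζ : ℝ → ℝ → ℝ}

theorem continuous_integral_bcf {E : Type*} [NormedAddCommGroup E] [NormedSpace ℝ E] (a b : ℝ) :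
    Continuous fun u : ℝ →ᵇ E => ∫ s in a..b, u s := by
  refine (LipschitzWith.of_dist_le_mul (K := ‖b - a‖₊) fun u v => ?_).continuous
  have hi : ∀ u : ℝ →ᵇ E, IntervalIntegrable u volume a b := fun u =>
    u.continuous.intervalIntegrable _ _
  rw [dist_eq_norm, ← intervalIntegral.integral_sub (hi u) (hi v), mul_comm]
  refine intervalIntegral.norm_integral_le_of_norm_le_const fun s _ => ?_
  rw [← dist_eq_norm]
  exact BoundedContinuousFunction.dist_coe_le_dist s

/-- The relation between position and velocity is proved in integrated form, because that form is
closed under uniform convergence of both curves; differentiability is recovered afterwards. -/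
theorem adjoint_integral (hk : 0 < k) (hk1 : k < 1) (hT : 0 < T) (d : H10 × L2 × L2L2 T) {t : ℝ}
    (ht : t ∈ Icc 0 T) : h10Val (adjPos k hT.le d t)
      = h10Val (adjPos k hT.le d 0) + ∫ s in (0 : ℝ)..t, adjVel k hT.le d s := by
  refine adjoint_induction hk hk1 hT
    (P := fun _ q dq _ => h10Val (q t) = h10Val (q 0) + ∫ s in (0 : ℝ)..t, dq s) ?_ ?_ d
  · have c := (continuous_integral_bcf 0 t).comp (adjVel k hT.le).continuous
    have c1 : ∀ t : ℝ, Continuous fun d => h10ValL (adjPos k hT.le d t) := fun t =>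
      h10ValL.continuous.comp ((BoundedContinuousFunction.evalCLM ℝ t).continuous.comp
        (adjPos k hT.le).continuous)
    exact isClosed_eq (c1 t) ((c1 0).add c)
  · intro θ
    have hθ : IsDirichlet T θ.1 := θ.2
    have h0 : (0 : ℝ) ∈ Icc 0 T := ⟨le_rfl, hT.le⟩
    rw [h10Val, h10Val, hθ.h10Curve_val, hθ.h10Curve_val, clamp_eq ht, clamp_eq h0]
    have h1 : ∫ s in (0 : ℝ)..t, l2Curve hT.le (dt θ.1) s
        = ∫ s in (0 : ℝ)..t, l2c fun y => dt θ.1 y s := by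
      refine intervalIntegral.integral_congr fun s hs => ?_
      rw [uIcc_of_le ht.1] at hs
      exact l2Curve_of_mem hT.le hθ.smooth.dt ⟨hs.1, hs.2.trans ht.2⟩
    rw [h1, intervalIntegral.integral_eq_sub_of_hasDerivAt
      (fun s _ => hasDerivAt_l2c_curve hθ.smooth s)
      ((continuous_l2c_curve hθ.smooth.dt.continuous).intervalIntegrable _ _)]
    abel

theorem adjoint_hasDeriv (hk : 0 < k) (hk1 : k < 1) (hT : 0 < T) (d : H10 × L2 × L2L2 T) {t : ℝ}
    (ht : t ∈ Icc 0 T) : HasDerivWithinAt (fun s => h10Val (adjPos k hT.le d s))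
      (adjVel k hT.le d t) (Icc 0 T) t := by
  have hc := (adjVel k hT.le d).continuous
  have h1 : HasDerivAt (fun t => h10Val (adjPos k hT.le d 0)
      + ∫ s in (0 : ℝ)..t, adjVel k hT.le d s) (adjVel k hT.le d t) t :=
    (intervalIntegral.integral_hasDerivAt_right (hc.intervalIntegrable _ _)
      (hc.stronglyMeasurableAtFilter _ _) hc.continuousAt).const_add _
  exact h1.hasDerivWithinAt.congr (fun s hs => adjoint_integral hk hk1 hT d hs)
    (adjoint_integral hk hk1 hT d ht)

/-- `θ'' + L θ`, as a smooth function. -/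
def waveL (k : ℝ) (θ : ℝ → ℝ → ℝ) (y t : ℝ) : ℝ := invAlpha k t ^ 2 * waveNum k θ y t

theorem Sm.waveL (h : Sm θ) (k : ℝ) : Sm (waveL k θ) := ((Sm.invAlpha k).pow 2).mul (h.waveNum k)

theorem weak_eq_pairQ (h : Sm θ) (hk : 0 < k) (q : ℝ → L2) :
    ∫ t in Ioo 0 T, ∫ y, q t y * (dt (dt θ) y t + opL k θ y t) ∂muOmega
      = pairQ T q (waveL k θ) := by
  refine integral_congr_ae ?_
  filter_upwards [ae_muTime_mem T] with t ht
  rw [inner_l2c _ ((h.waveL k).continuous_fst t)]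
  simp only [wave_opL_eq h hk ht.1.le]
  rfl

theorem source_eq_pairQ (h : Sm θ) (F : ℝ → L2) :
    ∫ t in Ioo 0 T, ∫ y, F t y * θ y t ∂muOmega = pairQ T F θ := by
  refine integral_congr_ae (Eventually.of_forall fun t => ?_)
  exact (inner_l2c _ (h.continuous_fst t)).symm

theorem IsInteriorTest.sm (h : IsInteriorTest T ζ) : Sm ζ := h.smooth

theorem IsInteriorTest.eq_zero (h : IsInteriorTest T ζ) {y t : ℝ}
    (hyt : (y, t) ∉ Ioo (0 : ℝ) 1 ×ˢ Ioo (0 : ℝ) T) :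
    ζ y t = 0 ∧ charD k (-1) ζ y t = 0 := by
  have hn : (y, t) ∉ tsupport fun z : ℝ × ℝ => ζ z.1 z.2 := fun h' => hyt (h.support h')
  have hev : (fun z : ℝ × ℝ => ζ z.1 z.2) =ᶠ[𝓝 (y, t)] 0 := notMem_tsupport_iff_eventuallyEq.1 hn
  have h1 : (fun z => ζ z t) =ᶠ[𝓝 y] fun _ => 0 :=
    (continuous_id.prodMk continuous_const : Continuous fun z : ℝ => (z, t)).continuousAt.eventually
      hev
  have h2 : (fun s => ζ y s) =ᶠ[𝓝 t] fun _ => 0 :=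
    (continuous_const.prodMk continuous_id : Continuous fun s : ℝ => (y, s)).continuousAt.eventually
      hev
  refine ⟨image_eq_zero_of_notMem_tsupport (f := fun z : ℝ × ℝ => ζ z.1 z.2) hn, ?_⟩
  rw [charD, dt, dy, h1.deriv_eq, h2.deriv_eq]; simp

theorem charD_invAlpha_sq (hk : 0 < k) {t : ℝ} (ht : 0 ≤ t) (e y : ℝ) :
    charD k e (fun _ t => invAlpha k t ^ 2) y t = -2 * k * invAlpha k t ^ 2 := by
  rw [charD_pow (Sm.invAlpha k), charD_invAlpha hk ht]; push_cast; ring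

/-- Green's formula against test functions in the interior. -/
theorem integral_mul_waveL (hk : 0 < k) (hT : 0 < T) (h : Sm θ) (hζ : IsInteriorTest T ζ) :
    ∫ t in (0 : ℝ)..T, ∫ y in (0 : ℝ)..1, θ y t * waveL k ζ y t
      = ∫ t in (0 : ℝ)..T, ∫ y in (0 : ℝ)..1, waveAdj k θ y t * ζ y t := by
  have si := (Sm.invAlpha k).pow 2
  have sw := hζ.sm.charD k (-1)
  have su := h.riem k (-1)
  set C : ℝ → ℝ → ℝ := fun y t => invAlpha k t ^ 2 * (θ y t * charD k (-1) ζ y t) with hC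
  set E : ℝ → ℝ → ℝ := fun y t => invAlpha k t ^ 2 * (riem k (-1) θ y t * ζ y t) with hE
  have sC : Sm C := si.mul (h.mul sw)
  have sE : Sm E := si.mul (su.mul hζ.sm)
  -- Two integrations by parts, one for each field: C moves D_1 from the test function to θ, and E
  -- moves D_{-1}. Both C and E vanish on the boundary of Q together with ζ and its first
  -- derivatives.
  have key : ∀ y ∈ Icc (0 : ℝ) 1, ∀ t ∈ Icc 0 T, θ y t * waveL k ζ y t
      = charD k 1 C y t + (-1 * charD k (-1) E y t + waveAdj k θ y t * ζ y t) := by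
    intro y _ t ht
    have ha := alpha_mul_invAlpha hk ht.1
    rw [hC, charD_mul si (h.mul sw), charD_mul h sw, charD_invAlpha_sq hk ht.1,
      hE, charD_mul si (su.mul hζ.sm), charD_mul su hζ.sm, charD_invAlpha_sq hk ht.1,
      charD_riem h (by norm_num) hk ht.1, waveL, waveNum]
    simp only [riem, neg_neg]
    linear_combination ((waveAdj k θ y t * ζ y t) * (alpha k t * invAlpha k t + 1)) * ha
  rw [rect_integral_congr zero_le_one hT.le key,
    rect_integral_add (sC.charD k 1) (((sE.charD k (-1)).const_mul (-1)).add
      ((h.waveAdj k).mul hζ.sm)),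
    rect_integral_add ((sE.charD k (-1)).const_mul (-1)) ((h.waveAdj k).mul hζ.sm),
    rect_integral_const_mul, integral_charD sC, integral_charD sE]
  have z : ∀ y t, (y, t) ∉ Ioo (0 : ℝ) 1 ×ˢ Ioo (0 : ℝ) T → C y t = 0 ∧ E y t = 0 := by
    intro y t hyt
    have := hζ.eq_zero (k := k) hyt
    simp [hC, hE, this.1, this.2]
  have z1 : ∀ y, C y T = 0 ∧ E y T = 0 := fun y => z y T (by simp)
  have z2 : ∀ y, C y 0 = 0 ∧ E y 0 = 0 := fun y => z y 0 (by simp)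
  have z3 : ∀ t, C 0 t = 0 ∧ E 0 t = 0 := fun t => z 0 t (by simp)
  have z4 : ∀ t, C 1 t = 0 ∧ E 1 t = 0 := fun t => z 1 t (by simp)
  simp only [(z1 _).1, (z1 _).2, (z2 _).1, (z2 _).2, (z3 _).1, (z3 _).2, (z4 _).1, (z4 _).2]
  simp

/-- The pairing of two smooth functions. -/
theorem pairQ_smooth (hT : 0 ≤ T) {V : ℝ → L2} (hθ : Sm θ)
    (hV : ∀ t ∈ Ioo 0 T, V t = l2c fun y => θ y t) (hζ : Sm ζ) :
    pairQ T V ζ = ∫ t in (0 : ℝ)..T, ∫ y in (0 : ℝ)..1, θ y t * ζ y t := by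
  rw [← integral_muTime hT]
  refine integral_congr_ae ?_
  filter_upwards [ae_muTime_mem T] with t ht
  rw [hV t ht, inner_l2c_l2c (hθ.continuous_fst t) (hζ.continuous_fst t)]

theorem continuous_pairQ_bcf (hT : 0 ≤ T) (hζ : Sm ζ) :
    Continuous fun u : ℝ →ᵇ L2 => pairQ T u ζ := by
  have h : ∀ u : ℝ →ᵇ L2, pairQ T u ζ = inner ℝ (toL2L2 T u) (toL2L2 T (l2Curve hT ζ)) := by
    intro u
    rw [inner_toL2L2_l2Curve hT hζ]
    refine integral_congr_ae ?_
    filter_upwards [coeFn_toL2L2 T u] with t ht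
    rw [ht]
  simp only [h]
  exact ((toL2L2 T).continuous).inner continuous_const

theorem continuous_pairQ_Lp (hT : 0 ≤ T) (hζ : Sm ζ) :
    Continuous fun u : L2L2 T => pairQ T u ζ := by
  simp only [← inner_toL2L2_l2Curve hT hζ]
  exact continuous_id.inner continuous_const

theorem pairQ_congr_ae {V W : ℝ → L2} (h : V =ᵐ[muTime T] W) : pairQ T V ζ = pairQ T W ζ := by
  refine integral_congr_ae ?_
  filter_upwards [h] with t ht
  rw [ht]

theorem adjoint_weak (hk : 0 < k) (hk1 : k < 1) (hT : 0 < T) (d : H10 × L2 × L2L2 T)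
    (hζ : IsInteriorTest T ζ) :
    pairQ T (fun t => h10Val (adjPos k hT.le d t)) (waveL k ζ) = pairQ T d.2.2 ζ := by
  refine adjoint_induction hk hk1 hT
    (P := fun d q _ _ => pairQ T (fun t => h10Val (q t)) (waveL k ζ) = pairQ T d.2.2 ζ) ?_ ?_ d
  · have c1 := (continuous_pairQ_bcf hT.le (hζ.sm.waveL k)).comp
      ((h10ValL.compLeftContinuousBounded ℝ).continuous.comp (adjPos k hT.le).continuous)
    exact isClosed_eq c1 ((continuous_pairQ_Lp hT.le hζ.sm).comp (by fun_prop))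
  · intro θ
    have hθ : IsDirichlet T θ.1 := θ.2
    rw [pairQ_smooth hT.le hθ.smooth (fun t ht => ?_) (hζ.sm.waveL k),
      integral_mul_waveL hk hT hθ.smooth hζ]
    · change _ = pairQ T (toL2L2 T (l2Curve hT.le (waveAdj k θ.1))) ζ
      rw [pairQ_congr_ae (coeFn_toL2L2 T _),
        pairQ_smooth hT.le (hθ.smooth.waveAdj k) (fun t ht => ?_) hζ.sm]
      exact l2Curve_of_mem hT.le (hθ.smooth.waveAdj k) (Ioo_subset_Icc_self ht)
    · rw [h10Val, hθ.h10Curve_val, clamp_eq (Ioo_subset_Icc_self ht)]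

theorem isAdjointState_adjPos (hk : 0 < k) (hk1 : k < 1) (hT : 0 < T) (d : H10 × L2 × L2L2 T)
    {F : ℝ → L2} (hF : d.2.2 =ᵐ[muTime T] F) :
    IsAdjointState k T F (adjPos k hT.le d) (adjVel k hT.le d) where
  cont := (adjPos k hT.le d).continuous.continuousOn
  cont_deriv := (adjVel k hT.le d).continuous.continuousOn
  hasDeriv _ ht := adjoint_hasDeriv hk hk1 hT d ht
  weak ζ hζ := by
    rw [weak_eq_pairQ hζ.sm hk, source_eq_pairQ hζ.sm, adjoint_weak hk hk1 hT d hζ,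
      pairQ_congr_ae hF]

/-! ### Final conditions and observability -/

theorem adjPos_final (hk : 0 < k) (hk1 : k < 1) (hT : 0 < T) (d : H10 × L2 × L2L2 T) :
    adjPos k hT.le d T = d.1 := by
  refine adjoint_induction hk hk1 hT (P := fun d q _ _ => q T = d.1) ?_ ?_ d
  · exact isClosed_eq ((BoundedContinuousFunction.evalCLM ℝ T).continuous.comp
        (adjPos k hT.le).continuous) continuous_fst
  · intro θ
    have hθ : IsDirichlet T θ.1 := θ.2
    exact clampCurve_of_mem hT.le hθ.continuousOn_h10c ⟨hT.le, le_rfl⟩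

/-- Pairing with a fixed η turns the final condition into a closed condition on the data;
`adjVel_final` then recovers the almost everywhere identity. -/
theorem adjVel_final_inner (hk : 0 < k) (hk1 : k < 1) (hT : 0 < T) (d : H10 × L2 × L2L2 T)
    {η : ℝ → ℝ} (hη : Continuous η) :
    inner ℝ (adjVel k hT.le d T) (l2c η)
      + (alpha k T)⁻¹ * (-2 * k) * (inner ℝ (h10Val d.1) (l2c η)
        + inner ℝ (h10Deriv d.1) (l2c fun y => y * η y)) = inner ℝ d.2.1 (l2c η) := by
  refine adjoint_induction hk hk1 hT (P := fun d _ dq _ => inner ℝ (dq T) (l2c η)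
    + (alpha k T)⁻¹ * (-2 * k) * (inner ℝ (h10Val d.1) (l2c η)
      + inner ℝ (h10Deriv d.1) (l2c fun y => y * η y)) = inner ℝ d.2.1 (l2c η)) ?_ ?_ d
  · have c1 : Continuous fun d => inner ℝ (adjVel k hT.le d T) (l2c η) :=
      ((BoundedContinuousFunction.evalCLM ℝ T).continuous.comp
        (adjVel k hT.le).continuous).inner continuous_const
    have c2 : Continuous fun d : H10 × L2 × L2L2 T => inner ℝ (h10ValL d.1) (l2c η) := by fun_prop
    have c3 : Continuous fun d : H10 × L2 × L2L2 T =>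
      inner ℝ (h10DerivL d.1) (l2c fun y => y * η y) := by fun_prop
    exact isClosed_eq (c1.add ((c2.add c3).const_mul _)) (by fun_prop)
  · intro θ
    have hθ : IsDirichlet T θ.1 := θ.2
    have hm : T ∈ Icc 0 T := ⟨hT.le, le_rfl⟩
    have hη' : Continuous fun y => y * η y := continuous_id.mul hη
    have c0 := hθ.smooth.continuous_fst T
    have c1 := hθ.smooth.dy.continuous_fst T
    have c2 := hθ.smooth.dt.continuous_fst T
    have c3 := (hθ.smooth.velocity k).continuous_fst T
    have d0 : Continuous fun y => θ.1 y T * η y := c0.mul hη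
    have d1 : Continuous fun y => StringControl.dy θ.1 y T * (y * η y) := c1.mul hη'
    have d2 : Continuous fun y => StringControl.dt θ.1 y T * η y := c2.mul hη
    have d3 : Continuous fun y => (alpha k T)⁻¹ * (-2 * k) * (θ.1 y T * η y
        + StringControl.dy θ.1 y T * (y * η y)) := (d0.add d1).const_mul _
    change inner ℝ (l2Curve hT.le (dt θ.1) T) (l2c η) + (alpha k T)⁻¹ * (-2 * k) *
      (inner ℝ (h10c fun y => θ.1 y T).1.1 (l2c η)
        + inner ℝ (h10c fun y => θ.1 y T).1.2 (l2c fun y => y * η y))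
      = inner ℝ (l2c fun y => velocity k θ.1 y T) (l2c η)
    rw [l2Curve_of_mem hT.le hθ.smooth.dt hm, hθ.h10c_slice hm, inner_l2c_l2c c2 hη,
      inner_l2c_l2c c0 hη, inner_l2c_l2c c1 hη', inner_l2c_l2c c3 hη,
      ← intervalIntegral.integral_add (d0.intervalIntegrable _ _)
        (d1.intervalIntegrable _ _), ← intervalIntegral.integral_const_mul,
      ← intervalIntegral.integral_add (d2.intervalIntegrable _ _)
        (d3.intervalIntegrable _ _)]
    refine intervalIntegral.integral_congr fun y _ => ?_
    simp only [velocity, invAlpha_eq_of_nonneg hk hT.le]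
    ring

theorem adjVel_final (hk : 0 < k) (hk1 : k < 1) (hT : 0 < T) (d : H10 × L2 × L2L2 T) :
    ∀ᵐ y ∂muOmega, adjVel k hT.le d T y
      + (deriv (gamma k) y * h10Val d.1 y + gamma k y * h10Deriv d.1 y) / alpha k T = d.2.1 y := by
  set u := adjVel k hT.le d T
  have hid : Continuous fun y : ℝ => y := continuous_id
  have m3 : MemLp (fun y => y * h10Deriv d.1 y) 2 muOmega :=
    MemLp.time_smul (T := 1) hid (Lp.memLp (h10Deriv d.1))
  set r : L2 := u + ((alpha k T)⁻¹ * (-2 * k)) • (h10Val d.1 + m3.toLp _) - d.2.1 with hr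
  have hr0 : r = 0 := by
    refine l2_eq_zero_of_forall_bump _ fun η hη => ?_
    have h1 := adjVel_final_inner hk hk1 hT d hη.continuous
    have hη' : Continuous fun y => y * η y := hid.mul hη.continuous
    have h2 : inner ℝ (m3.toLp _) (l2c η) = inner ℝ (h10Deriv d.1) (l2c fun y => y * η y) := by
      rw [inner_l2c _ hη.continuous, inner_l2c _ hη']
      refine integral_congr_ae ?_
      filter_upwards [m3.coeFn_toLp] with y hy
      rw [hy]; ring
    rw [hr, inner_sub_left, inner_add_left, inner_smul_left, inner_add_left, h2, ← h1]
    simp [u]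
  have hg : deriv (gamma k) = fun _ => -2 * k := by
    funext y
    have : gamma k = fun y => -2 * k * y := rfl
    rw [this]; simp
  have e0 := Lp.coeFn_sub (u + ((alpha k T)⁻¹ * (-2 * k)) • (h10Val d.1 + m3.toLp _)) d.2.1
  have e1 := Lp.coeFn_add u (((alpha k T)⁻¹ * (-2 * k)) • (h10Val d.1 + m3.toLp _))
  have e2 := Lp.coeFn_smul ((alpha k T)⁻¹ * (-2 * k)) (h10Val d.1 + m3.toLp _)
  have e3 := Lp.coeFn_add (h10Val d.1) (m3.toLp _)
  have e4 := Lp.eq_zero_iff_ae_eq_zero.1 hr0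
  filter_upwards [e0, e1, e2, e3, e4, m3.coeFn_toLp] with y h0 h1 h2 h3 h4 h5
  have h6 : u y + (alpha k T)⁻¹ * (-2 * k) * (h10Val d.1 y + y * h10Deriv d.1 y) - d.2.1 y = 0 := by
    rw [hr] at h4
    rw [h0, Pi.sub_apply, h1, Pi.add_apply, h2, Pi.smul_apply, h3, Pi.add_apply, h5] at h4
    simpa using h4
  rw [hg, gamma]
  have : (alpha k T)⁻¹ * (-2 * k) * (h10Val d.1 y + y * h10Deriv d.1 y)
      = (-2 * k * h10Val d.1 y + -2 * k * y * h10Deriv d.1 y) / alpha k T := by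
    rw [div_eq_inv_mul]; ring
  linarith

/-- The trace determines the data: the inverse inequality. -/
theorem exists_observability_data (hk : 0 < k) (hk1 : k < 1) (hT : 2 / (1 - k) < T) (hT0 : 0 < T) :
    ∃ C : ℝ, 0 < C ∧ ∀ d : H10 × L2 × L2L2 T,
      ‖d.1‖ + ‖d.2.1‖ ≤ C * (‖adjTrace k hT0.le d‖ + ‖d.2.2‖) := by
  obtain ⟨C, hC0, hC⟩ := exists_data_le_trace hk hk1 hT hT0
  refine ⟨C, hC0, fun d => ?_⟩
  refine adjoint_induction hk hk1 hT0
    (P := fun d _ _ c => ‖d.1‖ + ‖d.2.1‖ ≤ C * (‖c‖ + ‖d.2.2‖)) ?_ hC d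
  exact isClosed_le (by fun_prop) (by fun_prop)

/-! ### The normal trace -/

theorem tendsto_clm_of_dense {X Y : Type*} [SeminormedAddCommGroup X] [NormedSpace ℝ X]
    [SeminormedAddCommGroup Y] [NormedSpace ℝ Y] {ι : Type*} {l : Filter ι} {L : ι → X →L[ℝ] Y}
    {L₀ : X →L[ℝ] Y} {C : ℝ} (hb : ∀ᶠ i in l, ∀ x, ‖L i x‖ ≤ C * ‖x‖) {s : Set X} (hs : Dense s)
    (h : ∀ x ∈ s, Tendsto (fun i => L i x) l (𝓝 (L₀ x))) (x : X) :
    Tendsto (fun i => L i x) l (𝓝 (L₀ x)) := by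
  refine Metric.tendsto_nhds.2 fun ε hε => ?_
  set A := |C| + ‖L₀‖ + 1
  have hA : 0 < A := by positivity
  obtain ⟨x', hx', hd⟩ := hs.exists_dist_lt x (div_pos (half_pos hε) hA)
  filter_upwards [hb, Metric.tendsto_nhds.1 (h x' hx') (ε / 2) (half_pos hε)] with i h1 h2
  rw [dist_eq_norm] at hd h2 ⊢
  rw [lt_div_iff₀ hA] at hd
  have e : L i x - L₀ x = L i (x - x') + (L i x' - L₀ x') - L₀ (x - x') := by
    rw [map_sub, map_sub]; abel
  have h3 := h1 (x - x')
  have h4 := L₀.le_opNorm (x - x')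
  have h5 : C * ‖x - x'‖ ≤ |C| * ‖x - x'‖ :=
    mul_le_mul_of_nonneg_right (le_abs_self _) (norm_nonneg _)
  have h6 := norm_nonneg (x - x')
  rw [e]
  refine (norm_sub_le _ _).trans_lt ?_
  have := norm_add_le (L i (x - x')) (L i x' - L₀ x')
  simp only [A] at hd
  nlinarith

/-- The averages over `(0, ε)` of the space derivative. -/
def avgL (T ε : ℝ) : (ℝ →ᵇ H10) →L[ℝ] Lp ℝ 2 (muTime T) :=
  (BoundedContinuousFunction.toLp 2 (muTime T) ℝ).comp
    (ContinuousLinearMap.compLeftContinuousBounded ℝ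
      ((innerSL ℝ (ε⁻¹ • indicatorConstLp 2 (measurableSet_Ioo (a := 0) (b := ε))
        (measure_ne_top muOmega _) (1 : ℝ))).comp h10DerivL))

theorem coeFn_avgL {ε : ℝ} (hε : ε ≤ 1) (u : ℝ →ᵇ H10) :
    avgL T ε u =ᵐ[muTime T] fun t => ε⁻¹ * ∫ y in Ioo 0 ε, h10Deriv (u t) y := by
  refine (BoundedContinuousFunction.coeFn_toLp 2 (muTime T) ℝ _).trans
    (Eventually.of_forall fun t => ?_)
  change inner ℝ (ε⁻¹ • indicatorConstLp 2 measurableSet_Ioo (measure_ne_top muOmega _) (1 : ℝ))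
    (h10Deriv (u t)) = _
  rw [inner_smul_left, L2.inner_indicatorConstLp_one, Measure.restrict_restrict measurableSet_Ioo,
    Ioo_inter_Ioo, max_self, min_eq_left hε]
  rfl

theorem avgL_smooth (hT : 0 ≤ T) (h : IsDirichlet T θ) {ε : ℝ} (hε : ε ∈ Ioc (0 : ℝ) 1) :
    avgL T ε (h10Curve hT θ) = lpc T fun t => ε⁻¹ * ∫ y in (0 : ℝ)..ε, dy θ y t := by
  have hc := (h.smooth.dy.continuous_integral 0 ε).const_mul ε⁻¹
  refine Lp.ext ?_
  filter_upwards [coeFn_avgL hε.2 (h10Curve hT θ), coeFn_lpc hc, ae_muTime_mem T] with t h1 h2 ht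
  rw [h1, h2]
  congr 1
  rw [intervalIntegral.integral_of_le hε.1.le, integral_Ioc_eq_integral_Ioo]
  refine integral_congr_ae ?_
  have h3 := coeFn_l2c (h.smooth.dy.continuous_fst t)
  have h4 : (⇑(l2c fun y => dy θ y t)) =ᵐ[volume.restrict (Ioo 0 ε)] fun y => dy θ y t :=
    ae_mono (Measure.restrict_mono (Ioo_subset_Ioo_right hε.2) le_rfl) h3
  rw [h10Deriv, h.h10Curve_val, clamp_eq (Ioo_subset_Icc_self ht)]
  exact h4

/-- Uniform continuity of θ_y on the closed rectangle makes the averages converge uniformly in t;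
the factor α² undoes the α⁻² built into the trace. -/
theorem tendsto_avgL_smooth (hk : 0 < k) (hT : 0 < T) (h : IsDirichlet T θ) :
    Tendsto (fun ε => avgL T ε (h10Curve hT.le θ)) (𝓝[>] 0)
      (𝓝 (timeMul T ((contDiff_alpha k).continuous.pow 2)
        (lpc T fun t => invAlpha k t ^ 2 * dy θ 0 t))) := by
  have e : timeMul T ((contDiff_alpha k).continuous.pow 2)
      (lpc T fun t => invAlpha k t ^ 2 * dy θ 0 t) = lpc T fun t => dy θ 0 t := by
    refine Lp.ext ?_
    filter_upwards [coeFn_timeMul ((contDiff_alpha k).continuous.pow 2)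
      (lpc T fun t => invAlpha k t ^ 2 * dy θ 0 t), coeFn_lpc (h.smooth.continuous_trace k),
      coeFn_lpc (h.smooth.dy.continuous_snd 0), ae_muTime_mem T] with t h1 h2 h3 ht
    rw [h1, h2, h3]
    have := alpha_mul_invAlpha hk ht.1.le
    simp only [Pi.pow_apply, smul_eq_mul]
    linear_combination (dy θ 0 t * (alpha k t * invAlpha k t + 1)) * this
  rw [e]
  refine Metric.tendsto_nhds.2 fun η hη => ?_
  have hK : IsCompact (Icc (0 : ℝ) 1 ×ˢ Icc (0 : ℝ) T) := isCompact_Icc.prod isCompact_Icc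
  set B := ((muTime T).real univ) ^ ((2 : ℝ≥0∞).toReal)⁻¹
  have hB : 0 ≤ B := by positivity
  obtain ⟨δ, hδ, hu⟩ := Metric.uniformContinuousOn_iff.1
    (hK.uniformContinuousOn_of_continuous h.smooth.dy.continuous.continuousOn) (η / (2 * (B + 1)))
    (by positivity)
  have hnear : ∀ᶠ ε in 𝓝[>] (0 : ℝ), ε ∈ Ioo 0 (min δ 1) :=
    Ioo_mem_nhdsGT (lt_min hδ one_pos)
  filter_upwards [hnear] with ε hε
  have hε1 : ε ∈ Ioc (0 : ℝ) 1 := ⟨hε.1, (hε.2.trans_le (min_le_right _ _)).le⟩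
  have hεδ : ε < δ := hε.2.trans_le (min_le_left _ _)
  have hc := (h.smooth.dy.continuous_integral 0 ε).const_mul ε⁻¹
  have hc0 := h.smooth.dy.continuous_snd 0
  rw [avgL_smooth hT.le h hε1, dist_eq_norm, ← lpc_sub hc hc0]
  have hbd : ‖lpc T fun t => ε⁻¹ * (∫ y in (0 : ℝ)..ε, dy θ y t) - dy θ 0 t‖
      ≤ B * (η / (2 * (B + 1))) := by
    refine Lp.norm_le_of_ae_bound (by positivity) ?_
    filter_upwards [coeFn_lpc (T := T) (hc.sub hc0), ae_muTime_mem T] with t h1 ht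
    refine (congrArg norm h1).le.trans ?_
    have e2 : ε⁻¹ * (∫ y in (0 : ℝ)..ε, dy θ y t) - dy θ 0 t
        = ε⁻¹ * ∫ y in (0 : ℝ)..ε, (dy θ y t - dy θ 0 t) := by
      rw [intervalIntegral.integral_sub ((h.smooth.dy.continuous_fst t).intervalIntegrable _ _)
        (by simp), intervalIntegral.integral_const, sub_zero, smul_eq_mul]
      have := hε.1.ne'
      field_simp
    change ‖ε⁻¹ * (∫ y in (0 : ℝ)..ε, dy θ y t) - dy θ 0 t‖ ≤ _
    rw [e2, norm_mul, norm_inv, Real.norm_of_nonneg hε.1.le, inv_mul_le_iff₀ hε.1, mul_comm ε]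
    have := intervalIntegral.norm_integral_le_of_norm_le_const (a := 0) (b := ε)
      (f := fun y => dy θ y t - dy θ 0 t) (C := η / (2 * (B + 1))) fun y hy => ?_
    · rwa [sub_zero, abs_of_pos hε.1] at this
    · rw [uIoc_of_le hε.1.le] at hy
      have := hu (y, t) ⟨⟨hy.1.le, hy.2.trans hε1.2⟩, Ioo_subset_Icc_self ht⟩
        (0, t) ⟨⟨le_rfl, zero_le_one⟩, Ioo_subset_Icc_self ht⟩ (by
          rw [Prod.dist_eq, dist_self, Real.dist_eq, sub_zero, abs_of_pos hy.1]
          exact max_lt (hy.2.trans_lt hεδ) hδ)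
      exact (Real.dist_eq _ _ ▸ this).le
  refine hbd.trans_lt ?_
  rw [mul_div_assoc', div_lt_iff₀ (by positivity)]
  nlinarith

/-- The averages are bounded uniformly in ε by the data (`exists_average_bound`) and converge for
smooth functions, whose data are dense. -/
theorem tendsto_avgL_adjPos (hk : 0 < k) (hk1 : k < 1) (hT : 0 < T) (d : H10 × L2 × L2L2 T) :
    Tendsto (fun ε => avgL T ε (adjPos k hT.le d)) (𝓝[>] 0)
      (𝓝 (timeMul T ((contDiff_alpha k).continuous.pow 2) (adjTrace k hT.le d))) := by
  obtain ⟨C, hC0, hC⟩ := exists_average_bound hk hk1 hT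
  refine tendsto_clm_of_dense (L := fun ε => (avgL T ε).comp (adjPos k hT.le))
    (L₀ := (timeMul T ((contDiff_alpha k).continuous.pow 2)).comp (adjTrace k hT.le)) (C := C) ?_
    (denseRange_dataMap hk hk1 hT.le) ?_ d
  · have hnear : ∀ᶠ ε in 𝓝[>] (0 : ℝ), ε ∈ Ioo 0 (1 / 2) := Ioo_mem_nhdsGT (by norm_num)
    filter_upwards [hnear] with ε hε d
    refine adjoint_induction hk hk1 hT (P := fun d q _ _ => ‖avgL T ε q‖ ≤ C * ‖d‖) ?_ ?_ d
    · exact isClosed_le (by fun_prop) (by fun_prop)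
    · intro θ
      have hθ : IsDirichlet T θ.1 := θ.2
      have hε1 : ε ∈ Ioc (0 : ℝ) 1 := ⟨hε.1, by linarith [hε.2]⟩
      refine abs_le_of_sq_le_sq' ?_ (by positivity) |>.2
      rw [avgL_smooth hT.le hθ hε1,
        norm_sq_lpc hT.le ((hθ.smooth.dy.continuous_integral 0 ε).const_mul ε⁻¹)]
      exact hC θ ε ⟨hε.1, hε.2.le⟩
  · rintro _ ⟨θ, rfl⟩
    have hθ : IsDirichlet T θ.1 := θ.2
    have := tendsto_avgL_smooth hk hT hθ
    simp only [ContinuousLinearMap.comp_apply, adjPos_dataMap hk hk1 hT, adjTrace_dataMap hk hk1 hT]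
    exact this

theorem isNormalTrace_adjPos (hk : 0 < k) (hk1 : k < 1) (hT : 0 < T) (d : H10 × L2 × L2L2 T)
    {n : ℝ → ℝ} (hn : n =ᵐ[muTime T] fun t => -(alpha k t ^ 2 * adjTrace k hT.le d t)) :
    IsNormalTrace T (adjPos k hT.le d) n := by
  set g := timeMul T ((contDiff_alpha k).continuous.pow 2) (adjTrace k hT.le d)
  have hg : g =ᵐ[muTime T] fun t => -n t := by
    filter_upwards [hn, coeFn_timeMul ((contDiff_alpha k).continuous.pow 2)
      (adjTrace k hT.le d)] with t h1 h2
    rw [h2, h1]; simp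
  have hmem : MemLp n 2 (muTime T) := by
    refine (memLp_congr_ae ?_).1 (Lp.memLp g).neg
    filter_upwards [hg] with t ht
    rw [Pi.neg_apply, ht, neg_neg]
  refine ⟨hmem, ?_⟩
  have h := tendsto_avgL_adjPos hk hk1 hT d
  rw [tendsto_iff_edist_tendsto_0] at h
  refine h.congr' ?_
  have hnear : ∀ᶠ ε in 𝓝[>] (0 : ℝ), ε ∈ Ioo 0 1 := Ioo_mem_nhdsGT one_pos
  filter_upwards [hnear] with ε hε
  rw [Lp.edist_def]
  refine eLpNorm_congr_ae ?_
  filter_upwards [coeFn_avgL hε.2.le (adjPos k hT.le d), hg] with t h1 h2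
  change avgL T ε (adjPos k hT.le d) t - g t = _
  rw [h1, h2, sub_neg_eq_add]

end

/-! ### Waves emitted from the moving end -/

section

variable {k T : ℝ} {θ : ℝ → ℝ → ℝ}

/-- The adjoint of `q ↦ -(1 - e k y) q_y`. -/
def flux (k e : ℝ) : H10 →L[ℝ] L2 :=
  ((timeMul 1 (m := fun y => 1 - e * k * y) (by fun_prop) : L2 →L[ℝ] L2).comp h10DerivL)
    - (e * k) • h10ValL

/-- `flux k e h` is the derivative of (1 - eky)h, so this is one integration by parts, without
boundary term because h is in `H10`. Here `timeMul 1` acts as multiplication by a function of y,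
since `muTime 1` is the measure of `L2`. -/
theorem inner_flux (k e : ℝ) {q : ℝ → ℝ} (hq : ContDiff ℝ ∞ q) (h : H10) :
    inner ℝ (l2c q) (flux k e h)
      = -inner ℝ (h10Val h) (l2c fun y => (1 - e * k * y) * deriv q y) := by
  have hm : ContDiff ℝ ∞ fun y : ℝ => 1 - e * k * y := by fun_prop
  have hmq : ContDiff ℝ ∞ fun y => (1 - e * k * y) * q y := hm.mul hq
  have h1 := inner_h10Val_deriv hmq h
  have hd : deriv (fun y => (1 - e * k * y) * q y)
      = fun y => (1 - e * k * y) * deriv q y - e * k * q y := by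
    funext y
    have h2 : HasDerivAt (fun y : ℝ => 1 - e * k * y) (-(e * k)) y := by
      simpa using ((hasDerivAt_id y).const_mul (e * k)).const_sub 1
    have h3 := (hq.differentiable (by simp) y).hasDerivAt
    have h4 : HasDerivAt (fun y => (1 - e * k * y) * q y)
      (-(e * k) * q y + (1 - e * k * y) * deriv q y) y := h2.mul h3
    rw [h4.deriv]; ring
  have c1 : Continuous fun y => (1 - e * k * y) * deriv q y :=
    hm.continuous.mul (deriv_smooth hq).continuous
  rw [hd, l2c_sub c1 (hq.continuous.const_mul _), l2c_smul _ hq.continuous, inner_sub_right,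
    inner_smul_right] at h1
  have h5 : inner ℝ (l2c q) ((timeMul 1 (m := fun y => 1 - e * k * y) hm.continuous :
      L2 →L[ℝ] L2) (h10Deriv h)) = inner ℝ (h10Deriv h) (l2c fun y => (1 - e * k * y) * q y) := by
    rw [real_inner_comm, inner_l2c _ hq.continuous, inner_l2c _ hmq.continuous]
    refine integral_congr_ae ?_
    filter_upwards [coeFn_timeMul (T := 1) hm.continuous (h10Deriv h)] with y hy
    rw [hy, smul_eq_mul]; ring
  have h6 : flux k e h = (timeMul 1 (m := fun y => 1 - e * k * y) hm.continuous :
      L2 →L[ℝ] L2) (h10Deriv h) - (e * k) • h10Val h := rfl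
  rw [h6, inner_sub_right, h5, inner_smul_right, real_inner_comm (h10Val h)]
  linarith

/-- The functional `h ↦ (g, flux h)`. -/
def fluxL (k e : ℝ) : L2 →L[ℝ] Hm1 :=
  ((ContinuousLinearMap.compL ℝ H10 L2 ℝ).flip (flux k e)).comp (innerSL ℝ)

theorem fluxL_apply (k e : ℝ) (g : L2) (h : H10) : fluxL k e g h = inner ℝ g (flux k e h) := rfl

/-- The embedding of `L²` in `H⁻¹`, as a continuous linear map. -/
def l2ToHm1L : L2 →L[ℝ] Hm1 :=
  ((ContinuousLinearMap.compL ℝ H10 L2 ℝ).flip h10ValL).comp (innerSL ℝ)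

theorem l2ToHm1_apply (g : L2) (h : H10) : l2ToHm1 g h = inner ℝ g (h10Val h) := rfl

/-- The profile of the wave with its reflections. -/
def reflW (k : ℝ) (N : ℕ) (w : ℝ → ℝ) (s : ℝ) : ℝ :=
  ∑ j ∈ Finset.range (N + 1), w (((refl k)⁻¹ ^ j * s - 1) / k)

theorem contDiff_reflW (k : ℝ) (N : ℕ) {w : ℝ → ℝ} (hw : ContDiff ℝ ∞ w) :
    ContDiff ℝ ∞ (reflW k N w) := by
  refine ContDiff.sum fun j _ => hw.comp (by fun_prop)

theorem refl_inv_pow (hk : 0 < k) (hk1 : k < 1) (j : ℕ) :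
    0 < (refl k)⁻¹ ^ j ∧ (refl k)⁻¹ ^ j ≤ 1 := by
  have h := one_lt_refl hk hk1
  exact ⟨by positivity, pow_le_one₀ (by positivity) (inv_le_one_of_one_le₀ h.le)⟩

theorem reflW_eq_zero (hk : 0 < k) (hk1 : k < 1) (N : ℕ) {w : ℝ → ℝ} (hw : IsBump T w) {s : ℝ}
    (hs : s ≤ 1) : reflW k N w s = 0 := by
  refine Finset.sum_eq_zero fun j _ => hw.eq_zero fun h => ?_
  obtain ⟨h1, h2⟩ := refl_inv_pow hk hk1 j
  have h3 : 0 < (refl k)⁻¹ ^ j * s - 1 := by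
    have := mul_pos h.1 hk
    rwa [div_mul_cancel₀ _ hk.ne'] at this
  nlinarith

/-- A telescoping sum. At s = α(t) the left side is the value of the state at y = 0 and the first
term on the right is w(t). -/
theorem reflW_sub (N : ℕ) (w : ℝ → ℝ) (s : ℝ) :
    reflW k N w s - reflW k N w ((refl k)⁻¹ * s)
      = w ((s - 1) / k) - w (((refl k)⁻¹ ^ (N + 1) * s - 1) / k) := by
  have h : ∀ j, w (((refl k)⁻¹ ^ j * ((refl k)⁻¹ * s) - 1) / k)
      = w (((refl k)⁻¹ ^ (j + 1) * s - 1) / k) := fun j => by rw [pow_succ]; ring_nf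
  rw [reflW, reflW, ← Finset.sum_sub_distrib]
  simp only [h]
  rw [Finset.sum_range_sub' (fun j => w (((refl k)⁻¹ ^ j * s - 1) / k))]
  simp

theorem l2c_sum {ι : Type*} (s : Finset ι) {f : ι → ℝ → ℝ} (hf : ∀ i, Continuous (f i)) :
    l2c (fun y => ∑ i ∈ s, f i y) = ∑ i ∈ s, l2c (f i) := by
  classical
  induction s using Finset.induction_on with
  | empty => simpa using l2c_zero
  | insert i s hi ih =>
    simp only [Finset.sum_insert hi]
    rw [l2c_add (hf i) (continuous_finsetSum s fun j _ => hf j), ih]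

theorem norm_l2c_affine_le (hT : 0 ≤ T) {w : ℝ → ℝ} (hw : IsBump T w) {m b : ℝ} (hm : m ≠ 0) :
    ‖l2c fun y => w (m * y + b)‖ ^ 2 ≤ |m|⁻¹ * ‖lpc T w‖ ^ 2 := by
  have hc := hw.continuous
  have hc2 : Continuous fun x => w x ^ 2 := hc.pow 2
  have hi : Integrable fun x => w x ^ 2 := by
    refine hc2.integrable_of_hasCompactSupport ?_
    exact hw.compact.comp_left (g := fun x : ℝ => x ^ 2) (by norm_num)
  have htot : ∫ x, w x ^ 2 = ∫ x in (0 : ℝ)..T, w x ^ 2 := by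
    rw [intervalIntegral.integral_of_le hT]
    symm
    refine setIntegral_eq_integral_of_forall_compl_eq_zero fun x hx => ?_
    rw [hw.eq_zero fun h => hx ⟨h.1, h.2.le⟩]; norm_num
  have hbound : ∀ u v : ℝ, |∫ x in u..v, w x ^ 2| ≤ ∫ x, w x ^ 2 := by
    intro u v
    refine (intervalIntegral.norm_integral_le_integral_norm_uIoc (f := fun x => w x ^ 2)).trans ?_
    simp only [norm_pow, Real.norm_eq_abs, sq_abs]
    exact setIntegral_le_integral hi (Eventually.of_forall fun x => sq_nonneg _)
  have hcm : Continuous fun y => w (m * y + b) := hc.comp (by fun_prop)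
  rw [norm_sq_l2c hcm, norm_sq_lpc hT hc, ← htot]
  have h1 := intervalIntegral.integral_comp_mul_add (a := 0) (b := 1) (fun x => w x ^ 2) hm b
  rw [h1, smul_eq_mul]
  refine (le_abs_self _).trans ?_
  rw [abs_mul, abs_inv]
  exact mul_le_mul_of_nonneg_left (hbound _ _) (by positivity)

/-- The wave moving along the characteristics of slope `e`. -/
def travelFun (k : ℝ) (N : ℕ) (e c : ℝ) (w : ℝ → ℝ) (y t : ℝ) : ℝ :=
  reflW k N w (c * charS k e y t)

theorem Sm.travelFun (k : ℝ) (N : ℕ) (e c : ℝ) {w : ℝ → ℝ} (hw : ContDiff ℝ ∞ w) :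
    Sm (travelFun k N e c w) :=
  Sm.comp (contDiff_reflW k N hw) ((Sm.charS k e).const_mul c)

theorem charD_travelFun (k : ℝ) (N : ℕ) {e : ℝ} (he : e * e = 1) (c : ℝ) {w : ℝ → ℝ}
    (hw : ContDiff ℝ ∞ w) (y t : ℝ) : charD k e (travelFun k N e c w) y t = 0 := by
  have h := charD_comp (contDiff_reflW k N hw) ((Sm.charS k e).const_mul c) k e y t
  rw [charD_const_mul, charD_charS, he] at h
  refine Eq.trans h ?_
  ring

/-- Each of the N + 1 terms is w composed with an affine function of y whose slope has modulus
κ^(-j) c α ≥ κ^(-N) c. A change of variables bounds its L² norm, which allows the extension to all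
controls in L². -/
theorem norm_travelFun_le (hk : 0 < k) (hk1 : k < 1) (hT : 0 ≤ T) (N : ℕ) {e c : ℝ}
    (he : |e| = 1) (hc : 0 < c) {w : ℝ → ℝ} (hw : IsBump T w) {t : ℝ} (ht : 0 ≤ t) :
    ‖l2c fun y => travelFun k N e c w y t‖
      ≤ (N + 1) * √((refl k ^ N) * c⁻¹) * ‖lpc T w‖ := by
  have hκ := one_lt_refl hk hk1
  have hα := one_le_alpha hk ht
  have key : ∀ j ∈ Finset.range (N + 1),
      ‖l2c fun y => w (((refl k)⁻¹ ^ j * (c * charS k e y t) - 1) / k)‖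
        ≤ √((refl k ^ N) * c⁻¹) * ‖lpc T w‖ := by
    intro j hj
    have hj' : j ≤ N := Nat.lt_succ_iff.1 (Finset.mem_range.1 hj)
    have hr := (refl_inv_pow hk hk1 j).1
    set m := -e * ((refl k)⁻¹ ^ j * (c * alpha k t)) with hm
    have habs : |m| = (refl k)⁻¹ ^ j * (c * alpha k t) := by
      rw [hm, abs_mul, abs_neg, he, one_mul, abs_of_pos (by positivity)]
    have hm0 : m ≠ 0 := abs_pos.1 (by rw [habs]; positivity)
    have e1 : (fun y => w (((refl k)⁻¹ ^ j * (c * charS k e y t) - 1) / k))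
        = fun y => w (m * y + ((refl k)⁻¹ ^ j * (c * alpha k t) - 1) / k) := by
      funext y
      congr 1
      rw [hm, charS]; field_simp; ring
    have h1 := norm_l2c_affine_le hT hw (b := ((refl k)⁻¹ ^ j * (c * alpha k t) - 1) / k) hm0
    rw [← e1] at h1
    refine abs_le_of_sq_le_sq' (h1.trans ?_) (by positivity) |>.2
    rw [mul_pow, Real.sq_sqrt (by positivity)]
    refine mul_le_mul_of_nonneg_right ?_ (sq_nonneg _)
    rw [habs, mul_inv, inv_pow, inv_inv, mul_inv]
    refine mul_le_mul (pow_le_pow_right₀ hκ.le hj') ?_ (by positivity) (by positivity)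
    exact mul_le_of_le_one_right (by positivity) (inv_le_one_of_one_le₀ hα)
  have hcont : ∀ j : ℕ, Continuous fun y => w (((refl k)⁻¹ ^ j * (c * charS k e y t) - 1) / k) :=
    fun j => hw.continuous.comp
      (((((Sm.charS k e).continuous_fst t).const_mul c).const_mul _).sub continuous_const
        |>.div_const k)
  have h2 : (l2c fun y => travelFun k N e c w y t) = ∑ j ∈ Finset.range (N + 1),
      l2c fun y => w (((refl k)⁻¹ ^ j * (c * charS k e y t) - 1) / k) := l2c_sum
    (Finset.range (N + 1)) hcont
  rw [h2]
  refine (norm_sum_le_of_le _ key).trans ?_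
  rw [Finset.sum_const, Finset.card_range, nsmul_eq_mul]
  push_cast
  exact (mul_assoc _ _ _).ge

/-- The travelling wave as a function of a test function. -/
def travelMap (k : ℝ) (hT : 0 ≤ T) (N : ℕ) (e c : ℝ) : bumps T →ₗ[ℝ] (ℝ →ᵇ L2) where
  toFun w := l2Curve hT (travelFun k N e c w.1)
  map_add' w z := by
    have hw : IsBump T w.1 := w.2
    have hz : IsBump T z.1 := z.2
    refine l2Curve_add hT (Sm.travelFun k N e c hw.smooth) (Sm.travelFun k N e c hz.smooth)
      (Sm.travelFun k N e c (hw.add hz).smooth) fun y t => ?_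
    simp only [travelFun, reflW, ← Finset.sum_add_distrib]
    rfl
  map_smul' a w := by
    have hw : IsBump T w.1 := w.2
    refine l2Curve_smul hT a (Sm.travelFun k N e c hw.smooth)
      (Sm.travelFun k N e c (hw.const_mul a).smooth) fun y t => ?_
    simp only [travelFun, reflW, Finset.mul_sum]
    rfl

/-- A number of reflections that suffices up to the time `T`. -/
def reflCount (k T : ℝ) : ℕ := sInf {N : ℕ | alpha k T < refl k ^ (N : ℤ)}

theorem lt_reflCount (hk : 0 < k) (hk1 : k < 1) (T : ℝ) : alpha k T < refl k ^ reflCount k T := by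
  have h := Nat.sInf_mem (s := {N : ℕ | alpha k T < refl k ^ (N : ℤ)})
    (exists_refl_pow_gt hk hk1 _)
  rw [← zpow_natCast]; exact h

/-- The travelling wave emitted by a control in `L²(0, T)`. -/
def travel (k : ℝ) (hT : 0 ≤ T) (e c : ℝ) : Lp ℝ 2 (muTime T) →L[ℝ] (ℝ →ᵇ L2) :=
  LinearMap.extendOfNorm (F := ℝ →ᵇ L2) (travelMap k hT (reflCount k T) e c) (bumpToLp T)

theorem travel_bump (hk : 0 < k) (hk1 : k < 1) (hT : 0 ≤ T) {e c : ℝ} (he : |e| = 1) (hc : 0 < c)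
    (w : bumps T) : travel k hT e c (bumpToLp T w)
      = l2Curve hT (travelFun k (reflCount k T) e c w.1) := by
  have hb : ∀ w, ‖travelMap k hT (reflCount k T) e c w‖
      ≤ ((reflCount k T) + 1) * √((refl k ^ (reflCount k T)) * c⁻¹) * ‖bumpToLp T w‖ := by
    intro w
    have hw : IsBump T w.1 := w.2
    exact norm_clampCurve_le hT (continuous_l2c_curve
      (Sm.travelFun k (reflCount k T) e c hw.smooth).continuous).continuousOn
      fun t ht => norm_travelFun_le hk hk1 hT _ he hc hw ht.1
  exact LinearMap.extendOfNorm_eq (f := travelMap k hT (reflCount k T) e c)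
    (denseRange_bumpToLp T) ⟨_, hb⟩ w

/-- The wave emitted from the moving end. -/
def outWave (k T : ℝ) (w : ℝ → ℝ) : ℝ → ℝ → ℝ := travelFun k (reflCount k T) 1 1 w

/-- The wave reflected at the fixed end. -/
def inWave (k T : ℝ) (w : ℝ → ℝ) : ℝ → ℝ → ℝ := travelFun k (reflCount k T) (-1) (refl k)⁻¹ w

/-- The wave emitted from the moving end by a control in `L²(0, T)`. -/
def outL (k : ℝ) (hT : 0 ≤ T) : Lp ℝ 2 (muTime T) →L[ℝ] (ℝ →ᵇ L2) := travel k hT 1 1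

/-- The wave reflected at the fixed end for a control in `L²(0, T)`. -/
def inL (k : ℝ) (hT : 0 ≤ T) : Lp ℝ 2 (muTime T) →L[ℝ] (ℝ →ᵇ L2) :=
  travel k hT (-1) (refl k)⁻¹

theorem state_induction (hk : 0 < k) (hk1 : k < 1) (hT : 0 ≤ T)
    {P : Lp ℝ 2 (muTime T) → (ℝ →ᵇ L2) → (ℝ →ᵇ L2) → Prop}
    (hP : IsClosed {w | P w (outL k hT w) (inL k hT w)})
    (h : ∀ w, IsBump T w → P (lpc T w) (l2Curve hT (outWave k T w)) (l2Curve hT (inWave k T w)))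
    (w : Lp ℝ 2 (muTime T)) : P w (outL k hT w) (inL k hT w) := by
  have hκ := one_lt_refl hk hk1
  refine (denseRange_bumpToLp T).induction_on (p := fun w => P w (outL k hT w) (inL k hT w)) w hP
    fun w => ?_
  rw [outL, inL, travel_bump hk hk1 hT (by simp) one_pos, travel_bump hk hk1 hT (by simp)
    (by positivity)]
  exact h w.1 w.2

/-- The state, as a curve in `L²`. -/
def statePos (k : ℝ) (hT : 0 ≤ T) : Lp ℝ 2 (muTime T) →L[ℝ] (ℝ →ᵇ L2) := outL k hT - inL k hT

theorem statePos_apply (hT : 0 ≤ T) (w : Lp ℝ 2 (muTime T)) (t : ℝ) :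
    statePos k hT w t = outL k hT w t - inL k hT w t := rfl

theorem continuous_weighted_integral_bcf {E : Type*} [NormedAddCommGroup E] [NormedSpace ℝ E]
    {m : ℝ → ℝ} (hm : Continuous m) (hm1 : ∀ t, |m t| ≤ 1) (a b : ℝ) :
    Continuous fun u : ℝ →ᵇ E => ∫ s in a..b, m s • u s := by
  refine (LipschitzWith.of_dist_le_mul (K := ‖b - a‖₊) fun u v => ?_).continuous
  have hi : ∀ u : ℝ →ᵇ E, IntervalIntegrable (fun s => m s • u s) volume a b := fun u =>
    (hm.smul u.continuous).intervalIntegrable _ _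
  rw [dist_eq_norm, ← intervalIntegral.integral_sub (hi u) (hi v), mul_comm]
  refine intervalIntegral.norm_integral_le_of_norm_le_const fun s _ => ?_
  rw [← smul_sub, norm_smul, ← dist_eq_norm]
  exact (mul_le_of_le_one_left dist_nonneg (hm1 s)).trans
    (BoundedContinuousFunction.dist_coe_le_dist s)

theorem abs_invAlpha_clamp_le (hk : 0 < k) (hT : 0 ≤ T) (t : ℝ) :
    |invAlpha k (clamp T t)| ≤ 1 := by
  have h := (clamp_mem hT t).1
  rw [abs_of_pos (invAlpha_pos hk h)]
  exact invAlpha_le_one hk h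

theorem wave_eq_zero_at_zero (hk : 0 < k) (hk1 : k < 1) {w : ℝ → ℝ} (hw : IsBump T w) {y : ℝ}
    (hy : y ∈ Icc (0 : ℝ) 1) : outWave k T w y 0 = 0 ∧ inWave k T w y 0 = 0 := by
  have hκ := one_lt_refl hk hk1
  have hm := refl_mul hk1
  constructor
  · refine reflW_eq_zero hk hk1 _ hw ?_
    simp only [charS, alpha]
    have := mul_nonneg hk.le hy.1
    linarith
  · refine reflW_eq_zero hk hk1 _ hw ?_
    simp only [charS, alpha]
    rw [inv_mul_le_iff₀ (by linarith)]
    have : k * y ≤ k := mul_le_of_le_one_right hk.le hy.2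
    nlinarith

/-- Since κ⁻¹(1 + k) = 1 - k, the two arguments coincide at y = 1; this gives the Dirichlet
condition of the state there. -/
theorem wave_right (hk : 0 < k) (hk1 : k < 1) (w : ℝ → ℝ) (t : ℝ) :
    outWave k T w 1 t = inWave k T w 1 t := by
  have hκ := one_lt_refl hk hk1
  have hm := refl_mul hk1
  simp only [outWave, inWave, travelFun, charS]
  congr 1
  have : (refl k)⁻¹ * (1 + k) = 1 - k := by
    rw [← hm, mul_comm, mul_assoc, mul_inv_cancel₀ (by positivity), mul_one]
  linear_combination -alpha k t * this

/-- After telescoping, the leftover term has a negative argument, because κ^(N+1) > α(T) ≥ α(t) for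
N = `reflCount k T`; there w is zero. -/
theorem wave_left (hk : 0 < k) (hk1 : k < 1) {w : ℝ → ℝ} (hw : IsBump T w) {t : ℝ}
    (ht : t ∈ Icc 0 T) : outWave k T w 0 t - inWave k T w 0 t = w t := by
  have hκ := one_lt_refl hk hk1
  have e : ∀ e, charS k e 0 t = alpha k t := fun e => by simp [charS]
  simp only [outWave, inWave, travelFun, e, one_mul]
  rw [reflW_sub]
  have h1 : (alpha k t - 1) / k = t := by rw [alpha]; field_simp; ring
  have h2 : w (((refl k)⁻¹ ^ (reflCount k T + 1) * alpha k t - 1) / k) = 0 := by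
    refine hw.eq_zero fun h => ?_
    have h3 : 0 < (refl k)⁻¹ ^ (reflCount k T + 1) * alpha k t - 1 := by
      have := mul_pos h.1 hk
      rwa [div_mul_cancel₀ _ hk.ne'] at this
    have h4 := lt_reflCount hk hk1 T
    have h5 := alpha_mono hk ht.2
    have h6 : refl k ^ reflCount k T ≤ refl k ^ (reflCount k T + 1) :=
      pow_le_pow_right₀ hκ.le (Nat.le_succ _)
    rw [inv_pow, inv_mul_eq_div, sub_pos, lt_div_iff₀ (by positivity)] at h3
    linarith
  rw [h1, h2, sub_zero]

/-- From D_e q = 0 one gets q' = -(e/α)(1 - eky) q_y, and an integration by parts moves the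
derivative to the test element. The time derivative in `Hm1` is thus controlled by q in L², which
survives passage to rough controls. -/
theorem l2ToHm1_dt_travelFun (hk : 0 < k) {N : ℕ} {e : ℝ} (he : e * e = 1) (c : ℝ) {w : ℝ → ℝ}
    (hw : ContDiff ℝ ∞ w) {t : ℝ} (ht : 0 ≤ t) :
    l2ToHm1 (l2c fun y => dt (travelFun k N e c w) y t)
      = (invAlpha k t * e) • fluxL k e (l2c fun y => travelFun k N e c w y t) := by
  have hs := Sm.travelFun k N e c hw
  have ha := alpha_mul_invAlpha hk ht
  ext h
  rw [l2ToHm1_apply, _root_.smul_apply, fluxL_apply,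
    inner_flux k e (hs.slice_fst t)]
  have c1 : Continuous fun y => (1 - e * k * y) * deriv (fun z => travelFun k N e c w z t) y :=
    (by fun_prop : Continuous fun y : ℝ => 1 - e * k * y).mul (hs.dy.continuous_fst t)
  have e1 : (fun y => dt (travelFun k N e c w) y t) = fun y => (-(invAlpha k t * e)) *
      ((1 - e * k * y) * deriv (fun z => travelFun k N e c w z t) y) := by
    funext y
    have h0 := charD_travelFun k N he c hw y t
    rw [charD] at h0
    change _ = -(invAlpha k t * e) * ((1 - e * k * y) * dy (travelFun k N e c w) y t)
    linear_combination (-dt (travelFun k N e c w) y t) * ha + invAlpha k t * h0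
      + (-invAlpha k t * k * y * dy (travelFun k N e c w) y t) * he
  rw [e1, l2c_smul _ c1, inner_smul_left, real_inner_comm (h10Val h)]
  simp

section curve

variable {E : Type*} [NormedAddCommGroup E] [NormedSpace ℝ E] (Λ Φ Ψ : L2 →L[ℝ] E)

/-- The combination of the images of the two waves. -/
def waveCurve (k : ℝ) (hT : 0 ≤ T) (w : Lp ℝ 2 (muTime T)) (t : ℝ) : E :=
  invAlpha k (clamp T t) • (Φ (outL k hT w t) + Ψ (inL k hT w t))

theorem continuous_waveCurve (hT : 0 ≤ T) (w : Lp ℝ 2 (muTime T)) :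
    Continuous (waveCurve Φ Ψ k hT w) :=
  ((contDiff_invAlpha k).continuous.comp (continuous_clamp T)).smul
    ((Φ.continuous.comp (outL k hT w).continuous).add (Ψ.continuous.comp (inL k hT w).continuous))

/-- The image of the time derivative of the state is the combination of the images of the waves. -/
def WaveCompat (k T : ℝ) (w : ℝ → ℝ) (s : ℝ) : Prop :=
  Λ ((l2c fun y => dt (outWave k T w) y s) - l2c fun y => dt (inWave k T w) y s)
    = invAlpha k s • (Φ (l2c fun y => outWave k T w y s) + Ψ (l2c fun y => inWave k T w y s))

/-- The integrated relation is closed in the control, so smooth controls suffice. The two waves are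
kept apart because Φ and Ψ act on them separately. -/
theorem wave_integral [CompleteSpace E] (hk : 0 < k) (hk1 : k < 1) (hT : 0 ≤ T)
    (hΛ : ∀ w, IsBump T w → ∀ s ∈ Icc 0 T, WaveCompat Λ Φ Ψ k T w s)
    (w : Lp ℝ 2 (muTime T)) {t : ℝ} (ht : t ∈ Icc 0 T) :
    Λ (statePos k hT w t)
      = ∫ s in (0 : ℝ)..t, waveCurve Φ Ψ k hT w s := by
  set m : ℝ → ℝ := fun s => invAlpha k (clamp T s)
  have hm : Continuous m := (contDiff_invAlpha k).continuous.comp (continuous_clamp T)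
  have hsplit : ∀ p q : ℝ →ᵇ L2, ∫ s in (0 : ℝ)..t, m s • (Φ (p s) + Ψ (q s))
      = Φ (∫ s in (0 : ℝ)..t, m s • p s) + Ψ (∫ s in (0 : ℝ)..t, m s • q s) := by
    intro p q
    have i1 : Continuous fun s => m s • p s := hm.smul p.continuous
    have i2 : Continuous fun s => m s • q s := hm.smul q.continuous
    have j1 : Continuous fun s => Φ (m s • p s) := Φ.continuous.comp i1
    have j2 : Continuous fun s => Ψ (m s • q s) := Ψ.continuous.comp i2
    rw [← ContinuousLinearMap.intervalIntegral_comp_comm Φ (i1.intervalIntegrable _ _),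
      ← ContinuousLinearMap.intervalIntegral_comp_comm Ψ (i2.intervalIntegrable _ _),
      ← intervalIntegral.integral_add (j1.intervalIntegrable _ _) (j2.intervalIntegrable _ _)]
    refine intervalIntegral.integral_congr fun s _ => ?_
    simp only [map_smul, smul_add]
  refine state_induction hk hk1 hT (P := fun w p q => Λ (p t - q t)
    = ∫ s in (0 : ℝ)..t, m s • (Φ (p s) + Ψ (q s))) ?_ ?_ w
  · simp only [hsplit]
    have c1 : ∀ t : ℝ, Continuous fun u : ℝ →ᵇ L2 => u t := fun t =>
      (BoundedContinuousFunction.evalCLM ℝ t).continuous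
    have c2 : Continuous fun u : ℝ →ᵇ L2 => ∫ s in (0 : ℝ)..t, m s • u s :=
      continuous_weighted_integral_bcf hm (abs_invAlpha_clamp_le hk hT) 0 t
    refine isClosed_eq (Λ.continuous.comp (((c1 t).comp (outL k hT).continuous).sub
      ((c1 t).comp (inL k hT).continuous))) ?_
    exact (Φ.continuous.comp (c2.comp (outL k hT).continuous)).add
      (Ψ.continuous.comp (c2.comp (inL k hT).continuous))
  · intro w hw
    have h1 : Sm (outWave k T w) := Sm.travelFun _ _ _ _ hw.smooth
    have h2 : Sm (inWave k T w) := Sm.travelFun _ _ _ _ hw.smooth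
    have hd : ∀ s : ℝ, HasDerivAt (fun s => Λ ((l2c fun y => outWave k T w y s)
        - l2c fun y => inWave k T w y s))
        (Λ ((l2c fun y => dt (outWave k T w) y s) - l2c fun y => dt (inWave k T w) y s))
        s := fun s =>
      Λ.hasFDerivAt.comp_hasDerivAt s
        ((hasDerivAt_l2c_curve h1 s).sub (hasDerivAt_l2c_curve h2 s))
    have hi : ∫ s in (0 : ℝ)..t, m s • (Φ (l2Curve hT (outWave k T w) s)
          + Ψ (l2Curve hT (inWave k T w) s))
        = ∫ s in (0 : ℝ)..t, Λ ((l2c fun y => dt (outWave k T w) y s)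
          - l2c fun y => dt (inWave k T w) y s) := by
      refine intervalIntegral.integral_congr fun s hs => ?_
      rw [uIcc_of_le ht.1] at hs
      have hs' : s ∈ Icc 0 T := ⟨hs.1, hs.2.trans ht.2⟩
      simp only [m]
      rw [clamp_eq hs', l2Curve_of_mem hT h1 hs', l2Curve_of_mem hT h2 hs', ← hΛ w hw s hs']
    have hcont : Continuous fun s => Λ ((l2c fun y => dt (outWave k T w) y s)
        - l2c fun y => dt (inWave k T w) y s) :=
      Λ.continuous.comp ((continuous_l2c_curve h1.dt.continuous).sub
        (continuous_l2c_curve h2.dt.continuous))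
    have z1 : (l2c fun y => outWave k T w y 0) = 0 := by
      rw [← l2c_zero]
      exact l2c_congr fun y hy => (wave_eq_zero_at_zero hk hk1 hw (Ioo_subset_Icc_self hy)).1
    have z2 : (l2c fun y => inWave k T w y 0) = 0 := by
      rw [← l2c_zero]
      exact l2c_congr fun y hy => (wave_eq_zero_at_zero hk hk1 hw (Ioo_subset_Icc_self hy)).2
    rw [hi, intervalIntegral.integral_eq_sub_of_hasDerivAt (fun s _ => hd s)
      (hcont.intervalIntegrable _ _), z1, z2, sub_zero, map_zero, sub_zero,
      l2Curve_of_mem hT h1 ht, l2Curve_of_mem hT h2 ht]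

theorem wave_hasDeriv [CompleteSpace E] (hk : 0 < k) (hk1 : k < 1) (hT : 0 ≤ T)
    (hΛ : ∀ w, IsBump T w → ∀ s ∈ Icc 0 T, WaveCompat Λ Φ Ψ k T w s)
    (w : Lp ℝ 2 (muTime T)) {t : ℝ} (ht : t ∈ Icc 0 T) :
    HasDerivWithinAt (fun s => Λ (statePos k hT w s))
      (waveCurve Φ Ψ k hT w t) (Icc 0 T) t := by
  have hc := continuous_waveCurve (k := k) Φ Ψ hT w
  have h1 := (intervalIntegral.integral_hasDerivAt_right (hc.intervalIntegrable 0 t)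
      (hc.stronglyMeasurableAtFilter _ _) hc.continuousAt).hasDerivWithinAt (s := Icc 0 T)
  exact h1.congr (fun s hs => wave_integral Λ Φ Ψ hk hk1 hT hΛ w hs)
    (wave_integral Λ Φ Ψ hk hk1 hT hΛ w ht)

end curve

theorem l2ToHm1_dt_wave (hk : 0 < k) {w : ℝ → ℝ} (hw : IsBump T w) {s : ℝ} (hs : s ∈ Icc 0 T) :
    WaveCompat (E := Hm1) l2ToHm1L (fluxL k 1) (fluxL k (-1)) k T w s := by
  have e1 := l2ToHm1_dt_travelFun (N := reflCount k T) hk (e := 1) (by norm_num) 1 hw.smooth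
    hs.1
  have e2 := l2ToHm1_dt_travelFun (N := reflCount k T) hk (e := -1) (by norm_num) (refl k)⁻¹
    hw.smooth hs.1
  rw [WaveCompat, map_sub]
  refine Eq.trans (congrArg₂ (· - ·) e1 e2) ?_
  ext h
  change invAlpha k s * 1 * fluxL k 1 (l2c fun y => outWave k T w y s) h
    - invAlpha k s * -1 * fluxL k (-1) (l2c fun y => inWave k T w y s) h
    = invAlpha k s * (fluxL k 1 (l2c fun y => outWave k T w y s) h
      + fluxL k (-1) (l2c fun y => inWave k T w y s) h)
  ring

/-- The time derivative of the state, as a curve in `H⁻¹`. -/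
def stateVel (k : ℝ) (hT : 0 ≤ T) (w : Lp ℝ 2 (muTime T)) : ℝ → Hm1 :=
  waveCurve (E := Hm1) (fluxL k 1) (fluxL k (-1)) k hT w

theorem stateVel_apply (hT : 0 ≤ T) (w : Lp ℝ 2 (muTime T)) {t : ℝ} (ht : t ∈ Icc 0 T) (h : H10) :
    stateVel k hT w t h = invAlpha k t * (inner ℝ (outL k hT w t) (flux k 1 h)
      + inner ℝ (inL k hT w t) (flux k (-1) h)) := by
  rw [stateVel, waveCurve, clamp_eq ht]; rfl

theorem state_hasDeriv (hk : 0 < k) (hk1 : k < 1) (hT : 0 ≤ T) (w : Lp ℝ 2 (muTime T)) {t : ℝ}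
    (ht : t ∈ Icc 0 T) :
    HasDerivWithinAt (fun s => l2ToHm1 (statePos k hT w s)) (stateVel k hT w t) (Icc 0 T) t :=
  wave_hasDeriv (E := Hm1) l2ToHm1L (fluxL k 1) (fluxL k (-1)) hk hk1 hT
    (fun _ hw _ hs => l2ToHm1_dt_wave hk hw hs) w ht

theorem continuous_stateVel (hT : 0 ≤ T) (w : Lp ℝ 2 (muTime T)) :
    Continuous (stateVel k hT w) := by
  unfold stateVel
  have h := continuous_waveCurve (k := k) (E := Hm1) (fluxL k 1) (fluxL k (-1)) hT w
  convert h

theorem wave_init (hk : 0 < k) (hk1 : k < 1) (hT : 0 ≤ T) (w : Lp ℝ 2 (muTime T)) :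
    outL k hT w 0 = 0 ∧ inL k hT w 0 = 0 := by
  have c1 : Continuous fun u : ℝ →ᵇ L2 => u 0 := (BoundedContinuousFunction.evalCLM ℝ 0).continuous
  refine state_induction hk hk1 hT (P := fun w p q => p 0 = 0 ∧ q 0 = 0) ?_ ?_ w
  · exact (isClosed_eq (c1.comp (outL k hT).continuous) continuous_const).inter
      (isClosed_eq (c1.comp (inL k hT).continuous) continuous_const)
  · intro w hw
    have h1 : Sm (outWave k T w) := Sm.travelFun _ _ _ _ hw.smooth
    have h2 : Sm (inWave k T w) := Sm.travelFun _ _ _ _ hw.smooth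
    have h0 : (0 : ℝ) ∈ Icc 0 T := ⟨le_rfl, hT⟩
    rw [l2Curve_of_mem hT h1 h0, l2Curve_of_mem hT h2 h0, ← l2c_zero]
    exact ⟨l2c_congr fun y hy => (wave_eq_zero_at_zero hk hk1 hw (Ioo_subset_Icc_self hy)).1,
      l2c_congr fun y hy => (wave_eq_zero_at_zero hk hk1 hw (Ioo_subset_Icc_self hy)).2⟩

end

/-! ### Duality between the controlled and the backward problem -/

section

variable {k T : ℝ} {θ : ℝ → ℝ → ℝ}

theorem flux_eq (k e : ℝ) {h : H10} {η η' : ℝ → ℝ} (hη : Continuous η) (hη' : Continuous η')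
    (h0 : h10Val h = l2c η) (h1 : h10Deriv h = l2c η') :
    flux k e h = l2c fun y => (1 - e * k * y) * η' y - e * k * η y := by
  have hm : Continuous fun y : ℝ => 1 - e * k * y := by fun_prop
  have c1 : Continuous fun y => (1 - e * k * y) * η' y := hm.mul hη'
  have h6 : flux k e h = (timeMul 1 (m := fun y => 1 - e * k * y) hm :
      L2 →L[ℝ] L2) (h10Deriv h) - (e * k) • h10Val h := rfl
  rw [h6, l2c_sub c1 (hη.const_mul _), l2c_smul _ hη, h0, h1]
  congr 1
  refine Lp.ext ?_
  filter_upwards [coeFn_timeMul (T := 1) hm (l2c η'), coeFn_l2c hη', coeFn_l2c c1] with y a b c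
  rw [a, b, c, smul_eq_mul]

/-- Green's formula for a wave moving along one family of characteristics. -/
theorem integral_wave_mul_waveAdj (hk : 0 < k) (hT : 0 < T) {e : ℝ} (he : e * e = 1)
    {q : ℝ → ℝ → ℝ} (hq : Sm q) (hD : ∀ y t, charD k e q y t = 0)
    (h0 : ∀ y ∈ Icc (0 : ℝ) 1, q y 0 = 0) (h : IsDirichlet T θ) :
    ∫ t in (0 : ℝ)..T, ∫ y in (0 : ℝ)..1, q y t * waveAdj k θ y t
      = inner ℝ (l2c fun y => q y T) (l2c fun y => velocity k θ y T)
        - e * (invAlpha k T * inner ℝ (l2c fun y => q y T) (flux k e (h10c fun y => θ y T)))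
        + ((k ^ 2 - 1) * ∫ t in (0 : ℝ)..T, q 1 t * (invAlpha k t ^ 2 * dy θ 1 t))
        + ∫ t in (0 : ℝ)..T, q 0 t * (invAlpha k t ^ 2 * dy θ 0 t) := by
  have si := (Sm.invAlpha k).pow 2
  have sr := h.smooth.riem k e
  -- Since D_e q = 0 and D_e(α⁻² R_e) is the adjoint wave operator, the integrand is exactly D_e A.
  set A : ℝ → ℝ → ℝ := fun y t => q y t * (invAlpha k t ^ 2 * riem k e θ y t) with hA
  have sA : Sm A := hq.mul (si.mul sr)
  have key : ∀ y ∈ Icc (0 : ℝ) 1, ∀ t ∈ Icc 0 T, q y t * waveAdj k θ y t = charD k e A y t := by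
    intro y _ t ht
    have ha := alpha_mul_invAlpha hk ht.1
    rw [hA, charD_mul hq (si.mul sr), hD, charD_mul si sr, charD_invAlpha_sq hk ht.1,
      charD_riem h.smooth he hk ht.1]
    linear_combination (-(q y t * waveAdj k θ y t) * (alpha k t * invAlpha k t + 1)) * ha
  rw [rect_integral_congr zero_le_one hT.le key, integral_charD sA]
  have hTm : T ∈ Icc 0 T := ⟨hT.le, le_rfl⟩
  have haT := alpha_mul_invAlpha hk hT.le
  have cq := hq.continuous_fst T
  have cθ := h.smooth.continuous_fst T
  have cd := h.smooth.dy.continuous_fst T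
  have cv := (h.smooth.velocity k).continuous_fst T
  have e0 : ∫ y in (0 : ℝ)..1, alpha k 0 * A y 0 = 0 := by
    have : ∫ y in (0 : ℝ)..1, alpha k 0 * A y 0 = ∫ y in (0 : ℝ)..1, (0 : ℝ) := by
      refine intervalIntegral.integral_congr fun y hy => ?_
      rw [uIcc_of_le zero_le_one] at hy
      simp [hA, h0 y hy]
    rw [this]; simp
  have e1 : ∫ t in (0 : ℝ)..T, (e - k * 1) * A 1 t
      = (k ^ 2 - 1) * ∫ t in (0 : ℝ)..T, q 1 t * (invAlpha k t ^ 2 * dy θ 1 t) := by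
    rw [← intervalIntegral.integral_const_mul]
    refine intervalIntegral.integral_congr fun t ht => ?_
    rw [uIcc_of_le hT.le] at ht
    simp only [hA, h.riem_right hT e ht]
    linear_combination (-(q 1 t * (invAlpha k t ^ 2 * dy θ 1 t))) * he
  have e2 : ∫ t in (0 : ℝ)..T, (e - k * 0) * A 0 t
      = -∫ t in (0 : ℝ)..T, q 0 t * (invAlpha k t ^ 2 * dy θ 0 t) := by
    rw [← intervalIntegral.integral_neg]
    refine intervalIntegral.integral_congr fun t ht => ?_
    rw [uIcc_of_le hT.le] at ht
    simp only [hA, h.riem_left hT e ht]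
    linear_combination (-(q 0 t * (invAlpha k t ^ 2 * dy θ 0 t))) * he
  have hs := h.h10c_slice hTm
  have hf : flux k e (h10c fun y => θ y T)
      = l2c fun y => (1 - e * k * y) * dy θ y T - e * k * θ y T :=
    flux_eq k e cθ cd (congrArg Prod.fst hs) (congrArg Prod.snd hs)
  have cf : Continuous fun y => (1 - e * k * y) * dy θ y T - e * k * θ y T :=
    ((by fun_prop : Continuous fun y : ℝ => 1 - e * k * y).mul cd).sub (cθ.const_mul _)
  have e3 : ∫ y in (0 : ℝ)..1, alpha k T * A y T
      = inner ℝ (l2c fun y => q y T) (l2c fun y => velocity k θ y T)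
        - e * (invAlpha k T * inner ℝ (l2c fun y => q y T) (flux k e (h10c fun y => θ y T))) := by
    have d1 : Continuous fun y => q y T * velocity k θ y T := cq.mul cv
    have d2 : Continuous fun y => e * invAlpha k T *
      (q y T * ((1 - e * k * y) * dy θ y T - e * k * θ y T)) := (cq.mul cf).const_mul _
    rw [hf, inner_l2c_l2c cq cv, inner_l2c_l2c cq cf, ← mul_assoc,
      ← intervalIntegral.integral_const_mul, ← intervalIntegral.integral_sub
        (d1.intervalIntegrable _ _) (d2.intervalIntegrable _ _)]
    refine intervalIntegral.integral_congr fun y _ => ?_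
    simp only [hA, riem_eq_velocity hk hT.le]
    linear_combination (q y T * (velocity k θ y T * (alpha k T * invAlpha k T + 1)
      + invAlpha k T * (k * θ y T + (k * y - e) * dy θ y T))) * haT
      + (-(invAlpha k T * q y T * (k * θ y T + k * y * dy θ y T))) * he
  rw [e0, e1, e2, e3]
  ring

/-- Green's formula for each wave, subtracted. The boundary terms at y = 1 carry the same
coefficient k² - 1 and cancel because the waves agree there; at y = 0 the difference of the waves is
w. -/
theorem duality_smooth (hk : 0 < k) (hk1 : k < 1) (hT : 0 < T) {w : ℝ → ℝ} (hw : IsBump T w)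
    (h : IsDirichlet T θ) :
    inner ℝ (lpc T w) (lpc T fun t => invAlpha k t ^ 2 * dy θ 0 t)
      = invAlpha k T * (inner ℝ (l2c fun y => outWave k T w y T) (flux k 1 (h10c fun y => θ y T))
          + inner ℝ (l2c fun y => inWave k T w y T) (flux k (-1) (h10c fun y => θ y T)))
        - inner ℝ ((l2c fun y => outWave k T w y T) - l2c fun y => inWave k T w y T)
          (l2c fun y => velocity k θ y T)
        + ∫ t in (0 : ℝ)..T, ∫ y in (0 : ℝ)..1,
          (outWave k T w y t - inWave k T w y t) * waveAdj k θ y t := by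
  have h1 : Sm (outWave k T w) := Sm.travelFun _ _ _ _ hw.smooth
  have h2 : Sm (inWave k T w) := Sm.travelFun _ _ _ _ hw.smooth
  have g1 := integral_wave_mul_waveAdj hk hT (e := 1) (by norm_num) h1
    (charD_travelFun k _ (by norm_num) 1 hw.smooth)
    (fun y hy => (wave_eq_zero_at_zero hk hk1 hw hy).1) h
  have g2 := integral_wave_mul_waveAdj hk hT (e := -1) (by norm_num) h2
    (charD_travelFun k _ (by norm_num) (refl k)⁻¹ hw.smooth)
    (fun y hy => (wave_eq_zero_at_zero hk hk1 hw hy).2) h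
  have ct := h.smooth.continuous_trace k
  have sw := h.smooth.waveAdj k
  have e1 : ∫ t in (0 : ℝ)..T, ∫ y in (0 : ℝ)..1,
      (outWave k T w y t - inWave k T w y t) * waveAdj k θ y t
      = (∫ t in (0 : ℝ)..T, ∫ y in (0 : ℝ)..1, outWave k T w y t * waveAdj k θ y t)
        - ∫ t in (0 : ℝ)..T, ∫ y in (0 : ℝ)..1, inWave k T w y t * waveAdj k θ y t := by
    have := rect_integral_add (h1.mul sw) ((h2.mul sw).const_mul (-1)) 0 1 0 T
    rw [rect_integral_const_mul] at this
    rw [sub_eq_add_neg, ← neg_one_mul, ← this]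
    refine rect_integral_congr zero_le_one hT.le fun y _ t _ => ?_
    ring
  have e2 : ∫ t in (0 : ℝ)..T, outWave k T w 1 t * (invAlpha k t ^ 2 * dy θ 1 t)
      = ∫ t in (0 : ℝ)..T, inWave k T w 1 t * (invAlpha k t ^ 2 * dy θ 1 t) := by
    simp only [wave_right hk hk1]
  have c1 : Continuous fun t => outWave k T w 0 t * (invAlpha k t ^ 2 * dy θ 0 t) :=
    (h1.continuous_snd 0).mul ct
  have c2 : Continuous fun t => inWave k T w 0 t * (invAlpha k t ^ 2 * dy θ 0 t) :=
    (h2.continuous_snd 0).mul ct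
  have e3 : inner ℝ (lpc T w) (lpc T fun t => invAlpha k t ^ 2 * dy θ 0 t)
      = (∫ t in (0 : ℝ)..T, outWave k T w 0 t * (invAlpha k t ^ 2 * dy θ 0 t))
        - ∫ t in (0 : ℝ)..T, inWave k T w 0 t * (invAlpha k t ^ 2 * dy θ 0 t) := by
    rw [inner_lpc_lpc hT.le hw.continuous ct, ← intervalIntegral.integral_sub
      (c1.intervalIntegrable _ _) (c2.intervalIntegrable _ _)]
    refine intervalIntegral.integral_congr fun t ht => ?_
    rw [uIcc_of_le hT.le] at ht
    rw [← sub_mul, wave_left hk hk1 hw ht]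
  rw [e3, e1, g1, g2, e2, inner_sub_left]
  ring

/-- The identity on which the rest depends. Zero final data give the transposition formula and the
adjoint of the map from controls to states; zero source gives the adjoint of the map from controls
to final states. -/
theorem duality (hk : 0 < k) (hk1 : k < 1) (hT : 0 < T) (w : Lp ℝ 2 (muTime T))
    (d : H10 × L2 × L2L2 T) :
    inner ℝ w (adjTrace k hT.le d) = stateVel k hT.le w T d.1 - inner ℝ (statePos k hT.le w T) d.2.1
      + inner ℝ (toL2L2 T (statePos k hT.le w)) d.2.2 := by
  have hTm : T ∈ Icc 0 T := ⟨hT.le, le_rfl⟩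
  rw [stateVel_apply hT.le w hTm]
  refine adjoint_induction hk hk1 hT (P := fun d _ _ c => inner ℝ w c = invAlpha k T *
    (inner ℝ (outL k hT.le w T) (flux k 1 d.1) + inner ℝ (inL k hT.le w T) (flux k (-1) d.1))
    - inner ℝ (statePos k hT.le w T) d.2.1 + inner ℝ (toL2L2 T (statePos k hT.le w)) d.2.2) ?_ ?_ d
  · exact isClosed_eq (by fun_prop) (by fun_prop)
  · intro θ
    have hθ : IsDirichlet T θ.1 := θ.2
    have c1 : Continuous fun u : ℝ →ᵇ L2 => u T :=
      (BoundedContinuousFunction.evalCLM ℝ T).continuous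
    change inner ℝ w (lpc T fun t => invAlpha k t ^ 2 * dy θ.1 0 t) = invAlpha k T *
      (inner ℝ (outL k hT.le w T) (flux k 1 (h10c fun y => θ.1 y T))
        + inner ℝ (inL k hT.le w T) (flux k (-1) (h10c fun y => θ.1 y T)))
      - inner ℝ (outL k hT.le w T - inL k hT.le w T) (l2c fun y => velocity k θ.1 y T)
      + inner ℝ (toL2L2 T (outL k hT.le w - inL k hT.le w))
        (toL2L2 T (l2Curve hT.le (waveAdj k θ.1)))
    refine state_induction hk hk1 hT.le (P := fun w p q =>
      inner ℝ w (lpc T fun t => invAlpha k t ^ 2 * dy θ.1 0 t) = invAlpha k T *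
        (inner ℝ (p T) (flux k 1 (h10c fun y => θ.1 y T))
          + inner ℝ (q T) (flux k (-1) (h10c fun y => θ.1 y T)))
        - inner ℝ (p T - q T) (l2c fun y => velocity k θ.1 y T)
        + inner ℝ (toL2L2 T (p - q)) (toL2L2 T (l2Curve hT.le (waveAdj k θ.1)))) ?_ ?_ w
    · have a1 := c1.comp (outL k hT.le).continuous
      have a2 := c1.comp (inL k hT.le).continuous
      have a3 := (toL2L2 T).continuous.comp ((outL k hT.le).continuous.sub (inL k hT.le).continuous)
      refine isClosed_eq (continuous_id.inner continuous_const) ?_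
      exact ((((a1.inner continuous_const).add (a2.inner continuous_const)).const_mul _).sub
        ((a1.sub a2).inner continuous_const)).add (a3.inner continuous_const)
    · intro w hw
      have h1 : Sm (outWave k T w) := Sm.travelFun _ _ _ _ hw.smooth
      have h2 : Sm (inWave k T w) := Sm.travelFun _ _ _ _ hw.smooth
      rw [l2Curve_of_mem hT.le h1 hTm, l2Curve_of_mem hT.le h2 hTm,
        inner_toL2L2_l2Curve hT.le (hθ.smooth.waveAdj k), pairQ_congr_ae (coeFn_toL2L2 T _),
        pairQ_smooth hT.le (h1.sub h2) (fun t ht => ?_) (hθ.smooth.waveAdj k)]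
      · exact duality_smooth hk hk1 hT hw hθ
      · have ht' := Ioo_subset_Icc_self ht
        rw [BoundedContinuousFunction.sub_apply, l2Curve_of_mem hT.le h1 ht',
          l2Curve_of_mem hT.le h2 ht', l2c_sub (h1.continuous_fst t) (h2.continuous_fst t)]

theorem transposition_eq_pairQ (h : Sm θ) (hk : 0 < k) (v : ℝ → L2) :
    ∫ t in Ioo 0 T, ∫ y, v t y * (dt (dt θ) y t + opLadj k θ y t) ∂muOmega
      = pairQ T v (waveAdj k θ) := by
  refine integral_congr_ae ?_
  filter_upwards [ae_muTime_mem T] with t ht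
  rw [inner_l2c _ ((h.waveAdj k).continuous_fst t)]
  simp only [wave_opLadj_eq h hk ht.1.le]

/-- The solution by transposition for a control in `L²(0, T)`. -/
theorem isState_statePos (hk : 0 < k) (hk1 : k < 1) (hT : 0 < T) (w : Lp ℝ 2 (muTime T))
    {w' : ℝ → ℝ} (hw : w' =ᵐ[muTime T] w) :
    IsState k T w' (statePos k hT.le w) (stateVel k hT.le w) where
  control_memLp := (memLp_congr_ae hw).2 (Lp.memLp w)
  cont := (statePos k hT.le w).continuous.continuousOn
  cont_deriv := (continuous_stateVel hT.le w).continuousOn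
  hasDeriv _ ht := state_hasDeriv hk hk1 hT.le w ht
  init := by
    rw [statePos_apply, (wave_init hk hk1 hT.le w).1, (wave_init hk hk1 hT.le w).2, sub_zero]
  init_deriv := by
    ext h
    rw [stateVel_apply hT.le w ⟨le_rfl, hT.le⟩, (wave_init hk hk1 hT.le w).1,
      (wave_init hk hk1 hT.le w).2]
    simp
  transposition θ hθ := by
    have hd := hθ.isDirichlet
    have h1 := duality hk hk1 hT w (dataMap k hT.le ⟨θ, hd⟩)
    rw [adjTrace_dataMap hk hk1 hT, dataMap_of_test hT.le hθ] at h1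
    have h2 : inner ℝ w (lpc T fun t => invAlpha k t ^ 2 * dy θ 0 t)
        = inner ℝ (toL2L2 T (statePos k hT.le w)) (toL2L2 T (l2Curve hT.le (waveAdj k θ))) := by
      refine Eq.trans h1 ?_
      simp
    rw [transposition_eq_pairQ hd.smooth hk, ← pairQ_congr_ae (coeFn_toL2L2 T _),
      ← inner_toL2L2_l2Curve hT.le (hd.smooth.waveAdj k), ← h2,
      inner_lpc _ (hd.smooth.continuous_trace k)]
    refine integral_congr_ae ?_
    filter_upwards [hw, ae_muTime_mem T] with t h3 ht
    rw [h3, invAlpha_eq_of_nonneg hk ht.1.le, inv_pow, one_div]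
    ring

end

/-! ### Uniqueness of states -/

section

variable {k T : ℝ} {θ X : ℝ → ℝ → ℝ}

theorem pairQ_sub_left {V W : ℝ → L2} {F : ℝ → ℝ → ℝ} (hV : MemLp V 2 (muTime T))
    (hW : MemLp W 2 (muTime T)) (hF : Continuous fun z : ℝ × ℝ => F z.1 z.2) :
    pairQ T (fun t => V t - W t) F = pairQ T V F - pairQ T W F := by
  rw [pairQ, pairQ, pairQ, ← integral_sub (integrable_pairQ hV hF) (integrable_pairQ hW hF)]
  simp only [inner_sub_left]

theorem eqOn_Icc_of_ae_muTime {E : Type*} [TopologicalSpace E] [T2Space E] (hT : 0 < T)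
    {f g : ℝ → E} (h : f =ᵐ[muTime T] g) (hf : ContinuousOn f (Icc 0 T))
    (hg : ContinuousOn g (Icc 0 T)) : EqOn f g (Icc 0 T) := by
  refine Measure.eqOn_Icc_of_ae_eq volume hT.ne ?_ hf hg
  rwa [Measure.restrict_congr_set Ioo_ae_eq_Icc.symm]

theorem eqOn_deriv_of_eqOn {E : Type*} [NormedAddCommGroup E] [NormedSpace ℝ E] (hT : 0 < T)
    {f g f' g' : ℝ → E} (hf : ∀ t ∈ Icc 0 T, HasDerivWithinAt f (f' t) (Icc 0 T) t)
    (hg : ∀ t ∈ Icc 0 T, HasDerivWithinAt g (g' t) (Icc 0 T) t) (h : EqOn f g (Icc 0 T)) :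
    EqOn f' g' (Icc 0 T) := fun t ht =>
  (uniqueDiffOn_Icc hT t ht).eq_deriv _ (hf t ht) ((hg t ht).congr h (h ht))

/-- Transposition against the backward tests makes α(v - v') orthogonal to all products in
characteristic boxes, which are total; continuity in time removes the exceptional null set. -/
theorem IsState.eqOn {w w' : ℝ → ℝ} {v v' : ℝ → L2} {dv dv' : ℝ → Hm1} (hk : 0 < k) (hk1 : k < 1)
    (hT : 0 < T) (h : IsState k T w v dv) (h' : IsState k T w' v' dv') (hw : w =ᵐ[muTime T] w') :
    EqOn v v' (Icc 0 T) := by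
  have m1 : MemLp v 2 (muTime T) := memLp_of_continuousOn h.cont 2
  have m2 : MemLp v' 2 (muTime T) := memLp_of_continuousOn h'.cont 2
  have hα : Continuous (alpha k) := (contDiff_alpha k).continuous
  have key : (fun t => alpha k t • (v t - v' t)) =ᵐ[muTime T] 0 := by
    refine ae_eq_zero_of_forall_charBox hk hk1 (MemLp.time_smul hα (m1.sub m2)) ?_
    intro a₁ a₂ b₁ b₂ hbox f₁ f₂ hf₁ hf₂ s₁ s₂
    obtain ⟨θ, hθ, he⟩ := exists_backward_test hbox hk hk1 hf₁ hf₂ s₁ s₂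
    have hs := hθ.isDirichlet.smooth
    have e1 := h.transposition θ hθ
    have e2 := h'.transposition θ hθ
    rw [transposition_eq_pairQ hs hk] at e1 e2
    have e3 : ∫ t in Ioo 0 T, 1 / alpha k t ^ 2 * (w t * dy θ 0 t)
        = ∫ t in Ioo 0 T, 1 / alpha k t ^ 2 * (w' t * dy θ 0 t) := by
      refine integral_congr_ae ?_
      filter_upwards [hw] with t ht
      rw [ht]
    have e4 := pairQ_sub_left m1 m2 (hs.waveAdj k).continuous
    rw [e1, e2, e3, sub_self] at e4
    have sF : Sm fun y t => f₁ (charS k 1 y t) * f₂ (charS k (-1) y t) :=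
      (Sm.comp hf₁ (Sm.charS k 1)).mul (Sm.comp hf₂ (Sm.charS k (-1)))
    have e5 : pairQ T (fun t => v t - v' t) (waveAdj k θ) = 4 * k ^ 2 *
        pairQ T (fun t => alpha k t • (v t - v' t))
          (fun y t => f₁ (charS k 1 y t) * f₂ (charS k (-1) y t)) := by
      rw [pairQ_congr fun y hy t ht => he y hy t (Ioo_subset_Icc_self ht),
        pairQ_const_mul _ ((Sm.alpha k).mul sF).continuous]
      congr 1
      refine integral_congr_ae (Eventually.of_forall fun t => ?_)
      simp only
      rw [l2c_smul _ (sF.continuous_fst t), inner_smul_right, inner_smul_left]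
      simp
    rw [e5] at e4
    exact (mul_eq_zero.1 e4).resolve_left (by positivity)
  refine eqOn_Icc_of_ae_muTime hT ?_ h.cont h'.cont
  filter_upwards [key, ae_muTime_mem T] with t ht h0
  exact sub_eq_zero.1 ((smul_eq_zero.1 ht).resolve_left (alpha_pos hk h0.1.le).ne')

theorem IsState.eqOn_deriv {w w' : ℝ → ℝ} {v v' : ℝ → L2} {dv dv' : ℝ → Hm1} (hk : 0 < k)
    (hk1 : k < 1) (hT : 0 < T) (h : IsState k T w v dv) (h' : IsState k T w' v' dv')
    (hw : w =ᵐ[muTime T] w') : EqOn dv dv' (Icc 0 T) :=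
  eqOn_deriv_of_eqOn (E := Hm1) hT h.hasDeriv h'.hasDeriv fun _ ht =>
    congrArg l2ToHm1 (h.eqOn hk hk1 hT h' hw ht)

/-! ### Uniqueness of adjoint states -/

theorem waveNum_mul (hX : Sm X) (hθ : Sm θ) (k y t : ℝ) :
    waveNum k (fun y t => X y t * θ y t) y t
      = X y t * waveNum k θ y t + θ y t * waveNum k X y t
        + charD k (-1) X y t * charD k 1 θ y t + charD k 1 X y t * charD k (-1) θ y t := by
  have h1 : charD k (-1) (fun y t => X y t * θ y t)
      = fun y t => charD k (-1) X y t * θ y t + X y t * charD k (-1) θ y t := by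
    funext y t; exact charD_mul hX hθ k (-1) y t
  rw [waveNum, h1, charD_add ((hX.charD k (-1)).mul hθ) (hX.mul (hθ.charD k (-1))),
    charD_mul (hX.charD k (-1)) hθ, charD_mul hX (hθ.charD k (-1)), waveNum, waveNum]
  ring

theorem charD_of_fst (k e : ℝ) (Y : ℝ → ℝ) (y t : ℝ) :
    charD k e (fun y _ => Y y) y t = (e - k * y) * deriv Y y := by
  rw [charD, dt_of_fst, dy_of_fst]; ring

theorem charD_of_snd (k e : ℝ) (Z : ℝ → ℝ) (y t : ℝ) :
    charD k e (fun _ t => Z t) y t = alpha k t * deriv Z t := by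
  rw [charD, dt_of_snd, dy_of_snd]; ring

theorem waveNum_of_fst {Y : ℝ → ℝ} (hY : ContDiff ℝ ∞ Y) (k y t : ℝ) :
    waveNum k (fun y _ => Y y) y t
      = (1 - k * y) * (-k * deriv Y y + (-1 - k * y) * deriv (deriv Y) y)
        - k * ((-1 - k * y) * deriv Y y) := by
  have h1 : charD k (-1) (fun y _ => Y y) = fun y _ => (-1 - k * y) * deriv Y y := by
    funext y s; exact charD_of_fst k (-1) Y y s
  have h2 : HasDerivAt (fun y => (-1 - k * y) * deriv Y y)
      (-k * deriv Y y + (-1 - k * y) * deriv (deriv Y) y) y := by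
    have h3 : HasDerivAt (fun y : ℝ => -1 - k * y) (-k) y := by
      simpa using ((hasDerivAt_id y).const_mul k).const_sub (-1)
    exact h3.mul ((deriv_smooth hY).differentiable (by simp) y).hasDerivAt
  rw [waveNum, h1, charD_of_fst, h2.deriv]

theorem waveNum_of_snd {Z : ℝ → ℝ} (hZ : ContDiff ℝ ∞ Z) (k y t : ℝ) :
    waveNum k (fun _ t => Z t) y t = alpha k t ^ 2 * deriv (deriv Z) t := by
  have h1 : charD k (-1) (fun _ t => Z t) = fun _ t => alpha k t * deriv Z t := by
    funext y t; exact charD_of_snd k (-1) Z y t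
  have h2 : HasDerivAt (fun t => alpha k t * deriv Z t)
      (k * deriv Z t + alpha k t * deriv (deriv Z) t) t :=
    (hasDerivAt_alpha k t).mul ((deriv_smooth hZ).differentiable (by simp) t).hasDerivAt
  rw [waveNum, h1, charD_of_snd, h2.deriv]; ring

theorem Sm.exists_bound (h : Sm θ) (T : ℝ) :
    ∃ M : ℝ, 0 ≤ M ∧ ∀ y ∈ Icc (0 : ℝ) 1, ∀ t ∈ Icc 0 T, |θ y t| ≤ M := by
  obtain ⟨C, hC⟩ := (isCompact_Icc.prod isCompact_Icc).exists_bound_of_continuousOn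
    (s := Icc (0 : ℝ) 1 ×ˢ Icc (0 : ℝ) T) h.continuous.continuousOn
  exact ⟨|C|, abs_nonneg C, fun y hy t ht => (hC (y, t) ⟨hy, ht⟩).trans (le_abs_self C)⟩

/-- The effect of a cut-off near the ends of the interval. -/
theorem exists_cutB_error (hk : 0 < k) (hk1 : k < 1) (h : IsDirichlet T θ) :
    ∃ C : ℝ, 0 ≤ C ∧ ∀ n : ℝ, 1 ≤ n → ∀ y ∈ Icc (0 : ℝ) 1, ∀ t ∈ Icc 0 T,
      |waveNum k (fun y t => cutB n y * θ y t) y t - waveNum k θ y t| ≤ C * n ∧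
      (y ∈ Icc (3 / n) (1 - 3 / n) →
        waveNum k (fun y t => cutB n y * θ y t) y t - waveNum k θ y t = 0) := by
  obtain ⟨C, hC1, hC⟩ := exists_cutB_bound
  obtain ⟨M₁, h1, hM₁⟩ := h.smooth.dy.exists_bound T
  obtain ⟨M₂, h2, hM₂⟩ := (h.smooth.charD k 1).exists_bound T
  obtain ⟨M₃, h3, hM₃⟩ := (h.smooth.charD k (-1)).exists_bound T
  obtain ⟨M₄, h4, hM₄⟩ := (h.smooth.waveNum k).exists_bound T
  refine ⟨M₄ + 15 * (C * M₁) + 2 * (C * M₂) + 2 * (C * M₃), by positivity,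
    fun n hn y hy t ht => ?_⟩
  have hn0 : 0 < n := by linarith
  have e : waveNum k (fun y t => cutB n y * θ y t) y t - waveNum k θ y t
      = (cutB n y - 1) * waveNum k θ y t + θ y t * waveNum k (fun y _ => cutB n y) y t
        + (-1 - k * y) * deriv (cutB n) y * charD k 1 θ y t
        + (1 - k * y) * deriv (cutB n) y * charD k (-1) θ y t := by
    rw [waveNum_mul (Sm.of_fst (contDiff_cutB n)) h.smooth, charD_of_fst, charD_of_fst]; ring
  -- The strips have width 3/n instead of 2/n because the derivatives of the cut-off are known to
  -- vanish under the strict inequality 2 < ny.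
  have hzero : y ∈ Icc (3 / n) (1 - 3 / n) →
      cutB n y = 1 ∧ deriv (cutB n) y = 0 ∧ deriv (deriv (cutB n)) y = 0 := by
    intro hy'
    have a1 : 2 < n * y := by
      have := (div_le_iff₀ hn0).1 hy'.1
      linarith
    have a2 : 2 < n * (1 - y) := by
      have : 3 / n ≤ 1 - y := by linarith [hy'.2]
      have := (div_le_iff₀ hn0).1 this
      linarith
    have ev := eventually_cutB_eq_one a1 a2
    have ev' : deriv (cutB n) =ᶠ[𝓝 y] fun _ => 0 := by
      have := ev.deriv
      simpa using this
    exact ⟨ev.eq_of_nhds, ev'.eq_of_nhds, by rw [ev'.deriv_eq]; simp⟩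
  have hwn := waveNum_of_fst (contDiff_cutB n) k y t
  constructor
  · rw [e]
    obtain ⟨d1, d2⟩ := hC n y hn0.le
    have ky0 := mul_nonneg hk.le hy.1
    have ky1 : k * y ≤ 1 := by nlinarith [hy.2]
    have p1 : |(cutB n y - 1) * waveNum k θ y t| ≤ M₄ * n := by
      rw [abs_mul]
      have : |cutB n y - 1| ≤ 1 := by
        rw [abs_le]; constructor <;> linarith [cutB_nonneg n y, cutB_le_one n y]
      nlinarith [hM₄ y hy t ht, abs_nonneg (waveNum k θ y t), abs_nonneg (cutB n y - 1)]
    -- The second derivative of the cut-off is of order n², but on the strips where it lives θ is of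
    -- order 1/n, as it vanishes at both ends.
    have p2 : |θ y t * waveNum k (fun y _ => cutB n y) y t| ≤ 15 * (C * M₁) * n := by
      by_cases hy' : y ∈ Icc (3 / n) (1 - 3 / n)
      · obtain ⟨_, z1, z2⟩ := hzero hy'
        rw [hwn, z1, z2]
        simp only [mul_zero, add_zero, sub_zero, abs_zero]
        positivity
      · have hb := abs_le_of_deriv_le ((h.smooth.slice_fst t).differentiable (by simp))
          (fun y hy => hM₁ y hy t ht) (h.left t ht) (h.right t ht) hy
        have hb' : |θ y t| ≤ M₁ * (3 / n) := by
          by_cases hlt : y < 3 / n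
          · exact hb.1.trans (mul_le_mul_of_nonneg_left hlt.le h1)
          · refine hb.2.trans (mul_le_mul_of_nonneg_left ?_ h1)
            by_contra hh
            exact hy' ⟨not_lt.1 hlt, by linarith⟩
        have hw : |waveNum k (fun y _ => cutB n y) y t| ≤ 5 * (C * n ^ 2) := by
          rw [hwn]
          have q1 : |1 - k * y| ≤ 1 := by rw [abs_le]; constructor <;> linarith
          have q2 : |-1 - k * y| ≤ 2 := by rw [abs_le]; constructor <;> linarith
          have q3 : |-k * deriv (cutB n) y| ≤ C * n := by
            rw [abs_mul, abs_neg, abs_of_pos hk]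
            nlinarith [abs_nonneg (deriv (cutB n) y)]
          have q4 : |(-1 - k * y) * deriv (deriv (cutB n)) y| ≤ 2 * (C * n ^ 2) := by
            rw [abs_mul]
            exact mul_le_mul q2 d2 (abs_nonneg _) (by norm_num)
          have q5 : |k * ((-1 - k * y) * deriv (cutB n) y)| ≤ 2 * (C * n) := by
            rw [abs_mul, abs_mul, abs_of_pos hk]
            have := mul_le_mul q2 d1 (abs_nonneg _) (by norm_num)
            nlinarith [mul_nonneg (abs_nonneg (-1 - k * y)) (abs_nonneg (deriv (cutB n) y))]
          have q6 := abs_add_le (-k * deriv (cutB n) y) ((-1 - k * y) * deriv (deriv (cutB n)) y)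
          have q7 : |(1 - k * y) * (-k * deriv (cutB n) y
              + (-1 - k * y) * deriv (deriv (cutB n)) y)| ≤ C * n + 2 * (C * n ^ 2) := by
            rw [abs_mul]
            exact (mul_le_of_le_one_left (abs_nonneg _) q1).trans (by linarith)
          have q8 : C * n ≤ C * n ^ 2 := by
            have : n ≤ n ^ 2 := by nlinarith
            exact mul_le_mul_of_nonneg_left this (by linarith)
          exact (abs_sub _ _).trans (by linarith)
        rw [abs_mul]
        calc _ ≤ M₁ * (3 / n) * (5 * (C * n ^ 2)) :=
              mul_le_mul hb' hw (abs_nonneg _) (by positivity)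
          _ = 15 * (C * M₁) * n := by field_simp; ring
    have hdy : ∀ e M : ℝ, |e| ≤ 2 → ∀ x : ℝ, |x| ≤ M → |e * deriv (cutB n) y * x|
        ≤ 2 * (C * M) * n := by
      intro e M he x hx
      rw [abs_mul, abs_mul]
      calc _ ≤ 2 * (C * n) * M := mul_le_mul (mul_le_mul he d1 (abs_nonneg _) (by norm_num)) hx
            (abs_nonneg _) (by positivity)
        _ = _ := by ring
    have p3 := hdy (-1 - k * y) M₂ (by rw [abs_le]; constructor <;> linarith) _ (hM₂ y hy t ht)
    have p4 := hdy (1 - k * y) M₃ (by rw [abs_le]; constructor <;> linarith) _ (hM₃ y hy t ht)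
    refine (abs_add_le _ _).trans ?_
    refine (add_le_add ((abs_add_le _ _).trans (add_le_add (abs_add_le _ _) le_rfl)) le_rfl).trans ?_
    linarith
  · intro hy'
    obtain ⟨z0, z1, z2⟩ := hzero hy'
    rw [e, hwn, z0, z1, z2]; ring

theorem IsBump.of_support_subset {η : ℝ → ℝ} {a b : ℝ} (hη : ContDiff ℝ ∞ η) (ha : 0 < a)
    (hb : b < T) (hs : Function.support η ⊆ Icc a b) : IsBump T η where
  smooth := hη
  compact := HasCompactSupport.of_support_subset_isCompact isCompact_Icc hs
  support := (closure_minimal hs isClosed_Icc).trans (Icc_subset_Ioo ha hb)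

theorem isInteriorTest_mul {Y χ : ℝ → ℝ} (hY : IsBump 1 Y) (hχ : IsBump T χ) (hθ : Sm θ) :
    IsInteriorTest T fun y t => Y y * (χ t * θ y t) := by
  have hs : (Function.support fun z : ℝ × ℝ => Y z.1 * (χ z.2 * θ z.1 z.2))
      ⊆ tsupport Y ×ˢ tsupport χ := by
    intro z hz
    have h1 : Y z.1 ≠ 0 := fun h0 => hz (by simp [h0])
    have h2 : χ z.2 ≠ 0 := fun h0 => hz (by simp [h0])
    exact ⟨subset_tsupport _ h1, subset_tsupport _ h2⟩
  have hc : IsCompact (tsupport Y ×ˢ tsupport χ) := hY.compact.isCompact.prod hχ.compact.isCompact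
  exact ⟨(Sm.of_fst hY.smooth).mul ((Sm.of_snd hχ.smooth).mul hθ),
    HasCompactSupport.of_support_subset_isCompact hc hs,
    (closure_minimal hs hc.isClosed).trans (prod_mono hY.support hχ.support)⟩

/-- A curve in `H¹₀` satisfying the homogeneous equation, with zero final data. -/
structure IsNullAdjoint (k T : ℝ) (r : ℝ → H10) : Prop where
  cont : ContinuousOn r (Icc 0 T)
  final : HasDerivWithinAt (fun s => h10Val (r s)) 0 (Icc 0 T) T
  val_final : h10Val (r T) = 0
  weak : ∀ ζ, IsInteriorTest T ζ → pairQ T (fun t => h10Val (r t)) (waveL k ζ) = 0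

theorem IsNullAdjoint.memLp {r : ℝ → H10} (h : IsNullAdjoint k T r) :
    MemLp (fun t => h10Val (r t)) 2 (muTime T) :=
  memLp_of_continuousOn (h10ValL.continuous.comp_continuousOn h.cont) 2

theorem pairQ_sub_right {V : ℝ → L2} {F G : ℝ → ℝ → ℝ} (hV : MemLp V 2 (muTime T)) (hF : Sm F)
    (hG : Sm G) : pairQ T V (fun y t => F y t - G y t) = pairQ T V F - pairQ T V G := by
  have h := pairQ_add (G := fun y t => -1 * G y t) hV hF.continuous (hG.const_mul (-1)).continuous
  rw [pairQ_const_mul _ hG.continuous] at h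
  rw [sub_eq_add_neg, ← neg_one_mul, ← h]
  exact pairQ_congr fun y _ t _ => by ring

/-- Test functions that vanish on the lateral boundary, without compact support in y, are reached by
a cut-off. The commutator is O(n) on strips of width 3/n; there an element of `H10` is O(n^(-1/2)),
so the error is O(n^(-1/2)) in all. -/
theorem IsNullAdjoint.weak_of_bump (hk : 0 < k) (hk1 : k < 1) {r : ℝ → H10} (hr : IsNullAdjoint k T r)
    (hT : 0 < T) (h : IsDirichlet T θ) {χ : ℝ → ℝ} (hχ : IsBump T χ) :
    pairQ T (fun t => h10Val (r t)) (waveL k fun y t => χ t * θ y t) = 0 := by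
  set ξ : ℝ → ℝ → ℝ := fun y t => χ t * θ y t with hξdef
  have hξ : IsDirichlet T ξ := ⟨(Sm.of_snd hχ.smooth).mul h.smooth,
    fun t ht => by simp [hξdef, h.left t ht], fun t ht => by simp [hξdef, h.right t ht]⟩
  obtain ⟨C, hC0, hC⟩ := exists_cutB_error hk hk1 hξ
  obtain ⟨B, hB⟩ := isCompact_Icc.exists_bound_of_continuousOn hr.cont
  -- The condition n ≥ 6 ensures 3/n ≤ 1/2, so that the two strips do not overlap.
  have hbound : ∀ n : ℕ, 6 ≤ n → |pairQ T (fun t => h10Val (r t)) (waveL k ξ)|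
      ≤ 6 * C * |B| * T * √(3 / n) := by
    intro n hn
    have hn6 : (6 : ℝ) ≤ n := by exact_mod_cast hn
    have hn0 : (0 : ℝ) < n := by linarith
    set ζ : ℝ → ℝ → ℝ := fun y t => cutB n y * ξ y t
    have hζ : IsInteriorTest T ζ := by
      have hb := isBump_cutB_mul hn0 (η := fun _ => 1) contDiff_const
      simp only [one_mul] at hb
      exact isInteriorTest_mul hb hχ h.smooth
    have hsub := pairQ_sub_right hr.memLp (hζ.sm.waveL k) (hξ.smooth.waveL k)
    rw [hr.weak ζ hζ, zero_sub] at hsub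
    rw [← abs_neg, ← hsub, pairQ, ← Real.norm_eq_abs]
    refine (norm_setIntegral_le_of_norm_le_const (C := 6 * C * |B| * √(3 / n))
      measure_Ioo_lt_top fun t ht => ?_).trans ?_
    · have ht' := Ioo_subset_Icc_self ht
      have hδ : 3 / (n : ℝ) ≤ 1 / 2 := by rw [div_le_div_iff₀ hn0 two_pos]; linarith
      have cR := ((hζ.sm.waveL k).sub (hξ.smooth.waveL k)).continuous_fst t
      have ha0 := invAlpha_pos hk ht.1.le
      have ha1 := invAlpha_le_one hk ht.1.le
      have ha2 : |invAlpha k t ^ 2| ≤ 1 := by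
        rw [abs_of_pos (by positivity)]; exact pow_le_one₀ ha0.le ha1
      have e : ∀ y, waveL k ζ y t - waveL k ξ y t
          = invAlpha k t ^ 2 * (waveNum k ζ y t - waveNum k ξ y t) := fun y => by
        rw [waveL, waveL]; ring
      have h1 := abs_inner_h10Val_strip_le (r t) cR (M := C * n) (δ := 3 / n) (by positivity) hδ
        (fun y hy => by
          rw [e, abs_mul]
          exact (mul_le_of_le_one_left (abs_nonneg _) ha2).trans (hC n (by linarith) y hy t ht').1)
        (fun y hy => by
          have h3 : (0 : ℝ) < 3 / n := by positivity
          rw [e, (hC n (by linarith) y ⟨by linarith [hy.1], by linarith [hy.2]⟩ t ht').2 hy,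
            mul_zero])
      rw [Real.norm_eq_abs]
      refine h1.trans ?_
      have h2 : ‖h10Deriv (r t)‖ ≤ |B| := by
        rw [← norm_H10_eq]; exact (hB t ht').trans (le_abs_self B)
      have e2 : 2 * (C * n) * (3 / n) = 6 * C := by field_simp; ring
      rw [e2]
      have := mul_le_mul_of_nonneg_left h2 (by positivity : 0 ≤ 6 * C * √(3 / (n : ℝ)))
      linarith
    · rw [Measure.real, Real.volume_Ioo, sub_zero, ENNReal.toReal_ofReal hT.le]
      exact le_of_eq (by ring)
  have hlim : Tendsto (fun n : ℕ => 6 * C * |B| * T * √(3 / (n : ℝ))) atTop (𝓝 0) := by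
    have := ((tendsto_const_div_atTop_nhds_zero_nat (3 : ℝ)).sqrt).const_mul (6 * C * |B| * T)
    simpa using this
  have h0 := ge_of_tendsto hlim ((eventually_ge_atTop 6).mono hbound)
  exact abs_eq_zero.1 (le_antisymm h0 (abs_nonneg _))

/-- The effect of a cut-off near the final time. -/
theorem exists_cutL_error (hk : 0 < k) (hT : 0 < T) (h : Sm θ) :
    ∃ C : ℝ, 0 ≤ C ∧ ∀ n : ℝ, 1 ≤ n → ∀ y ∈ Icc (0 : ℝ) 1, ∀ t ∈ Icc 0 T,
      |waveNum k (fun y t => cutL n (T - t) * θ y t) y t - waveNum k θ y t| ≤ C * n ^ 2 ∧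
      (t ≤ T - 3 / n → waveNum k (fun y t => cutL n (T - t) * θ y t) y t - waveNum k θ y t = 0) := by
  obtain ⟨C, hC1, hC', hC''⟩ := exists_smoothTransition_bound
  obtain ⟨M₁, h1, hM₁⟩ := h.exists_bound T
  obtain ⟨M₂, h2, hM₂⟩ := (h.charD k 1).exists_bound T
  obtain ⟨M₃, h3, hM₃⟩ := (h.charD k (-1)).exists_bound T
  obtain ⟨M₄, h4, hM₄⟩ := (h.waveNum k).exists_bound T
  have hA1 := one_le_alpha hk hT.le
  set A := alpha k T
  refine ⟨M₄ + A ^ 2 * C * M₁ + A * C * M₂ + A * C * M₃, by positivity, fun n hn y hy t ht => ?_⟩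
  have hn0 : 0 < n := by linarith
  set Z : ℝ → ℝ := fun t => cutL n (T - t) with hZdef
  have hZ : ContDiff ℝ ∞ Z := (contDiff_cutL n).comp (by fun_prop)
  have dZ : ∀ t, deriv Z t = -deriv (cutL n) (T - t) := fun t => deriv_comp_const_sub _ _ _
  have ddZ : ∀ t, deriv (deriv Z) t = deriv (deriv (cutL n)) (T - t) := fun t => by
    have : deriv Z = fun t => -deriv (cutL n) (T - t) := funext dZ
    rw [this, deriv.fun_neg, deriv_comp_const_sub (f := deriv (cutL n)), neg_neg]
  have e : waveNum k (fun y t => Z t * θ y t) y t - waveNum k θ y t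
      = (Z t - 1) * waveNum k θ y t + θ y t * (alpha k t ^ 2 * deriv (deriv Z) t)
        + alpha k t * deriv Z t * charD k 1 θ y t
        + alpha k t * deriv Z t * charD k (-1) θ y t := by
    rw [waveNum_mul (Sm.of_snd hZ) h, charD_of_snd, charD_of_snd, waveNum_of_snd hZ]; ring
  have hα0 := alpha_pos hk ht.1
  have hαA : alpha k t ≤ A := alpha_mono hk ht.2
  change |waveNum k (fun y t => Z t * θ y t) y t - waveNum k θ y t| ≤ _ ∧ (_ →
    waveNum k (fun y t => Z t * θ y t) y t - waveNum k θ y t = 0)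
  rw [e]
  have hn2 : n ≤ n ^ 2 := by nlinarith
  have hn21 : 1 ≤ n ^ 2 := by nlinarith
  constructor
  · have d1 : |deriv Z t| ≤ C * n ^ 2 := by
      rw [dZ, abs_neg, deriv_cutL, abs_mul, abs_of_pos hn0, mul_comm]
      exact mul_le_mul (hC' _) hn2 hn0.le (by linarith)
    have d2 : |deriv (deriv Z) t| ≤ C * n ^ 2 := by
      rw [ddZ, deriv_deriv_cutL, abs_mul, abs_of_pos (by positivity : 0 < n ^ 2), mul_comm]
      exact mul_le_mul_of_nonneg_right (hC'' _) (by positivity)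
    have p1 : |(Z t - 1) * waveNum k θ y t| ≤ M₄ * n ^ 2 := by
      rw [abs_mul]
      have : |Z t - 1| ≤ 1 := by
        rw [abs_le]
        constructor <;> linarith [cutL_nonneg n (T - t), cutL_le_one n (T - t)]
      calc _ ≤ 1 * M₄ := mul_le_mul this (hM₄ y hy t ht) (abs_nonneg _) zero_le_one
        _ ≤ M₄ * n ^ 2 := by nlinarith
    have p2 : |θ y t * (alpha k t ^ 2 * deriv (deriv Z) t)| ≤ A ^ 2 * C * M₁ * n ^ 2 := by
      rw [abs_mul, abs_mul, abs_of_pos (by positivity : 0 < alpha k t ^ 2)]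
      calc _ ≤ M₁ * (A ^ 2 * (C * n ^ 2)) := by
            refine mul_le_mul (hM₁ y hy t ht) ?_ (by positivity) h1
            exact mul_le_mul (pow_le_pow_left₀ hα0.le hαA 2) d2 (abs_nonneg _) (by positivity)
        _ = _ := by ring
    have hd : ∀ M x : ℝ, |x| ≤ M → |alpha k t * deriv Z t * x| ≤ A * C * M * n ^ 2 := by
      intro M x hx
      rw [abs_mul, abs_mul, abs_of_pos hα0]
      calc _ ≤ A * (C * n ^ 2) * M := mul_le_mul (mul_le_mul hαA d1 (abs_nonneg _) (by linarith)) hx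
            (abs_nonneg _) (by positivity)
        _ = _ := by ring
    have p3 := hd M₂ _ (hM₂ y hy t ht)
    have p4 := hd M₃ _ (hM₃ y hy t ht)
    refine (abs_add_le _ _).trans ?_
    refine (add_le_add ((abs_add_le _ _).trans (add_le_add (abs_add_le _ _) le_rfl)) le_rfl).trans ?_
    linarith
  · intro ht'
    have h2 : 2 < n * (T - t) := by
      have : 3 / n ≤ T - t := by linarith
      have := (div_le_iff₀ hn0).1 this
      linarith
    have z0 : Z t = 1 := cutL_eq_one h2.le
    rw [z0, dZ, ddZ, deriv_cutL_eq_zero h2, deriv_deriv_cutL_eq_zero h2]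
    ring

/-- A cut-off near t = T removes the support condition there. The commutator is O(n²) on the last
interval, of length 3/n, and on it r = o(1/n) in L² because the position and the velocity of r
vanish at T. -/
theorem IsNullAdjoint.weak_of_early (hk : 0 < k) (hk1 : k < 1) {r : ℝ → H10}
    (hr : IsNullAdjoint k T r) (hT : 0 < T) (h : IsDirichlet T θ) {t₁ : ℝ} (ht₁ : 0 < t₁)
    (h0 : ∀ y ∈ Icc (0 : ℝ) 1, ∀ t ∈ Icc 0 t₁, θ y t = 0) :
    pairQ T (fun t => h10Val (r t)) (waveL k θ) = 0 := by
  -- The cut-off `cutL m` is 1 from t₁ on, and before t₁ the function θ is zero, so θ is unchanged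
  -- for nonnegative times.
  set m := 2 / t₁ with hm
  have hm0 : 0 < m := by positivity
  set ξ : ℝ → ℝ → ℝ := fun y t => cutL m t * θ y t with hξdef
  have hξs : Sm ξ := (Sm.of_snd (contDiff_cutL m)).mul h.smooth
  have hξ : ∀ y ∈ Icc (0 : ℝ) 1, ∀ t, 0 ≤ t → ξ y t = θ y t := by
    intro y hy t ht
    simp only [hξdef]
    by_cases h1 : t ≤ t₁
    · rw [h0 y hy t ⟨ht, h1⟩, mul_zero]
    · rw [cutL_eq_one, one_mul]
      rw [hm, div_mul_eq_mul_div, le_div_iff₀ ht₁]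
      linarith
  have hwave : pairQ T (fun t => h10Val (r t)) (waveL k θ)
      = pairQ T (fun t => h10Val (r t)) (waveL k ξ) := by
    refine pairQ_congr fun y hy t ht => ?_
    have hd : ∀ z : ℝ × ℝ, z ∈ Ioo (0 : ℝ) 1 ×ˢ Ioo (0 : ℝ) T → ∀ f g : ℝ → ℝ → ℝ,
        (∀ z : ℝ × ℝ, z ∈ Ioo (0 : ℝ) 1 ×ˢ Ioo (0 : ℝ) T → f z.1 z.2 = g z.1 z.2) → ∀ e,
        charD k e f z.1 z.2 = charD k e g z.1 z.2 := by
      rintro ⟨y, t⟩ hz f g hfg e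
      have e1 : (fun z => f z t) =ᶠ[𝓝 y] fun z => g z t :=
        Filter.mem_of_superset (Ioo_mem_nhds hz.1.1 hz.1.2) fun z hz' => hfg (z, t) ⟨hz', hz.2⟩
      have e2 : (fun s => f y s) =ᶠ[𝓝 t] fun s => g y s :=
        Filter.mem_of_superset (Ioo_mem_nhds hz.2.1 hz.2.2) fun s hs' => hfg (y, s) ⟨hz.1, hs'⟩
      simp only [charD, dt, dy]
      rw [e1.deriv_eq, e2.deriv_eq]
    have hz : ((y, t) : ℝ × ℝ) ∈ Ioo (0 : ℝ) 1 ×ˢ Ioo (0 : ℝ) T := ⟨hy, ht⟩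
    have b0 : ∀ z : ℝ × ℝ, z ∈ Ioo (0 : ℝ) 1 ×ˢ Ioo (0 : ℝ) T → θ z.1 z.2 = ξ z.1 z.2 :=
      fun z hz => (hξ z.1 (Ioo_subset_Icc_self hz.1) z.2 hz.2.1.le).symm
    have b1 := fun z hz => hd z hz θ ξ b0 (-1)
    have b2 := hd (y, t) hz _ _ b1 1
    rw [waveL, waveL, waveNum, waveNum]
    have b3 := b1 (y, t) hz
    simp only at b2 b3
    rw [b2, b3]
  rw [hwave]
  obtain ⟨C, hC0, hC⟩ := exists_cutL_error hk hT hξs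
  refine abs_eq_zero.1 (le_antisymm (le_of_forall_pos_le_add fun ε hε => ?_) (abs_nonneg _))
  -- The final estimate multiplies this constant by (3/n) · Cn² · (3/n) = 9C; the added 1 keeps the
  -- denominator positive.
  have hlo := (hasDerivWithinAt_iff_isLittleO.1 hr.final).def
    (c := ε / (9 * C + 1)) (by positivity)
  obtain ⟨δ, hδ, hlo⟩ := Metric.eventually_nhds_iff.1 (eventually_nhdsWithin_iff.1 hlo)
  obtain ⟨n, hn⟩ := exists_nat_gt (max (max 1 (3 / δ)) (3 / T))
  have hn1 : (1 : ℝ) ≤ n := ((le_max_left _ _).trans (le_max_left _ _)).trans hn.le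
  have hn0 : (0 : ℝ) < n := by linarith
  have hnδ : 3 / (n : ℝ) < δ := by
    have := ((le_max_right 1 (3 / δ)).trans (le_max_left _ _)).trans_lt hn
    rw [div_lt_iff₀ hδ] at this
    rw [div_lt_iff₀ hn0]; linarith
  have hnT : 3 / (n : ℝ) < T := by
    have := (le_max_right (max 1 (3 / δ)) (3 / T)).trans_lt hn
    rw [div_lt_iff₀ hT] at this
    rw [div_lt_iff₀ hn0]; linarith
  set χ : ℝ → ℝ := fun t => cutL n (T - t) * cutL m t
  have hχ : IsBump T χ := by
    refine IsBump.of_support_subset (a := 1 / m) (b := T - 1 / n)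
      (((contDiff_cutL n).comp (by fun_prop)).mul (contDiff_cutL m)) (by positivity)
      (by have : (0 : ℝ) < 1 / n := by positivity
          linarith) fun t ht => ?_
    constructor
    · by_contra hh
      refine ht ?_
      have : m * t ≤ 1 := by
        rw [not_le, lt_div_iff₀ hm0] at hh; linarith
      simp [χ, cutL_eq_zero this]
    · by_contra hh
      refine ht ?_
      have : (n : ℝ) * (T - t) ≤ 1 := by
        have : T - t < 1 / n := by linarith
        rw [lt_div_iff₀ hn0] at this; linarith
      simp [χ, cutL_eq_zero this]
  set ζ : ℝ → ℝ → ℝ := fun y t => cutL n (T - t) * ξ y t with hζdef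
  have hζs : Sm ζ := (Sm.of_snd ((contDiff_cutL n).comp (by fun_prop))).mul hξs
  have hζ0 : pairQ T (fun t => h10Val (r t)) (waveL k ζ) = 0 := by
    have e : ζ = fun y t => χ t * θ y t := by funext y t; simp only [hζdef, hξdef, χ]; ring
    rw [e]
    exact hr.weak_of_bump hk hk1 hT h hχ
  have hsub := pairQ_sub_right hr.memLp (hζs.waveL k) (hξs.waveL k)
  rw [hζ0, zero_sub] at hsub
  have e : ∀ y t, waveL k ζ y t - waveL k ξ y t
      = invAlpha k t ^ 2 * (waveNum k ζ y t - waveNum k ξ y t) := fun y t => by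
    rw [waveL, waveL]; ring
  have hres : pairQ T (fun t => h10Val (r t)) (fun y t => waveL k ζ y t - waveL k ξ y t)
      = ∫ t in Ioo (T - 3 / n) T, inner ℝ (h10Val (r t))
        (l2c fun y => waveL k ζ y t - waveL k ξ y t) := by
    refine setIntegral_eq_of_subset_of_forall_sdiff_eq_zero measurableSet_Ioo
      (Ioo_subset_Ioo_left (by linarith)) fun t ht => ?_
    have ht2 : t ≤ T - 3 / n := by
      by_contra hh
      exact ht.2 ⟨not_le.1 hh, ht.1.2⟩
    have : (l2c fun y => waveL k ζ y t - waveL k ξ y t) = 0 := by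
      rw [← l2c_zero]
      refine l2c_congr fun y hy => ?_
      simp only [e]
      rw [(hC n hn1 y (Ioo_subset_Icc_self hy) t (Ioo_subset_Icc_self ht.1)).2 ht2, mul_zero]
    rw [this, inner_zero_right]
  rw [zero_add, ← abs_neg, ← hsub, hres, ← Real.norm_eq_abs]
  refine (norm_setIntegral_le_of_norm_le_const (C := ε / (9 * C + 1) * (3 / n) * (C * n ^ 2))
    measure_Ioo_lt_top fun t ht => ?_).trans ?_
  · have ht' : t ∈ Icc 0 T := ⟨by linarith [ht.1], ht.2.le⟩
    have ha0 := invAlpha_pos hk ht'.1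
    have ha1 := invAlpha_le_one hk ht'.1
    have ha2 : |invAlpha k t ^ 2| ≤ 1 := by
      rw [abs_of_pos (by positivity)]; exact pow_le_one₀ ha0.le ha1
    have b1 : ‖l2c fun y => waveL k ζ y t - waveL k ξ y t‖ ≤ C * n ^ 2 := by
      refine norm_l2c_le (((hζs.waveL k).sub (hξs.waveL k)).continuous_fst t) (by positivity)
        fun y hy => ?_
      rw [e, abs_mul]
      exact (mul_le_of_le_one_left (abs_nonneg _) ha2).trans (hC n hn1 y hy t ht').1
    have b2 : ‖h10Val (r t)‖ ≤ ε / (9 * C + 1) * (3 / n) := by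
      have hdist : dist t T < δ := by
        rw [Real.dist_eq, abs_sub_comm, abs_of_pos (by linarith [ht.2])]; linarith [ht.1]
      have := hlo hdist ht'
      rw [hr.val_final, sub_zero, smul_zero, sub_zero, Real.norm_eq_abs, abs_sub_comm,
        abs_of_pos (by linarith [ht.2])] at this
      refine this.trans (mul_le_mul_of_nonneg_left (by linarith [ht.1]) (by positivity))
    refine (norm_inner_le_norm _ _).trans ?_
    exact mul_le_mul b2 b1 (norm_nonneg _) (by positivity)
  · rw [Measure.real, Real.volume_Ioo, sub_sub_cancel, ENNReal.toReal_ofReal (by positivity)]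
    have e3 : ε / (9 * C + 1) * (3 / n) * (C * n ^ 2) * (3 / n) = ε * (9 * C / (9 * C + 1)) := by
      field_simp; ring
    rw [e3]
    refine mul_le_of_le_one_right hε.le ?_
    rw [div_le_one (by positivity)]; linarith

/-- By `weak_of_early` the forward tests of `exists_forward_test` may be inserted, and their images
under the wave operator are total. -/
theorem IsNullAdjoint.eq_zero (hk : 0 < k) (hk1 : k < 1) {r : ℝ → H10} (hr : IsNullAdjoint k T r)
    (hT : 0 < T) : ∀ t ∈ Icc 0 T, r t = 0 := by
  have key : (fun t => h10Val (r t)) =ᵐ[muTime T] 0 := by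
    refine ae_eq_zero_of_forall_charBox hk hk1 hr.memLp ?_
    intro a₁ a₂ b₁ b₂ hbox f₁ f₂ hf₁ hf₂ s₁ s₂
    obtain ⟨θ, hθ, ⟨t₁, ht₁, h0⟩, he⟩ := exists_forward_test hbox hk hk1 hf₁ hf₂ s₁ s₂
    have h1 := hr.weak_of_early hk hk1 hT hθ ht₁ h0
    have sF : Sm fun y t => f₁ (charS k 1 y t) * f₂ (charS k (-1) y t) :=
      (Sm.comp hf₁ (Sm.charS k 1)).mul (Sm.comp hf₂ (Sm.charS k (-1)))
    have he' : ∀ y ∈ Ioo (0 : ℝ) 1, ∀ t ∈ Ioo 0 T, waveL k θ y t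
        = 4 * k ^ 2 * (f₁ (charS k 1 y t) * f₂ (charS k (-1) y t)) := fun y hy t ht =>
      (wave_opL_eq hθ.smooth hk ht.1.le y).symm.trans (he y hy t (Ioo_subset_Icc_self ht))
    rw [pairQ_congr he', pairQ_const_mul _ sF.continuous] at h1
    exact (mul_eq_zero.1 h1).resolve_left (by positivity)
  have h1 := eqOn_Icc_of_ae_muTime hT key (h10ValL.continuous.comp_continuousOn hr.cont)
    continuousOn_const
  exact fun t ht => h10_ext (h1 ht)

theorem IsAdjointState.eqOn (hk : 0 < k) (hk1 : k < 1) (hT : 0 < T) {F F' : ℝ → L2} {q q' : ℝ → H10}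
    {dq dq' : ℝ → L2} (h : IsAdjointState k T F q dq) (h' : IsAdjointState k T F' q' dq')
    (hF : F =ᵐ[muTime T] F') (hq : q T = q' T) (hdq : dq T = dq' T) : EqOn q q' (Icc 0 T) := by
  have hTm : T ∈ Icc 0 T := ⟨hT.le, le_rfl⟩
  have m1 : MemLp (fun t => h10Val (q t)) 2 (muTime T) :=
    memLp_of_continuousOn (h10ValL.continuous.comp_continuousOn h.cont) 2
  have m2 : MemLp (fun t => h10Val (q' t)) 2 (muTime T) :=
    memLp_of_continuousOn (h10ValL.continuous.comp_continuousOn h'.cont) 2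
  have hr : IsNullAdjoint k T fun t => q t - q' t := by
    refine ⟨h.cont.sub h'.cont, ?_, ?_, fun ζ hζ => ?_⟩
    · have := (h.hasDeriv T hTm).sub (h'.hasDeriv T hTm)
      rw [hdq, sub_self] at this
      exact this
    · rw [hq, sub_self]; rfl
    · have e1 := h.weak ζ hζ
      have e2 := h'.weak ζ hζ
      rw [weak_eq_pairQ hζ.sm hk, source_eq_pairQ hζ.sm] at e1 e2
      have e3 := pairQ_sub_left m1 m2 (hζ.sm.waveL k).continuous
      rw [e1, e2, pairQ_congr_ae hF, sub_self] at e3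
      exact e3
  exact fun t ht => sub_eq_zero.1 (hr.eq_zero hk hk1 hT t ht)

theorem IsAdjointState.eqOn_deriv (hT : 0 < T) {F F' : ℝ → L2} {q q' : ℝ → H10}
    {dq dq' : ℝ → L2} (h : IsAdjointState k T F q dq) (h' : IsAdjointState k T F' q' dq')
    (hq : EqOn q q' (Icc 0 T)) : EqOn dq dq' (Icc 0 T) :=
  eqOn_deriv_of_eqOn hT h.hasDeriv h'.hasDeriv fun _ ht => congrArg h10Val (hq ht)

/-- The averages cancel in the difference of the two approximating expressions. That the second
curve is bounded and continuous on the line supplies their measurability. -/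
theorem IsNormalTrace.ae_eq {q : ℝ → H10} {u : ℝ →ᵇ H10} {n n' : ℝ → ℝ}
    (hq : EqOn q u (Icc 0 T)) (h : IsNormalTrace T q n) (h' : IsNormalTrace T u n') :
    n =ᵐ[muTime T] n' := by
  set a : ℝ → ℝ → ℝ := fun ε t => ε⁻¹ * ∫ y in Ioo 0 ε, h10Deriv (u t) y
  have hnear : ∀ᶠ ε in 𝓝[>] (0 : ℝ), ε ∈ Ioo 0 1 := Ioo_mem_nhdsGT one_pos
  have h1 : Tendsto (fun ε => eLpNorm (fun t => a ε t + n t) 2 (muTime T)) (𝓝[>] 0) (𝓝 0) := by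
    refine h.tendsto.congr fun ε => eLpNorm_congr_ae ?_
    filter_upwards [ae_muTime_mem T] with t ht
    rw [hq (Ioo_subset_Icc_self ht)]
  have h2 := h1.add h'.tendsto
  rw [add_zero] at h2
  have h3 : eLpNorm (n - n') 2 (muTime T) ≤ 0 := by
    refine ge_of_tendsto h2 ?_
    filter_upwards [hnear] with ε hε
    have ma : AEStronglyMeasurable (a ε) (muTime T) :=
      (Lp.aestronglyMeasurable (avgL T ε u)).congr (coeFn_avgL hε.2.le u)
    have := eLpNorm_sub_le (ma.add h.memLp.1) (ma.add h'.memLp.1) one_le_two (p := 2)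
    rw [add_sub_add_left_eq_sub] at this
    exact this
  have h4 := (eLpNorm_eq_zero_iff (h.memLp.1.sub h'.memLp.1) two_ne_zero).1
    (le_antisymm h3 zero_le)
  filter_upwards [h4] with t ht
  exact sub_eq_zero.1 ht

end

/-! ### Convex minimization in Hilbert spaces -/

section

variable {W : Type*} [NormedAddCommGroup W] [InnerProductSpace ℝ W]

/-- Lax–Milgram: the form of σ + A is coercive with constant σ. -/
theorem exists_equiv_of_nonneg [CompleteSpace W] (A : W →L[ℝ] W) (hA : ∀ u, 0 ≤ inner ℝ (A u) u)
    {σ : ℝ} (hσ : 0 < σ) :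
    ∃ e : W ≃L[ℝ] W, (e : W →L[ℝ] W) = σ • ContinuousLinearMap.id ℝ W + A := by
  set S : W →L[ℝ] W := σ • ContinuousLinearMap.id ℝ W + A
  have hB : IsCoercive ((innerSL ℝ).comp S) := by
    refine ⟨σ, hσ, fun u => ?_⟩
    change σ * ‖u‖ * ‖u‖ ≤ inner ℝ (σ • u + A u) u
    rw [inner_add_left, inner_smul_left, real_inner_self_eq_norm_sq]
    have := hA u
    simp only [conj_trivial]
    nlinarith
  refine ⟨hB.continuousLinearEquivOfBilin, ?_⟩
  ext u
  exact ext_inner_right ℝ fun w => hB.continuousLinearEquivOfBilin_apply u w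

/-- A quadratic functional is minimal where its gradient vanishes. -/
theorem quadratic_min_iff {Q : W → ℝ} {z g : W} {q : W → ℝ} (hq : ∀ h, 0 ≤ q h)
    (hq2 : ∀ (t : ℝ) h, q (t • h) = t ^ 2 * q h)
    (hQ : ∀ h, Q (z + h) = Q z + inner ℝ g h + q h) : (∀ u, Q z ≤ Q u) ↔ g = 0 := by
  constructor
  · intro hmin
    by_contra hg
    have hg0 : 0 < ‖g‖ ^ 2 := by have := norm_pos_iff.2 hg; positivity
    -- For a step -t g the linear gain is t‖g‖² and the quadratic loss t² q(g); this t keeps the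
    -- loss below half of the gain.
    set t := ‖g‖ ^ 2 / (q g + 1) / 2
    have hq0 := hq g
    have ht : 0 < t := by positivity
    have h1 := hmin (z + (-t) • g)
    rw [hQ, hq2, inner_smul_right, real_inner_self_eq_norm_sq] at h1
    have h2 : t * (q g + 1) = ‖g‖ ^ 2 / 2 := by
      simp only [t]; field_simp
    nlinarith
  · rintro rfl u
    have := hQ (u - z)
    rw [add_sub_cancel, inner_zero_left] at this
    linarith [hq (u - z)]

/-! ### Variational inequalities and elements of least norm. -/

variable {X : Type*} [NormedAddCommGroup X] [NormedSpace ℝ X]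

/-- A continuous gauge: nonnegative, positively homogeneous and subadditive. -/
structure IsGauge (j : X → ℝ) : Prop where
  cont : Continuous j
  nonneg : ∀ x, 0 ≤ j x
  smul : ∀ (t : ℝ) x, 0 ≤ t → j (t • x) = t * j x
  add : ∀ x y, j (x + y) ≤ j x + j y

variable {Λ : X →L[ℝ] W} {m : X →L[ℝ] ℝ} {j : X → ℝ}

/-- The variational inequality for the functional `‖Λ x‖² / 2 - m x + j x`. -/
def VarIneq (Λ : X →L[ℝ] W) (m : X →L[ℝ] ℝ) (j : X → ℝ) (f : X) : Prop :=
  ∀ g, 0 ≤ inner ℝ (Λ f) (Λ (g - f)) - m (g - f) + j g - j f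

/-- The dual constraint of the variational inequality. -/
def DualAdmissible (Λ : X →L[ℝ] W) (m : X →L[ℝ] ℝ) (j : X → ℝ) (w : W) : Prop :=
  ∀ h, 0 ≤ inner ℝ w (Λ h) - m h + j h

/-- The functional minimized by the solution of the variational inequality. -/
def dualCost (Λ : X →L[ℝ] W) (m : X →L[ℝ] ℝ) (j : X → ℝ) (x : X) : ℝ :=
  1 / 2 * ‖Λ x‖ ^ 2 - m x + j x

theorem varIneq_of_min (hj : IsGauge j) {f : X}
    (h : ∀ x, dualCost Λ m j f ≤ dualCost Λ m j x) : VarIneq Λ m j f := by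
  intro g
  by_contra hneg
  set I := inner ℝ (Λ f) (Λ (g - f)) - m (g - f) + j g - j f
  have hI : I < 0 := not_le.1 hneg
  set N := ‖Λ (g - f)‖ ^ 2
  have hN : 0 ≤ N := by positivity
  -- Along f + t(g - f) the functional changes by at most tI + t²N/2, which is negative for this t
  -- when I < 0.
  set t := min 1 (-I / (N + 1))
  have ht : 0 < t := lt_min one_pos (div_pos (neg_pos.2 hI) (by positivity))
  have ht1 : t ≤ 1 := min_le_left _ _
  have htN : t * (N + 1) ≤ -I := by
    have := min_le_right 1 (-I / (N + 1))
    rwa [le_div_iff₀ (by positivity)] at this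
  have h1 := h (f + t • (g - f))
  have h2 : j (f + t • (g - f)) ≤ (1 - t) * j f + t * j g := by
    have e : f + t • (g - f) = (1 - t) • f + t • g := by
      rw [smul_sub, sub_smul, one_smul]; abel
    rw [e]
    refine (hj.add _ _).trans ?_
    rw [hj.smul _ _ (by linarith), hj.smul _ _ ht.le]
  have h3 : ‖Λ (f + t • (g - f))‖ ^ 2
      = ‖Λ f‖ ^ 2 + 2 * (t * inner ℝ (Λ f) (Λ (g - f))) + t ^ 2 * N := by
    rw [map_add, map_smul, norm_add_sq_real, inner_smul_right, norm_smul, mul_pow,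
      Real.norm_eq_abs, sq_abs]
  have h4 : m (f + t • (g - f)) = m f + t * m (g - f) := by
    rw [map_add, map_smul, smul_eq_mul]
  simp only [dualCost] at h1
  rw [h3, h4] at h1
  have h5 : 0 ≤ t * I + 1 / 2 * (t ^ 2 * N) := by
    simp only [I]
    linarith
  nlinarith

/-- No weak compactness is needed: by the parallelogram law the functional is uniformly convex in ‖Λ
·‖, so a minimizing sequence is Cauchy there, and hΛ transfers this to X. -/
theorem exists_min_dualCost [CompleteSpace X] (hj : IsGauge j) {c : ℝ} (hc : 0 < c)
    (hΛ : ∀ x, ‖x‖ ≤ c * ‖Λ x‖) : ∃ f, ∀ x, dualCost Λ m j f ≤ dualCost Λ m j x := by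
  have hbdd : BddBelow (range (dualCost Λ m j)) := by
    -- Complete the square, using |m x| ≤ ‖m‖ c ‖Λ x‖ and the nonnegativity of j.
    refine ⟨-(1 / 2 * (‖m‖ * c) ^ 2), ?_⟩
    rintro _ ⟨x, rfl⟩
    have h1 := (le_abs_self _).trans (m.le_opNorm x)
    have h2 := mul_le_mul_of_nonneg_left (hΛ x) (norm_nonneg m)
    have h3 := hj.nonneg x
    rw [dualCost]
    nlinarith [sq_nonneg (‖Λ x‖ - ‖m‖ * c)]
  set I := sInf (range (dualCost Λ m j))
  have hI : ∀ x, I ≤ dualCost Λ m j x := fun x => csInf_le hbdd ⟨x, rfl⟩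
  have hex : ∀ n : ℕ, ∃ x, dualCost Λ m j x < I + 1 / ((n : ℝ) + 1) := by
    intro n
    obtain ⟨_, ⟨x, rfl⟩, hx⟩ := exists_lt_of_csInf_lt (range_nonempty (dualCost Λ m j))
      (show I < I + 1 / ((n : ℝ) + 1) by have : 0 < 1 / ((n : ℝ) + 1) := by positivity
                                         linarith)
    exact ⟨x, hx⟩
  choose x hx using hex
  have hpar : ∀ a b : X, 1 / 8 * ‖Λ (a - b)‖ ^ 2
      ≤ 1 / 2 * dualCost Λ m j a + 1 / 2 * dualCost Λ m j b - I := by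
    intro a b
    have h1 := hI ((1 / 2 : ℝ) • (a + b))
    have h2 : j ((1 / 2 : ℝ) • (a + b)) ≤ 1 / 2 * j a + 1 / 2 * j b := by
      rw [hj.smul _ _ (by norm_num)]
      have := hj.add a b
      linarith
    have h3 := parallelogram_law_with_norm ℝ (Λ a) (Λ b)
    have h4 : ‖Λ ((1 / 2 : ℝ) • (a + b))‖ ^ 2 = 1 / 4 * ‖Λ a + Λ b‖ ^ 2 := by
      rw [map_smul, map_add, norm_smul, mul_pow]; norm_num
    have h5 : m ((1 / 2 : ℝ) • (a + b)) = 1 / 2 * m a + 1 / 2 * m b := by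
      rw [map_smul, map_add, smul_eq_mul]; ring
    simp only [dualCost] at h1 ⊢
    rw [h4, h5] at h1
    rw [map_sub]
    nlinarith
  have hcauchy : CauchySeq x := by
    refine Metric.cauchySeq_iff'.2 fun ε hε => ?_
    obtain ⟨N, hN⟩ := exists_nat_one_div_lt (show 0 < ε ^ 2 / (8 * c ^ 2) by positivity)
    refine ⟨N, fun n hn => ?_⟩
    have h1 := hpar (x n) (x N)
    have h2 := hx n
    have h3 := hx N
    have h4 : 1 / ((n : ℝ) + 1) ≤ 1 / ((N : ℝ) + 1) :=
      one_div_le_one_div_of_le (by positivity) (by have : (N : ℝ) ≤ n := by exact_mod_cast hn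
                                                   linarith)
    have h5 : ‖Λ (x n - x N)‖ ^ 2 < ε ^ 2 / c ^ 2 := by
      have : ε ^ 2 / (8 * c ^ 2) = 1 / 8 * (ε ^ 2 / c ^ 2) := by field_simp
      linarith
    have h6 : ‖Λ (x n - x N)‖ < ε / c := by
      rw [← div_pow] at h5
      exact lt_of_pow_lt_pow_left₀ 2 (by positivity) h5
    rw [dist_eq_norm]
    refine (hΛ _).trans_lt ?_
    rw [lt_div_iff₀ hc] at h6
    linarith
  obtain ⟨f, hf⟩ := cauchySeq_tendsto_of_complete hcauchy
  refine ⟨f, fun y => le_trans ?_ (hI y)⟩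
  have hcont : Continuous (dualCost Λ m j) := by
    have := hj.cont
    unfold dualCost
    fun_prop
  have hlim : Tendsto (fun n : ℕ => I + 1 / ((n : ℝ) + 1)) atTop (𝓝 (I + 0)) :=
    tendsto_const_nhds.add tendsto_one_div_add_atTop_nhds_zero_nat
  rw [add_zero] at hlim
  exact le_of_tendsto_of_tendsto' ((hcont.tendsto f).comp hf) hlim fun n => (hx n).le

/-- Adding the inequalities of two solutions, each tested with the other, gives ‖Λ(g - f)‖ = 0,
hence g = f by hΛ. -/
theorem existsUnique_varIneq [CompleteSpace X] (hj : IsGauge j) {c : ℝ} (hc : 0 < c)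
    (hΛ : ∀ x, ‖x‖ ≤ c * ‖Λ x‖) : ∃! f, VarIneq Λ m j f := by
  obtain ⟨f, hf⟩ := exists_min_dualCost (m := m) hj hc hΛ
  refine ⟨f, varIneq_of_min hj hf, fun g hg => ?_⟩
  have h1 := varIneq_of_min hj hf g
  have h2 := hg f
  have h3 : ‖Λ (g - f)‖ ^ 2 ≤ 0 := by
    have e : inner ℝ (Λ f) (Λ (g - f)) + inner ℝ (Λ g) (Λ (f - g)) = -‖Λ (g - f)‖ ^ 2 := by
      rw [← neg_sub g f, map_neg, inner_neg_right, ← sub_eq_add_neg, ← inner_sub_left, ← map_sub,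
        ← neg_sub g f, map_neg, inner_neg_left, real_inner_self_eq_norm_sq]
    have e2 : m (f - g) = -m (g - f) := by rw [← neg_sub g f, map_neg]
    rw [e2] at h2
    linarith
  have h4 : ‖Λ (g - f)‖ = 0 := by nlinarith [norm_nonneg (Λ (g - f))]
  have h5 := hΛ (g - f)
  rw [h4, mul_zero] at h5
  exact sub_eq_zero.1 (norm_le_zero_iff.1 h5)

/-- Test with f + h and use subadditivity of j. -/
theorem VarIneq.dualAdmissible (hj : IsGauge j) {f : X} (hf : VarIneq Λ m j f) :
    DualAdmissible Λ m j (Λ f) := by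
  intro h
  have h1 := hf (f + h)
  rw [add_sub_cancel_left] at h1
  linarith [hj.add f h]

/-- The inequality tested with 0 gives m(f) - j(f) ≥ ‖Λ f‖², and admissibility of w at h = f gives
(w, Λ f) ≥ m(f) - j(f). So Λ f is the projection of 0 on the admissible set, which yields minimality
and uniqueness at once. -/
theorem VarIneq.norm_sub_sq_le (hj : IsGauge j) {f : X} (hf : VarIneq Λ m j f) {w : W}
    (hw : DualAdmissible Λ m j w) : ‖w - Λ f‖ ^ 2 ≤ ‖w‖ ^ 2 - ‖Λ f‖ ^ 2 := by
  have h1 := hf 0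
  have hj0 : j 0 = 0 := by
    have := hj.smul 0 0 le_rfl
    rwa [zero_smul, zero_mul] at this
  rw [zero_sub, map_neg, map_neg, inner_neg_right, real_inner_self_eq_norm_sq, hj0] at h1
  have h2 := hw f
  rw [norm_sub_sq_real]
  linarith

end

/-! ### The control operators -/

section

variable {k T σ : ℝ}

/-- The state as a function of the control, in `L²(Q)`. -/
def stateL (k : ℝ) (hT : 0 ≤ T) : Lp ℝ 2 (muTime T) →L[ℝ] L2L2 T :=
  (toL2L2 T).comp (statePos k hT)

/-- Multiplication by the length of the string. -/
def alphaMul (k T : ℝ) : L2L2 T →L[ℝ] L2L2 T := timeMul T (contDiff_alpha k).continuous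

/-- The trace of the solution of the homogeneous backward problem. -/
def dataTrace (k : ℝ) (hT : 0 ≤ T) : (H10 × L2) →L[ℝ] Lp ℝ 2 (muTime T) :=
  (adjTrace k hT).comp ((ContinuousLinearMap.fst ℝ H10 L2).prod
    ((ContinuousLinearMap.snd ℝ H10 L2).prod 0))

/-- The trace of the solution of the backward problem with zero final data. -/
def sourceTrace (k : ℝ) (hT : 0 ≤ T) : L2L2 T →L[ℝ] Lp ℝ 2 (muTime T) :=
  (adjTrace k hT).comp ((0 : L2L2 T →L[ℝ] H10).prod
    ((0 : L2L2 T →L[ℝ] L2).prod (ContinuousLinearMap.id ℝ (L2L2 T))))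

theorem dataTrace_apply (hT : 0 ≤ T) (f : H10 × L2) :
    dataTrace k hT f = adjTrace k hT (f.1, f.2, 0) := rfl

theorem sourceTrace_apply (hT : 0 ≤ T) (g : L2L2 T) :
    sourceTrace k hT g = adjTrace k hT (0, 0, g) := rfl

theorem adjTrace_eq (hT : 0 ≤ T) (f : H10 × L2) (g : L2L2 T) :
    adjTrace k hT (f.1, f.2, g) = dataTrace k hT f + sourceTrace k hT g := by
  rw [dataTrace_apply, sourceTrace_apply, ← map_add]
  simp

/-- Duality with zero final data: `sourceTrace` is the Hilbert space adjoint of `stateL`, and so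
`gram` is S*αS, symmetric and nonnegative. -/
theorem inner_sourceTrace (hk : 0 < k) (hk1 : k < 1) (hT : 0 < T) (w : Lp ℝ 2 (muTime T))
    (g : L2L2 T) : inner ℝ w (sourceTrace k hT.le g) = inner ℝ (stateL k hT.le w) g := by
  rw [sourceTrace_apply, duality hk hk1 hT]
  simp [stateL]

theorem inner_dataTrace (hk : 0 < k) (hk1 : k < 1) (hT : 0 < T) (w : Lp ℝ 2 (muTime T))
    (f : H10 × L2) : inner ℝ w (dataTrace k hT.le f)
      = stateVel k hT.le w T f.1 - inner ℝ (statePos k hT.le w T) f.2 := by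
  rw [dataTrace_apply, duality hk hk1 hT]
  simp

theorem inner_alphaMul (u v : L2L2 T) :
    inner ℝ (alphaMul k T u) v = ∫ t in Ioo 0 T, alpha k t * inner ℝ (u t) (v t) := by
  rw [L2.inner_def]
  refine integral_congr_ae ?_
  filter_upwards [coeFn_timeMul (contDiff_alpha k).continuous u] with t ht
  rw [alphaMul, ht, inner_smul_left]; rfl

theorem alphaMul_symm (u v : L2L2 T) :
    inner ℝ (alphaMul k T u) v = inner ℝ u (alphaMul k T v) := by
  rw [inner_alphaMul, real_inner_comm, inner_alphaMul]
  exact integral_congr_ae (Eventually.of_forall fun t => by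
    change alpha k t * inner ℝ (u t) (v t) = alpha k t * inner ℝ (v t) (u t)
    rw [real_inner_comm])

theorem alphaMul_nonneg (hk : 0 < k) (u : L2L2 T) : 0 ≤ inner ℝ (alphaMul k T u) u := by
  rw [inner_alphaMul]
  exact setIntegral_nonneg measurableSet_Ioo fun t ht =>
    mul_nonneg (alpha_pos hk ht.1.le).le real_inner_self_nonneg

/-- The Gram operator of the control problem of the follower. -/
def gram (k : ℝ) (hT : 0 ≤ T) : Lp ℝ 2 (muTime T) →L[ℝ] Lp ℝ 2 (muTime T) :=
  (sourceTrace k hT).comp ((alphaMul k T).comp (stateL k hT))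

theorem inner_gram (hk : 0 < k) (hk1 : k < 1) (hT : 0 < T) (w z : Lp ℝ 2 (muTime T)) :
    inner ℝ w (gram k hT.le z) = inner ℝ (stateL k hT.le w) (alphaMul k T (stateL k hT.le z)) :=
  inner_sourceTrace hk hk1 hT _ _

theorem gram_symm (hk : 0 < k) (hk1 : k < 1) (hT : 0 < T) (w z : Lp ℝ 2 (muTime T)) :
    inner ℝ (gram k hT.le w) z = inner ℝ w (gram k hT.le z) := by
  rw [real_inner_comm, inner_gram hk hk1 hT, inner_gram hk hk1 hT, ← alphaMul_symm, real_inner_comm]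

theorem gram_nonneg (hk : 0 < k) (hk1 : k < 1) (hT : 0 < T) (w : Lp ℝ 2 (muTime T)) :
    0 ≤ inner ℝ (gram k hT.le w) w := by
  rw [real_inner_comm, inner_gram hk hk1 hT, ← alphaMul_symm]
  exact alphaMul_nonneg hk _

/-- The inverse of `σ + gram`. -/
def resolv (k : ℝ) (hT : 0 ≤ T) (σ : ℝ) : Lp ℝ 2 (muTime T) →L[ℝ] Lp ℝ 2 (muTime T) :=
  ContinuousLinearMap.inverse (σ • ContinuousLinearMap.id ℝ _ + gram k hT)

theorem resolv_spec (hk : 0 < k) (hk1 : k < 1) (hT : 0 < T) (hσ : 0 < σ)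
    (u : Lp ℝ 2 (muTime T)) :
    σ • resolv k hT.le σ u + gram k hT.le (resolv k hT.le σ u) = u ∧
      resolv k hT.le σ (σ • u + gram k hT.le u) = u := by
  obtain ⟨e, he⟩ := exists_equiv_of_nonneg (gram k hT.le) (gram_nonneg hk hk1 hT) hσ
  have hr : resolv k hT.le σ = (e.symm : Lp ℝ 2 (muTime T) →L[ℝ] Lp ℝ 2 (muTime T)) := by
    rw [resolv, ← he, ContinuousLinearMap.inverse_equiv]
  have h1 : ∀ u, σ • u + gram k hT.le u = e u := fun u => by
    have := congrArg (fun L : Lp ℝ 2 (muTime T) →L[ℝ] Lp ℝ 2 (muTime T) => L u) he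
    exact this.symm
  rw [h1, h1, hr]
  exact ⟨e.apply_symm_apply u, e.symm_apply_apply u⟩

theorem eq_resolv_iff (hk : 0 < k) (hk1 : k < 1) (hT : 0 < T) (hσ : 0 < σ)
    {u z : Lp ℝ 2 (muTime T)} : z = resolv k hT.le σ u ↔ σ • z + gram k hT.le z = u := by
  constructor
  · rintro rfl; exact (resolv_spec hk hk1 hT hσ u).1
  · rintro rfl; exact (resolv_spec hk hk1 hT hσ z).2.symm

theorem resolv_symm (hk : 0 < k) (hk1 : k < 1) (hT : 0 < T) (hσ : 0 < σ)
    (u z : Lp ℝ 2 (muTime T)) :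
    inner ℝ (resolv k hT.le σ u) z = inner ℝ u (resolv k hT.le σ z) := by
  have h1 := (resolv_spec hk hk1 hT hσ u).1
  have h2 := (resolv_spec hk hk1 hT hσ z).1
  conv_lhs => rw [← h2]
  conv_rhs => rw [← h1]
  rw [inner_add_left, inner_add_right, inner_smul_left, inner_smul_right, gram_symm hk hk1 hT]
  rfl

/-- The control of the leader as a function of the final data. -/
def leaderMap (k : ℝ) (hT : 0 ≤ T) (σ : ℝ) : (H10 × L2) →L[ℝ] Lp ℝ 2 (muTime T) :=
  σ • (resolv k hT σ).comp (dataTrace k hT)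

theorem leaderMap_apply (hT : 0 ≤ T) (f : H10 × L2) :
    leaderMap k hT σ f = σ • resolv k hT σ (dataTrace k hT f) := rfl

/-- The equation left for the trace c of φ when ψ is eliminated: ψ is the state for the control
-σ⁻¹c, and as a source of φ it contributes -σ⁻¹Gc to the trace. -/
theorem leaderMap_spec (hk : 0 < k) (hk1 : k < 1) (hT : 0 < T) (hσ : 0 < σ) (f : H10 × L2) :
    leaderMap k hT.le σ f + σ⁻¹ • gram k hT.le (leaderMap k hT.le σ f) = dataTrace k hT.le f := by
  have h := (resolv_spec hk hk1 hT hσ (dataTrace k hT.le f)).1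
  rw [leaderMap_apply, map_smul, smul_smul, inv_mul_cancel₀ hσ.ne', one_smul, h]

/-- Observability with zero source bounds f by `dataTrace` f, and `leaderMap_spec` bounds
`dataTrace` f by the leader. -/
theorem exists_leaderMap_bound (hk : 0 < k) (hk1 : k < 1) (hT : 2 / (1 - k) < T) (hT0 : 0 < T)
    (hσ : 0 < σ) : ∃ c : ℝ, 0 < c ∧ ∀ f, ‖f‖ ≤ c * ‖leaderMap k hT0.le σ f‖ := by
  obtain ⟨C, hC0, hC⟩ := exists_observability_data hk hk1 hT hT0
  refine ⟨C * (1 + σ⁻¹ * ‖gram k hT0.le‖), by positivity, fun f => ?_⟩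
  have h1 := hC (f.1, f.2, 0)
  rw [norm_zero, add_zero, ← dataTrace_apply, ← leaderMap_spec hk hk1 hT0 hσ] at h1
  have h2 : ‖f‖ ≤ ‖f.1‖ + ‖f.2‖ :=
    max_le (le_add_of_nonneg_right (norm_nonneg _)) (le_add_of_nonneg_left (norm_nonneg _))
  refine (h2.trans h1).trans ?_
  rw [mul_assoc]
  refine mul_le_mul_of_nonneg_left ?_ hC0.le
  refine (norm_add_le _ _).trans ?_
  rw [norm_smul, Real.norm_of_nonneg (inv_nonneg.2 hσ.le)]
  have := (gram k hT0.le).le_opNorm (leaderMap k hT0.le σ f)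
  have := mul_le_mul_of_nonneg_left this (inv_nonneg.2 hσ.le)
  linarith

/-- The equilibrium total control for a given leader. -/
def totalControl (k : ℝ) (hT : 0 ≤ T) (σ : ℝ) (V : L2L2 T) (u : Lp ℝ 2 (muTime T)) :
    Lp ℝ 2 (muTime T) :=
  resolv k hT σ (σ • u + sourceTrace k hT (alphaMul k T V))

/-! ### The optimality system -/

/-- The conversion between the outward derivative n = -q_y(0,·) and the trace c = q_y(0,·)/α² used
by the operators. -/
theorem neg_alpha_sq_mul (hk : 0 < k) (hσ : 0 < σ) {n : ℝ → ℝ} {c : Lp ℝ 2 (muTime T)}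
    (hn : n =ᵐ[muTime T] fun t => -(alpha k t ^ 2 * c t)) :
    (fun t => 1 / (σ * alpha k t ^ 2) * n t) =ᵐ[muTime T] ⇑(-(σ⁻¹ • c)) ∧
      (fun t => -(1 / alpha k t ^ 2) * n t) =ᵐ[muTime T] c := by
  constructor
  · filter_upwards [hn, ae_muTime_mem T, Lp.coeFn_neg (σ⁻¹ • c), Lp.coeFn_smul σ⁻¹ c]
      with t h1 ht h2 h3
    have := (alpha_pos hk ht.1.le).ne'
    rw [h1, h2, Pi.neg_apply, h3, Pi.smul_apply, smul_eq_mul]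
    field_simp
  · filter_upwards [hn, ae_muTime_mem T] with t h1 ht
    have := (alpha_pos hk ht.1.le).ne'
    rw [h1]
    field_simp

theorem alphaMul_stateL_ae (hT : 0 ≤ T) (w : Lp ℝ 2 (muTime T)) {u : ℝ → L2}
    (hu : EqOn u (statePos k hT w) (Icc 0 T)) :
    alphaMul k T (stateL k hT w) =ᵐ[muTime T] fun t => alpha k t • u t := by
  filter_upwards [coeFn_timeMul (contDiff_alpha k).continuous (stateL k hT w),
    coeFn_toL2L2 T (statePos k hT w), ae_muTime_mem T] with t h1 h2 ht
  rw [alphaMul, h1, hu (Ioo_subset_Icc_self ht)]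
  exact congrArg _ h2

theorem alphaMul_stateL_sub_ae (hT : 0 ≤ T) (w : Lp ℝ 2 (muTime T)) {u v₂ : ℝ → L2} {V : L2L2 T}
    (hu : EqOn u (statePos k hT w) (Icc 0 T)) (hV : V =ᵐ[muTime T] v₂) :
    alphaMul k T (stateL k hT w - V) =ᵐ[muTime T] fun t => alpha k t • (u t - v₂ t) := by
  filter_upwards [coeFn_timeMul (contDiff_alpha k).continuous (stateL k hT w - V),
    coeFn_toL2L2 T (statePos k hT w), ae_muTime_mem T, Lp.coeFn_sub (stateL k hT w) V, hV]
    with t h1 h2 ht h3 h4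
  rw [alphaMul, h1, h3, hu (Ioo_subset_Icc_self ht), Pi.sub_apply, h4]
  exact congrArg (fun x => alpha k t • (x - v₂ t)) h2

variable {v₂ : ℝ → L2} {V : L2L2 T}

/-- The solution of the optimality system. -/
def optQuad (k : ℝ) (hT : 0 ≤ T) (σ : ℝ) (V : L2L2 T) (f : H10 × L2) : Quadruple :=
  let c := leaderMap k hT σ f
  let wψ := -(σ⁻¹ • c)
  let w := totalControl k hT σ V c
  let dφ : H10 × L2 × L2L2 T := (f.1, f.2, alphaMul k T (stateL k hT wψ))
  let dp : H10 × L2 × L2L2 T := (0, 0, alphaMul k T (stateL k hT w - V))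
  { φ := adjPos k hT dφ
    dφ := adjVel k hT dφ
    ψ := statePos k hT wψ
    dψ := stateVel k hT wψ
    v := statePos k hT w
    dv := stateVel k hT w
    p := adjPos k hT dp
    dp := adjVel k hT dp
    nφ := fun t => -(alpha k t ^ 2 * c t)
    np := fun t => -(alpha k t ^ 2 * adjTrace k hT dp t) }

theorem adjTrace_leader (hk : 0 < k) (hk1 : k < 1) (hT : 0 < T) (hσ : 0 < σ) (f : H10 × L2) :
    adjTrace k hT.le (f.1, f.2, alphaMul k T (stateL k hT.le (-(σ⁻¹ • leaderMap k hT.le σ f))))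
      = leaderMap k hT.le σ f := by
  have h := leaderMap_spec hk hk1 hT hσ f
  have h2 : sourceTrace k hT.le (alphaMul k T (stateL k hT.le (-(σ⁻¹ • leaderMap k hT.le σ f))))
      = -(σ⁻¹ • gram k hT.le (leaderMap k hT.le σ f)) := by
    rw [map_neg, map_neg, map_neg, map_smul, map_smul, map_smul]; rfl
  rw [adjTrace_eq, h2, ← h]
  abel

theorem adjTrace_follower (hT : 0 ≤ T) (w : Lp ℝ 2 (muTime T)) :
    adjTrace k hT (0, 0, alphaMul k T (stateL k hT w - V))
      = gram k hT w - sourceTrace k hT (alphaMul k T V) := by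
  rw [← sourceTrace_apply, map_sub, map_sub]; rfl

/-- The right side is the boundary condition of v, with u the trace of φ and Gw - S*αV the trace of
p; it is the follower's equation (σ + G)w = σu + S*αV divided by σ. -/
theorem eq_totalControl_iff (hk : 0 < k) (hk1 : k < 1) (hT : 0 < T) (hσ : 0 < σ)
    {u w : Lp ℝ 2 (muTime T)} : w = totalControl k hT.le σ V u ↔
      w = u - σ⁻¹ • (gram k hT.le w - sourceTrace k hT.le (alphaMul k T V)) := by
  rw [totalControl, eq_resolv_iff hk hk1 hT hσ]
  set b := sourceTrace k hT.le (alphaMul k T V)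
  constructor
  · intro h
    have h1 : gram k hT.le w - b = σ • (u - w) := by
      rw [smul_sub, sub_eq_sub_iff_add_eq_add, add_comm, h]
    rw [h1, smul_smul, inv_mul_cancel₀ hσ.ne', one_smul, sub_sub_cancel]
  · intro h
    have h1 : σ • w = σ • u - (gram k hT.le w - b) := by
      conv_lhs => rw [h]
      rw [smul_sub, smul_smul, mul_inv_cancel₀ hσ.ne', one_smul]
    rw [h1]; abel

theorem control_ae (hk : 0 < k) (hσ : 0 < σ) {n n' : ℝ → ℝ} {c c' : Lp ℝ 2 (muTime T)}
    (hn : n =ᵐ[muTime T] fun t => -(alpha k t ^ 2 * c t))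
    (hn' : n' =ᵐ[muTime T] fun t => -(alpha k t ^ 2 * c' t)) :
    (fun t => -(1 / alpha k t ^ 2) * n t + 1 / (σ * alpha k t ^ 2) * n' t)
      =ᵐ[muTime T] ⇑(c - σ⁻¹ • c') := by
  filter_upwards [(neg_alpha_sq_mul hk hσ hn).2, (neg_alpha_sq_mul hk hσ hn').1,
    Lp.coeFn_sub c (σ⁻¹ • c'), Lp.coeFn_neg (σ⁻¹ • c')] with t h1 h2 h3 h4
  rw [h1, h2, h3, h4, Pi.sub_apply, Pi.neg_apply, sub_eq_add_neg]

theorem isOptimalitySystem_optQuad (hk : 0 < k) (hk1 : k < 1) (hT : 0 < T) (hσ : 0 < σ)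
    (hV : V =ᵐ[muTime T] v₂) (f : H10 × L2) :
    IsOptimalitySystem k T σ v₂ f (optQuad k hT.le σ V f) where
  φ_eq := isAdjointState_adjPos hk hk1 hT _ (alphaMul_stateL_ae hT.le _ fun _ _ => rfl)
  φ_trace := isNormalTrace_adjPos hk hk1 hT _ (by
    rw [adjTrace_leader hk hk1 hT hσ f]; exact EventuallyEq.rfl)
  φ_final := adjPos_final hk hk1 hT _
  dφ_final := adjVel_final hk hk1 hT (f.1, f.2, _)
  ψ_eq := isState_statePos hk hk1 hT _ (neg_alpha_sq_mul hk hσ EventuallyEq.rfl).1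
  v_eq := isState_statePos hk hk1 hT _ (by
    refine (control_ae hk hσ EventuallyEq.rfl EventuallyEq.rfl).trans ?_
    rw [adjTrace_follower, ← (eq_totalControl_iff hk hk1 hT hσ).1 rfl])
  p_eq := isAdjointState_adjPos hk hk1 hT _ (alphaMul_stateL_sub_ae hT.le _ (fun _ _ => rfl) hV)
  p_trace := isNormalTrace_adjPos hk hk1 hT _ EventuallyEq.rfl
  p_final := adjPos_final hk hk1 hT _
  dp_final := by
    have h := adjVel_final hk hk1 hT (0, 0, alphaMul k T (stateL k hT.le
      (totalControl k hT.le σ V (leaderMap k hT.le σ f)) - V))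
    refine Lp.ext ?_
    have z0 : (h10Val (0 : H10) : L2) = 0 := rfl
    have z1 : (h10Deriv (0 : H10) : L2) = 0 := rfl
    filter_upwards [h, Lp.coeFn_zero ℝ 2 muOmega] with y h1 h2
    rw [z0, z1, h2] at h1
    rw [h2]
    simp only [Pi.zero_apply, mul_zero, add_zero, zero_div] at h1 ⊢
    exact h1

theorem adjVel_eq_of_final (hk : 0 < k) (hk1 : k < 1) (hT : 0 < T) (f : H10 × L2) (g : L2L2 T)
    {u : L2} (hu : ∀ᵐ y ∂muOmega, u y
      + (deriv (gamma k) y * h10Val f.1 y + gamma k y * h10Deriv f.1 y) / alpha k T = f.2 y) :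
    u = adjVel k hT.le (f.1, f.2, g) T := by
  refine Lp.ext ?_
  filter_upwards [hu, adjVel_final hk hk1 hT (f.1, f.2, g)] with y h1 h2
  linarith

theorem IsAdjointState.eq_adjPos (hk : 0 < k) (hk1 : k < 1) (hT : 0 < T) {F : ℝ → L2} {q : ℝ → H10}
    {dq : ℝ → L2} {n : ℝ → ℝ} (h : IsAdjointState k T F q dq) (hn : IsNormalTrace T q n)
    {f : H10 × L2} {g : L2L2 T} (hg : g =ᵐ[muTime T] F) (h0 : q T = f.1)
    (h1 : dq T = adjVel k hT.le (f.1, f.2, g) T) :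
    EqOn q (adjPos k hT.le (f.1, f.2, g)) (Icc 0 T) ∧
      EqOn dq (adjVel k hT.le (f.1, f.2, g)) (Icc 0 T) ∧
      n =ᵐ[muTime T] fun t => -(alpha k t ^ 2 * adjTrace k hT.le (f.1, f.2, g) t) := by
  have hs := isAdjointState_adjPos hk hk1 hT (f.1, f.2, g) hg
  have e := h.eqOn hk hk1 hT hs EventuallyEq.rfl
    (h0.trans (adjPos_final hk hk1 hT (f.1, f.2, g)).symm) h1
  exact ⟨e, h.eqOn_deriv hT hs e,
    IsNormalTrace.ae_eq e hn (isNormalTrace_adjPos hk hk1 hT _ EventuallyEq.rfl)⟩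

/-- By uniqueness of states and adjoint states, all components are given by the solution operators
applied to the boundary controls and to f. The two remaining unknowns, the trace c of φ and the
control w of v, solve linear equations with operator σ + G: first c, which does not involve w, then
w. -/
theorem IsOptimalitySystem.same_optQuad (hk : 0 < k) (hk1 : k < 1) (hT : 0 < T) (hσ : 0 < σ)
    (hV : V =ᵐ[muTime T] v₂) {f : H10 × L2} {s : Quadruple}
    (h : IsOptimalitySystem k T σ v₂ f s) : s.Same T (optQuad k hT.le σ V f) := by
  have hwψ := coeFn_lpc_of_memLp h.ψ_eq.control_memLp
  set wψ := lpc T fun t => 1 / (σ * alpha k t ^ 2) * s.nφ t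
  have hw := coeFn_lpc_of_memLp h.v_eq.control_memLp
  set w := lpc T fun t => -(1 / alpha k t ^ 2) * s.nφ t + 1 / (σ * alpha k t ^ 2) * s.np t
  have sψ := isState_statePos hk hk1 hT wψ hwψ.symm
  have sv := isState_statePos hk hk1 hT w hw.symm
  have eψ := h.ψ_eq.eqOn hk hk1 hT sψ EventuallyEq.rfl
  have edψ := h.ψ_eq.eqOn_deriv hk hk1 hT sψ EventuallyEq.rfl
  have ev := h.v_eq.eqOn hk hk1 hT sv EventuallyEq.rfl
  have edv := h.v_eq.eqOn_deriv hk hk1 hT sv EventuallyEq.rfl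
  obtain ⟨eφ, edφ, enφ⟩ := h.φ_eq.eq_adjPos hk hk1 hT h.φ_trace (f := f)
    (alphaMul_stateL_ae hT.le wψ eψ) h.φ_final (adjVel_eq_of_final hk hk1 hT f _ h.dφ_final)
  have z0 : (h10Val (0 : H10) : L2) = 0 := rfl
  have z1 : (h10Deriv (0 : H10) : L2) = 0 := rfl
  have hdp := adjVel_eq_of_final hk hk1 hT (0 : H10 × L2) (alphaMul k T (stateL k hT.le w - V))
    (u := s.dp T) (by
      rw [h.dp_final]
      change ∀ᵐ y ∂muOmega, (0 : L2) y + (deriv (gamma k) y * h10Val (0 : H10) y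
        + gamma k y * h10Deriv (0 : H10) y) / alpha k T = (0 : L2) y
      rw [z0, z1]
      filter_upwards [Lp.coeFn_zero ℝ 2 muOmega] with y h2
      rw [h2]; simp)
  obtain ⟨ep, edp, enp⟩ := h.p_eq.eq_adjPos hk hk1 hT h.p_trace (f := 0)
    (alphaMul_stateL_sub_ae hT.le w ev hV) h.p_final hdp
  set c := adjTrace k hT.le (f.1, f.2, alphaMul k T (stateL k hT.le wψ)) with hc
  have hwψ' : wψ = -(σ⁻¹ • c) := Lp.ext (hwψ.trans (neg_alpha_sq_mul hk hσ enφ).1)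
  have hc' : c = leaderMap k hT.le σ f := by
    have h2 : c = dataTrace k hT.le f - σ⁻¹ • gram k hT.le c := by
      conv_lhs => rw [hc, adjTrace_eq, hwψ']
      rw [map_neg, map_neg, map_neg, map_smul, map_smul, map_smul, sub_eq_add_neg]
      rfl
    have h3 : σ⁻¹ • c = resolv k hT.le σ (dataTrace k hT.le f) := by
      rw [eq_resolv_iff hk hk1 hT hσ, smul_smul, mul_inv_cancel₀ hσ.ne', one_smul, map_smul]
      exact eq_sub_iff_add_eq.1 h2
    rw [leaderMap_apply, ← h3, smul_smul, mul_inv_cancel₀ hσ.ne', one_smul]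
  have hw' : w = totalControl k hT.le σ V c := by
    rw [eq_totalControl_iff hk hk1 hT hσ, ← adjTrace_follower]
    exact Lp.ext (hw.trans (control_ae hk hσ enφ enp))
  rw [hwψ', hc'] at eψ edψ eφ edφ
  rw [hw', hc'] at ev edv ep edp enp
  rw [hc'] at enφ
  exact ⟨eφ, edφ, eψ, edψ, ev, edv, ep, edp, enφ, enp⟩

theorem IsOptimalitySystem.same (hk : 0 < k) (hk1 : k < 1) (hT : 0 < T) (hσ : 0 < σ)
    (hV : V =ᵐ[muTime T] v₂) {f : H10 × L2} {s s' : Quadruple}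
    (h : IsOptimalitySystem k T σ v₂ f s) (h' : IsOptimalitySystem k T σ v₂ f s') :
    s.Same T s' := by
  have a := h.same_optQuad hk hk1 hT hσ hV
  have b := h'.same_optQuad hk hk1 hT hσ hV
  exact ⟨a.φ.trans b.φ.symm, a.dφ.trans b.dφ.symm, a.ψ.trans b.ψ.symm, a.dψ.trans b.dψ.symm,
    a.v.trans b.v.symm, a.dv.trans b.dv.symm, a.p.trans b.p.symm, a.dp.trans b.dp.symm,
    a.nφ.trans b.nφ.symm, a.np.trans b.np.symm⟩

end

/-! ### The follower -/

section

variable {k T σ ρ₀ ρ₁ : ℝ} {v₂ : ℝ → L2} {V : L2L2 T} {v0 : L2} {v1 : Hm1}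

/-- The cost of the follower as a function of the controls. -/
def followerCost (k : ℝ) (hT : 0 ≤ T) (σ : ℝ) (V : L2L2 T) (u z : Lp ℝ 2 (muTime T)) : ℝ :=
  1 / 2 * inner ℝ (alphaMul k T (stateL k hT (u + z) - V)) (stateL k hT (u + z) - V)
    + σ / 2 * ‖z‖ ^ 2

theorem integral_sq_eq_norm_sq {z : ℝ → ℝ} (hz : MemLp z 2 (muTime T)) :
    ∫ t in Ioo 0 T, z t ^ 2 = ‖lpc T z‖ ^ 2 := by
  rw [← real_inner_self_eq_norm_sq, L2.inner_def]
  refine integral_congr_ae ?_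
  filter_upwards [coeFn_lpc_of_memLp hz] with t ht
  rw [ht, real_inner_self_eq_norm_sq, Real.norm_eq_abs, sq_abs]

theorem costLeader_eq {w : ℝ → ℝ} (hw : MemLp w 2 (muTime T)) :
    costLeader T w = 1 / 2 * ‖lpc T w‖ ^ 2 := by
  rw [costLeader, integral_sq_eq_norm_sq hw]

theorem costFollower_eq (hk : 0 < k) (hk1 : k < 1) (hT : 0 < T) (hV : V =ᵐ[muTime T] v₂)
    {w₁ z : ℝ → ℝ} {v : ℝ → L2} {dv : ℝ → Hm1} (hw : MemLp w₁ 2 (muTime T))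
    (hz : MemLp z 2 (muTime T)) (h : IsState k T (w₁ + z) v dv) :
    costFollower k T σ v₂ v z = followerCost k hT.le σ V (lpc T w₁) (lpc T z) := by
  have hs : lpc T (w₁ + z) = lpc T w₁ + lpc T z := lpc_add_of_memLp hw hz
  have e := h.eqOn hk hk1 hT (isState_statePos hk hk1 hT _ (coeFn_lpc_of_memLp h.control_memLp).symm)
    EventuallyEq.rfl
  rw [costFollower, followerCost, integral_sq_eq_norm_sq hz, inner_alphaMul, ← hs]
  congr 2
  refine integral_congr_ae ?_
  filter_upwards [coeFn_toL2L2 T (statePos k hT.le (lpc T (w₁ + z))), ae_muTime_mem T,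
    Lp.coeFn_sub (stateL k hT.le (lpc T (w₁ + z))) V, hV] with t h1 ht h2 h3
  have h4 : stateL k hT.le (lpc T (w₁ + z)) t = v t := h1.trans (e (Ioo_subset_Icc_self ht)).symm
  rw [h2, Pi.sub_apply, h3, h4, real_inner_self_eq_norm_sq]

/-- The cost is quadratic in z with gradient σz + S*α(S(u + z) - V); it vanishes exactly when (σ +
G)(u + z) = σu + S*αV. -/
theorem followerCost_min_iff (hk : 0 < k) (hk1 : k < 1) (hT : 0 < T) (hσ : 0 < σ)
    (u z : Lp ℝ 2 (muTime T)) :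
    (∀ x, followerCost k hT.le σ V u z ≤ followerCost k hT.le σ V u x) ↔
      u + z = totalControl k hT.le σ V u := by
  set g := σ • z + sourceTrace k hT.le (alphaMul k T (stateL k hT.le (u + z) - V)) with hg
  rw [quadratic_min_iff (g := g)
    (q := fun h => 1 / 2 * inner ℝ (alphaMul k T (stateL k hT.le h)) (stateL k hT.le h)
      + σ / 2 * ‖h‖ ^ 2)]
  · rw [totalControl, eq_resolv_iff hk hk1 hT hσ, hg, map_sub, map_sub, smul_add, add_assoc,
      add_right_inj]
    change σ • z + (gram k hT.le (u + z) - _) = 0 ↔ _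
    rw [← add_sub_assoc, sub_eq_zero]
  · intro h
    have := alphaMul_nonneg hk (stateL k hT.le h)
    positivity
  · intro t h
    simp only [map_smul, inner_smul_left, inner_smul_right, norm_smul, mul_pow, Real.norm_eq_abs,
      sq_abs, conj_trivial]
    ring
  · intro h
    have h1 : stateL k hT.le (u + (z + h)) - V
        = (stateL k hT.le (u + z) - V) + stateL k hT.le h := by
      rw [← add_assoc, map_add]; abel
    have h2 : inner ℝ (sourceTrace k hT.le (alphaMul k T (stateL k hT.le (u + z) - V))) h
        = inner ℝ (alphaMul k T (stateL k hT.le (u + z) - V)) (stateL k hT.le h) := by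
      rw [real_inner_comm, inner_sourceTrace hk hk1 hT, real_inner_comm]
    have h3 : inner ℝ (alphaMul k T (stateL k hT.le h)) (stateL k hT.le (u + z) - V)
        = inner ℝ (alphaMul k T (stateL k hT.le (u + z) - V)) (stateL k hT.le h) := by
      rw [alphaMul_symm, real_inner_comm]
    rw [followerCost, followerCost, h1, hg, inner_add_left (σ • z), h2, map_add, inner_add_left,
      inner_add_right, inner_add_right, h3, norm_add_sq_real, inner_smul_left, conj_trivial]
    ring

theorem lpc_coeFn (u : Lp ℝ 2 (muTime T)) : lpc T u = u :=
  Lp.ext (coeFn_lpc_of_memLp (Lp.memLp u))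

theorem isNashEquilibrium_iff (hk : 0 < k) (hk1 : k < 1) (hT : 0 < T) (hσ : 0 < σ)
    (hV : V =ᵐ[muTime T] v₂) {w₁ w₂ : ℝ → ℝ} (hw : MemLp w₁ 2 (muTime T)) :
    IsNashEquilibrium k T σ v₂ w₁ w₂ ↔ MemLp w₂ 2 (muTime T) ∧
      lpc T w₁ + lpc T w₂ = totalControl k hT.le σ V (lpc T w₁) := by
  refine and_congr_right fun hw2 => ?_
  have hstate : ∀ z : ℝ → ℝ, MemLp z 2 (muTime T) → ∃ (u : ℝ → L2) (du : ℝ → Hm1),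
      IsState k T (w₁ + z) u du := fun z hz =>
    ⟨_, _, isState_statePos hk hk1 hT _ (coeFn_lpc_of_memLp (hw.add hz)).symm⟩
  rw [← followerCost_min_iff hk hk1 hT hσ]
  constructor
  · rintro ⟨v, dv, hv, hmin⟩ x
    obtain ⟨u, du, hu⟩ := hstate x (Lp.memLp x)
    have h1 := hmin x u du (Lp.memLp x) hu
    rwa [costFollower_eq hk hk1 hT hV hw hw2 hv,
      costFollower_eq hk hk1 hT hV hw (Lp.memLp x) hu, lpc_coeFn] at h1
  · intro hmin
    obtain ⟨v, dv, hv⟩ := hstate w₂ hw2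
    refine ⟨v, dv, hv, fun z u du hz hu => ?_⟩
    rw [costFollower_eq hk hk1 hT hV hw hw2 hv, costFollower_eq hk hk1 hT hV hw hz hu]
    exact hmin _

/-! ### The leader -/

/-- The linear part of the functional of the leader. -/
def leaderLin (k : ℝ) (hT : 0 ≤ T) (σ : ℝ) (V : L2L2 T) (v0 : L2) (v1 : Hm1) :
    (H10 × L2) →L[ℝ] ℝ :=
  v1.comp (ContinuousLinearMap.fst ℝ H10 L2)
    - (innerSL ℝ v0).comp (ContinuousLinearMap.snd ℝ H10 L2)
    - (innerSL ℝ (resolv k hT σ (sourceTrace k hT (alphaMul k T V)))).comp (dataTrace k hT)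

theorem leaderLin_apply (hT : 0 ≤ T) (h : H10 × L2) :
    leaderLin k hT σ V v0 v1 h = v1 h.1 - inner ℝ v0 h.2
      - inner ℝ (resolv k hT σ (sourceTrace k hT (alphaMul k T V))) (dataTrace k hT h) := rfl

/-- The support function of the target. -/
def targetGauge (ρ₀ ρ₁ : ℝ) (h : H10 × L2) : ℝ := ρ₁ * h10Norm h.1 + ρ₀ * ‖h.2‖

theorem isGauge_targetGauge (hρ₀ : 0 ≤ ρ₀) (hρ₁ : 0 ≤ ρ₁) : IsGauge (targetGauge ρ₀ ρ₁) := by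
  have e : targetGauge ρ₀ ρ₁ = fun h => ρ₁ * ‖h.1‖ + ρ₀ * ‖h.2‖ := by
    funext h; rw [targetGauge, h10Norm, ← norm_H10_eq]
  rw [e]
  refine ⟨by fun_prop, fun x => by positivity, fun t x ht => ?_, fun x y => ?_⟩
  · simp only [Prod.smul_fst, Prod.smul_snd, norm_smul, Real.norm_of_nonneg ht]
    ring
  · have h1 := mul_le_mul_of_nonneg_left (norm_add_le x.1 y.1) hρ₁
    have h2 := mul_le_mul_of_nonneg_left (norm_add_le x.2 y.2) hρ₀
    change ρ₁ * ‖x.1 + y.1‖ + ρ₀ * ‖x.2 + y.2‖ ≤ _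
    linarith

/-- The gauge is the support function of the product of balls, so this is the dual description of
the target. For the converse, the first ball is tested with h = (0, x - v0), the second with (h, 0)
and (-h, 0). -/
theorem target_iff (hρ₀ : 0 ≤ ρ₀) {x : L2} {ℓ : Hm1} :
    (x ∈ Metric.closedBall v0 ρ₀ ∧ ℓ ∈ hm1Ball v1 ρ₁) ↔
      ∀ h : H10 × L2, 0 ≤ (ℓ - v1) h.1 - inner ℝ (x - v0) h.2 + targetGauge ρ₀ ρ₁ h := by
  rw [mem_closedBall_iff_norm]
  constructor
  · rintro ⟨h1, h2⟩ h
    have h3 := neg_le_of_abs_le (h2 h.1)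
    have h4 := (real_inner_le_norm (x - v0) h.2).trans
      (mul_le_mul_of_nonneg_right h1 (norm_nonneg h.2))
    change 0 ≤ ℓ h.1 - v1 h.1 - _ + (ρ₁ * h10Norm h.1 + ρ₀ * ‖h.2‖)
    linarith
  · intro H
    have hn : ∀ h : H10, h10Norm h = ‖h‖ := fun h => (norm_H10_eq h).symm
    constructor
    · have h1 := H (0, x - v0)
      rw [targetGauge, hn, norm_zero, mul_zero, zero_add, map_zero, zero_sub,
        real_inner_self_eq_norm_sq] at h1
      by_contra! hlt
      have h0 : 0 < ‖x - v0‖ := hρ₀.trans_lt hlt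
      nlinarith
    · intro h
      have h1 := H (h, 0)
      have h2 := H (-h, 0)
      rw [targetGauge, hn, norm_zero, mul_zero, add_zero, inner_zero_right, sub_zero] at h1 h2
      rw [hn]
      rw [norm_neg, map_neg] at h2
      change 0 ≤ ℓ h - v1 h + ρ₁ * ‖h‖ at h1
      change 0 ≤ -(ℓ h - v1 h) + ρ₁ * ‖h‖ at h2
      exact abs_le.2 ⟨by linarith, by linarith⟩

/-- Duality pairs the final state with h through `dataTrace` h; the symmetry of `resolv` moves the
resolvent to that side, where σ `resolv` (`dataTrace` h) is `leaderMap` h. The part due to v₂ goes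
into `leaderLin`. -/
theorem state_final_eq (hk : 0 < k) (hk1 : k < 1) (hT : 0 < T) (hσ : 0 < σ)
    (u : Lp ℝ 2 (muTime T)) (h : H10 × L2) :
    (stateVel k hT.le (totalControl k hT.le σ V u) T - v1) h.1
        - inner ℝ (statePos k hT.le (totalControl k hT.le σ V u) T - v0) h.2
      = inner ℝ u (leaderMap k hT.le σ h) - leaderLin k hT.le σ V v0 v1 h := by
  have h1 := inner_dataTrace hk hk1 hT (totalControl k hT.le σ V u) h
  rw [totalControl, map_add, inner_add_left, map_smul, inner_smul_left, resolv_symm hk hk1 hT hσ,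
    conj_trivial, ← map_smul, ← map_add] at h1
  rw [leaderLin_apply, leaderMap_apply, inner_smul_right, inner_sub_left]
  change stateVel k hT.le (totalControl k hT.le σ V u) T h.1 - v1 h.1 - _ = _
  rw [totalControl]
  linarith

/-- The equilibrium and its state are determined by the leader, so the existential quantifiers
disappear and only the position of the final state remains; `target_iff` and `state_final_eq`
rewrite that. -/
theorem mem_admissibleLeaders_iff (hk : 0 < k) (hk1 : k < 1) (hT : 0 < T) (hσ : 0 < σ)
    (hρ₀ : 0 ≤ ρ₀) (hV : V =ᵐ[muTime T] v₂) {w₁ : ℝ → ℝ} :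
    w₁ ∈ admissibleLeaders k T σ ρ₀ ρ₁ v₂ v0 v1 ↔ MemLp w₁ 2 (muTime T) ∧
      DualAdmissible (leaderMap k hT.le σ) (leaderLin k hT.le σ V v0 v1) (targetGauge ρ₀ ρ₁)
        (lpc T w₁) := by
  refine and_congr_right fun hw => ?_
  have key : DualAdmissible (leaderMap k hT.le σ) (leaderLin k hT.le σ V v0 v1)
      (targetGauge ρ₀ ρ₁) (lpc T w₁) ↔
      (statePos k hT.le (totalControl k hT.le σ V (lpc T w₁)) T ∈ Metric.closedBall v0 ρ₀ ∧
        stateVel k hT.le (totalControl k hT.le σ V (lpc T w₁)) T ∈ hm1Ball v1 ρ₁) := by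
    rw [target_iff hρ₀]
    exact forall_congr' fun h => by rw [state_final_eq hk hk1 hT hσ]
  rw [key]
  constructor
  · rintro ⟨w₂, v, dv, hN, hs, hb⟩
    obtain ⟨hw2, hN⟩ := (isNashEquilibrium_iff hk hk1 hT hσ hV hw).1 hN
    have hc : w₁ + w₂ =ᵐ[muTime T] totalControl k hT.le σ V (lpc T w₁) := by
      rw [← hN, ← lpc_add_of_memLp hw hw2]
      exact (coeFn_lpc_of_memLp (hw.add hw2)).symm
    have s := isState_statePos hk hk1 hT _ hc
    rwa [← hs.eqOn hk hk1 hT s EventuallyEq.rfl (right_mem_Icc.2 hT.le),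
      ← hs.eqOn_deriv hk hk1 hT s EventuallyEq.rfl (right_mem_Icc.2 hT.le)]
  · intro hb
    set c := totalControl k hT.le σ V (lpc T w₁)
    have h1 := coeFn_lpc_of_memLp hw
    refine ⟨⇑(c - lpc T w₁), statePos k hT.le c, stateVel k hT.le c,
      (isNashEquilibrium_iff hk hk1 hT hσ hV hw).2 ⟨Lp.memLp _, ?_⟩,
      isState_statePos hk hk1 hT c ?_, hb⟩
    · rw [lpc_coeFn, add_sub_cancel]
    · filter_upwards [h1, Lp.coeFn_sub c (lpc T w₁)] with t h2 h3
      rw [Pi.add_apply, h3, Pi.sub_apply, h2, add_sub_cancel]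

/-- Every quadruple attached to f has the same final values of v and v', those of the equilibrium
for the leader Λ f; the claim is then `state_final_eq` at h = g - f. -/
theorem solvesVI_iff (hk : 0 < k) (hk1 : k < 1) (hT : 0 < T) (hσ : 0 < σ)
    (hV : V =ᵐ[muTime T] v₂) {f : H10 × L2} :
    SolvesVI k T σ ρ₀ ρ₁ v₂ v0 v1 f ↔
      VarIneq (leaderMap k hT.le σ) (leaderLin k hT.le σ V v0 v1) (targetGauge ρ₀ ρ₁) f := by
  have key : ∀ s : Quadruple, IsOptimalitySystem k T σ v₂ f s → ∀ g : H10 × L2,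
      (s.dv T - v1) (g.1 - f.1) - inner ℝ (s.v T - v0) (g.2 - f.2)
        + ρ₁ * (h10Norm g.1 - h10Norm f.1) + ρ₀ * (‖g.2‖ - ‖f.2‖)
      = inner ℝ (leaderMap k hT.le σ f) (leaderMap k hT.le σ (g - f))
        - leaderLin k hT.le σ V v0 v1 (g - f) + targetGauge ρ₀ ρ₁ g - targetGauge ρ₀ ρ₁ f := by
    intro s hs g
    have a := hs.same_optQuad hk hk1 hT hσ hV
    rw [← state_final_eq hk hk1 hT hσ, a.v (right_mem_Icc.2 hT.le), a.dv (right_mem_Icc.2 hT.le),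
      targetGauge, targetGauge]
    change (stateVel k hT.le (totalControl k hT.le σ V (leaderMap k hT.le σ f)) T - v1) (g.1 - f.1)
      - inner ℝ (statePos k hT.le (totalControl k hT.le σ V (leaderMap k hT.le σ f)) T - v0)
        (g.2 - f.2) + _ + _ = _
    rw [Prod.fst_sub, Prod.snd_sub]
    ring
  constructor
  · rintro ⟨s, hs, h⟩ g
    rw [← key s hs]; exact h g
  · intro h
    have hs := isOptimalitySystem_optQuad hk hk1 hT hσ hV f
    exact ⟨_, hs, fun g => by rw [key _ hs]; exact h g⟩

/-- Λ f is admissible, and by `VarIneq.norm_sub_sq_le` any admissible control with no larger norm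
coincides with it. -/
theorem isOptimalLeader_iff (hk : 0 < k) (hk1 : k < 1) (hT : 0 < T) (hσ : 0 < σ)
    (hρ₀ : 0 ≤ ρ₀) (hρ₁ : 0 ≤ ρ₁) (hV : V =ᵐ[muTime T] v₂) {f : H10 × L2}
    (hf : VarIneq (leaderMap k hT.le σ) (leaderLin k hT.le σ V v0 v1) (targetGauge ρ₀ ρ₁) f)
    {w₁ : ℝ → ℝ} : IsOptimalLeader k T σ ρ₀ ρ₁ v₂ v0 v1 w₁ ↔
      w₁ =ᵐ[muTime T] leaderMap k hT.le σ f := by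
  have hj := isGauge_targetGauge hρ₀ hρ₁
  set u := leaderMap k hT.le σ f
  constructor
  · rintro ⟨hw, hmin⟩
    rw [mem_admissibleLeaders_iff hk hk1 hT hσ hρ₀ hV] at hw
    have h1 := hmin u ((mem_admissibleLeaders_iff hk hk1 hT hσ hρ₀ hV).2
      ⟨Lp.memLp u, by rw [lpc_coeFn]; exact hf.dualAdmissible hj⟩)
    rw [costLeader_eq hw.1, costLeader_eq (Lp.memLp u), lpc_coeFn] at h1
    have h2 := hf.norm_sub_sq_le hj hw.2
    have h3 : ‖lpc T w₁ - u‖ ^ 2 ≤ 0 := by linarith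
    have h4 : lpc T w₁ = u := by
      rw [← sub_eq_zero, ← norm_eq_zero]
      exact pow_eq_zero_iff two_ne_zero |>.1 (h3.antisymm (sq_nonneg _))
    rw [← h4]
    exact (coeFn_lpc_of_memLp hw.1).symm
  · intro h
    have hm : MemLp w₁ 2 (muTime T) := (memLp_congr_ae h).2 (Lp.memLp u)
    have hu : lpc T w₁ = u := Lp.ext ((coeFn_lpc_of_memLp hm).trans h)
    refine ⟨(mem_admissibleLeaders_iff hk hk1 hT hσ hρ₀ hV).2
      ⟨hm, by rw [hu]; exact hf.dualAdmissible hj⟩, fun w hw => ?_⟩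
    rw [mem_admissibleLeaders_iff hk hk1 hT hσ hρ₀ hV] at hw
    rw [costLeader_eq hm, costLeader_eq hw.1, hu]
    have h2 := hf.norm_sub_sq_le hj hw.2
    have := sq_nonneg ‖lpc T w - u‖
    linarith

end

end StringControl

end

theorem mainTheorem3 (k T σ ρ₀ ρ₁ : ℝ)
    (hk : 0 < k) (hk' : k < 1 - 1 / Real.sqrt (Real.exp 1)) (hT : 2 / (1 - k) < T)
    (hσ : 0 < σ) (hρ₀ : 0 < ρ₀) (hρ₁ : 0 < ρ₁)
    (v₂ : ℝ → StringControl.L2) (hv₂ : MemLp v₂ 2 (StringControl.muTime T))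
    (v0 : StringControl.L2) (v1 : StringControl.Hm1) :
    (∀ f : StringControl.H10 × StringControl.L2,
      (∃ s : StringControl.Quadruple, StringControl.IsOptimalitySystem k T σ v₂ f s) ∧
      ∀ s s' : StringControl.Quadruple, StringControl.IsOptimalitySystem k T σ v₂ f s →
        StringControl.IsOptimalitySystem k T σ v₂ f s' → StringControl.Quadruple.Same T s s') ∧
    (∃! f : StringControl.H10 × StringControl.L2,
      StringControl.SolvesVI k T σ ρ₀ ρ₁ v₂ v0 v1 f) ∧
    (∀ (f : StringControl.H10 × StringControl.L2) (s : StringControl.Quadruple),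
      StringControl.SolvesVI k T σ ρ₀ ρ₁ v₂ v0 v1 f →
      StringControl.IsOptimalitySystem k T σ v₂ f s →
      ∀ w₁ : ℝ → ℝ, StringControl.IsOptimalLeader k T σ ρ₀ ρ₁ v₂ v0 v1 w₁ ↔
        w₁ =ᵐ[StringControl.muTime T]
          fun t => -(1 / StringControl.alpha k t ^ 2) * s.nφ t) := by
  have hk1 : k < 1 := by
    have : 0 < 1 / Real.sqrt (Real.exp 1) := by positivity
    linarith
  have hT0 : 0 < T := lt_trans (div_pos two_pos (sub_pos.2 hk1)) hT
  have hV := hv₂.coeFn_toLp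
  refine ⟨fun f => ⟨⟨_, StringControl.isOptimalitySystem_optQuad hk hk1 hT0 hσ hV f⟩,
    fun s s' h h' => h.same hk hk1 hT0 hσ hV h'⟩, ?_, fun f s hf hs w₁ => ?_⟩
  · obtain ⟨c, hc0, hc⟩ := StringControl.exists_leaderMap_bound hk hk1 hT hT0 hσ
    simp only [StringControl.solvesVI_iff hk hk1 hT0 hσ hV]
    exact StringControl.existsUnique_varIneq
      (StringControl.isGauge_targetGauge hρ₀.le hρ₁.le) hc0 hc
  · rw [StringControl.solvesVI_iff hk hk1 hT0 hσ hV] at hf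
    rw [StringControl.isOptimalLeader_iff hk hk1 hT0 hσ hρ₀.le hρ₁.le hV hf]
    -- For any quadruple attached to f the normal derivative is -α² Λ f almost everywhere, so the
    -- formula in the statement is the minimizer Λ f.
    have h := (StringControl.neg_alpha_sq_mul hk hσ (hs.same_optQuad hk hk1 hT0 hσ hV).nφ).2
    exact ⟨fun h1 => h1.trans h.symm, fun h1 => h1.trans h⟩
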